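/- **Setting.** Let $d\ge 2$ and $\mathfrak w\in\mathbb R^d\setminus\{0\}$. Let $e_k(x)=(2\pi)^{-d/2}e^{\iota k\cdot x}$, $k\in\mathbb Z^d$, be the Fourier basis of the torus $\mathbb T^d$ of side length $2\pi$, and $\hat\varphi(k)=\int_{\mathbb T^d}\varphi\,e_{-k}\,dx$. The Fock space $\Gamma L^2=\bigoplus_{n\ge0}\Gamma L^2_n$ consists of sequences of symmetric square-integrable kernels $f_n$ on $(\mathbb T^{d})^n$ with zero average in each variable (so $\hat f_n(k_{1:n})=0$ if some $k_i=0$), with norm $\|f\|^2=\sum_n n!\sum_{k_{1:n}}|\hat f_n(k_{1:n})|^2$. Write $|k_{1:n}|^2=\sum_i|k_i|^2$ and $(\mathfrak w\cdot k)^2_{1:n}=\sum_i(\mathfrak w\cdot k_i)^2$. Let $\varepsilon\in(0,1)$; if $d\ge3$ only those $\varepsilon$ with $1/\varepsilon\in\mathbb N+\frac12$ are considered, and $\varepsilon\to0$ is taken along them. Let $\lambda_\varepsilon=(\log\varepsilon^{-2})^{-1/2}$ if $d=2$ and $\lambda_\varepsilon=\varepsilon^{d/2-1}$ if $d\ge3$.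 Let $\mathbb J^\varepsilon_{\ell,m}$ be the indicator that each of $\varepsilon|\ell|$, $\varepsilon|m|$, $\varepsilon|\ell+m|$ lies in $(0,1]$, where $|\cdot|$ is here the Euclidean norm if $d=2$ and the sup-norm if $d\ge3$. On $f\in\Gamma L^2_n$ define $\mathcal L_0$ and $\mathcal L_0^{\mathfrak w}$ by the Fourier multipliers $-\frac12|k_{1:n}|^2$ and $-\frac12(\mathfrak w\cdot k)_{1:n}^2$, and $$\mathcal F(\mathcal A^\varepsilon_+f)(k_{1:n+1})=-\frac{2\iota}{(2\pi)^{d/2}}\frac{\lambda_\varepsilon}{n+1}\sum_{1\le i<j\le n+1}[\mathfrak w\cdot(k_i+k_j)]\,\mathbb J^\varepsilon_{k_i,k_j}\,\hat f(k_i+k_j,k_{\{1:n+1\}\setminus\{i,j\}}),$$ $$\mathcal F(\mathcal A^\varepsilon_-f)(k_{1:n-1})=-\frac{\iota}{(2\pi)^{d/2}}\,n\lambda_\varepsilon\sum_{j=1}^{n-1}(\mathfrak w\cdot k_j)\sum_{\ell+m=k_j}\mathbb J^\varepsilon_{\ell,m}\,\hat f(\ell,m,k_{\{1:n-1\}\setminus\{j\}}),$$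 so that $\mathcal A^\varepsilon_-=-(\mathcal A^\varepsilon_+)^*$; $\mathcal A^\varepsilon_+$ vanishes on $\Gamma L^2_0$ and $\mathcal A^\varepsilon_-$ on $\Gamma L^2_0\oplus\Gamma L^2_1$. Put $\mathcal A^\varepsilon=\mathcal A^\varepsilon_++\mathcal A^\varepsilon_-$. Let $P_i^n$ be the projection onto $\bigoplus_{j=i}^n\Gamma L^2_j$ and $\mathcal L^\varepsilon_{i,n}=\mathcal L_0+P_i^n\mathcal A^\varepsilon P_i^n$. For $d=2$ let $$G(x)=\frac1{|\mathfrak w|^2}\Big[\Big(\frac{3|\mathfrak w|^2}{2\pi}x+1\Big)^{2/3}-1\Big],\qquad \mathrm L^\varepsilon(x)=\lambda_\varepsilon^2\log\Big(1+\frac1{\varepsilon^2x}\Big),\qquad \mathcal G^\varepsilon=G(\mathrm L^\varepsilon(-\mathcal L_0)).$$ Let $\phi,\psi$ be smooth (complex-valued) functions on $\mathbb T^d$, $f_1=\phi\in\Gamma L^2_1$ and $f_2=\frac12(\phi\otimes\psi+\psi\otimes\phi)\in\Gamma L^2_2$ (zero Fourier modes, if any, being discarded). For $i\in\{2,3\}$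 and $n\ge i$ let $w^{\varepsilon,n}\in\bigoplus_{j=i}^n\Gamma L^2_j$ be the solution of $$-\mathcal L^\varepsilon_{i,n}w^{\varepsilon,n}=\mathcal A^\varepsilon_+f_{i-1}\qquad\text{if } d\ge3,$$ $$w^{\varepsilon,n}=(-\mathcal L_0-\mathcal L_0^{\mathfrak w}\mathcal G^\varepsilon)^{-1}\mathcal A^\varepsilon_+P_i^{n-1}w^{\varepsilon,n}+(-\mathcal L_0-\mathcal L_0^{\mathfrak w}\mathcal G^\varepsilon)^{-1}\mathcal A^\varepsilon_+f_{i-1}\qquad\text{if } d=2,$$ and let $w^{\varepsilon,n}_i$ be its component in $\Gamma L^2_i$. **Theorem.** The solution $w^{\varepsilon,n}$ exists and is unique. There is a constant $D_{\rm SHE}>0$, depending only on $d$ and $\mathfrak w$ (not on $i$, $\phi$, $\psi$), such that for $i=2,3$ and all smooth $\phi,\psi$ $$\lim_{n\to\infty}\limsup_{\varepsilon\to0}\big\|(-\mathcal L_0)^{-1/2}\big[\mathcal A^\varepsilon_-w^{\varepsilon,n}_i-D_{\rm SHE}\,\mathcal L_0^{\mathfrak w}f_{i-1}\big]\big\|=0,$$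 and it is the only real constant with this property. If $d=2$, then $D_{\rm SHE}=G(1)$. Moreover, for every $n\ge i$, $\lim_{\varepsilon\to0}\|w^{\varepsilon,n}\|=0$. -/

import Mathlib

open Filter Topology MeasureTheory
open scoped ENNReal

noncomputable section

namespace Burgers

/-! ### Fourier modes and test functions on the torus of side length `2π` -/

/-- Fourier modes of the `d`-dimensional torus. -/
abbrev Mode (d : ℕ) : Type := Fin d → ℤ

/-- `|k|²`, the squared Euclidean length of a mode. -/
def modeSq {d : ℕ} (k : Mode d) : ℝ := ∑ a, (k a : ℝ) ^ 2

/-- The scalar product `𝔴 · k`. -/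
def dotMode {d : ℕ} (w : EuclideanSpace ℝ (Fin d)) (k : Mode d) : ℝ := ∑ a, w a * (k a : ℝ)

/-- A (complex-valued) smooth function on the torus `ℝ^d / (2πℤ)^d`, given by its periodic lift. -/
def IsTorusTest {d : ℕ} (φ : (Fin d → ℝ) → ℂ) : Prop :=
  ContDiff ℝ (⊤ : ℕ∞) φ ∧
    ∀ (x : Fin d → ℝ) (m : Mode d), φ (fun a => x a + 2 * Real.pi * (m a : ℝ)) = φ x

/-- `φ̂(k) = ∫ φ(x) e_{-k}(x) dx` over the torus, where `e_k(x) = (2π)^{-d/2} e^{i k·x}`. -/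
def fourierMode {d : ℕ} (φ : (Fin d → ℝ) → ℂ) (k : Mode d) : ℂ :=
  ∫ x in Set.Icc (0 : Fin d → ℝ) (fun _ => 2 * Real.pi),
    φ x * ((((2 * Real.pi) ^ (-(d : ℝ) / 2) : ℝ) : ℂ) *
      Complex.exp (-(Complex.I * ((∑ a, (k a : ℝ) * x a : ℝ) : ℂ))))

/-! ### The Fock space, in Fourier variables -/

/-- A sequence of kernels `(ψ_n)_n`, each given by its Fourier coefficients
`ψ̂_n(k_1, …, k_n)`. -/
abbrev FockVec (d : ℕ) : Type := (n : ℕ) → (Fin n → Mode d) → ℂ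

/-- `‖ψ‖ = (∑_n n! ∑_{k_{1:n}} |ψ̂_n(k_{1:n})|²)^{1/2}`, with values in `[0, ∞]`. -/
def fockNorm {d : ℕ} (ψ : FockVec d) : ℝ≥0∞ :=
  (∑' n : ℕ, (n.factorial : ℝ≥0∞) * ∑' k : Fin n → Mode d, ‖ψ n k‖ₑ ^ 2) ^ (1 / 2 : ℝ)

/-- Membership in the Fock space `⊕_n L²_sym`: kernels which are symmetric, of zero average in each
variable (no Fourier coefficient with a vanishing mode), and of finite norm. -/
def IsFock {d : ℕ} (ψ : FockVec d) : Prop :=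
  (∀ (n : ℕ) (σ : Equiv.Perm (Fin n)) (k : Fin n → Mode d), ψ n (k ∘ σ) = ψ n k) ∧
  (∀ (n : ℕ) (k : Fin n → Mode d), (∃ i, k i = 0) → ψ n k = 0) ∧
  fockNorm ψ < ⊤

/-- The projection `P_i^n` onto the chaoses of order `i, …, n`. -/
def chaosProj {d : ℕ} (i n : ℕ) (ψ : FockVec d) : FockVec d :=
  fun j k => if i ≤ j ∧ j ≤ n then ψ j k else 0

/-- `|k_{1:n}|² = |k_1|² + ⋯ + |k_n|²`. -/
def tupleSq {d n : ℕ} (k : Fin n → Mode d) : ℝ := ∑ i, modeSq (k i)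

/-- `(𝔴·k)²_{1:n} = (𝔴·k_1)² + ⋯ + (𝔴·k_n)²`. -/
def tupleDotSq {d n : ℕ} (w : EuclideanSpace ℝ (Fin d)) (k : Fin n → Mode d) : ℝ :=
  ∑ i, dotMode w (k i) ^ 2

/-- The first-chaos kernel `φ`; its zero mode is discarded. -/
def oneParticle {d : ℕ} (φ : (Fin d → ℝ) → ℂ) : FockVec d
  | 1, k => if k 0 = 0 then 0 else fourierMode φ (k 0)
  | _, _ => 0

/-- The second-chaos kernel `(φ ⊗ ψ + ψ ⊗ φ) / 2`; its zero modes are discarded. -/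
def twoParticle {d : ℕ} (φ ψ : (Fin d → ℝ) → ℂ) : FockVec d
  | 2, k => if k 0 = 0 ∨ k 1 = 0 then 0 else
      (fourierMode φ (k 0) * fourierMode ψ (k 1) + fourierMode ψ (k 0) * fourierMode φ (k 1)) / 2
  | _, _ => 0

/-- `f_{i-1}` for `i = 2, 3`: `f_1 = φ` and `f_2 = [φ ⊗ ψ]_sym`. -/
def inputVec {d : ℕ} (φ ψ : (Fin d → ℝ) → ℂ) (i : ℕ) : FockVec d :=
  if i = 2 then oneParticle φ else twoParticle φ ψ

/-! ### Scale parameter, coupling constant and cut-off -/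

/-- The admissible scales: `ε ∈ (0,1)`, and moreover `1/ε ∈ ℕ + 1/2` in dimension `d ≥ 3`. -/
def scales (d : ℕ) : Set ℝ :=
  {ε | 0 < ε ∧ ε < 1 ∧ (3 ≤ d → ∃ N : ℕ, 1 / ε = (N : ℝ) + 1 / 2)}

/-- The limit `ε → 0` along admissible scales. -/
def scaleFilter (d : ℕ) : Filter ℝ := 𝓝[scales d] 0

/-- `λ_ε = (log ε⁻²)^{-1/2}` for `d = 2` and `λ_ε = ε^{d/2-1}` for `d ≥ 3`. -/
def coupling (d : ℕ) (ε : ℝ) : ℝ :=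
  if d = 2 then 1 / Real.sqrt (Real.log (ε⁻¹ ^ 2)) else ε ^ ((d : ℝ) / 2 - 1)

/-- The norm in the Fourier cut-off: Euclidean for `d = 2`, the sup-norm for `d ≥ 3`. -/
def cutoffNorm {d : ℕ} (k : Mode d) : ℝ :=
  if d = 2 then Real.sqrt (modeSq k) else ‖k‖

open Classical in
/-- The indicator of `0 < ε|ℓ| ≤ 1`, `0 < ε|m| ≤ 1`, `0 < ε|ℓ+m| ≤ 1`. -/
def cutoff {d : ℕ} (ε : ℝ) (l m : Mode d) : ℝ :=
  if (0 < ε * cutoffNorm l ∧ ε * cutoffNorm l ≤ 1) ∧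
      (0 < ε * cutoffNorm m ∧ ε * cutoffNorm m ≤ 1) ∧
      (0 < ε * cutoffNorm (l + m) ∧ ε * cutoffNorm (l + m) ≤ 1) then 1 else 0

/-! ### The operators -/

/-- `L_0`, with Fourier multiplier `-|k_{1:n}|²/2`. -/
def opL0 {d : ℕ} (ψ : FockVec d) : FockVec d :=
  fun _ k => ((-(1 / 2) * tupleSq k : ℝ) : ℂ) * ψ _ k

/-- `(-L_0)^{-1/2}`, with Fourier multiplier `(|k_{1:n}|²/2)^{-1/2}`. -/
def opL0InvSqrt {d : ℕ} (ψ : FockVec d) : FockVec d :=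
  fun _ k => (((1 / 2 * tupleSq k) ^ (-(1 / 2) : ℝ) : ℝ) : ℂ) * ψ _ k

/-- `L_0^𝔴`, with Fourier multiplier `-(𝔴·k)²_{1:n}/2`. -/
def opL0w {d : ℕ} (w : EuclideanSpace ℝ (Fin d)) (ψ : FockVec d) : FockVec d :=
  fun _ k => ((-(1 / 2) * tupleDotSq w k : ℝ) : ℂ) * ψ _ k

/-- The creation part `A_+^ε`, mapping the `n`-th chaos to the `(n+1)`-st:
`-(2ι/(2π)^{d/2}) λ_ε/(n+1) ∑_{i<j} [𝔴·(k_i+k_j)] 𝕁(k_i,k_j) ψ̂(k_i+k_j, k_{{1:n+1}∖{i,j}})`.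
The argument of `ψ̂` is listed with `k_i` replaced by `k_i+k_j` and `k_j` removed; the order is
immaterial on symmetric kernels. -/
def opAplus {d : ℕ} (w : EuclideanSpace ℝ (Fin d)) (ε : ℝ) (ψ : FockVec d) : FockVec d
  | 0, _ => 0
  | n + 1, k =>
      -(2 * Complex.I / (((2 * Real.pi) ^ ((d : ℝ) / 2) : ℝ) : ℂ)) *
        ((coupling d ε / ((n : ℝ) + 1) : ℝ) : ℂ) *
        ∑ i : Fin (n + 1), ∑ j : Fin (n + 1), if i < j then
          ((dotMode w (k i + k j) * cutoff ε (k i) (k j) : ℝ) : ℂ) *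
            ψ n (fun a => Function.update k i (k i + k j) (j.succAbove a))
        else 0

/-- The annihilation part `A_-^ε = -(A_+^ε)^*` (adjoint for the Fock scalar product
`∑_n n! ⟨·,·⟩`), mapping the `(n+1)`-st chaos to the `n`-th:
`-(ι/(2π)^{d/2}) (n+1) λ_ε ∑_j (𝔴·k_j) ∑_{ℓ+m=k_j} 𝕁(ℓ,m) ψ̂(ℓ, m, k_{{1:n}∖{j}})`.
The inner sum has finitely many non-zero terms because of the cut-off. The argument of `ψ̂` is
listed with `k_j` replaced by `m` and `ℓ` put in front. -/
def opAminus {d : ℕ} (w : EuclideanSpace ℝ (Fin d)) (ε : ℝ) (ψ : FockVec d) : FockVec d :=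
  fun n k =>
    -(Complex.I / (((2 * Real.pi) ^ ((d : ℝ) / 2) : ℝ) : ℂ)) *
      ((((n : ℝ) + 1) * coupling d ε : ℝ) : ℂ) *
      ∑ j : Fin n, (dotMode w (k j) : ℂ) *
        ∑' l : Mode d, (cutoff ε l (k j - l) : ℂ) *
          ψ (n + 1) (Fin.cons l (Function.update k j (k j - l)))

/-- `A^ε = A_+^ε + A_-^ε`. -/
def opA {d : ℕ} (w : EuclideanSpace ℝ (Fin d)) (ε : ℝ) (ψ : FockVec d) : FockVec d :=
  opAplus w ε ψ + opAminus w ε ψ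

/-- The truncated generator `L^ε_{i,n} = L_0 + P_i^n A^ε P_i^n`. -/
def opLtrunc {d : ℕ} (w : EuclideanSpace ℝ (Fin d)) (ε : ℝ) (i n : ℕ) (ψ : FockVec d) :
    FockVec d :=
  opL0 ψ + chaosProj i n (opA w ε (chaosProj i n ψ))

/-- `G(x) = |𝔴|⁻² ((3|𝔴|² x/(2π) + 1)^{2/3} - 1)`. -/
def funG {d : ℕ} (w : EuclideanSpace ℝ (Fin d)) (x : ℝ) : ℝ :=
  1 / ‖w‖ ^ 2 * ((3 * ‖w‖ ^ 2 / (2 * Real.pi) * x + 1) ^ (2 / 3 : ℝ) - 1)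

/-- `L^ε(x) = λ_ε² log(1 + 1/(ε² x))`. -/
def funL (d : ℕ) (ε x : ℝ) : ℝ := coupling d ε ^ 2 * Real.log (1 + 1 / (ε ^ 2 * x))

/-- `(-L_0 - L_0^𝔴 G^ε)^{-1}`, where `G^ε = G(L^ε(-L_0))`: the Fourier multiplier
`[|k_{1:n}|²/2 + ((𝔴·k)²_{1:n}/2) G(L^ε(|k_{1:n}|²/2))]^{-1}`. -/
def opResolvent {d : ℕ} (w : EuclideanSpace ℝ (Fin d)) (ε : ℝ) (ψ : FockVec d) : FockVec d :=
  fun _ k => (((1 / 2 * tupleSq k +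
    1 / 2 * tupleDotSq w k * funG w (funL d ε (1 / 2 * tupleSq k)))⁻¹ : ℝ) : ℂ) * ψ _ k

/-! ### The approximations `w^{ε,n}` -/

/-- `v` is the element `w^{ε,n}` of `⊕_{j=i}^n ΓL²_j` with input `f`: for `d ≥ 3` the solution of
the truncated generator equation `-L^ε_{i,n} v = A_+^ε f`, and for `d = 2` the solution of
`v = (-L_0 - L_0^𝔴 G^ε)^{-1} A_+^ε P_i^{n-1} v + (-L_0 - L_0^𝔴 G^ε)^{-1} A_+^ε f`. -/
def IsApproxSol {d : ℕ} (w : EuclideanSpace ℝ (Fin d)) (ε : ℝ) (i n : ℕ) (f v : FockVec d) :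
    Prop :=
  IsFock v ∧ chaosProj i n v = v ∧
    if d = 2 then
      v = opResolvent w ε (opAplus w ε (chaosProj i (n - 1) v)) + opResolvent w ε (opAplus w ε f)
    else
      -opLtrunc w ε i n v = opAplus w ε f

/-- `W ε n` is `w^{ε,n}` with input `f_{i-1}`, for all admissible `ε` and all `n ≥ i`. -/
def IsApproxFamily {d : ℕ} (w : EuclideanSpace ℝ (Fin d)) (i : ℕ) (f : FockVec d)
    (W : ℝ → ℕ → FockVec d) : Prop :=
  ∀ ε ∈ scales d, ∀ n : ℕ, i ≤ n → IsApproxSol w ε i n f (W ε n)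

/-- `lim_{n→∞} limsup_{ε→0} ‖(-L_0)^{-1/2} [A_-^ε w_i^{ε,n} - D L_0^𝔴 f_{i-1}]‖ = 0` for `i = 2, 3`
and all test functions `φ, ψ`. -/
def HasDiffusivity {d : ℕ} (w : EuclideanSpace ℝ (Fin d)) (D : ℝ) : Prop :=
  ∀ φ ψ : (Fin d → ℝ) → ℂ, IsTorusTest φ → IsTorusTest ψ →
  ∀ i : ℕ, i = 2 ∨ i = 3 →
  ∀ W : ℝ → ℕ → FockVec d, IsApproxFamily w i (inputVec φ ψ i) W →
    Tendsto (fun n : ℕ => limsup (fun ε : ℝ =>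
        fockNorm (opL0InvSqrt (opAminus w ε (chaosProj i i (W ε n)) -
          (D : ℂ) • opL0w w (inputVec φ ψ i)))) (scaleFilter d))
      atTop (𝓝 0)

end Burgers

end

/-!
Put `Λ = (-𝓛₀)^{1/2}`. A function with coefficients `f̂_n` is stored as `co x n k = √n! f̂_n(k)`
with `x` in the Hilbert space `Fock d`, and the equations are read between energy spaces. There
`𝒜_+` and `𝒜_-` become the operators `raise = Λ⁻¹ 𝒜_+ Λ⁻¹` and `lower = Λ⁻¹ 𝒜_- Λ⁻¹`. They are
bounded, with norms growing linearly in the chaos order, uniformly in `ε` (`norm_lower_le`,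
`exists_loopSum_le`), and `raise + lower` is skew. Hence the truncated equation for `d ≥ 3` is
solved by the contraction `resolvent (skewOp w ε i n) = (1 - S)⁻¹`, whereas for `d = 2` the
solution is the finite sum `ladderSum` of the powers of `(-𝓛₀ - 𝓛₀^𝔴 𝒢)⁻¹ 𝒜_+` applied to the
input. The output `Λ⁻¹ 𝒜_- w_i` depends linearly on the input, with bounds uniform in `ε`, so its
limit is only needed for single modes (`i = 2`) and for symmetrised pairs of modes (`i = 3`).

* **One mode.** By conservation of momentum the output for the mode `p` is a multiple of that
  mode. The theorem for `i = 2` says that this scalar tends to `D` times the symbol of `Λ⁻¹ 𝓛₀^𝔴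
  Λ⁻¹` (`driftMul`).
* **Two modes.** Creating a spectator particle commutes with `raise` and `lower` up to errors
  bounded by a weaker norm `‖Λ⁻¹ x‖` (`norm_sub_skewOp_upCreat_le`). This norm of the solutions
  vanishes as `ε → 0`; this is also the last claim of the theorem. So the limit for `i = 3` and
  truncation `n + 1` follows from that for `i = 2` and truncation `n`, with the same constant; for
  `d = 2` the spectator just shifts the argument of the effective multiplier.
* **Dimension two.** Only the first rung of the ladder contributes, and the scalar is an explicit
  sum over the loop momentum. In logarithmic polar coordinates `ℓ = e^{s log(1/ε)} e_θ` it
  converges to an integral over `(s, θ)`. The angular integral is elementary, and the radial one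
  equals `G(1)` by the formula for `G` (`tendsto_loopSum_effMul`).
* **Dimension at least three.** After rescaling by `ε`, the mode `p` tends to `0` and the
  normalised source `modeDir` has a kernel with a limit at almost every configuration, independent
  of `p`. This property (`Good`, and its closure `Approx`) is stable under the skew operator, once
  low energies are cut off, which costs little since the source is square integrable at `0`. It
  passes to the resolvent, a uniform limit of damped Picard iterations
  (`IsSkew.norm_dampedIter_sub_le`), and scalar products of such families converge, being Riemann
  sums. So the response `⟨g, (1 - S)⁻¹ g⟩` converges as `ε → 0` for every `n`, and it is real by
  the parity symmetry `(-1)^n`. The limits form a Cauchy sequence in `n`: the difference of two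
  truncations has a flux through every level `j < n` of order at most `j`, and `∑ 1/j` diverges
  (`carleman`). They stay away from `0`, since the real part of the response is the squared norm
  of the solution, and `‖g‖ ≤ C ‖(1 - S)⁻¹ g‖` for `g` in the lowest chaos.

Uniqueness of `D` follows by inserting one Fourier mode `φ = e_k` with `𝔴·k ≠ 0`.
-/

open Filter Topology MeasureTheory
open scoped ENNReal

noncomputable section

namespace Burgers

open scoped Real
open Finset (sum_congr mul_sum sum_le_sum mem_univ univ range Ico sum_const sum_add_distrib card_univ
  sum_singleton sum_eq_zero sum_nonneg sum_eq_single)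
open Complex (norm_real ofReal_mul ofReal_ne_zero conj_ofReal ofReal_pow I)
open Real (exp log sq_sqrt norm_eq_abs sqrt_pos sqrt_nonneg sqrt_mul exp_pos)
open ContinuousLinearMap (comp_apply)
open Function (update)
open Equiv (Perm)

variable {d : ℕ} (w : EuclideanSpace ℝ (Fin d)) (ε : ℝ)

/-! ### Rearrangements of tuples -/

/-- The multiset of entries of a tuple; it determines the tuple up to rearrangement. -/
def entries {α : Type*} {n : ℕ} (k : Fin n → α) : Multiset α := univ.val.map k

section entries
variable {α : Type*} {n : ℕ}

lemma entries_comp_perm (k : Fin n → α) (σ : Perm (Fin n)) :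
    entries (k ∘ σ) = entries k := by
  unfold entries
  rw [← Multiset.map_map, Multiset.map_univ_val_equiv]

lemma exists_perm_of_entries_eq {k k' : Fin n → α} (h : entries k = entries k') :
    ∃ σ : Perm (Fin n), k' = k ∘ σ := by
  classical
  have hc : ∀ c, Nonempty ({i // k' i = c} ≃ {i // k i = c}) := by
    intro c
    refine ⟨Fintype.equivOfCardEq ?_⟩
    have := congrArg (Multiset.count c) h
    unfold entries at this
    rw [Multiset.count_map, Multiset.count_map] at this
    rw [Fintype.card_subtype, Fintype.card_subtype, Finset.card_def, Finset.card_def,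
      Finset.filter_val, Finset.filter_val]
    simpa [eq_comm] using this.symm
  refine ⟨Equiv.ofFiberEquiv (fun c => (hc c).some), ?_⟩
  funext i
  exact (Equiv.ofFiberEquiv_map (fun c => (hc c).some) i).symm

lemma entries_cons (a : α) (k : Fin n → α) :
    entries (Fin.cons a k : Fin (n + 1) → α) = a ::ₘ entries k := by
  unfold entries
  rw [Fin.univ_succ]
  simp [Function.comp_def]

lemma entries_succAbove (k : Fin (n + 1) → α) (i : Fin (n + 1)) :
    k i ::ₘ entries (k ∘ i.succAbove) = entries k := by
  unfold entries
  rw [Fin.univ_succAbove n i]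
  simp [Function.comp_def]

lemma entries_tail (k : Fin (n + 1) → α) : k 0 ::ₘ entries (Fin.tail k) = entries k := by
  rw [← entries_cons, Fin.cons_self_tail]

lemma entries_update (k : Fin n → α) (i : Fin n) (v : α) :
    k i ::ₘ entries (update k i v) = v ::ₘ entries k := by
  obtain _ | n := n
  · exact i.elim0
  rw [← entries_succAbove (update k i v) i, ← entries_succAbove k i, Multiset.cons_swap]
  have : update k i v ∘ i.succAbove = k ∘ i.succAbove := by
    funext c; simp [Fin.succAbove_ne]
  simp [this]

end entries

/-! ### The Fock space as a closed subspace of a sequence space -/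

/-- Labels of Fourier coefficients: a chaos order and a tuple of modes. -/
abbrev Idx (d : ℕ) : Type := Σ n : ℕ, Fin n → Mode d

/-- Square summable families of coefficients. -/
abbrev SeqSpace (d : ℕ) : Type := lp (fun _ : Idx d => ℂ) 2

/-- The Fock space without vacuum, a kernel `ψ_n` being recorded through the coefficients
`√(n!) ψ̂_n`, so that the norm is the plain `ℓ²` norm. -/
def fockSub (d : ℕ) : Submodule ℂ (SeqSpace d) where
  carrier := {x | (∀ (n : ℕ) (σ : Perm (Fin n)) (k : Fin n → Mode d), x ⟨n, k ∘ σ⟩ = x ⟨n, k⟩) ∧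
    ∀ (n : ℕ) (k : Fin n → Mode d), (n = 0 ∨ ∃ i, k i = 0) → x ⟨n, k⟩ = 0}
  add_mem' := by
    rintro x y ⟨h1, h2⟩ ⟨h3, h4⟩
    refine ⟨fun n σ k => ?_, fun n k h => ?_⟩
    · simp [h1 n σ k, h3 n σ k]
    · simp [h2 n k h, h4 n k h]
  zero_mem' := ⟨fun _ _ _ => rfl, fun _ _ _ => rfl⟩
  smul_mem' := by
    rintro c x ⟨h1, h2⟩
    refine ⟨fun n σ k => ?_, fun n k h => ?_⟩
    · simp [h1 n σ k]
    · simp [h2 n k h]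

/-- The Fock space without vacuum, as a Hilbert space. -/
abbrev Fock (d : ℕ) : Type := fockSub d

local notation "𝕄" n:max => Fin n → Mode d
local notation "𝓛" => Fock d →L[ℂ] Fock d
local notation:max "𝔼" n:max => EuclideanSpace ℝ (Fin n)

/-- The scalar product of the sequence space; the shortcut keeps instance search away from the
scalar product of Hilbert `C⋆`-modules. -/
instance : Inner ℂ (SeqSpace d) := InnerProductSpace.toInner

/-- The scalar product of the Fock space. -/
instance : Inner ℂ (Fock d) := InnerProductSpace.toInner

lemma isClosed_fockSub : IsClosed (fockSub d : Set (SeqSpace d)) := by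
  have hc : ∀ i : Idx d, Continuous fun x : SeqSpace d => x i := fun i =>
    (lp.lipschitzWith_one_eval 2 i).continuous
  have : (fockSub d : Set (SeqSpace d)) = (⋂ (n : ℕ) (σ : Perm (Fin n)) (k : 𝕄 n),
        {x : SeqSpace d | x ⟨n, k ∘ σ⟩ = x ⟨n, k⟩}) ∩
      ⋂ (n : ℕ) (k : 𝕄 n) (_ : n = 0 ∨ ∃ i, k i = 0),
        {x : SeqSpace d | x ⟨n, k⟩ = 0} := by
    ext x
    simp only [Set.mem_inter_iff, Set.mem_iInter]
    rfl
  rw [this]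
  refine IsClosed.inter ?_ ?_
  · exact isClosed_iInter fun n => isClosed_iInter fun σ => isClosed_iInter fun k =>
      isClosed_eq (hc _) (hc _)
  · exact isClosed_iInter fun n => isClosed_iInter fun k => isClosed_iInter fun _ =>
      isClosed_eq (hc _) continuous_const

instance : CompleteSpace (Fock d) := isClosed_fockSub.completeSpace_coe

/-- The coefficient of a Fock vector at a tuple of modes. -/
def co (x : Fock d) (n : ℕ) (k : 𝕄 n) : ℂ := (x : SeqSpace d) ⟨n, k⟩

lemma Fock.ext {x y : Fock d} (h : ∀ n k, co x n k = co y n k) : x = y := by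
  apply Subtype.ext
  apply lp.ext
  funext ⟨n, k⟩
  exact h n k

@[simp] lemma co_add (x y : Fock d) (n k) : co (x + y) n k = co x n k + co y n k := rfl
@[simp] lemma co_sub (x y : Fock d) (n k) : co (x - y) n k = co x n k - co y n k := rfl
@[simp] lemma co_neg (x : Fock d) (n k) : co (-x) n k = -co x n k := rfl
@[simp] lemma co_smul (c : ℂ) (x : Fock d) (n k) : co (c • x) n k = c * co x n k := rfl
@[simp] lemma co_zero (n k) : co (0 : Fock d) n k = 0 := rfl

lemma co_perm (x : Fock d) {n : ℕ} (σ : Perm (Fin n)) (k : 𝕄 n) :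
    co x n (k ∘ σ) = co x n k := x.2.1 n σ k

lemma co_congr (x : Fock d) {n : ℕ} {k k' : 𝕄 n} (h : entries k = entries k') :
    co x n k = co x n k' := by
  obtain ⟨σ, rfl⟩ := exists_perm_of_entries_eq h
  exact (co_perm x σ k).symm

lemma co_of_zero (x : Fock d) {n : ℕ} {k : 𝕄 n} {i : Fin n} (h : k i = 0) :
    co x n k = 0 := x.2.2 n k (Or.inr ⟨i, h⟩)

@[simp] lemma co_chaos_zero (x : Fock d) (k : 𝕄 0) : co x 0 k = 0 := x.2.2 0 k (Or.inl rfl)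

lemma hasSum_norm_sq (x : Fock d) : HasSum (fun i : Idx d => ‖co x i.1 i.2‖ ^ 2) (‖x‖ ^ 2) := by
  have := lp.hasSum_norm (p := 2) (by norm_num) (x : SeqSpace d)
  simp only [ENNReal.toReal_ofNat, Real.rpow_ofNat] at this
  exact this

lemma enorm_sq_eq_tsum (x : Fock d) : ‖x‖ₑ ^ 2 = ∑' (n : ℕ) (k : 𝕄 n), ‖co x n k‖ₑ ^ 2 := by
  rw [← ENNReal.tsum_sigma (fun n k => ‖co x n k‖ₑ ^ 2)]
  have h := hasSum_norm_sq x
  have h2 : ∀ z : ℂ, ‖z‖ₑ ^ 2 = ENNReal.ofReal (‖z‖ ^ 2) := fun z => by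
    rw [ENNReal.ofReal_pow (norm_nonneg _), ofReal_norm]
  simp only [h2]
  rw [← ENNReal.ofReal_tsum_of_nonneg (fun i => by positivity) h.summable, h.tsum_eq,
    ENNReal.ofReal_pow (norm_nonneg _), ofReal_norm]

lemma memlp_of_tsum_lt_top {f : Idx d → ℂ} (h : ∑' i, ‖f i‖ₑ ^ 2 < ⊤) : Memℓp f 2 := by
  apply memℓp_gen
  have h2 : ∀ z : ℂ, ‖z‖ₑ ^ 2 = ((‖z‖₊ ^ 2 : NNReal) : ℝ≥0∞) := fun z => by
    simp [enorm_eq_nnnorm]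
  simp only [h2] at h
  have := ENNReal.tsum_coe_ne_top_iff_summable.1 h.ne
  have := (NNReal.summable_coe.2 this)
  simpa using this

/-- A Fock vector from its coefficients. -/
def mkFock (f : (n : ℕ) → 𝕄 n → ℂ)
    (hs : ∀ (n : ℕ) (σ : Perm (Fin n)) (k : 𝕄 n), f n (k ∘ σ) = f n k)
    (hz : ∀ (n : ℕ) (k : 𝕄 n), (n = 0 ∨ ∃ i, k i = 0) → f n k = 0)
    (hf : ∑' (n : ℕ) (k : 𝕄 n), ‖f n k‖ₑ ^ 2 < ⊤) : Fock d :=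
  ⟨⟨fun i => f i.1 i.2, memlp_of_tsum_lt_top (by
    rw [ENNReal.tsum_sigma (fun n k => ‖f n k‖ₑ ^ 2)]; exact hf)⟩, hs, hz⟩

@[simp] lemma co_mkFock (f : (n : ℕ) → 𝕄 n → ℂ) (hs hz hf) (n k) :
    co (mkFock f hs hz hf) n k = f n k := rfl

lemma norm_le_of_enorm_sq_le {x : Fock d} {B a : ℝ} (hB : 0 ≤ B) (ha : 0 ≤ a)
    (h : ∑' (n : ℕ) (k : 𝕄 n), ‖co x n k‖ₑ ^ 2
      ≤ ENNReal.ofReal B ^ 2 * ENNReal.ofReal a ^ 2) : ‖x‖ ≤ B * a := by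
  rw [← enorm_sq_eq_tsum, ← mul_pow] at h
  have h1 : ‖x‖ₑ ≤ ENNReal.ofReal B * ENNReal.ofReal a :=
    le_of_not_gt fun hlt => absurd h (not_le.2 (ENNReal.pow_lt_pow_left two_ne_zero hlt))
  rw [← ENNReal.ofReal_mul hB, ← ofReal_norm] at h1
  exact (ENNReal.ofReal_le_ofReal_iff (by positivity)).1 h1

/-- A bounded operator on the Fock space from its action on coefficients. -/
def mkOp (f : Fock d → (n : ℕ) → 𝕄 n → ℂ) (hadd : ∀ x y n k, f (x + y) n k = f x n k + f y n k)
    (hsmul : ∀ (c : ℂ) x n k, f (c • x) n k = c * f x n k)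
    (hs : ∀ x (n : ℕ) (σ : Perm (Fin n)) (k : 𝕄 n), f x n (k ∘ σ) = f x n k)
    (hz : ∀ x (n : ℕ) (k : 𝕄 n), (n = 0 ∨ ∃ i, k i = 0) → f x n k = 0)
    (B : ℝ) (hB : 0 ≤ B)
    (hf : ∀ x, ∑' (n : ℕ) (k : 𝕄 n), ‖f x n k‖ₑ ^ 2 ≤ ENNReal.ofReal B ^ 2 * ‖x‖ₑ ^ 2) : 𝓛 :=
  LinearMap.mkContinuous
    { toFun := fun x => mkFock (f x) (hs x) (hz x) ((hf x).trans_lt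
        (ENNReal.mul_lt_top (by simp) (by simp [enorm_lt_top])))
      map_add' := fun x y => Fock.ext fun n k => by simp [hadd]
      map_smul' := fun c x => Fock.ext fun n k => by simp [hsmul] } B fun x => by
    apply norm_le_of_enorm_sq_le hB (norm_nonneg _)
    rw [ofReal_norm]
    exact hf x

lemma hasSum_inner_co (x y : Fock d) :
    HasSum (fun i : Idx d => starRingEnd ℂ (co x i.1 i.2) * co y i.1 i.2) (inner ℂ x y) := by
  have := lp.hasSum_inner (𝕜 := ℂ) (x : SeqSpace d) (y : SeqSpace d)
  simp only [RCLike.inner_apply'] at this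
  exact this

/-! ### Fourier multipliers -/

/-- A bounded symmetric real Fourier multiplier. -/
structure Multiplier (d : ℕ) where
  /-- the values of the multiplier -/
  val : (n : ℕ) → (Fin n → Mode d) → ℝ
  symm : ∀ (n : ℕ) (σ : Perm (Fin n)) (k : Fin n → Mode d), val n (k ∘ σ) = val n k
  bdd : ∃ C : ℝ, 0 ≤ C ∧ ∀ n k, |val n k| ≤ C

lemma enorm_mul_le_of_abs_le {C r : ℝ} (h : |r| ≤ C) (z : ℂ) :
    ‖(r : ℂ) * z‖ₑ ^ 2 ≤ ENNReal.ofReal C ^ 2 * ‖z‖ₑ ^ 2 := by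
  rw [enorm_mul, mul_pow]
  gcongr
  rw [← ofReal_norm]
  apply ENNReal.ofReal_le_ofReal
  simpa using h

/-- The operator of multiplication by a Fourier multiplier. -/
def Multiplier.op (m : Multiplier d) : 𝓛 :=
  mkOp (fun x n k => (m.val n k : ℂ) * co x n k) (fun x y n k => by simp [mul_add])
    (fun c x n k => by simp; ring) (fun x n σ k => by rw [m.symm, co_perm])
    (fun x n k h => by rw [show co x n k = 0 from x.2.2 n k h, mul_zero])
    m.bdd.choose m.bdd.choose_spec.1 (fun x => by
      rw [enorm_sq_eq_tsum, ← ENNReal.tsum_mul_left]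
      refine ENNReal.tsum_le_tsum fun n => ?_
      rw [← ENNReal.tsum_mul_left]
      exact ENNReal.tsum_le_tsum fun k => enorm_mul_le_of_abs_le (m.bdd.choose_spec.2 n k) _)

@[simp] lemma Multiplier.co_op (m : Multiplier d) (x : Fock d) (n k) :
    co (m.op x) n k = (m.val n k : ℂ) * co x n k := rfl

lemma Multiplier.norm_op_le (m : Multiplier d) {C : ℝ} (hC : 0 ≤ C) (x : Fock d)
    (h : ∀ n k, co x n k ≠ 0 → |m.val n k| ≤ C) : ‖m.op x‖ ≤ C * ‖x‖ := by
  apply norm_le_of_enorm_sq_le hC (norm_nonneg _)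
  rw [ofReal_norm, enorm_sq_eq_tsum, ← ENNReal.tsum_mul_left]
  refine ENNReal.tsum_le_tsum fun n => ?_
  rw [← ENNReal.tsum_mul_left]
  refine ENNReal.tsum_le_tsum fun k => ?_
  by_cases h0 : co x n k = 0
  · simp [h0]
  · exact enorm_mul_le_of_abs_le (h n k h0) _

lemma Multiplier.inner_op (m : Multiplier d) (x y : Fock d) :
    inner ℂ (m.op x) y = inner ℂ x (m.op y) := by
  rw [← (hasSum_inner_co _ _).tsum_eq, ← (hasSum_inner_co _ _).tsum_eq]
  refine tsum_congr fun i => ?_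
  simp only [Multiplier.co_op, map_mul, conj_ofReal]
  ring

open Classical in
/-- The projection onto a set of chaoses. -/
def chaosMul (d : ℕ) (s : Set ℕ) : Multiplier d where
  val n _ := if n ∈ s then 1 else 0
  symm _ _ _ := rfl
  bdd := ⟨1, zero_le_one, fun n k => by split_ifs <;> simp⟩

open Classical in
lemma co_chaosMul (s : Set ℕ) (x : Fock d) (n k) :
    co ((chaosMul d s).op x) n k = if n ∈ s then co x n k else 0 := by
  simp only [Multiplier.co_op, chaosMul]
  split_ifs <;> simp

lemma norm_chaosMul_le (s : Set ℕ) (x : Fock d) : ‖(chaosMul d s).op x‖ ≤ ‖x‖ := by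
  simpa using (chaosMul d s).norm_op_le zero_le_one x
    fun n k _ => by simp only [chaosMul]; split_ifs <;> simp

/-! ### Row bounds -/

/-- Cauchy–Schwarz bound for an operator between sequence spaces given by finitely many
injective substitutions: it is controlled by the largest Hilbert–Schmidt norm of a row. -/
lemma tsum_enorm_sq_le_of_row {α β ι L : Type*} [Fintype ι] (s : Finset L)
    (e : ι → α → L → β) (he : ∀ j, Function.Injective fun p : α × L => e j p.1 p.2)
    (K : α → ι → L → ℝ) (f : α → ℂ) (x : β → ℂ)
    (hf : ∀ a, ‖f a‖ ≤ ∑ j, ∑ l ∈ s, K a j l * ‖x (e j a l)‖) {C : ℝ}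
    (hC : ∀ a, ∑ j, ∑ l ∈ s, K a j l ^ 2 ≤ C) :
    ∑' a, ‖f a‖ₑ ^ 2 ≤ ENNReal.ofReal (C * Fintype.card ι) * ∑' b, ‖x b‖ₑ ^ 2 := by
  have h2 : ∀ z : ℂ, ‖z‖ₑ ^ 2 = ENNReal.ofReal (‖z‖ ^ 2) := fun z => by
    rw [ENNReal.ofReal_pow (norm_nonneg _), ofReal_norm]
  rcases isEmpty_or_nonempty α with hα | ⟨⟨a0⟩⟩
  · simp
  have hC0 : 0 ≤ C := le_trans (by positivity) (hC a0)
  have key : ∀ a, ‖f a‖ₑ ^ 2 ≤ ENNReal.ofReal C * ∑ j, ∑ l ∈ s, ‖x (e j a l)‖ₑ ^ 2 := by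
    intro a
    have h1 : ‖f a‖ ^ 2 ≤ C * ∑ j, ∑ l ∈ s, ‖x (e j a l)‖ ^ 2 := by
      have hcs := Finset.sum_mul_sq_le_sq_mul_sq (univ ×ˢ s)
        (fun p : ι × L => K a p.1 p.2) (fun p => ‖x (e p.1 a p.2)‖)
      rw [Finset.sum_product, Finset.sum_product, Finset.sum_product] at hcs
      calc ‖f a‖ ^ 2 ≤ (∑ j, ∑ l ∈ s, K a j l * ‖x (e j a l)‖) ^ 2 := by
            gcongr; exact hf a
        _ ≤ _ := hcs
        _ ≤ _ := by gcongr; exact hC a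
    rw [h2]
    simp only [h2]
    rw [← sum_congr rfl fun j _ => ENNReal.ofReal_sum_of_nonneg (fun l _ => by positivity),
      ← ENNReal.ofReal_sum_of_nonneg (fun j _ => by positivity), ← ENNReal.ofReal_mul hC0]
    exact ENNReal.ofReal_le_ofReal h1
  calc ∑' a, ‖f a‖ₑ ^ 2 ≤ ∑' a, ENNReal.ofReal C * ∑ j, ∑ l ∈ s, ‖x (e j a l)‖ₑ ^ 2 :=
        ENNReal.tsum_le_tsum key
    _ = ENNReal.ofReal C * ∑ j, ∑' a, ∑ l ∈ s, ‖x (e j a l)‖ₑ ^ 2 := by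
        rw [ENNReal.tsum_mul_left, Summable.tsum_finsetSum (fun _ _ => ENNReal.summable)]
    _ ≤ ENNReal.ofReal C * ∑ j : ι, ∑' b, ‖x b‖ₑ ^ 2 := by
        gcongr with j
        calc ∑' a, ∑ l ∈ s, ‖x (e j a l)‖ₑ ^ 2 ≤ ∑' a, ∑' l, ‖x (e j a l)‖ₑ ^ 2 :=
              ENNReal.tsum_le_tsum fun a => ENNReal.sum_le_tsum s
          _ = ∑' p : α × L, ‖x (e j p.1 p.2)‖ₑ ^ 2 :=
              (ENNReal.tsum_prod (f := fun a l => ‖x (e j a l)‖ₑ ^ 2)).symm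
          _ ≤ _ := ENNReal.tsum_comp_le_tsum_of_injective (he j) (fun b => ‖x b‖ₑ ^ 2)
    _ = _ := by
        rw [sum_const, card_univ, ENNReal.ofReal_mul hC0, nsmul_eq_mul,
          ENNReal.ofReal_natCast, mul_assoc]

/-- A bound for an operator which lowers the chaos order by `s`, from bounds on each chaos. -/
lemma tsum_enorm_sq_le_of_shift {f : (n : ℕ) → 𝕄 n → ℂ} {x : Fock d} {B : ℝ}
    (s : ℕ) (h : ∀ n, ∑' k, ‖f n k‖ₑ ^ 2 ≤ ENNReal.ofReal B ^ 2 * ∑' k, ‖co x (n + s) k‖ₑ ^ 2) :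
    ∑' (n : ℕ) (k : 𝕄 n), ‖f n k‖ₑ ^ 2 ≤ ENNReal.ofReal B ^ 2 * ‖x‖ₑ ^ 2 := by
  calc _ ≤ ∑' n, ENNReal.ofReal B ^ 2 * ∑' k, ‖co x (n + s) k‖ₑ ^ 2 := ENNReal.tsum_le_tsum h
    _ ≤ _ := by
      rw [ENNReal.tsum_mul_left, enorm_sq_eq_tsum]
      refine mul_le_mul_right ?_ _
      exact ENNReal.tsum_comp_le_tsum_of_injective (add_left_injective s)
        (fun n => ∑' k, ‖co x n k‖ₑ ^ 2)

-- The energy of the pair of modes `(ℓ, p - ℓ)`.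
local notation:max "𝓔" p:max l:max => 1 / 2 * (modeSq l + modeSq (p - l))
open Multiplier (co_op inner_op)

/-! ### Modes and the cut-off -/

lemma modeSq_nonneg (k : Mode d) : 0 ≤ modeSq k := sum_nonneg fun _ _ => sq_nonneg _

lemma modeSq_eq_zero {k : Mode d} : modeSq k = 0 ↔ k = 0 := by
  unfold modeSq
  rw [Finset.sum_eq_zero_iff_of_nonneg fun _ _ => sq_nonneg _]
  constructor
  · intro h
    funext a
    simpa using h a (mem_univ a)
  · rintro rfl
    simp

lemma one_le_modeSq {k : Mode d} (h : k ≠ 0) : 1 ≤ modeSq k := by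
  have hint : modeSq k = ((∑ a, k a ^ 2 : ℤ) : ℝ) := by simp [modeSq]
  have hpos : 0 < modeSq k := lt_of_le_of_ne (modeSq_nonneg k) fun h0 =>
    h (modeSq_eq_zero.1 h0.symm)
  rw [hint] at hpos ⊢
  exact_mod_cast hpos

@[simp] lemma dotMode_zero : dotMode w (0 : Mode d) = 0 := by
  simp [dotMode]

lemma dotMode_sq_le (k : Mode d) :
    dotMode w k ^ 2 ≤ ‖w‖ ^ 2 * modeSq k := by
  rw [EuclideanSpace.norm_sq_eq]
  simp only [norm_eq_abs, sq_abs]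
  exact Finset.sum_mul_sq_le_sq_mul_sq _ _ _

lemma abs_coord_le_cutoffNorm (k : Mode d) (a : Fin d) : |(k a : ℝ)| ≤ cutoffNorm k := by
  unfold cutoffNorm
  split_ifs
  · apply Real.abs_le_sqrt
    exact Finset.single_le_sum (f := fun a => (k a : ℝ) ^ 2) (fun _ _ => sq_nonneg _) (mem_univ a)
  · simpa [Int.norm_eq_abs] using norm_le_pi_norm k a

lemma cutoffNorm_nonneg (k : Mode d) : 0 ≤ cutoffNorm k := by
  unfold cutoffNorm; split_ifs <;> positivity

lemma cutoff_nonneg (ε : ℝ) (l m : Mode d) : 0 ≤ cutoff ε l m := by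
  unfold cutoff; split_ifs <;> simp

lemma cutoff_le_one (ε : ℝ) (l m : Mode d) : cutoff ε l m ≤ 1 := by
  unfold cutoff; split_ifs <;> simp

lemma cutoff_sq (ε : ℝ) (l m : Mode d) : cutoff ε l m ^ 2 = cutoff ε l m := by
  unfold cutoff; split_ifs <;> simp

lemma cutoff_comm (ε : ℝ) (l m : Mode d) : cutoff ε l m = cutoff ε m l := by
  unfold cutoff; rw [add_comm l m]; congr 1; simp only [eq_iff_iff]; tauto

@[simp] lemma cutoffNorm_zero : cutoffNorm (0 : Mode d) = 0 := by
  unfold cutoffNorm; split_ifs <;> simp [modeSq]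

lemma of_cutoff_ne_zero {ε : ℝ} {l m : Mode d} (h : cutoff ε l m ≠ 0) :
    (0 < ε * cutoffNorm l ∧ ε * cutoffNorm l ≤ 1) ∧ (0 < ε * cutoffNorm m ∧ ε * cutoffNorm m ≤ 1) ∧
      (0 < ε * cutoffNorm (l + m) ∧ ε * cutoffNorm (l + m) ≤ 1) := by
  unfold cutoff at h
  by_contra h2
  exact h (if_neg h2)

lemma cutoff_zero_left (ε : ℝ) (m : Mode d) : cutoff ε 0 m = 0 := by
  by_contra h
  have := (of_cutoff_ne_zero h).1.1
  simp at this

lemma cutoff_zero_right (ε : ℝ) (m : Mode d) : cutoff ε m 0 = 0 := by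
  rw [cutoff_comm, cutoff_zero_left]

lemma ne_zero_of_cutoffNorm_pos {ε : ℝ} {l : Mode d} (h : 0 < ε * cutoffNorm l) : l ≠ 0 := by
  rintro rfl; simp at h

lemma eps_pos_of_cutoffNorm_pos {ε : ℝ} {l : Mode d} (h : 0 < ε * cutoffNorm l) : 0 < ε :=
  pos_of_mul_pos_left h (cutoffNorm_nonneg l)

lemma abs_coord_le_inv {ε : ℝ} {l : Mode d} (h : 0 < ε * cutoffNorm l ∧ ε * cutoffNorm l ≤ 1)
    (a : Fin d) : |(l a : ℝ)| ≤ ε⁻¹ := by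
  have hε := eps_pos_of_cutoffNorm_pos h.1
  refine (abs_coord_le_cutoffNorm l a).trans ?_
  rw [← one_div, le_div_iff₀' hε]
  exact h.2

/-- A finite set of modes containing all those selected by the cut-off. -/
def box (d : ℕ) (ε : ℝ) : Finset (Mode d) := Fintype.piFinset fun _ => Finset.Icc (-⌈ε⁻¹⌉) ⌈ε⁻¹⌉

lemma mem_box_of_abs_le {ε : ℝ} {l : Mode d} (h : ∀ a, |(l a : ℝ)| ≤ ε⁻¹) : l ∈ box d ε := by
  simp only [box, Fintype.mem_piFinset, Finset.mem_Icc]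
  intro a
  have h1 := (h a).trans (Int.le_ceil ε⁻¹)
  rw [abs_le] at h1
  constructor
  · exact_mod_cast h1.1
  · exact_mod_cast h1.2

lemma mem_box_of_cutoff {ε : ℝ} {l m : Mode d} (h : cutoff ε l m ≠ 0) : l ∈ box d ε :=
  mem_box_of_abs_le (abs_coord_le_inv (of_cutoff_ne_zero h).1)

/-! ### The annihilation operator -/

/-- The scalar prefactor of the annihilation operator on normalised coefficients, restricted to
target chaoses in `[a, b)`. -/
def annihCoef (d : ℕ) (ε : ℝ) (a b n : ℕ) : ℂ := if a ≤ n ∧ n < b then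
    -(I / (((2 * π) ^ ((d : ℝ) / 2) : ℝ) : ℂ)) * ((√(n + 1) * coupling d ε : ℝ) : ℂ) else 0

lemma two_pi_rpow_pos (s : ℝ) : 0 < (2 * π) ^ s := Real.rpow_pos_of_pos (by positivity) _

lemma norm_annihCoef_le (ε : ℝ) (a b n : ℕ) :
    ‖annihCoef d ε a b n‖ ≤ √(n + 1) * |coupling d ε| / (2 * π) ^ ((d : ℝ) / 2) := by
  have := two_pi_rpow_pos ((d : ℝ) / 2)
  unfold annihCoef
  split_ifs
  · rw [norm_mul, norm_neg, norm_div, Complex.norm_I, norm_real, norm_real,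
      norm_eq_abs, norm_eq_abs, abs_mul, abs_of_pos this,
      abs_of_nonneg (sqrt_nonneg _)]
    apply le_of_eq; ring
  · rw [norm_zero]; positivity

lemma conj_annihCoef (ε : ℝ) (a b n : ℕ) :
    starRingEnd ℂ (annihCoef d ε a b n) = -annihCoef d ε a b n := by
  unfold annihCoef
  split_ifs
  · simp only [map_mul, map_neg, map_div₀, Complex.conj_I, conj_ofReal]; ring
  · simp

/-- The tuple `(ℓ, k_1, …, k_j - ℓ, …, k_n)` obtained by splitting the mode `k_j`. -/
def split {n : ℕ} (k : 𝕄 n) (j : Fin n) (l : Mode d) : 𝕄 (n + 1) :=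
  Fin.cons l (update k j (k j - l))

lemma split_injective {n : ℕ} (j : Fin n) :
    Function.Injective fun p : 𝕄 n × Mode d => split p.1 j p.2 := by
  rintro ⟨k, l⟩ ⟨k', l'⟩ h
  obtain ⟨rfl, h2⟩ := Fin.cons_injective2 h
  have hj := congrFun h2 j
  simp only [Function.update_self, sub_left_inj] at hj
  refine Prod.ext (funext fun i => ?_) rfl
  by_cases hi : i = j
  · subst hi; exact hj
  · have := congrFun h2 i
    simpa [hi] using this

lemma entries_split {n : ℕ} (k : 𝕄 n) (j : Fin n) (l : Mode d) :
    k j ::ₘ entries (split k j l) = l ::ₘ (k j - l) ::ₘ entries k := by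
  rw [split, entries_cons, Multiset.cons_swap, entries_update]

lemma sum_split {n : ℕ} (k : 𝕄 n) (j : Fin n) (l : Mode d) : ∑ i, split k j l i = ∑ i, k i := by
  rw [split, Fin.sum_cons]
  rw [Finset.sum_update_of_mem (mem_univ j)]
  rw [← Finset.sum_sdiff (Finset.subset_univ {j})]
  simp only [sum_singleton]
  abel

/-- The coefficients of the annihilation operator. -/
def annihFun (a b : ℕ) (x : Fock d) (n : ℕ) (k : 𝕄 n) : ℂ :=
  annihCoef d ε a b n * ∑ j, ∑ l ∈ box d ε,
    ((dotMode w (k j) * cutoff ε l (k j - l) : ℝ) : ℂ) * co x (n + 1) (split k j l)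

lemma annihFun_perm (a b : ℕ) (x : Fock d) (n : ℕ) (σ : Perm (Fin n)) (k : 𝕄 n) :
    annihFun w ε a b x n (k ∘ σ) = annihFun w ε a b x n k := by
  unfold annihFun
  congr 1
  rw [← Equiv.sum_comp σ (fun j => ∑ l ∈ box d ε,
    ((dotMode w (k j) * cutoff ε l (k j - l) : ℝ) : ℂ) * co x (n + 1) (split k j l))]
  refine sum_congr rfl fun j _ => sum_congr rfl fun l _ => ?_
  congr 1
  apply co_congr
  have h1 := entries_split (k ∘ σ) j l
  rw [entries_comp_perm] at h1
  have h2 := entries_split k (σ j) l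
  exact (Multiset.cons_inj_right (k (σ j))).1 (h1.trans h2.symm)

lemma annihFun_zero (a b : ℕ) (x : Fock d) (n : ℕ)
    (k : 𝕄 n) (h : n = 0 ∨ ∃ i, k i = 0) : annihFun w ε a b x n k = 0 := by
  unfold annihFun
  rcases h with rfl | ⟨i, hi⟩
  · simp
  · rw [sum_eq_zero, mul_zero]
    intro j _
    refine sum_eq_zero fun l _ => ?_
    by_cases hj : i = j
    · subst hj; simp [hi]
    · rw [co_of_zero (i := i.succ), mul_zero]
      simp [split, hj, hi]

/-- The bound for the annihilation operator, between two multipliers, in terms of its rows. -/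
lemma tsum_annihFun_le (a b : ℕ) (x : Fock d) (m₁ m₂ : (n : ℕ) → 𝕄 n → ℝ) (y : Fock d)
    (hy : ∀ n k, co y n k = (m₂ n k : ℂ) * co x n k) {B : ℝ} (hB0 : 0 ≤ B)
    (hB : ∀ n k, a ≤ n → n < b → (∑ j, ∑ l ∈ box d ε,
      (√(n + 1) * |coupling d ε| / (2 * π) ^ ((d : ℝ) / 2) * |m₁ n k| *
        |dotMode w (k j)| * cutoff ε l (k j - l) * |m₂ (n + 1) (split k j l)|) ^ 2) * n ≤ B ^ 2) :
    ∑' (n : ℕ) (k : 𝕄 n), ‖(m₁ n k : ℂ) * annihFun w ε a b y n k‖ₑ ^ 2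
      ≤ ENNReal.ofReal B ^ 2 * ‖x‖ₑ ^ 2 := by
  refine tsum_enorm_sq_le_of_shift 1 fun n => ?_
  by_cases hn : a ≤ n ∧ n < b
  swap
  · simp [annihFun, annihCoef, hn]
  obtain rfl | hn0 := Nat.eq_zero_or_pos n
  · simp [annihFun]
  have hn' : (0 : ℝ) < n := by exact_mod_cast hn0
  refine (tsum_enorm_sq_le_of_row (box d ε) (fun j k l => split k j l)
    (fun j => split_injective j) (fun k j l => √(n + 1) * |coupling d ε| /
      (2 * π) ^ ((d : ℝ) / 2) * |m₁ n k| *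
        |dotMode w (k j)| * cutoff ε l (k j - l) * |m₂ (n + 1) (split k j l)|) _
      (fun κ => co x (n + 1) κ) (fun k => ?_) (C := B ^ 2 / n) fun k => ?_).trans ?_
  · rw [norm_mul, annihFun, norm_mul]
    have h1 := norm_annihCoef_le (d := d) ε a b n
    calc _ ≤ ‖(m₁ n k : ℂ)‖ * (√(n + 1) * |coupling d ε| /
          (2 * π) ^ ((d : ℝ) / 2) * ∑ j, ∑ l ∈ box d ε,
          ‖((dotMode w (k j) * cutoff ε l (k j - l) : ℝ) : ℂ) * co y (n + 1) (split k j l)‖) := by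
          gcongr
          exact (norm_sum_le _ _).trans (sum_le_sum fun j _ => norm_sum_le _ _)
      _ = _ := by
          simp only [mul_sum]
          refine sum_congr rfl fun j _ => sum_congr rfl fun l _ => ?_
          rw [hy, norm_mul, norm_mul, norm_real, norm_real, norm_real,
            norm_eq_abs, norm_eq_abs, norm_eq_abs, abs_mul,
            abs_of_nonneg (cutoff_nonneg _ _ _)]
          ring
  · rw [le_div_iff₀ hn']
    exact hB n k hn.1 hn.2
  · rw [Fintype.card_fin, div_mul_cancel₀ _ hn'.ne', ENNReal.ofReal_pow hB0]

/-- A crude bound for `|𝔴 · k|` on modes below the cut-off. -/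
lemma abs_dotMode_mul_cutoff_le (k l : Mode d) :
    |dotMode w k| * cutoff ε l (k - l) ≤ (∑ a, |w a|) * |ε⁻¹| := by
  by_cases h : cutoff ε l (k - l) = 0
  · rw [h, mul_zero]; positivity
  · have h3 := (of_cutoff_ne_zero h).2.2
    rw [add_sub_cancel] at h3
    calc _ ≤ |dotMode w k| * 1 := by gcongr; exact cutoff_le_one _ _ _
      _ ≤ ∑ a, |w a| * |(k a : ℝ)| := by
        rw [mul_one]
        exact (Finset.abs_sum_le_sum_abs _ _).trans_eq (by simp [abs_mul])
      _ ≤ _ := by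
        rw [Finset.sum_mul]
        refine sum_le_sum fun a _ => mul_le_mul_of_nonneg_left ?_ (abs_nonneg _)
        exact (abs_coord_le_inv h3 a).trans (le_abs_self _)

/-- A crude bound for the norm of the annihilation operator at a fixed scale. -/
def annihBound (b : ℕ) : ℝ := √((b * (box d ε).card * (√(b + 1) * |coupling d ε| /
    (2 * π) ^ ((d : ℝ) / 2) * ((∑ a, |w a|) * |ε⁻¹|)) ^ 2) * b)

lemma tsum_annihFun_le_annihBound (a b : ℕ) (x : Fock d) :
    ∑' (n : ℕ) (k : 𝕄 n), ‖annihFun w ε a b x n k‖ₑ ^ 2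
      ≤ ENNReal.ofReal (annihBound w ε b) ^ 2 * ‖x‖ₑ ^ 2 := by
  have hpi := two_pi_rpow_pos ((d : ℝ) / 2)
  have h := tsum_annihFun_le w ε a b x (fun _ _ => 1) (fun _ _ => 1) x (by simp)
    (B := annihBound w ε b) (sqrt_nonneg _) (fun n k _ hn => ?_)
  · simpa using h
  · rw [annihBound, sq_sqrt (by positivity)]
    have hnb : (n : ℝ) ≤ b := by exact_mod_cast hn.le
    refine mul_le_mul ?_ hnb (by positivity) (by positivity)
    calc _ ≤ ∑ j : Fin n, ∑ l ∈ box d ε, (√(b + 1) * |coupling d ε| /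
          (2 * π) ^ ((d : ℝ) / 2) * ((∑ a, |w a|) * |ε⁻¹|)) ^ 2 := by
          refine sum_le_sum fun j _ => sum_le_sum fun l _ => ?_
          have := cutoff_nonneg ε l (k j - l)
          rw [abs_one, mul_one, mul_one, mul_assoc]
          refine pow_le_pow_left₀ (by positivity) (mul_le_mul ?_
            (abs_dotMode_mul_cutoff_le w ε _ _) (by positivity) (by positivity)) 2
          gcongr
      _ = n * (box d ε).card * (√(b + 1) * |coupling d ε| /
          (2 * π) ^ ((d : ℝ) / 2) * ((∑ a, |w a|) * |ε⁻¹|)) ^ 2 := by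
          simp only [sum_const, card_univ, Fintype.card_fin, nsmul_eq_mul]; ring
      _ ≤ _ := by gcongr

/-- The annihilation operator `A_-^ε` on normalised coefficients, restricted to target chaoses in
`[a, b)`. -/
def annih (a b : ℕ) : 𝓛 := mkOp (annihFun w ε a b)
    (fun x y n k => by simp only [annihFun, co_add, mul_add, sum_add_distrib])
    (fun c x n k => by
      simp only [annihFun, co_smul, mul_sum]
      refine sum_congr rfl fun j _ => sum_congr rfl fun l _ => ?_
      ring)
    (annihFun_perm w ε a b) (annihFun_zero w ε a b) (annihBound w ε b) (sqrt_nonneg _)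
    (tsum_annihFun_le_annihBound w ε a b)

lemma co_annih (a b : ℕ) (x : Fock d) (n k) :
    co (annih w ε a b x) n k = annihCoef d ε a b n * ∑ j, ∑ l ∈ box d ε,
    ((dotMode w (k j) * cutoff ε l (k j - l) : ℝ) : ℂ) * co x (n + 1) (split k j l) := rfl

/-- The creation operator `A_+^ε` on normalised coefficients, restricted to source chaoses in
`[a, b)`: minus the adjoint of the annihilation operator. -/
def creat (a b : ℕ) : 𝓛 := -ContinuousLinearMap.adjoint (annih w ε a b)

lemma inner_creat_right (a b : ℕ) (x y : Fock d) :
    inner ℂ x (creat w ε a b y) = -inner ℂ (annih w ε a b x) y := by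
  simp only [creat, neg_apply, inner_neg_right]
  rw [ContinuousLinearMap.adjoint_inner_right]

lemma inner_creat_left (a b : ℕ) (x y : Fock d) :
    inner ℂ (creat w ε a b x) y = -inner ℂ x (annih w ε a b y) := by
  simp only [creat, neg_apply, inner_neg_left]
  rw [ContinuousLinearMap.adjoint_inner_left]

/-! ### Symmetrised point masses -/

open Classical in
/-- The symmetrised point mass at a tuple of non-zero modes: the representative of evaluation. -/
def symDelta {n : ℕ} (κ : 𝕄 (n + 1)) (hκ : ∀ i, κ i ≠ 0) : Fock d :=
  ⟨(((n + 1).factorial : ℂ)⁻¹) • ∑ σ : Perm (Fin (n + 1)), lp.single 2 ⟨n + 1, κ ∘ σ⟩ 1, by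
    constructor
    · intro m τ k
      simp only [lp.coeFn_smul, lp.coeFn_sum, Pi.smul_apply, Finset.sum_apply, lp.coeFn_single]
      congr 1
      simp only [Pi.single_apply]
      by_cases hm : m = n + 1
      · subst hm
        rw [← Equiv.sum_comp (Equiv.mulRight τ)]
        refine sum_congr rfl fun σ _ => ?_
        have : (k ∘ τ = κ ∘ (σ * τ)) ↔ k = κ ∘ σ := by
          rw [Equiv.Perm.coe_mul, ← Function.comp_assoc]
          exact τ.surjective.injective_comp_right.eq_iff
        simp only [Equiv.coe_mulRight, Sigma.mk.injEq, heq_eq_eq, true_and, this]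
      · simp [hm]
    · intro m k h
      simp only [lp.coeFn_smul, lp.coeFn_sum, Pi.smul_apply, Finset.sum_apply, lp.coeFn_single]
      rw [sum_eq_zero, smul_zero]
      intro σ _
      rw [Pi.single_apply, if_neg]
      rintro h2
      obtain ⟨rfl, h2⟩ := Sigma.mk.inj h2
      obtain rfl := eq_of_heq h2
      rcases h with h | ⟨i, hi⟩
      · omega
      · exact hκ _ hi⟩

open Classical in
lemma co_symDelta {n : ℕ} (κ : 𝕄 (n + 1)) (hκ : ∀ i, κ i ≠ 0) (m k) :
    co (symDelta κ hκ) m k = (((n + 1).factorial : ℂ)⁻¹) * ∑ σ : Perm (Fin (n + 1)),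
      if (⟨m, k⟩ : Idx d) = ⟨n + 1, κ ∘ σ⟩ then 1 else 0 := by
  simp only [co, symDelta, lp.coeFn_smul, lp.coeFn_sum, Pi.smul_apply, Finset.sum_apply,
    lp.coeFn_single, Pi.single_apply, smul_eq_mul]

lemma inner_symDelta {n : ℕ} (κ : 𝕄 (n + 1)) (hκ : ∀ i, κ i ≠ 0) (y : Fock d) :
    inner ℂ (symDelta κ hκ) y = co y (n + 1) κ := by
  classical
  change inner ℂ (symDelta κ hκ : SeqSpace d) (y : SeqSpace d) = _
  simp only [symDelta, inner_smul_left, sum_inner, lp.inner_single_left]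
  have : ∀ σ : Perm (Fin (n + 1)),
      inner ℂ (1 : ℂ) ((y : SeqSpace d) ⟨n + 1, κ ∘ σ⟩) = co y (n + 1) κ := fun σ => by
    rw [← co_perm y σ κ]; simp [co]
  simp only [this, sum_const, card_univ, Fintype.card_perm, Fintype.card_fin]
  have h0 : ((n + 1).factorial : ℂ) ≠ 0 := by exact_mod_cast (n + 1).factorial_ne_zero
  simp
  field_simp

/-! ### The coefficients of the creation operator -/

/-- The tuple obtained by merging the modes `k_a` and `k_c` (at position `a`). -/
def merge {n : ℕ} (k : 𝕄 (n + 1)) (a c : Fin (n + 1)) : 𝕄 n :=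
  fun i => update k a (k a + k c) (c.succAbove i)

lemma entries_merge {n : ℕ} (k : 𝕄 (n + 1)) {a c : Fin (n + 1)} (h : a ≠ c) :
    k a ::ₘ k c ::ₘ entries (merge k a c) = (k a + k c) ::ₘ entries k := by
  have h1 := entries_succAbove (update k a (k a + k c)) c
  rw [Function.update_of_ne h.symm] at h1
  rw [← entries_update k a (k a + k c), ← h1]
  rfl

lemma sum_merge {n : ℕ} (k : 𝕄 (n + 1)) {a c : Fin (n + 1)} (h : a ≠ c) :
    ∑ i, merge k a c i = ∑ i, k i := by
  have := congrArg Multiset.sum (entries_merge k h)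
  simp only [Multiset.sum_cons, entries] at this
  have h2 : k a + k c + ∑ i, merge k a c i = k a + k c + ∑ i, k i := by
    rw [← add_assoc] at this
    exact this
  exact add_left_cancel h2

open Classical in
/-- The contribution of a pair of slots to the creation operator. -/
def pairTerm (y : Fock d) {n : ℕ} (κ : 𝕄 (n + 1)) (a c : Fin (n + 1)) : ℂ := if a = c then 0 else
    ((dotMode w (κ a + κ c) * cutoff ε (κ a) (κ c) : ℝ) : ℂ) * co y n (merge κ a c)

lemma pairTerm_of_entries (y : Fock d) {n : ℕ}
    (κ : 𝕄 (n + 1)) {a c : Fin (n + 1)} (h : a ≠ c) {k : 𝕄 n}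
    (hk : κ a ::ₘ κ c ::ₘ entries k = (κ a + κ c) ::ₘ entries κ) :
    pairTerm w ε y κ a c = ((dotMode w (κ a + κ c) * cutoff ε (κ a) (κ c) : ℝ) : ℂ) * co y n k := by
  rw [pairTerm, if_neg h]
  congr 1
  apply co_congr
  exact (Multiset.cons_inj_right _).1 ((Multiset.cons_inj_right _).1
    ((entries_merge κ h).trans hk.symm))

lemma pairTerm_comm (y : Fock d) {n : ℕ} (κ : 𝕄 (n + 1)) (a c : Fin (n + 1)) :
    pairTerm w ε y κ a c = pairTerm w ε y κ c a := by
  by_cases h : a = c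
  · simp [h]
  · rw [pairTerm_of_entries w ε y κ h (k := merge κ c a), pairTerm, if_neg (Ne.symm h),
      cutoff_comm, add_comm (κ a)]
    rw [Multiset.cons_swap, entries_merge κ (Ne.symm h), add_comm]

lemma split_eq_iff {n : ℕ} {k : 𝕄 n} {j : Fin n} {l : Mode d}
    {κ : 𝕄 (n + 1)} :
    split k j l = κ ↔ l = κ 0 ∧ k = update (Fin.tail κ) j (κ 0 + κ j.succ) := by
  have hinv : split (update (Fin.tail κ) j (κ 0 + κ j.succ)) j (κ 0) = κ := by
    funext i
    refine Fin.cases ?_ (fun i => ?_) i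
    · simp [split]
    · by_cases hi : i = j
      · subst hi; simp [split]
      · simp [split, hi, Fin.tail]
  constructor
  · intro h
    have := @split_injective d n j (k, l) (_, κ 0) (h.trans hinv.symm)
    simp only [Prod.mk.injEq] at this
    exact this.symm
  · rintro ⟨rfl, rfl⟩
    exact hinv

lemma entries_update_tail {n : ℕ} (κ : 𝕄 (n + 1)) (j : Fin n) (v : Mode d) :
    κ 0 ::ₘ κ j.succ ::ₘ entries (update (Fin.tail κ) j v) = v ::ₘ entries κ := by
  have := entries_update (Fin.tail κ) j v
  rw [show Fin.tail κ j = κ j.succ from rfl] at this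
  rw [this, Multiset.cons_swap, entries_tail]

lemma co_annih_symDelta (a b : ℕ) {n : ℕ} (κ : 𝕄 (n + 1)) (hκ : ∀ i, κ i ≠ 0) (y : Fock d) :
    inner ℂ (annih w ε a b (symDelta κ hκ)) y =
      -annihCoef d ε a b n * ((((n + 1).factorial : ℂ)⁻¹) * ∑ σ : Perm (Fin (n + 1)),
        ∑ j : Fin n, pairTerm w ε y κ (σ 0) (σ j.succ)) := by
  classical
  set u : Perm (Fin (n + 1)) → Fin n → 𝕄 n := fun σ j =>
    update (Fin.tail (κ ∘ σ)) j (κ (σ 0) + κ (σ j.succ)) with hu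
  set r : Perm (Fin (n + 1)) → Fin n → ℂ := fun σ j =>
    ((dotMode w (κ (σ 0) + κ (σ j.succ)) * cutoff ε (κ (σ 0)) (κ (σ j.succ)) : ℝ) : ℂ) with hr
  -- the image of the symmetrised point mass is a combination of point masses at merged tuples
  have key : (annih w ε a b (symDelta κ hκ) : SeqSpace d) =
      (annihCoef d ε a b n * ((n + 1).factorial : ℂ)⁻¹) •
        ∑ σ : Perm (Fin (n + 1)), ∑ j : Fin n, r σ j • lp.single 2 ⟨n, u σ j⟩ 1 := by
    apply lp.ext
    funext ⟨m, k⟩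
    change co (annih w ε a b (symDelta κ hκ)) m k = _
    simp only [lp.coeFn_smul, lp.coeFn_sum, Pi.smul_apply, Finset.sum_apply, lp.coeFn_single,
      co_annih, co_symDelta, smul_eq_mul, Pi.single_apply]
    by_cases hm : m = n
    swap
    · have h1 : ∀ k' : 𝕄 (m + 1), ∀ σ : Perm (Fin (n + 1)),
          ((⟨m + 1, k'⟩ : Idx d) = ⟨n + 1, κ ∘ σ⟩) = False := fun k' σ => by
        simp [hm]
      have h2 : ∀ σ j, ((⟨m, k⟩ : Idx d) = ⟨n, u σ j⟩) = False := fun σ j => by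
        simp [hm]
      simp [h1, h2]
    · subst hm
      rw [mul_assoc]
      congr 1
      simp only [mul_sum]
      have h1 : ∀ j l (σ : Perm (Fin (m + 1))),
          ((⟨m + 1, split k j l⟩ : Idx d) = ⟨m + 1, κ ∘ σ⟩) = (l = κ (σ 0) ∧ k = u σ j) := by
        intro j l σ
        simp only [Sigma.mk.injEq, heq_eq_eq, true_and, split_eq_iff, eq_iff_iff]
        rfl
      simp only [h1]
      have h3 : ∀ j : Fin m, ∑ l ∈ box d ε, ∑ σ : Perm (Fin (m + 1)),
          ((dotMode w (k j) * cutoff ε l (k j - l) : ℝ) : ℂ) * ((((m + 1).factorial : ℂ)⁻¹) *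
            if l = κ (σ 0) ∧ k = u σ j then 1 else 0) =
          ∑ σ : Perm (Fin (m + 1)), (((m + 1).factorial : ℂ)⁻¹) *
            (r σ j * if (⟨m, k⟩ : Idx d) = ⟨m, u σ j⟩ then 1 else 0) := by
        intro j
        rw [Finset.sum_comm]
        refine sum_congr rfl fun σ _ => ?_
        by_cases hk : k = u σ j
        · have hkj : k j = κ (σ 0) + κ (σ j.succ) := by rw [hk]; simp [hu]
          simp only [← hk, and_true, if_true]
          have hterm : ∀ l ∈ box d ε, ((dotMode w (k j) * cutoff ε l (k j - l) : ℝ) : ℂ) *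
              ((((m + 1).factorial : ℂ)⁻¹) * if l = κ (σ 0) then 1 else 0) =
              if l = κ (σ 0) then (((m + 1).factorial : ℂ)⁻¹) * r σ j else 0 := by
            intro l _
            split_ifs with hl
            · subst hl
              simp only [hr, hkj, add_sub_cancel_left]
              ring
            · simp
          rw [sum_congr rfl hterm, Finset.sum_ite_eq']
          split_ifs with hb
          · ring
          · have : cutoff ε (κ (σ 0)) (κ (σ j.succ)) = 0 := by
              by_contra h
              exact hb (mem_box_of_cutoff h)
            simp [hr, this]
        · simp [hk]
      rw [sum_congr rfl fun j _ => h3 j, Finset.sum_comm]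
  change inner ℂ (annih w ε a b (symDelta κ hκ) : SeqSpace d) (y : SeqSpace d) = _
  rw [key]
  simp only [inner_smul_left, sum_inner, lp.inner_single_left, map_mul, conj_annihCoef, map_inv₀,
    map_natCast]
  rw [mul_assoc]
  congr 2
  refine sum_congr rfl fun σ _ => sum_congr rfl fun j _ => ?_
  rw [pairTerm_of_entries w ε y κ (k := u σ j)]
  · simp [hr, co]
  · exact fun h => absurd (σ.injective h) (Fin.succ_ne_zero j).symm
  · have := entries_update_tail (κ ∘ σ) j (κ (σ 0) + κ (σ j.succ))
    rw [entries_comp_perm] at this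
    exact this

/-- The coefficients of the creation operator as a sum over ordered pairs. -/
lemma co_creat (a b : ℕ) (y : Fock d) {n : ℕ} (κ : 𝕄 (n + 1)) : co (creat w ε a b y) (n + 1) κ =
      annihCoef d ε a b n * (((n : ℂ) + 1)⁻¹ * ∑ i, ∑ c, pairTerm w ε y κ i c) := by
  by_cases hκ : ∀ i, κ i ≠ 0
  swap
  · push Not at hκ
    obtain ⟨i, hi⟩ := hκ
    rw [co_of_zero _ hi, sum_eq_zero, mul_zero, mul_zero]
    intro e _
    refine sum_eq_zero fun c _ => ?_
    unfold pairTerm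
    split_ifs with hec
    · rfl
    by_cases hie : i = e
    · subst hie; simp [hi, cutoff_zero_left]
    by_cases hic : i = c
    · subst hic; simp [hi, cutoff_zero_right]
    obtain ⟨z, hz⟩ := Fin.exists_succAbove_eq hic
    rw [co_of_zero (i := z), mul_zero]
    simp [merge, hz, hie, hi]
  · rw [← inner_symDelta κ hκ, inner_creat_right, co_annih_symDelta]
    have h1 : ∀ σ : Perm (Fin (n + 1)),
        ∑ j : Fin n, pairTerm w ε y κ (σ 0) (σ j.succ) = ∑ c, pairTerm w ε y κ (σ 0) c := by
      intro σ
      rw [← Equiv.sum_comp σ, Fin.sum_univ_succ]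
      simp [pairTerm]
    simp only [h1]
    set g : Fin (n + 1) → ℂ := fun i => ∑ c, pairTerm w ε y κ i c with hg
    -- by invariance under right multiplication, `σ 0` is equidistributed
    have h2 : ((n : ℂ) + 1) * ∑ σ : Perm (Fin (n + 1)), g (σ 0) =
        ((n + 1).factorial : ℂ) * ∑ i, g i := by
      have h3 : ∀ i : Fin (n + 1), ∑ σ : Perm (Fin (n + 1)), g (σ 0) =
          ∑ σ : Perm (Fin (n + 1)), g (σ i) := by
        intro i
        rw [← Equiv.sum_comp (Equiv.mulRight (Equiv.swap 0 i))]
        simp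
      calc _ = ∑ i : Fin (n + 1), ∑ σ : Perm (Fin (n + 1)), g (σ 0) := by
            simp
        _ = ∑ i : Fin (n + 1), ∑ σ : Perm (Fin (n + 1)), g (σ i) :=
            sum_congr rfl fun i _ => h3 i
        _ = ∑ σ : Perm (Fin (n + 1)), ∑ i, g i := by
            rw [Finset.sum_comm]
            exact sum_congr rfl fun σ _ => Equiv.sum_comp σ g
        _ = _ := by simp [Fintype.card_perm]
    have h0 : ((n + 1).factorial : ℂ) ≠ 0 := by exact_mod_cast (n + 1).factorial_ne_zero
    have h0' : (n : ℂ) + 1 ≠ 0 := by exact_mod_cast n.succ_ne_zero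
    have h4 : ((n + 1).factorial : ℂ)⁻¹ * ∑ σ : Perm (Fin (n + 1)), g (σ 0) =
        ((n : ℂ) + 1)⁻¹ * ∑ i, g i := by
      field_simp
      linear_combination h2
    rw [h4]
    ring

/-- The coefficients of the creation operator as a sum over increasing pairs. -/
lemma co_creat_lt (a b : ℕ) (y : Fock d) {n : ℕ} (κ : 𝕄 (n + 1)) :
    co (creat w ε a b y) (n + 1) κ = annihCoef d ε a b n * (2 * ((n : ℂ) + 1)⁻¹ *
      ∑ i, ∑ c, if i < c then
        ((dotMode w (κ i + κ c) * cutoff ε (κ i) (κ c) : ℝ) : ℂ) * co y n (merge κ i c)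
      else 0) := by
  rw [co_creat]
  have h : ∑ i, ∑ c, pairTerm w ε y κ i c = 2 * ∑ i, ∑ c, if i < c then
        ((dotMode w (κ i + κ c) * cutoff ε (κ i) (κ c) : ℝ) : ℂ) * co y n (merge κ i c)
      else 0 := by
    have h1 : ∀ i c, pairTerm w ε y κ i c = (if i < c then pairTerm w ε y κ i c else 0) +
        (if c < i then pairTerm w ε y κ c i else 0) := by
      intro i c
      rcases lt_trichotomy i c with h | rfl | h
      · simp [h, h.not_gt]
      · simp [pairTerm]
      · simp [h, h.not_gt, pairTerm_comm w ε y κ i c]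
    have h2 : ∀ i c, (if i < c then pairTerm w ε y κ i c else 0) = if i < c then
        ((dotMode w (κ i + κ c) * cutoff ε (κ i) (κ c) : ℝ) : ℂ) * co y n (merge κ i c)
        else 0 := by
      intro i c
      split_ifs with h
      · rw [pairTerm, if_neg h.ne]
      · rfl
    calc _ = ∑ i, ∑ c, ((if i < c then pairTerm w ε y κ i c else 0) +
        (if c < i then pairTerm w ε y κ c i else 0)) :=
          sum_congr rfl fun i _ => sum_congr rfl fun c _ => h1 i c
      _ = _ := by
          simp only [sum_add_distrib]
          rw [Finset.sum_comm (f := fun i c => if c < i then pairTerm w ε y κ c i else 0)]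
          simp only [h2]
          ring
  rw [h]
  ring

/-! ### Resolvents of skew-adjoint operators -/

section Skew

variable {V : Type*} [NormedAddCommGroup V] [InnerProductSpace ℂ V]

/-- A bounded operator is skew when `⟨x, S y⟩ = -⟨S x, y⟩`. -/
def IsSkew (S : V →L[ℂ] V) : Prop := ∀ x y, inner ℂ x (S y) = -inner ℂ (S x) y

lemma IsSkew.re_inner_self {S : V →L[ℂ] V} (hS : IsSkew S) (x : V) : (inner ℂ x (S x)).re = 0 := by
  have h := hS x x
  rw [← inner_conj_symm (S x) x] at h
  have := congrArg Complex.re h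
  simp only [Complex.neg_re, Complex.conj_re] at this
  linarith

lemma IsSkew.norm_le {S : V →L[ℂ] V} (hS : IsSkew S) (x : V) : ‖x‖ ≤ ‖(1 - S) x‖ := by
  by_cases hx : x = 0
  · simp [hx]
  have hpos : 0 < ‖x‖ := norm_pos_iff.2 hx
  have h1 : (inner ℂ x ((1 - S) x)).re = ‖x‖ ^ 2 := by
    rw [sub_apply, inner_sub_right, Complex.sub_re, hS.re_inner_self]
    have : (inner ℂ x x).re = ‖x‖ ^ 2 := inner_self_eq_norm_sq (𝕜 := ℂ) x
    rw [one_apply_eq_self, this, sub_zero]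
  have h2 : (inner ℂ x ((1 - S) x)).re ≤ ‖x‖ * ‖(1 - S) x‖ :=
    (Complex.re_le_norm _).trans (norm_inner_le_norm _ _)
  rw [h1, sq] at h2
  exact le_of_mul_le_mul_left h2 hpos

lemma norm_le_of_inner_eq_neg {A B : V →L[ℂ] V} {C : ℝ}
    (hAB : ∀ x y, inner ℂ x (B y) = -inner ℂ (A x) y) (h : ∀ x, ‖A x‖ ≤ C * ‖x‖) (x : V) :
    ‖B x‖ ≤ C * ‖x‖ := by
  by_cases h0 : B x = 0
  · rw [h0, norm_zero]
    exact (norm_nonneg _).trans (h x)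
  have hpos : 0 < ‖B x‖ := norm_pos_iff.2 h0
  have h1 : ‖B x‖ * ‖B x‖ ≤ ‖B x‖ * (C * ‖x‖) := by
    have h3 : ‖inner ℂ (B x) (B x)‖ = ‖B x‖ * ‖B x‖ := by
      rw [inner_self_eq_norm_sq_to_K]
      simp [sq]
    rw [← h3, hAB, norm_neg]
    calc _ ≤ ‖A (B x)‖ * ‖x‖ := norm_inner_le_norm _ _
      _ ≤ C * ‖B x‖ * ‖x‖ := by gcongr; exact h _
      _ = _ := by ring
  exact le_of_mul_le_mul_left h1 hpos

variable [CompleteSpace V]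

lemma IsSkew.isUnit {S : V →L[ℂ] V} (hS : IsSkew S) : IsUnit (1 - S) := by
  have hadj : star S = -S := by
    rw [ContinuousLinearMap.star_eq_adjoint]
    symm
    rw [ContinuousLinearMap.eq_adjoint_iff]
    intro x y
    rw [neg_apply, inner_neg_left, hS x y]
  have hsa : IsSelfAdjoint (I • S) := by
    rw [IsSelfAdjoint, star_smul, hadj]
    simp
  have hI : I ∉ spectrum ℂ (I • S) := by
    intro h
    have := hsa.mem_spectrum_eq_re h
    have := congrArg Complex.im this
    simp at this
  rw [spectrum.notMem_iff] at hI
  have h2 : algebraMap ℂ (V →L[ℂ] V) I - I • S =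
      algebraMap ℂ (V →L[ℂ] V) I * (1 - S) := by
    rw [mul_sub, mul_one, Algebra.smul_def]
  rw [h2] at hI
  have hu : IsUnit (algebraMap ℂ (V →L[ℂ] V) I) := (IsUnit.mk0 I Complex.I_ne_zero).map _
  exact (hu.mul_left_iff).1 hI

/-- The resolvent `(1 - S)⁻¹`. -/
def resolvent (S : V →L[ℂ] V) : V →L[ℂ] V := Ring.inverse (1 - S)

lemma IsSkew.resolvent_eq {S : V →L[ℂ] V} (hS : IsSkew S) (g : V) :
    resolvent S g = S (resolvent S g) + g := by
  have h := congrArg (fun T : V →L[ℂ] V => T g) (Ring.mul_inverse_cancel _ hS.isUnit)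
  simp only [mul_apply_eq_comp, sub_apply, one_apply_eq_self] at h
  exact sub_eq_iff_eq_add'.1 h

lemma IsSkew.eq_resolvent {S : V →L[ℂ] V} (hS : IsSkew S) {x g : V} (h : x = S x + g) :
    x = resolvent S g := by
  have h1 := hS.resolvent_eq g
  have h2 : (1 - S) (x - resolvent S g) = 0 := by
    rw [sub_apply, one_apply_eq_self, map_sub, sub_sub_sub_comm]
    nth_rewrite 1 [h]
    nth_rewrite 1 [h1]
    abel
  have h3 := hS.norm_le (x - resolvent S g)
  rw [h2, norm_zero] at h3
  exact sub_eq_zero.1 (norm_le_zero_iff.1 h3)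

lemma IsSkew.norm_resolvent_le {S : V →L[ℂ] V} (hS : IsSkew S) (g : V) : ‖resolvent S g‖ ≤ ‖g‖ := by
  have h := hS.norm_le (resolvent S g)
  rwa [sub_apply, one_apply_eq_self, sub_eq_of_eq_add' (hS.resolvent_eq g)] at h

/-- The damped iteration `z ↦ (1 - c) z + c (S z + g)`, whose fixed point is the resolvent. -/
def dampedIter (S : V →L[ℂ] V) (c : ℝ) (g : V) : ℕ → V
  | 0 => 0
  | m + 1 => ((1 - c : ℝ) : ℂ) • dampedIter S c g m + (c : ℂ) • (S (dampedIter S c g m) + g)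

/-- With `c = 1 / (1 + R²)`, one step of the damped iteration contracts by `√(1 - c)`: the cross
term vanishes because `S` is skew. -/
lemma IsSkew.norm_dampedIter_sub_le {S : V →L[ℂ] V} (hS : IsSkew S) {R : ℝ}
    (hR : ∀ x, ‖S x‖ ≤ R * ‖x‖) (g : V) (m : ℕ) :
    ‖dampedIter S (1 / (1 + R ^ 2)) g m - resolvent S g‖ ≤ √(1 - 1 / (1 + R ^ 2)) ^ m * ‖g‖ := by
  set c : ℝ := 1 / (1 + R ^ 2) with hc
  have hpos : 0 < 1 + R ^ 2 := by positivity
  have hcR : c * (1 + R ^ 2) = 1 := by rw [hc]; field_simp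
  have hc1 : 0 ≤ 1 - c := by
    rw [hc, sub_nonneg, div_le_one hpos]; nlinarith [sq_nonneg R]
  induction m with
  | zero => simpa [dampedIter] using hS.norm_resolvent_le g
  | succ m ih =>
    set e := dampedIter S c g m - resolvent S g with he
    have h1 : dampedIter S c g (m + 1) - resolvent S g = ((1 - c : ℝ) : ℂ) • e + (c : ℂ) • S e := by
      have h2 := hS.resolvent_eq g
      have h3 : S (resolvent S g) = resolvent S g - g := by rw [eq_sub_iff_add_eq]; exact h2.symm
      rw [dampedIter, he, map_sub, h3]
      push_cast
      module
    have h4 : ‖((1 - c : ℝ) : ℂ) • e + (c : ℂ) • S e‖ ^ 2 ≤ (1 - c) * ‖e‖ ^ 2 := by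
      rw [@norm_add_sq ℂ]
      have h5 : RCLike.re (inner ℂ (((1 - c : ℝ) : ℂ) • e) ((c : ℂ) • S e)) = 0 := by
        rw [inner_smul_left, inner_smul_right, conj_ofReal]
        have := hS.re_inner_self e
        change (_ * (_ * _) : ℂ).re = 0
        rw [Complex.re_ofReal_mul, Complex.re_ofReal_mul, this]
        simp
      rw [h5, norm_smul, norm_smul, norm_real, norm_real, mul_pow, mul_pow,
        norm_eq_abs, norm_eq_abs, sq_abs, sq_abs]
      have h6 : ‖S e‖ ^ 2 ≤ R ^ 2 * ‖e‖ ^ 2 := by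
        rw [← mul_pow]; exact pow_le_pow_left₀ (norm_nonneg _) (hR e) 2
      have h7 : c ^ 2 * ‖S e‖ ^ 2 ≤ c ^ 2 * (R ^ 2 * ‖e‖ ^ 2) := by gcongr
      have h8 : (1 - c) ^ 2 * ‖e‖ ^ 2 + c ^ 2 * (R ^ 2 * ‖e‖ ^ 2) = (1 - c) * ‖e‖ ^ 2 := by
        have : c ^ 2 * (1 + R ^ 2) = c := by rw [sq, mul_assoc, hcR, mul_one]
        linear_combination ‖e‖ ^ 2 * this
      linarith
    rw [h1]
    calc _ ≤ √((1 - c) * ‖e‖ ^ 2) := Real.le_sqrt_of_sq_le h4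
      _ = √(1 - c) * ‖e‖ := by
        rw [sqrt_mul hc1, Real.sqrt_sq (norm_nonneg _)]
      _ ≤ √(1 - c) * (√(1 - c) ^ m * ‖g‖) := by gcongr
      _ = _ := by rw [pow_succ]; ring

end Skew

/-! ### The operators between energy spaces -/

lemma tupleSq_nonneg {n : ℕ} (k : 𝕄 n) : 0 ≤ tupleSq k := sum_nonneg fun _ _ => modeSq_nonneg _

lemma modeSq_le_tupleSq {n : ℕ} (k : 𝕄 n) (i : Fin n) : modeSq (k i) ≤ tupleSq k :=
  Finset.single_le_sum (f := fun i => modeSq (k i)) (fun _ _ => modeSq_nonneg _) (mem_univ i)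

lemma tupleSq_comp_perm {n : ℕ} (σ : Perm (Fin n)) (k : 𝕄 n) :
    tupleSq (k ∘ σ) = tupleSq k := Equiv.sum_comp σ fun i => modeSq (k i)

lemma tupleDotSq_comp_perm {n : ℕ} (σ : Perm (Fin n))
    (k : 𝕄 n) : tupleDotSq w (k ∘ σ) = tupleDotSq w k :=
  Equiv.sum_comp σ fun i => dotMode w (k i) ^ 2

lemma tupleDotSq_nonneg {n : ℕ} (k : 𝕄 n) : 0 ≤ tupleDotSq w k := sum_nonneg fun _ _ => sq_nonneg _

lemma tupleDotSq_le {n : ℕ} (k : 𝕄 n) :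
    tupleDotSq w k ≤ ‖w‖ ^ 2 * tupleSq k := by
  rw [tupleSq, mul_sum]
  exact sum_le_sum fun i _ => dotMode_sq_le w (k i)

lemma one_le_tupleSq_of_ne_zero {n : ℕ} {k : 𝕄 n} (h : tupleSq k ≠ 0) : 1 ≤ tupleSq k := by
  obtain ⟨i, -, hi⟩ := Finset.exists_ne_zero_of_sum_ne_zero h
  exact (one_le_modeSq fun h0 => hi (modeSq_eq_zero.2 h0)).trans (modeSq_le_tupleSq k i)

lemma one_le_tupleSq_of_co_ne_zero {x : Fock d} {n : ℕ} {k : 𝕄 n}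
    (h : co x n k ≠ 0) : 1 ≤ tupleSq k := by
  obtain _ | n := n
  · simp at h
  · exact (one_le_modeSq fun h0 => h (co_of_zero x h0)).trans (modeSq_le_tupleSq k 0)

/-- The multiplier `Λ⁻¹ = (-L_0)^{-1/2}`. -/
def invLam : Multiplier d where
  val _ k := (√(1 / 2 * tupleSq k))⁻¹
  symm n σ k := by rw [tupleSq_comp_perm]
  bdd := ⟨2, by norm_num, fun n k => by
    rw [abs_of_nonneg (by positivity)]
    by_cases h : tupleSq k = 0
    · simp [h]
    · apply inv_le_of_inv_le₀ (by norm_num)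
      apply Real.le_sqrt_of_sq_le
      linarith [one_le_tupleSq_of_ne_zero h]⟩

lemma invLam_val_sq {n : ℕ} (k : 𝕄 n) : invLam.val n k ^ 2 = (1 / 2 * tupleSq k)⁻¹ := by
  simp only [invLam]
  rw [inv_pow, sq_sqrt (mul_nonneg (by norm_num) (tupleSq_nonneg k))]

lemma invLam_val_nonneg {n : ℕ} (k : 𝕄 n) : 0 ≤ invLam.val n k := by
  simp only [invLam]; positivity

lemma norm_invLam_le (x : Fock d) : ‖invLam.op x‖ ≤ 2 * ‖x‖ := by
  refine invLam.norm_op_le (by norm_num) x fun n k h => ?_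
  rw [abs_of_nonneg (invLam_val_nonneg k)]
  simp only [invLam]
  apply inv_le_of_inv_le₀ (by norm_num)
  apply Real.le_sqrt_of_sq_le
  linarith [one_le_tupleSq_of_co_ne_zero h]

/-- `Λ⁻¹ A_- Λ⁻¹`. -/
def lower (a b : ℕ) : 𝓛 := invLam.op ∘L annih w ε a b ∘L invLam.op

/-- `Λ⁻¹ A_+ Λ⁻¹`. -/
def raise (a b : ℕ) : 𝓛 := invLam.op ∘L creat w ε a b ∘L invLam.op

/-- `Λ⁻¹ A Λ⁻¹`, with `A = A_+ + A_-`, between chaoses `a, …, b`. -/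
def skewOp (a b : ℕ) : 𝓛 := lower w ε a b + raise w ε a b

lemma inner_raise_right (a b : ℕ) (x y : Fock d) :
    inner ℂ x (raise w ε a b y) = -inner ℂ (lower w ε a b x) y := by
  simp only [raise, lower, comp_apply]
  rw [← inner_op, inner_creat_right, inner_op]

lemma inner_raise_left (a b : ℕ) (x y : Fock d) :
    inner ℂ (raise w ε a b x) y = -inner ℂ x (lower w ε a b y) := by
  simp only [raise, lower, comp_apply]
  rw [inner_op, inner_creat_left, inner_op]

lemma isSkew_skewOp (a b : ℕ) :
    IsSkew (skewOp w ε a b) := by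
  intro x y
  simp only [skewOp, add_apply, inner_add_left, inner_add_right, inner_raise_right,
    inner_raise_left]
  ring

lemma norm_raise_le {w : 𝔼 d} {ε : ℝ} {a b : ℕ} {C : ℝ}
    (h : ∀ x, ‖lower w ε a b x‖ ≤ C * ‖x‖) (x : Fock d) : ‖raise w ε a b x‖ ≤ C * ‖x‖ :=
  norm_le_of_inner_eq_neg (inner_raise_right w ε a b) h x

/-- The loop sum `λ_ε² ∑_{ℓ+m=k} 𝕁(ℓ,m) / (½(|ℓ|² + |m|²))`, which controls the row norms. -/
def loopSum (ε : ℝ) (k : Mode d) : ℝ :=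
  coupling d ε ^ 2 * ∑ l ∈ box d ε, cutoff ε l (k - l) * (𝓔 k l)⁻¹

lemma tupleSq_split {n : ℕ} (k : 𝕄 n) (j : Fin n) (l : Mode d) :
    tupleSq (split k j l) + modeSq (k j) = tupleSq k + (modeSq l + modeSq (k j - l)) := by
  have h := congrArg (fun s => (s.map modeSq).sum) (entries_split k j l)
  simp only [Multiset.map_cons, Multiset.sum_cons, entries, Multiset.map_map] at h
  have h' : modeSq (k j) + tupleSq (split k j l) = modeSq l + (modeSq (k j - l) + tupleSq k) := h
  linarith

lemma le_tupleSq_split {n : ℕ} (k : 𝕄 n) (j : Fin n) (l : Mode d) :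
    modeSq l + modeSq (k j - l) ≤ tupleSq (split k j l) := by
  have := tupleSq_split k j l
  linarith [modeSq_le_tupleSq k j]

lemma modeSq_add_le (l m : Mode d) : modeSq (l + m) ≤ 2 * (modeSq l + modeSq m) := by
  unfold modeSq
  rw [← sum_add_distrib, mul_sum]
  refine sum_le_sum fun a _ => ?_
  simp only [Pi.add_apply, Int.cast_add]
  nlinarith [sq_nonneg ((l a : ℝ) - m a)]

lemma tupleSq_le_two_mul_split {n : ℕ} (k : 𝕄 n) (j : Fin n) (l : Mode d) :
    tupleSq k ≤ 2 * tupleSq (split k j l) := by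
  have h := tupleSq_split k j l
  have h2 := modeSq_add_le l (k j - l)
  rw [add_sub_cancel] at h2
  have := modeSq_le_tupleSq k j
  linarith [tupleSq_nonneg k]

/-- The constant in the bound for `Λ⁻¹ A_- Λ⁻¹`, in terms of a bound for the loop sums. -/
def opConst (C₀ : ℝ) : ℝ := ‖w‖ * √(2 * C₀) / (2 * π) ^ ((d : ℝ) / 2)

lemma opConst_nonneg (C₀ : ℝ) : 0 ≤ opConst w C₀ := by
  have := two_pi_rpow_pos ((d : ℝ) / 2)
  unfold opConst; positivity

lemma loopSum_nonneg (ε : ℝ) (k : Mode d) : 0 ≤ loopSum ε k := by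
  unfold loopSum
  refine mul_nonneg (sq_nonneg _) (sum_nonneg fun l _ => mul_nonneg (cutoff_nonneg _ _ _) ?_)
  have := modeSq_nonneg l
  have := modeSq_nonneg (k - l)
  positivity

/-- Bound for the annihilation operator between two multipliers dominated by `Λ⁻¹`. The norm grows
linearly in the chaos order; the sum over slots is absorbed by `∑_j (𝔴·k_j)² ≤ 2|𝔴|² Λ²`. -/
lemma norm_annih_between_le {ε : ℝ} {C₀ : ℝ}
    (hC : ∀ k : Mode d, loopSum ε k ≤ C₀) (a b : ℕ) (m₁ m₂ : Multiplier d) {K : ℝ} (hK : 0 ≤ K)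
    (hm : ∀ n (k : 𝕄 n) j l, cutoff ε l (k j - l) ≠ 0 →
      m₁.val n k ^ 2 * m₂.val (n + 1) (split k j l) ^ 2 ≤
        K ^ 2 * ((1 / 2 * tupleSq k)⁻¹ * (1 / 2 * tupleSq (split k j l))⁻¹)) (x : Fock d) :
    ‖m₁.op (annih w ε a b (m₂.op x))‖ ≤ K * (opConst w C₀ * b) * ‖x‖ := by
  have hop := opConst_nonneg w C₀
  have hC0 : 0 ≤ C₀ := (loopSum_nonneg ε 0).trans (hC 0)
  have hp := two_pi_rpow_pos ((d : ℝ) / 2)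
  set p := (2 * π) ^ ((d : ℝ) / 2) with hpdef
  apply norm_le_of_enorm_sq_le (by positivity) (norm_nonneg _)
  rw [ofReal_norm]
  refine tsum_annihFun_le w ε a b x m₁.val m₂.val (m₂.op x) (fun n k => rfl) (by positivity) ?_
  intro n k _ hn
  have hnb : (n : ℝ) + 1 ≤ b := by exact_mod_cast hn
  have hterm : ∀ j, ∀ l ∈ box d ε, (√(n + 1) * |coupling d ε| / p * |m₁.val n k| *
      |dotMode w (k j)| * cutoff ε l (k j - l) * |m₂.val (n + 1) (split k j l)|) ^ 2 ≤
      ((n + 1) * K ^ 2 / p ^ 2) * ((1 / 2 * tupleSq k)⁻¹ * dotMode w (k j) ^ 2 *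
        (coupling d ε ^ 2 * (cutoff ε l (k j - l) * (𝓔 (k j) l)⁻¹))) := by
    intro j l _
    by_cases hc : cutoff ε l (k j - l) = 0
    · simp [hc]
    have h1 := hm n k j l hc
    have hl : 0 < modeSq l := lt_of_lt_of_le one_pos
      (one_le_modeSq (ne_zero_of_cutoffNorm_pos (of_cutoff_ne_zero hc).1.1))
    have h2 : (1 / 2 * tupleSq (split k j l))⁻¹ ≤ (𝓔 (k j) l)⁻¹ := by
      have := modeSq_nonneg (k j - l)
      apply inv_anti₀ (by positivity)
      linarith [le_tupleSq_split k j l]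
    have ht : 0 ≤ (1 / 2 * tupleSq k)⁻¹ := by have := tupleSq_nonneg k; positivity
    calc _ = ((n + 1) / p ^ 2) * (coupling d ε ^ 2 * dotMode w (k j) ^ 2 * cutoff ε l (k j - l)) *
          (m₁.val n k ^ 2 * m₂.val (n + 1) (split k j l) ^ 2) := by
          simp only [mul_pow, div_pow, sq_abs, cutoff_sq]
          rw [sq_sqrt (by positivity)]
          ring
      _ ≤ ((n + 1) / p ^ 2) * (coupling d ε ^ 2 * dotMode w (k j) ^ 2 * cutoff ε l (k j - l)) *
          (K ^ 2 * ((1 / 2 * tupleSq k)⁻¹ * (𝓔 (k j) l)⁻¹)) := by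
          have := cutoff_nonneg ε l (k j - l)
          refine mul_le_mul_of_nonneg_left (h1.trans ?_) (by positivity)
          gcongr
      _ = _ := by ring
  have hsum : (∑ j : Fin n, ∑ l ∈ box d ε, (√(n + 1) * |coupling d ε| / p *
      |m₁.val n k| * |dotMode w (k j)| * cutoff ε l (k j - l) *
        |m₂.val (n + 1) (split k j l)|) ^ 2) ≤ ((n + 1) * K ^ 2 / p ^ 2) * (2 * ‖w‖ ^ 2 * C₀) := by
    calc _ ≤ ∑ j : Fin n, ∑ l ∈ box d ε, ((n + 1) * K ^ 2 / p ^ 2) *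
          ((1 / 2 * tupleSq k)⁻¹ * dotMode w (k j) ^ 2 *
          (coupling d ε ^ 2 * (cutoff ε l (k j - l) * (𝓔 (k j) l)⁻¹))) :=
          sum_le_sum fun j _ => sum_le_sum (hterm j)
      _ = ((n + 1) * K ^ 2 / p ^ 2) * ((1 / 2 * tupleSq k)⁻¹ *
          ∑ j : Fin n, dotMode w (k j) ^ 2 * loopSum ε (k j)) := by
          simp only [loopSum, mul_sum, mul_assoc]
      _ ≤ _ := by
          have ht := tupleSq_nonneg k
          refine mul_le_mul_of_nonneg_left ?_ (by positivity)
          calc (1 / 2 * tupleSq k)⁻¹ * ∑ j : Fin n, dotMode w (k j) ^ 2 * loopSum ε (k j)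
              ≤ (1 / 2 * tupleSq k)⁻¹ * ∑ j : Fin n, dotMode w (k j) ^ 2 * C₀ := by
                refine mul_le_mul_of_nonneg_left (sum_le_sum fun j _ => ?_) (by positivity)
                exact mul_le_mul_of_nonneg_left (hC _) (sq_nonneg _)
            _ = (1 / 2 * tupleSq k)⁻¹ * tupleDotSq w k * C₀ := by
                rw [← Finset.sum_mul, tupleDotSq, mul_assoc]
            _ ≤ (1 / 2 * tupleSq k)⁻¹ * (‖w‖ ^ 2 * tupleSq k) * C₀ := by
                gcongr; exact tupleDotSq_le w k
            _ ≤ 2 * ‖w‖ ^ 2 * C₀ := by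
                refine mul_le_mul_of_nonneg_right ?_ hC0
                by_cases h0 : tupleSq k = 0
                · simp [h0]
                · exact le_of_eq (by field_simp)
  calc _ ≤ ((n + 1) * K ^ 2 / p ^ 2) * (2 * ‖w‖ ^ 2 * C₀) * n := by gcongr
    _ ≤ (b * K ^ 2 / p ^ 2) * (2 * ‖w‖ ^ 2 * C₀) * b := by
      have : (n : ℝ) ≤ b := by linarith
      gcongr
    _ = _ := by
      rw [opConst, mul_pow, mul_pow, div_pow, mul_pow, sq_sqrt (by positivity)]
      ring

lemma norm_lower_le {ε : ℝ} {C₀ : ℝ} (hC : ∀ k : Mode d, loopSum ε k ≤ C₀) (a b : ℕ) (x : Fock d) :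
    ‖lower w ε a b x‖ ≤ opConst w C₀ * b * ‖x‖ := by
  have := norm_annih_between_le w hC a b invLam invLam zero_le_one (fun n k j l _ => by
    rw [invLam_val_sq, invLam_val_sq]; simp) x
  rwa [one_mul] at this

lemma norm_skewOp_le {ε : ℝ} {C₀ : ℝ} (hC : ∀ k : Mode d, loopSum ε k ≤ C₀) (a b : ℕ) (x : Fock d) :
    ‖skewOp w ε a b x‖ ≤ 2 * (opConst w C₀ * b) * ‖x‖ := by
  have h1 := norm_lower_le w hC a b x
  have h2 := norm_raise_le (norm_lower_le w hC a b) x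
  calc _ ≤ ‖lower w ε a b x‖ + ‖raise w ε a b x‖ := norm_add_le _ _
    _ ≤ _ := by linarith

local notation:max "𝓡" w:max ε:max a:max b:max => resolvent (skewOp w ε a b)

/-! ### The chaos grading -/

lemma annihCoef_of_notMem {ε : ℝ} {a b n : ℕ} (h : ¬(a ≤ n ∧ n < b)) :
    annihCoef d ε a b n = 0 := if_neg h

lemma annihCoef_add {ε : ℝ} {a b c : ℕ} (hab : a ≤ b) (hbc : b ≤ c) (n : ℕ) :
    annihCoef d ε a b n + annihCoef d ε b c n = annihCoef d ε a c n := by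
  unfold annihCoef
  by_cases h1 : a ≤ n ∧ n < b
  · rw [if_pos h1, if_neg (by omega), if_pos (by omega), add_zero]
  · by_cases h2 : b ≤ n ∧ n < c
    · rw [if_neg h1, if_pos h2, if_pos (by omega), zero_add]
    · rw [if_neg h1, if_neg h2, if_neg (by omega), add_zero]

lemma co_lower (a b : ℕ) (x : Fock d) (n : ℕ) (k : 𝕄 n) :
    co (lower w ε a b x) n k = annihCoef d ε a b n * (invLam.val n k *
      ∑ j, ∑ l ∈ box d ε, ((dotMode w (k j) * cutoff ε l (k j - l) : ℝ) : ℂ) *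
        (invLam.val (n + 1) (split k j l) * co x (n + 1) (split k j l))) := by
  simp only [lower, comp_apply, co_op, co_annih]
  ring

lemma co_raise (a b : ℕ) (x : Fock d) (n : ℕ) (k : 𝕄 (n + 1)) :
    co (raise w ε a b x) (n + 1) k = annihCoef d ε a b n * (invLam.val (n + 1) k *
      (((n : ℂ) + 1)⁻¹ * ∑ i, ∑ c, pairTerm w ε (invLam.op x) k i c)) := by
  simp only [raise, comp_apply, co_op, co_creat]
  ring

lemma pairTerm_congr {x y : Fock d} {n : ℕ} (h : ∀ k : 𝕄 n, co x n k = co y n k)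
    (κ : 𝕄 (n + 1)) (i c : Fin (n + 1)) :
    pairTerm w ε x κ i c = pairTerm w ε y κ i c := by
  unfold pairTerm
  rw [h]

lemma co_lower_of_notMem {a b : ℕ} (x : Fock d) {n : ℕ} (k : 𝕄 n)
    (h : ¬(a ≤ n ∧ n < b)) : co (lower w ε a b x) n k = 0 := by
  rw [co_lower, annihCoef_of_notMem h, zero_mul]

lemma co_raise_of_notMem {a b : ℕ} (x : Fock d) {n : ℕ} (k : 𝕄 n)
    (h : ¬(a + 1 ≤ n ∧ n ≤ b)) : co (raise w ε a b x) n k = 0 := by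
  obtain _ | n := n
  · simp
  · rw [co_raise, annihCoef_of_notMem (by omega), zero_mul]

lemma lower_congr {a b : ℕ} {x y : Fock d}
    (h : ∀ n, a + 1 ≤ n → n ≤ b → ∀ k, co x n k = co y n k) :
    lower w ε a b x = lower w ε a b y := by
  refine Fock.ext fun n k => ?_
  by_cases hn : a ≤ n ∧ n < b
  · simp only [co_lower, h (n + 1) (by omega) (by omega)]
  · rw [co_lower_of_notMem w ε x k hn, co_lower_of_notMem w ε y k hn]

lemma raise_congr {a b : ℕ} {x y : Fock d}
    (h : ∀ n, a ≤ n → n < b → ∀ k, co x n k = co y n k) : raise w ε a b x = raise w ε a b y := by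
  refine Fock.ext fun n k => ?_
  obtain _ | n := n
  · simp
  by_cases hn : a ≤ n ∧ n < b
  · rw [co_raise, co_raise]
    have : ∀ i c, pairTerm w ε (invLam.op x) k i c = pairTerm w ε (invLam.op y) k i c :=
      pairTerm_congr w ε (fun κ => by simp [h n hn.1 hn.2]) k
    simp only [this]
  · rw [co_raise_of_notMem w ε x k (by omega), co_raise_of_notMem w ε y k (by omega)]

lemma lower_add_lower {a b c : ℕ} (hab : a ≤ b) (hbc : b ≤ c) (x : Fock d) :
    lower w ε a b x + lower w ε b c x = lower w ε a c x := by
  refine Fock.ext fun n k => ?_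
  rw [co_add, co_lower, co_lower, co_lower, ← add_mul, annihCoef_add hab hbc]

lemma raise_add_raise {a b c : ℕ} (hab : a ≤ b) (hbc : b ≤ c) (x : Fock d) :
    raise w ε a b x + raise w ε b c x = raise w ε a c x := by
  refine Fock.ext fun n k => ?_
  obtain _ | n := n
  · simp
  rw [co_add, co_raise, co_raise, co_raise, ← add_mul, annihCoef_add hab hbc]

lemma skewOp_add_skewOp {a b c : ℕ} (hab : a ≤ b) (hbc : b ≤ c) (x : Fock d) :
    skewOp w ε a b x + skewOp w ε b c x = skewOp w ε a c x := by
  simp only [skewOp, add_apply]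
  rw [← lower_add_lower w ε hab hbc, ← raise_add_raise w ε hab hbc]
  abel

lemma co_skewOp_of_notMem {a b : ℕ} (x : Fock d) {n : ℕ} (k : 𝕄 n)
    (h : ¬(a ≤ n ∧ n ≤ b)) : co (skewOp w ε a b x) n k = 0 := by
  simp only [skewOp, add_apply, co_add]
  rw [co_lower_of_notMem w ε x k (by omega), co_raise_of_notMem w ε x k (by omega), add_zero]

lemma skewOp_congr {a b : ℕ} {x y : Fock d} (h : ∀ n, a ≤ n → n ≤ b → ∀ k, co x n k = co y n k) :
    skewOp w ε a b x = skewOp w ε a b y := by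
  simp only [skewOp, add_apply]
  rw [lower_congr w ε (x := x) (y := y) fun n h1 h2 => h n (by omega) h2,
    raise_congr w ε (x := x) (y := y) fun n h1 h2 => h n h1 (by omega)]

/-- The solution of the truncated resolvent equation is supported on the chaoses `a, …, b`. -/
lemma co_resolvent_of_notMem {a b : ℕ} {g : Fock d} (hab : a ≤ b)
    (hg : ∀ n k, n ≠ a → co g n k = 0) {n : ℕ} (k : 𝕄 n) (h : ¬(a ≤ n ∧ n ≤ b)) :
    co (𝓡 w ε a b g) n k = 0 := by
  rw [(isSkew_skewOp w ε a b).resolvent_eq g, co_add, co_skewOp_of_notMem w ε _ k h, hg n k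
    (by omega), add_zero]

/-! ### Dependence of the truncated resolvent on the truncation -/

lemma sum_norm_sq_chaos_le (y : Fock d) (s : Finset ℕ) :
    ∑ j ∈ s, ‖(chaosMul d {j}).op y‖ ^ 2 ≤ ‖y‖ ^ 2 := by
  classical
  have h1 : ∀ j, ‖(chaosMul d {j}).op y‖ₑ ^ 2 = ∑' k : 𝕄 j, ‖co y j k‖ₑ ^ 2 := by
    intro j
    rw [enorm_sq_eq_tsum, tsum_eq_single j]
    · simp only [co_chaosMul, Set.mem_singleton_iff, if_true]
    · intro m hm
      simp only [co_chaosMul, Set.mem_singleton_iff, hm, if_false]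
      simp
  have h2 : ∑ j ∈ s, ‖(chaosMul d {j}).op y‖ₑ ^ 2 ≤ ‖y‖ₑ ^ 2 := by
    simp only [h1]
    rw [enorm_sq_eq_tsum y]
    exact ENNReal.sum_le_tsum s
  have h3 : ∀ z : Fock d, ‖z‖ₑ ^ 2 = ENNReal.ofReal (‖z‖ ^ 2) := fun z => by
    rw [ENNReal.ofReal_pow (norm_nonneg _), ofReal_norm]
  simp only [h3] at h2
  rw [← ENNReal.ofReal_sum_of_nonneg (fun _ _ => by positivity)] at h2
  exact (ENNReal.ofReal_le_ofReal_iff (by positivity)).1 h2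

/-- A flux estimate of Carleman type. If two truncations are solved with the same input, the energy
of the difference `y` below level `j` is controlled by the flux between the chaoses `j` and
`j + 1`, which is at most `C (j + 1) ‖y_j‖ ‖y_{j+1}‖`; since `∑ 1/(j+1)` diverges, the lowest
component of `y` is small. -/
lemma carleman {C : ℝ} (hC0 : 0 ≤ C) (hC : ∀ a b x, ‖lower w ε a b x‖ ≤ C * b * ‖x‖)
    {i n m : ℕ} (hnm : n ≤ m) (g : Fock d) {y : Fock d}
    (hy : y = 𝓡 w ε i m g - 𝓡 w ε i n g) :
    ‖(chaosMul d {i}).op y‖ ^ 2 * ∑ j ∈ Ico i n, 1 / ((j : ℝ) + 1) ≤ C * ‖y‖ ^ 2 := by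
  have step : ∀ j ∈ Ico i n, ‖(chaosMul d {i}).op y‖ ^ 2 * (1 / ((j : ℝ) + 1)) ≤
      C / 2 * (‖(chaosMul d {j}).op y‖ ^ 2 + ‖(chaosMul d {j + 1}).op y‖ ^ 2) := by
    intro j hj
    rw [Finset.mem_Ico] at hj
    set P := (chaosMul d (Set.Iic j)).op with hP
    have hPco : ∀ (z : Fock d) l k, co (P z) l k = if l ≤ j then co z l k else 0 := fun z l k => by
      classical
      rw [hP, co_chaosMul]; simp
    have hz : ∀ z : Fock d, (∀ l k, l ≤ j → co z l k = 0) → inner ℂ (P y) z = 0 := by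
      intro z hz
      have : P z = 0 := Fock.ext fun l k => by
        rw [hPco]; split_ifs with hl
        · exact hz l k hl
        · rfl
      rw [hP, inner_op, ← hP, this, inner_zero_right]
    -- the equation for `y` below level `n`
    have h1 : inner ℂ (P y) (y - skewOp w ε i m y) = 0 := by
      have e1 := (isSkew_skewOp w ε i m).resolvent_eq g
      have e2 := (isSkew_skewOp w ε i n).resolvent_eq g
      set xm := 𝓡 w ε i m g
      set xn := 𝓡 w ε i n g
      have e3 := skewOp_add_skewOp w ε (hj.1.trans hj.2.le) hnm xn
      have e4 : y - skewOp w ε i m y = skewOp w ε n m xn := by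
        rw [hy, map_sub, ← e3]
        calc _ = (xm - skewOp w ε i m xm) - (xn - skewOp w ε i n xn) + skewOp w ε n m xn := by abel
          _ = g - g + skewOp w ε n m xn := by
            rw [sub_eq_of_eq_add' e1, sub_eq_of_eq_add' e2]
          _ = _ := by simp
      rw [e4]
      exact hz _ fun l k hl => co_skewOp_of_notMem w ε _ k (by omega)
    have h2 : inner ℂ (P y) (y - P y) = 0 :=
      hz _ fun l k hl => by rw [co_sub, hPco, if_pos hl, sub_self]
    rw [inner_sub_right, sub_eq_zero] at h1 h2
    have h4 : skewOp w ε i m y = skewOp w ε i j (P y) + lower w ε j (j + 1) y +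
        raise w ε j (j + 1) y + skewOp w ε (j + 1) m y := by
      rw [← skewOp_add_skewOp w ε hj.1 (by omega : j ≤ m), ← skewOp_add_skewOp w ε
        (by omega : j ≤ j + 1) (by omega : j + 1 ≤ m)]
      rw [skewOp_congr w ε (x := P y) (y := y) fun l _ h2 k => by rw [hPco, if_pos h2]]
      simp only [skewOp, add_apply]
      abel
    have h5 : ‖P y‖ ^ 2 = (inner ℂ (P y) (lower w ε j (j + 1) y)).re := by
      have h6 := congrArg Complex.re (h2.symm.trans h1)
      rw [h4, inner_add_right, inner_add_right, inner_add_right, hz (raise w ε j (j + 1) y)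
        (fun l k hl => co_raise_of_notMem w ε _ k (by omega)), hz (skewOp w ε (j + 1) m y)
        (fun l k hl => co_skewOp_of_notMem w ε _ k (by omega)), add_zero, add_zero,
        Complex.add_re, (isSkew_skewOp w ε i j).re_inner_self, zero_add] at h6
      rw [← h6]
      exact (inner_self_eq_norm_sq (𝕜 := ℂ) (P y)).symm
    have h7 : inner ℂ (P y) (lower w ε j (j + 1) y) = inner ℂ ((chaosMul d {j}).op y)
          (lower w ε j (j + 1) ((chaosMul d {j + 1}).op y)) := by
      classical
      rw [lower_congr w ε (x := y) (y := (chaosMul d {j + 1}).op y) fun l h1 h2 k => by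
        rw [co_chaosMul, if_pos (by simp; omega)]]
      rw [hP, inner_op, inner_op]
      congr 1
      refine Fock.ext fun l k => ?_
      rw [co_chaosMul, co_chaosMul]
      by_cases hl : l = j
      · subst hl; simp
      · rw [co_lower_of_notMem w ε _ k (by omega)]; simp
    have h8 : ‖P y‖ ^ 2 ≤ ‖(chaosMul d {j}).op y‖ *
        (C * (j + 1) * ‖(chaosMul d {j + 1}).op y‖) := by
      rw [h5, h7]
      refine (Complex.re_le_norm _).trans ((norm_inner_le_norm _ _).trans ?_)
      gcongr
      have := hC j (j + 1) ((chaosMul d {j + 1}).op y)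
      push_cast at this
      exact this
    have h9 : ‖(chaosMul d {i}).op y‖ ≤ ‖P y‖ := by
      classical
      have : (chaosMul d {i}).op y = (chaosMul d {i}).op (P y) := Fock.ext fun l k => by
        rw [co_chaosMul, co_chaosMul, hPco]
        by_cases hl : l = i
        · simp [hl, hj.1]
        · simp [hl]
      rw [this]
      exact norm_chaosMul_le _ _
    have hjpos : (0 : ℝ) < (j : ℝ) + 1 := by positivity
    calc _ ≤ ‖P y‖ ^ 2 * (1 / ((j : ℝ) + 1)) := by gcongr
      _ ≤ (‖(chaosMul d {j}).op y‖ * (C * (j + 1) * ‖(chaosMul d {j + 1}).op y‖)) *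
          (1 / ((j : ℝ) + 1)) := by gcongr
      _ = C * (‖(chaosMul d {j}).op y‖ * ‖(chaosMul d {j + 1}).op y‖) := by field_simp
      _ ≤ _ := by
        nlinarith [sq_nonneg (‖(chaosMul d {j}).op y‖ - ‖(chaosMul d {j + 1}).op y‖)]
  rw [mul_sum]
  calc _ ≤ ∑ j ∈ Ico i n,
        C / 2 * (‖(chaosMul d {j}).op y‖ ^ 2 + ‖(chaosMul d {j + 1}).op y‖ ^ 2) :=
        sum_le_sum step
    _ = C / 2 * (∑ j ∈ Ico i n, ‖(chaosMul d {j}).op y‖ ^ 2 +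
        ∑ j ∈ Ico (i + 1) (n + 1), ‖(chaosMul d {j}).op y‖ ^ 2) := by
        rw [← mul_sum, sum_add_distrib,
          Finset.sum_Ico_add' (fun j => ‖(chaosMul d {j}).op y‖ ^ 2) i n 1]
    _ ≤ C / 2 * (‖y‖ ^ 2 + ‖y‖ ^ 2) := by
        gcongr <;> exact sum_norm_sq_chaos_le y _
    _ = _ := by ring

/-! ### Removing a spectator particle -/

lemma tsum_annihAt_le (q : Mode d) (N : ℕ) (x : Fock d) :
    ∑' (n : ℕ) (k : 𝕄 n), ‖if 1 ≤ n ∧ n < N then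
      ((√(n + 1) : ℝ) : ℂ) * co x (n + 1) (Fin.cons q k) else 0‖ₑ ^ 2
      ≤ ENNReal.ofReal (√N) ^ 2 * ‖x‖ₑ ^ 2 := by
  refine tsum_enorm_sq_le_of_shift 1 fun n => ?_
  by_cases hn : 1 ≤ n ∧ n < N
  swap
  · simp [hn]
  simp only [hn, and_self, if_true, enorm_mul, mul_pow]
  rw [ENNReal.tsum_mul_left]
  refine mul_le_mul' ?_ ?_
  · rw [← ofReal_norm, norm_real, norm_eq_abs, abs_of_nonneg (sqrt_nonneg _)]
    have : (n : ℝ) + 1 ≤ N := by exact_mod_cast hn.2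
    gcongr
  · exact ENNReal.tsum_comp_le_tsum_of_injective (f := fun k : 𝕄 n =>
      (Fin.cons q k : 𝕄 (n + 1))) (fun k k' h => (Fin.cons_injective2 h).2)
      (fun κ => ‖co x (n + 1) κ‖ₑ ^ 2)

/-- The annihilation operator of a single mode `q`, restricted to target chaoses in `[1, N)`. -/
def annihAt (q : Mode d) (N : ℕ) : 𝓛 := mkOp (fun x n k => if 1 ≤ n ∧ n < N then
      ((√(n + 1) : ℝ) : ℂ) * co x (n + 1) (Fin.cons q k) else 0)
    (fun x y n k => by split_ifs <;> simp [mul_add])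
    (fun c x n k => by
      split_ifs
      · rw [co_smul]; ring
      · simp)
    (fun x n σ k => by
      split_ifs
      · congr 1
        apply co_congr
        rw [entries_cons, entries_cons, entries_comp_perm]
      · rfl)
    (fun x n k h => by
      rcases h with rfl | ⟨i, hi⟩
      · simp
      · rw [co_of_zero x (i := i.succ) (by simpa using hi)]; simp)
    (√N) (sqrt_nonneg _) (tsum_annihAt_le q N)

lemma co_annihAt (q : Mode d) (N : ℕ) (x : Fock d) (n : ℕ) (k : 𝕄 n) :
    co (annihAt q N x) n k = if 1 ≤ n ∧ n < N then
      ((√(n + 1) : ℝ) : ℂ) * co x (n + 1) (Fin.cons q k) else 0 := rfl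

lemma tupleSq_cons {n : ℕ} (q : Mode d) (k : 𝕄 n) :
    tupleSq (Fin.cons q k : 𝕄 (n + 1)) = modeSq q + tupleSq k := by
  simp [tupleSq, Fin.sum_univ_succ]

/-- The ratio `Λ(q, k) / Λ(k)`. -/
def ratioUp (q : Mode d) : Multiplier d where
  val _ k := √(modeSq q + tupleSq k) / √(tupleSq k)
  symm n σ k := by rw [tupleSq_comp_perm]
  bdd := ⟨√(modeSq q + 1), sqrt_nonneg _, fun n k => by
    have := modeSq_nonneg q
    rw [abs_of_nonneg (by positivity)]
    by_cases h : tupleSq k = 0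
    · simp [h]
    have h1 := one_le_tupleSq_of_ne_zero h
    rw [← Real.sqrt_div' _ (by linarith)]
    apply Real.sqrt_le_sqrt
    rw [div_le_iff₀ (by linarith)]
    nlinarith⟩

/-- The ratio `Λ(k) / Λ(q, k)`. -/
def ratioDown (q : Mode d) : Multiplier d where
  val _ k := √(tupleSq k) / √(modeSq q + tupleSq k)
  symm n σ k := by rw [tupleSq_comp_perm]
  bdd := ⟨1, zero_le_one, fun n k => by
    rw [abs_of_nonneg (by positivity)]
    apply div_le_one_of_le₀ _ (sqrt_nonneg _)
    apply Real.sqrt_le_sqrt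
    linarith [modeSq_nonneg q]⟩

lemma abs_ratioGap_le (q : Mode d) {n : ℕ} (k : 𝕄 n) :
    |modeSq q / (√2 * √(modeSq q + tupleSq k))| ≤ modeSq q := by
  have hq := modeSq_nonneg q
  rw [abs_of_nonneg (by positivity)]
  by_cases h : q = 0
  · simp [h, modeSq_eq_zero.2 rfl]
  apply div_le_self hq
  have h1 : (1 : ℝ) ≤ √2 := Real.le_sqrt_of_sq_le (by norm_num)
  have h2 : (1 : ℝ) ≤ √(modeSq q + tupleSq k) :=
    Real.le_sqrt_of_sq_le (by linarith [one_le_modeSq h, tupleSq_nonneg k])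
  nlinarith

/-- `Λ(k) (Λ(q, k) / Λ(k) - Λ(k) / Λ(q, k))`. -/
def ratioGap (q : Mode d) : Multiplier d where
  val _ k := modeSq q / (√2 * √(modeSq q + tupleSq k))
  symm n σ k := by rw [tupleSq_comp_perm]
  bdd := ⟨modeSq q, modeSq_nonneg q, fun n k => abs_ratioGap_le q k⟩

/-- `Λ⁻¹ a(q) Λ`. -/
def upAnnih (q : Mode d) (N : ℕ) : 𝓛 := (ratioUp q).op ∘L annihAt q N

/-- `Λ a(q) Λ⁻¹`. -/
def downAnnih (q : Mode d) (N : ℕ) : 𝓛 := (ratioDown q).op ∘L annihAt q N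

lemma upAnnih_invLam (q : Mode d) (N : ℕ) (x : Fock d) :
    upAnnih q N (invLam.op x) = invLam.op (annihAt q N x) := by
  refine Fock.ext fun n k => ?_
  simp only [upAnnih, comp_apply, co_op, co_annihAt]
  split_ifs with h
  swap
  · simp
  by_cases h0 : co x (n + 1) (Fin.cons q k) = 0
  · simp [h0]
  have h1 : 1 ≤ tupleSq k := by
    obtain ⟨n, rfl⟩ : ∃ m, n = m + 1 := ⟨n - 1, by omega⟩
    have hk : k 0 ≠ 0 := fun hk => h0 (co_of_zero x (i := 1) (by simpa using hk))
    exact (one_le_modeSq hk).trans (modeSq_le_tupleSq k 0)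
  have h2 := modeSq_nonneg q
  have e1 : √(tupleSq k) ≠ 0 := (sqrt_pos.2 (by linarith)).ne'
  have e2 : √(modeSq q + tupleSq k) ≠ 0 := (sqrt_pos.2 (by linarith)).ne'
  have key : (ratioUp q).val n k * invLam.val (n + 1) (Fin.cons q k) = invLam.val n k := by
    simp only [ratioUp, invLam, tupleSq_cons]
    rw [sqrt_mul (by norm_num), sqrt_mul (by norm_num)]
    field_simp
  rw [← key]
  push_cast
  ring

lemma invLam_downAnnih (q : Mode d) (N : ℕ) (x : Fock d) :
    invLam.op (downAnnih q N x) = annihAt q N (invLam.op x) := by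
  refine Fock.ext fun n k => ?_
  simp only [downAnnih, comp_apply, co_op, co_annihAt]
  split_ifs with h
  swap
  · simp
  by_cases h0 : co x (n + 1) (Fin.cons q k) = 0
  · simp [h0]
  have h1 : 1 ≤ tupleSq k := by
    obtain ⟨n, rfl⟩ : ∃ m, n = m + 1 := ⟨n - 1, by omega⟩
    have hk : k 0 ≠ 0 := fun hk => h0 (co_of_zero x (i := 1) (by simpa using hk))
    exact (one_le_modeSq hk).trans (modeSq_le_tupleSq k 0)
  have h2 := modeSq_nonneg q
  have e1 : √(tupleSq k) ≠ 0 := (sqrt_pos.2 (by linarith)).ne'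
  have e2 : √(modeSq q + tupleSq k) ≠ 0 := (sqrt_pos.2 (by linarith)).ne'
  have key : invLam.val n k * (ratioDown q).val n k = invLam.val (n + 1) (Fin.cons q k) := by
    simp only [ratioDown, invLam, tupleSq_cons]
    rw [sqrt_mul (by norm_num), sqrt_mul (by norm_num)]
    field_simp
  rw [← key]
  push_cast
  ring

lemma upAnnih_sub_downAnnih (q : Mode d) (N : ℕ) (x : Fock d) :
    upAnnih q N x - downAnnih q N x = invLam.op ((ratioGap q).op (annihAt q N x)) := by
  refine Fock.ext fun n k => ?_
  simp only [upAnnih, downAnnih, comp_apply, co_op, co_annihAt, co_sub]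
  split_ifs with h
  swap
  · simp
  by_cases h0 : co x (n + 1) (Fin.cons q k) = 0
  · simp [h0]
  have h1 : 1 ≤ tupleSq k := by
    obtain ⟨n, rfl⟩ : ∃ m, n = m + 1 := ⟨n - 1, by omega⟩
    have hk : k 0 ≠ 0 := fun hk => h0 (co_of_zero x (i := 1) (by simpa using hk))
    exact (one_le_modeSq hk).trans (modeSq_le_tupleSq k 0)
  have h2 := modeSq_nonneg q
  have e1 : √(tupleSq k) ≠ 0 := (sqrt_pos.2 (by linarith)).ne'
  have e2 : √(modeSq q + tupleSq k) ≠ 0 := (sqrt_pos.2 (by linarith)).ne'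
  have key : (ratioUp q).val n k - (ratioDown q).val n k =
      invLam.val n k * (ratioGap q).val n k := by
    have hh : √(1 / 2) * √2 = 1 := by
      rw [← sqrt_mul (by norm_num)]; norm_num
    have s1 := sq_sqrt (show (0 : ℝ) ≤ tupleSq k by linarith)
    have s2 := sq_sqrt (show (0 : ℝ) ≤ modeSq q + tupleSq k by linarith)
    simp only [ratioUp, ratioDown, invLam, ratioGap]
    rw [sqrt_mul (by norm_num), div_sub_div _ _ e1 e2, inv_mul_eq_div, div_div,
      show √2 * √(modeSq q + tupleSq k) * (√(1 / 2) * √(tupleSq k)) = (√(1 / 2) * √2) *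
        (√(tupleSq k) * √(modeSq q + tupleSq k)) by ring, hh, one_mul]
    congr 1
    nlinarith
  calc _ = (((ratioUp q).val n k - (ratioDown q).val n k : ℝ) : ℂ) *
        (((√(n + 1) : ℝ) : ℂ) * co x (n + 1) (Fin.cons q k)) := by push_cast; ring
    _ = _ := by rw [key]; push_cast; ring

/-- The commutator of `A_-` with the removal of a mode `q`. -/
def commLower (a b : ℕ) (q : Mode d) (N : ℕ) : 𝓛 :=
  annihAt q N ∘L annih w ε (a + 1) (b + 1) - annih w ε a b ∘L annihAt q N

/-- The commutator of `A_+` with the removal of a mode `q`. -/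
def commRaise (a b : ℕ) (q : Mode d) (N : ℕ) : 𝓛 :=
  annihAt q N ∘L creat w ε (a + 1) (b + 1) - creat w ε a b ∘L annihAt q N

lemma entries_split_cons_succ {n : ℕ} (q : Mode d) (k : 𝕄 n) (j : Fin n) (l : Mode d) :
    entries (split (Fin.cons q k : 𝕄 (n + 1)) j.succ l) =
      entries (Fin.cons q (split k j l) : 𝕄 (n + 2)) := by
  have h1 := entries_split (Fin.cons q k : 𝕄 (n + 1)) j.succ l
  have h2 := entries_split k j l
  rw [Fin.cons_succ, entries_cons] at h1
  rw [entries_cons]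
  apply (Multiset.cons_inj_right (k j)).1
  rw [h1, Multiset.cons_swap (k j) q, h2, Multiset.cons_swap q l, Multiset.cons_swap q (k j - l)]

lemma sqrt_mul_annihCoef_succ (ε : ℝ) (a b n : ℕ) :
    ((√(n + 1) : ℝ) : ℂ) * annihCoef d ε (a + 1) (b + 1) (n + 1) =
      annihCoef d ε a b n * ((√((n + 1 : ℕ) + 1) : ℝ) : ℂ) := by
  unfold annihCoef
  by_cases h : a ≤ n ∧ n < b
  · rw [if_pos (by omega), if_pos h]
    push_cast
    ring
  · rw [if_neg (by omega), if_neg h]; simp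

lemma co_commLower {a b : ℕ} (ha : 1 ≤ a) (q : Mode d)
    {N : ℕ} (hN : b < N) (x : Fock d) (n : ℕ) (k : 𝕄 n) :
    co (commLower w ε a b q N x) n k = annihCoef d ε a b n *
      (((√((n + 1 : ℕ) + 1) : ℝ) : ℂ) * ∑ l ∈ box d ε,
        ((dotMode w q * cutoff ε l (q - l) : ℝ) : ℂ) *
          co x (n + 2) (split (Fin.cons q k : 𝕄 (n + 1)) 0 l)) := by
  simp only [commLower, sub_apply, comp_apply, co_sub]
  by_cases hn : a ≤ n ∧ n < b
  swap
  · rw [co_annihAt, co_annih, co_annih, annihCoef_of_notMem hn, annihCoef_of_notMem (by omega)]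
    simp
  rw [co_annihAt, if_pos (by omega), co_annih, ← mul_assoc, sqrt_mul_annihCoef_succ,
    Fin.sum_univ_succ, co_annih, mul_assoc, ← mul_sub]
  congr 1
  rw [mul_add, add_sub_assoc, Fin.cons_zero]
  refine (add_eq_left.2 ?_)
  rw [sub_eq_zero, mul_sum]
  refine sum_congr rfl fun j _ => ?_
  rw [mul_sum]
  refine sum_congr rfl fun l _ => ?_
  rw [co_annihAt, if_pos (by omega), co_congr x (entries_split_cons_succ q k j l), Fin.cons_succ]
  push_cast
  ring

lemma entries_merge_cons_succ {n : ℕ} (q : Mode d) (k : 𝕄 (n + 1))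
    {i c : Fin (n + 1)} (h : i ≠ c) :
    k i ::ₘ k c ::ₘ entries (Fin.cons q (merge k i c) : 𝕄 (n + 1)) =
      (k i + k c) ::ₘ entries (Fin.cons q k : 𝕄 (n + 2)) := by
  rw [entries_cons, entries_cons, Multiset.cons_swap (k c) q, Multiset.cons_swap (k i) q,
    entries_merge k h, Multiset.cons_swap]

lemma co_commRaise {a b : ℕ} (ha : 1 ≤ a) (q : Mode d)
    {N : ℕ} (hN : b < N) (x : Fock d) (n : ℕ) (k : 𝕄 n) :
    co (commRaise w ε a b q N x) n k = (((√(n + 1))⁻¹ : ℝ) : ℂ) *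
      (annihCoef d ε (a + 1) (b + 1) n * (2 * ∑ c : Fin n,
        ((dotMode w (q + k c) * cutoff ε q (k c) : ℝ) : ℂ) *
          co x n (update k c (q + k c)))) := by
  simp only [commRaise, sub_apply, comp_apply, co_sub]
  obtain _ | n := n
  · simp
  by_cases hn : a ≤ n ∧ n < b
  swap
  · rw [co_annihAt, co_creat, co_creat, annihCoef_of_notMem (a := a) hn,
      annihCoef_of_notMem (a := a + 1) (by omega)]
    simp
  rw [co_annihAt, if_pos (by omega), co_creat, co_creat]
  have hs := sqrt_mul_annihCoef_succ (d := d) ε a b n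
  rw [Fin.sum_univ_succ]
  simp only [Fin.sum_univ_succ (n := n + 1)]
  have h00 : pairTerm w ε x (Fin.cons q k : 𝕄 (n + 2)) 0 0 = 0 := by simp [pairTerm]
  have h1 : ∀ c : Fin (n + 1), pairTerm w ε x (Fin.cons q k : 𝕄 (n + 2)) 0 c.succ =
      ((dotMode w (q + k c) * cutoff ε q (k c) : ℝ) : ℂ) *
          co x (n + 1) (update k c (q + k c)) := by
    intro c
    rw [pairTerm_of_entries w ε x _ (Fin.succ_ne_zero c).symm (k := update k c (q + k c))]
    · simp
    · have := entries_update_tail (Fin.cons q k : 𝕄 (n + 2)) c (q + k c)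
      simpa using this
  have h2 : ∀ i c : Fin (n + 1), ((√(n + 1) : ℝ) : ℂ) *
        pairTerm w ε x (Fin.cons q k : 𝕄 (n + 2)) i.succ c.succ =
      pairTerm w ε (annihAt q N x) k i c := by
    intro i c
    by_cases hic : i = c
    · simp [pairTerm, hic]
    rw [pairTerm_of_entries w ε x _ (fun h => hic (Fin.succ_injective _ h))
      (k := Fin.cons q (merge k i c)) (by simpa using entries_merge_cons_succ q k hic),
      pairTerm, if_neg hic, co_annihAt, if_pos (by omega)]
    simp only [Fin.cons_succ]
    push_cast
    ring
  simp only [← h2, h00, h1, pairTerm_comm w ε x _ (Fin.succ _) 0, sum_add_distrib]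
  simp only [← mul_sum]
  set X := ∑ c : Fin (n + 1), ((dotMode w (q + k c) * cutoff ε q (k c) : ℝ) : ℂ) *
          co x (n + 1) (update k c (q + k c))
  set Y := ∑ i : Fin (n + 1), ∑ c : Fin (n + 1),
    pairTerm w ε x (Fin.cons q k : 𝕄 (n + 2)) i.succ c.succ
  have e1 : ∀ m : ℕ, ((√(m + 1) : ℝ) : ℂ) ≠ 0 := fun m => by
    rw [ofReal_ne_zero]; exact (sqrt_pos.2 (by positivity)).ne'
  have s1 : ∀ m : ℕ, ((√(m + 1) : ℝ) : ℂ) ^ 2 = (m : ℂ) + 1 := fun m => by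
    rw [← ofReal_pow, sq_sqrt (by positivity)]; push_cast; ring
  have e2 := e1 (n + 1)
  replace e1 := e1 n
  rw [← s1 n, ← s1 (n + 1)]
  set r1 := ((√(n + 1) : ℝ) : ℂ)
  rw [Complex.ofReal_inv]
  set r2 := ((√((n + 1 : ℕ) + 1) : ℝ) : ℂ)
  set A := annihCoef d ε (a + 1) (b + 1) (n + 1)
  set A' := annihCoef d ε a b n
  have hA' : A' = r1 * A / r2 := by rw [eq_div_iff e2]; exact hs.symm
  rw [hA']
  field_simp
  ring

/-- A uniform bound for the commutators with the removal of a mode, composed with `Λ⁻¹`. -/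
def commBound (C₀ : ℝ) (b : ℕ) (q : Mode d) : ℝ :=
  ((b : ℝ) + 1) * (|dotMode w q| * √C₀ + 4 * ‖w‖) / (2 * π) ^ ((d : ℝ) / 2)

lemma commBound_nonneg (C₀ : ℝ) (b : ℕ) (q : Mode d) : 0 ≤ commBound w C₀ b q := by
  have := two_pi_rpow_pos ((d : ℝ) / 2)
  unfold commBound; positivity

lemma split_cons_zero {n : ℕ} (q : Mode d) (k : 𝕄 n) (l : Mode d) :
    split (Fin.cons q k : 𝕄 (n + 1)) 0 l = Fin.cons l (Fin.cons (q - l) k) := by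
  rw [split, Fin.cons_zero, Fin.update_cons_zero]

lemma norm_commLower_invLam_le {ε C₀ : ℝ} {a b : ℕ} (ha : 1 ≤ a)
    (q : Mode d) (hC : loopSum ε q ≤ C₀) {N : ℕ} (hN : b < N) (x : Fock d) :
    ‖commLower w ε a b q N (invLam.op x)‖ ≤ commBound w C₀ b q * ‖x‖ := by
  have hp := two_pi_rpow_pos ((d : ℝ) / 2)
  have hC0 : 0 ≤ C₀ := (loopSum_nonneg ε q).trans hC
  set p := (2 * π) ^ ((d : ℝ) / 2) with hpdef
  set B : ℝ := ((b : ℝ) + 1) * (|dotMode w q| * √C₀) / p with hB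
  have hB0 : 0 ≤ B := by positivity
  have hBle : B ≤ commBound w C₀ b q := by
    rw [hB, commBound]
    have := norm_nonneg w
    gcongr
    linarith
  refine le_trans ?_ (mul_le_mul_of_nonneg_right hBle (norm_nonneg x))
  apply norm_le_of_enorm_sq_le hB0 (norm_nonneg _)
  rw [ofReal_norm]
  refine tsum_enorm_sq_le_of_shift 2 fun n => ?_
  by_cases hn : a ≤ n ∧ n < b
  swap
  · simp [co_commLower w ε ha q hN, annihCoef_of_notMem hn]
  have hnb : (n : ℝ) + 1 ≤ b := by exact_mod_cast hn.2
  refine (tsum_enorm_sq_le_of_row (ι := Unit) (box d ε)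
    (fun _ k l => split (Fin.cons q k : 𝕄 (n + 1)) 0 l) ?_
    (fun k _ l => √(n + 1) * |coupling d ε| / p * √((n + 1 : ℕ) + 1) *
      |dotMode w q| * cutoff ε l (q - l) *
        invLam.val (n + 2) (split (Fin.cons q k : 𝕄 (n + 1)) 0 l)) _
      (fun κ => co x (n + 2) κ) (fun k => ?_) (C := B ^ 2) fun k => ?_).trans ?_
  · rintro - ⟨k, l⟩ ⟨k', l'⟩ h
    have := split_injective (d := d) (0 : Fin (n + 1)) (a₁ := (Fin.cons q k, l))
      (a₂ := (Fin.cons q k', l')) h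
    simp only [Prod.mk.injEq] at this
    exact Prod.ext (Fin.cons_injective2 this.1).2 this.2
  · rw [co_commLower w ε ha q hN, norm_mul, norm_mul]
    have h1 := norm_annihCoef_le (d := d) ε a b n
    calc _ ≤ (√(n + 1) * |coupling d ε| / p) * (√((n + 1 : ℕ) + 1) *
          ∑ l ∈ box d ε, ‖((dotMode w q * cutoff ε l (q - l) : ℝ) : ℂ) *
          co (invLam.op x) (n + 2) (split (Fin.cons q k : 𝕄 (n + 1)) 0 l)‖) := by
          have h2 : ‖((√((n + 1 : ℕ) + 1) : ℝ) : ℂ)‖ = √((n + 1 : ℕ) + 1) := by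
            rw [norm_real, norm_eq_abs, abs_of_nonneg (sqrt_nonneg _)]
          rw [h2]
          gcongr
          exact norm_sum_le _ _
      _ = _ := by
          simp only [Finset.univ_unique, sum_singleton, mul_sum]
          refine sum_congr rfl fun l _ => ?_
          rw [co_op, norm_mul, norm_mul, norm_real, norm_real,
            norm_eq_abs, norm_eq_abs, abs_of_nonneg (invLam_val_nonneg _), abs_mul,
            abs_of_nonneg (cutoff_nonneg _ _ _)]
          ring
  · simp only [Finset.univ_unique, sum_singleton]
    have hterm : ∀ l ∈ box d ε, (√(n + 1) * |coupling d ε| / p *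
        √((n + 1 : ℕ) + 1) * |dotMode w q| * cutoff ε l (q - l) *
        invLam.val (n + 2) (split (Fin.cons q k : 𝕄 (n + 1)) 0 l)) ^ 2 ≤
        ((n + 1) * ((n + 1 : ℕ) + 1) / p ^ 2 * dotMode w q ^ 2) * (coupling d ε ^ 2 *
          (cutoff ε l (q - l) * (𝓔 q l)⁻¹)) := by
      intro l _
      by_cases hc : cutoff ε l (q - l) = 0
      · simp [hc]
      have hl : 0 < modeSq l := lt_of_lt_of_le one_pos
        (one_le_modeSq (ne_zero_of_cutoffNorm_pos (of_cutoff_ne_zero hc).1.1))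
      simp only [mul_pow, div_pow, sq_abs, cutoff_sq, invLam_val_sq]
      rw [sq_sqrt (by positivity), sq_sqrt (by positivity)]
      have h2 : (1 / 2 * tupleSq (split (Fin.cons q k : 𝕄 (n + 1)) 0 l))⁻¹ ≤ (𝓔 q l)⁻¹ := by
        have := modeSq_nonneg (q - l)
        apply inv_anti₀ (by positivity)
        have := le_tupleSq_split (Fin.cons q k : 𝕄 (n + 1)) 0 l
        rw [Fin.cons_zero] at this
        linarith
      have := cutoff_nonneg ε l (q - l)
      calc _ ≤ (↑n + 1) * coupling d ε ^ 2 / p ^ 2 * (((n + 1 : ℕ) : ℝ) + 1) * dotMode w q ^ 2 *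
            cutoff ε l (q - l) * (𝓔 q l)⁻¹ := by gcongr
        _ = _ := by ring
    calc _ ≤ _ := sum_le_sum hterm
      _ = ((n + 1) * ((n + 1 : ℕ) + 1) / p ^ 2 * dotMode w q ^ 2) * loopSum ε q := by
          rw [loopSum, mul_sum, mul_sum]
      _ ≤ ((b + 1) * (b + 1) / p ^ 2 * dotMode w q ^ 2) * C₀ := by
          push_cast
          have := loopSum_nonneg ε q
          gcongr; linarith
      _ = B ^ 2 := by
          rw [hB, div_pow, mul_pow, mul_pow, sq_sqrt hC0, sq_abs]
          ring
  · apply le_of_eq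
    rw [Fintype.card_unit, Nat.cast_one, mul_one, ENNReal.ofReal_pow hB0]

lemma norm_commRaise_invLam_le {ε C₀ : ℝ} {a b : ℕ} (ha : 1 ≤ a)
    (q : Mode d) (hl : |coupling d ε| ≤ 1) {N : ℕ} (hN : b < N) (x : Fock d) :
    ‖commRaise w ε a b q N (invLam.op x)‖ ≤ commBound w C₀ b q * ‖x‖ := by
  have hp := two_pi_rpow_pos ((d : ℝ) / 2)
  set p := (2 * π) ^ ((d : ℝ) / 2) with hpdef
  set B : ℝ := ((b : ℝ) + 1) * (4 * ‖w‖) / p with hB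
  have hB0 : 0 ≤ B := by positivity
  have hBle : B ≤ commBound w C₀ b q := by
    rw [hB, commBound]
    have : 0 ≤ |dotMode w q| * √C₀ := by positivity
    gcongr
    linarith
  refine le_trans ?_ (mul_le_mul_of_nonneg_right hBle (norm_nonneg x))
  apply norm_le_of_enorm_sq_le hB0 (norm_nonneg _)
  rw [ofReal_norm]
  refine tsum_enorm_sq_le_of_shift 0 fun n => ?_
  by_cases hn : a + 1 ≤ n ∧ n < b + 1
  swap
  · simp [co_commRaise w ε ha q hN, annihCoef_of_notMem hn]
  have hnb : (n : ℝ) ≤ b := by exact_mod_cast Nat.lt_succ_iff.1 hn.2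
  have hn0 : (0 : ℝ) < n := by exact_mod_cast (show 0 < n by omega)
  refine (tsum_enorm_sq_le_of_row ({()} : Finset Unit) (fun c k _ => update k c (q + k c)) ?_
    (fun k c _ => 4 * ‖w‖ / p) _
      (fun κ => co x n κ) (fun k => ?_) (C := B ^ 2 / n) fun k => ?_).trans ?_
  · rintro c ⟨k, l⟩ ⟨k', l'⟩ h
    refine Prod.ext (funext fun i => ?_) rfl
    have := congrFun h i
    by_cases hi : i = c
    · subst hi; simpa using this
    · simpa [hi] using this
  · rw [co_commRaise w ε ha q hN, norm_mul, norm_mul, norm_mul]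
    have h1 := norm_annihCoef_le (d := d) ε (a + 1) (b + 1) n
    have hs : 0 < √((n : ℝ) + 1) := sqrt_pos.2 (by positivity)
    have hs' : ‖(((√(n + 1))⁻¹ : ℝ) : ℂ)‖ = (√(n + 1))⁻¹ := by
      rw [norm_real, norm_eq_abs, abs_of_nonneg (by positivity)]
    rw [hs']
    have hterm : ∀ c : Fin n, ‖((dotMode w (q + k c) * cutoff ε q (k c) : ℝ) : ℂ) *
          co (invLam.op x) n (update k c (q + k c))‖ ≤
          2 * ‖w‖ * ‖co x n (update k c (q + k c))‖ := by
      intro c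
      rw [co_op, norm_mul, norm_mul, norm_real, norm_real,
        norm_eq_abs, norm_eq_abs, abs_of_nonneg (invLam_val_nonneg _), abs_mul,
        abs_of_nonneg (cutoff_nonneg _ _ _), ← mul_assoc]
      refine mul_le_mul_of_nonneg_right ?_ (norm_nonneg _)
      have h2 : |dotMode w (q + k c)| * invLam.val n (update k c (q + k c)) ≤ 2 * ‖w‖ := by
        apply abs_le_of_sq_le_sq' _ (by positivity) |>.2
        rw [mul_pow, sq_abs, invLam_val_sq, mul_pow]
        by_cases h0 : tupleSq (update k c (q + k c)) = 0
        · rw [h0]; simp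
        have h3 := modeSq_le_tupleSq (update k c (q + k c)) c
        rw [Function.update_self] at h3
        have h4 := lt_of_lt_of_le one_pos (one_le_tupleSq_of_ne_zero h0)
        rw [← div_eq_mul_inv, div_le_iff₀ (by positivity)]
        calc _ ≤ ‖w‖ ^ 2 * modeSq (q + k c) := dotMode_sq_le w _
          _ ≤ ‖w‖ ^ 2 * tupleSq (update k c (q + k c)) := by gcongr
          _ ≤ _ := by nlinarith [sq_nonneg ‖w‖, mul_nonneg (sq_nonneg ‖w‖) h4.le]
      have h5 := invLam_val_nonneg (d := d) (update k c (q + k c))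
      calc _ ≤ |dotMode w (q + k c)| * 1 * invLam.val n (update k c (q + k c)) := by
            gcongr; exact cutoff_le_one _ _ _
        _ ≤ _ := by rwa [mul_one]
    have h2 : ‖(2 : ℂ) * ∑ c : Fin n, ((dotMode w (q + k c) * cutoff ε q (k c) : ℝ) : ℂ) *
          co (invLam.op x) n (update k c (q + k c))‖ ≤
          2 * ∑ c : Fin n, 2 * ‖w‖ * ‖co x n (update k c (q + k c))‖ := by
      rw [norm_mul, Complex.norm_ofNat]
      gcongr
      exact (norm_sum_le _ _).trans (sum_le_sum fun c _ => hterm c)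
    have h3 : ‖annihCoef d ε (a + 1) (b + 1) n‖ ≤ √(n + 1) / p := by
      refine h1.trans ?_
      gcongr
      nlinarith
    rw [← norm_mul (2 : ℂ)]
    calc _ ≤ (√(n + 1))⁻¹ * (√(n + 1) / p * (2 * ∑ c : Fin n, 2 * ‖w‖ *
          ‖co x n (update k c (q + k c))‖)) := by gcongr
      _ = _ := by
          simp only [sum_singleton, ← mul_sum]
          field_simp
          ring
  · simp only [sum_singleton]
    rw [sum_const, card_univ, Fintype.card_fin, nsmul_eq_mul]
    rw [hB, le_div_iff₀ hn0, div_pow, mul_pow, div_pow]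
    have : (n : ℝ) * n ≤ (b + 1) ^ 2 := by nlinarith
    calc _ = (n : ℝ) * n * ((4 * ‖w‖) ^ 2 / p ^ 2) := by ring
      _ ≤ (b + 1) ^ 2 * ((4 * ‖w‖) ^ 2 / p ^ 2) := by gcongr
      _ = _ := by ring
  · apply le_of_eq
    rw [Fintype.card_fin, div_mul_cancel₀ _ hn0.ne', ENNReal.ofReal_pow hB0]
    rfl

lemma norm_le_of_forall_inner {r : Fock d} {B : ℝ} (hB : 0 ≤ B)
    (h : ∀ χ : Fock d, ‖(inner ℂ χ r : ℂ)‖ ≤ B * ‖χ‖) : ‖r‖ ≤ B := by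
  by_cases hr : r = 0
  · rwa [hr, norm_zero]
  have h1 := h r
  rw [inner_self_eq_norm_sq_to_K] at h1
  simp only [Complex.coe_algebraMap, norm_pow, norm_real, norm_norm] at h1
  have hpos : 0 < ‖r‖ := norm_pos_iff.2 hr
  rw [sq] at h1
  exact le_of_mul_le_mul_right h1 hpos

/-- `a(q)† (Λ(q,·) / Λ)`, the adjoint of `Λ⁻¹ a(q) Λ`. -/
def upCreat (q : Mode d) (N : ℕ) : 𝓛 := ContinuousLinearMap.adjoint (upAnnih q N)

/-- `a(q)† (Λ / Λ(q,·))`, the adjoint of `Λ a(q) Λ⁻¹`. -/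
def downCreat (q : Mode d) (N : ℕ) : 𝓛 := ContinuousLinearMap.adjoint (downAnnih q N)

lemma inner_upCreat (q : Mode d) (N : ℕ) (x y : Fock d) :
    inner ℂ x (upCreat q N y) = inner ℂ (upAnnih q N x) y :=
  ContinuousLinearMap.adjoint_inner_right _ _ _

lemma inner_downCreat (q : Mode d) (N : ℕ) (x y : Fock d) :
    inner ℂ x (downCreat q N y) = inner ℂ (downAnnih q N x) y :=
  ContinuousLinearMap.adjoint_inner_right _ _ _

lemma upAnnih_lower (a b : ℕ) (q : Mode d) (N : ℕ)
    (x : Fock d) : upAnnih q N (lower w ε (a + 1) (b + 1) x) = lower w ε a b (downAnnih q N x) +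
        invLam.op (commLower w ε a b q N (invLam.op x)) := by
  simp only [lower, comp_apply, upAnnih_invLam, invLam_downAnnih, ← map_add, commLower, sub_apply]
  congr 1
  abel

lemma upAnnih_raise (a b : ℕ) (q : Mode d) (N : ℕ)
    (x : Fock d) : upAnnih q N (raise w ε (a + 1) (b + 1) x) = raise w ε a b (downAnnih q N x) +
        invLam.op (commRaise w ε a b q N (invLam.op x)) := by
  simp only [raise, comp_apply, upAnnih_invLam, invLam_downAnnih, ← map_add, commRaise, sub_apply]
  congr 1
  abel

lemma norm_annihAt_le (q : Mode d) (N : ℕ) (x : Fock d) : ‖annihAt q N x‖ ≤ √N * ‖x‖ := by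
  apply norm_le_of_enorm_sq_le (sqrt_nonneg _) (norm_nonneg _)
  rw [ofReal_norm]
  exact tsum_annihAt_le q N x

lemma norm_ratioGap_le (q : Mode d) (x : Fock d) : ‖(ratioGap q).op x‖ ≤ modeSq q * ‖x‖ := by
  refine (ratioGap q).norm_op_le (modeSq_nonneg q) x fun n k _ => ?_
  exact abs_ratioGap_le q k

lemma norm_upCreat_sub_downCreat_le (q : Mode d) (N : ℕ) (u : Fock d) :
    ‖upCreat q N u - downCreat q N u‖ ≤ modeSq q * √N * ‖invLam.op u‖ := by
  have hq := modeSq_nonneg q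
  refine norm_le_of_forall_inner (by positivity) fun χ => ?_
  rw [inner_sub_right, inner_upCreat, inner_downCreat, ← inner_sub_left, upAnnih_sub_downAnnih,
    inner_op]
  calc _ ≤ ‖(ratioGap q).op (annihAt q N χ)‖ * ‖invLam.op u‖ := norm_inner_le_norm _ _
    _ ≤ modeSq q * (√N * ‖χ‖) * ‖invLam.op u‖ := by
        gcongr
        exact (norm_ratioGap_le q _).trans (by gcongr; exact norm_annihAt_le q N χ)
    _ = _ := by ring

/-- The constant in the comparison of the resolvents with and without a spectator mode `q`. -/
def spectatorBound (C₀ : ℝ) (b : ℕ) (q : Mode d) (N : ℕ) : ℝ :=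
  modeSq q * √N + 2 * commBound w C₀ b q

lemma spectatorBound_nonneg (C₀ : ℝ) (b : ℕ) (q : Mode d) (N : ℕ) :
    0 ≤ spectatorBound w C₀ b q N := by
  have := modeSq_nonneg q
  have := commBound_nonneg w C₀ b q
  unfold spectatorBound
  positivity

/-- A spectator mode can be added to a resolvent, up to an error controlled by the weak norm. -/
lemma norm_sub_skewOp_upCreat_le {ε C₀ : ℝ} {a b : ℕ} (ha : 1 ≤ a)
    (q : Mode d) (hC : loopSum ε q ≤ C₀) (hl : |coupling d ε| ≤ 1) {N : ℕ} (hN : b < N)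
    {u g : Fock d} (hu : u = skewOp w ε a b u + g) :
    ‖upCreat q N u - skewOp w ε (a + 1) (b + 1) (upCreat q N u) - downCreat q N g‖ ≤
      spectatorBound w C₀ b q N * ‖invLam.op u‖ := by
  have hs := spectatorBound_nonneg w C₀ b q N
  refine norm_le_of_forall_inner (by positivity) fun χ => ?_
  have hS := isSkew_skewOp w ε (a + 1) (b + 1) χ (upCreat q N u)
  have hS' := isSkew_skewOp w ε a b (downAnnih q N χ) u
  have hg : g = u - skewOp w ε a b u := by rw [eq_sub_iff_add_eq, add_comm]; exact hu.symm
  have e1 : upAnnih q N (skewOp w ε (a + 1) (b + 1) χ) = skewOp w ε a b (downAnnih q N χ) +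
      invLam.op (commLower w ε a b q N (invLam.op χ) +
        commRaise w ε a b q N (invLam.op χ)) := by
    simp only [skewOp, add_apply, map_add, upAnnih_lower, upAnnih_raise]
    abel
  have key : inner ℂ χ (upCreat q N u - skewOp w ε (a + 1) (b + 1) (upCreat q N u) -
      downCreat q N g) = inner ℂ ((ratioGap q).op (annihAt q N χ) +
        (commLower w ε a b q N (invLam.op χ) + commRaise w ε a b q N (invLam.op χ)))
        (invLam.op u) := by
    rw [inner_sub_right, inner_sub_right, hS, inner_upCreat, inner_upCreat, inner_downCreat, e1,
      inner_add_left, hg, inner_sub_right, hS', inner_add_left, ← inner_op,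
      ← inner_op, ← upAnnih_sub_downAnnih, inner_sub_left]
    ring
  rw [key]
  have h1 := norm_commLower_invLam_le w ha q hC hN χ
  have h2 := norm_commRaise_invLam_le (C₀ := C₀) w ha q hl hN χ
  have h3 : ‖(ratioGap q).op (annihAt q N χ)‖ ≤ modeSq q * (√N * ‖χ‖) := by
    have := modeSq_nonneg q
    exact (norm_ratioGap_le q _).trans (by gcongr; exact norm_annihAt_le q N χ)
  calc _ ≤ _ := norm_inner_le_norm _ _
    _ ≤ (modeSq q * (√N * ‖χ‖) + (commBound w C₀ b q * ‖χ‖ + commBound w C₀ b q * ‖χ‖)) *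
        ‖invLam.op u‖ := by
        gcongr
        refine (norm_add_le _ _).trans (add_le_add h3 ((norm_add_le _ _).trans (add_le_add h1 h2)))
    _ = _ := by rw [spectatorBound]; ring

lemma norm_lower_upCreat_sub_le {ε : ℝ} (C₀ : ℝ) {a b : ℕ}
    (ha : 1 ≤ a) (q : Mode d) (hl : |coupling d ε| ≤ 1) {N : ℕ} (hN : b < N) (u : Fock d) :
    ‖lower w ε (a + 1) (b + 1) (upCreat q N u) - downCreat q N (lower w ε a b u)‖ ≤
      commBound w C₀ b q * ‖invLam.op u‖ := by
  have hs := commBound_nonneg w C₀ b q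
  refine norm_le_of_forall_inner (by positivity) fun χ => ?_
  have h0 : ∀ a b x y, inner ℂ x (lower w ε a b y) = -inner ℂ (raise w ε a b x) y :=
    fun a b x y => by rw [inner_raise_left, neg_neg]
  rw [inner_sub_right, h0, inner_upCreat, upAnnih_raise, inner_downCreat, h0, inner_add_left,
    inner_op]
  have h2 := norm_commRaise_invLam_le (C₀ := C₀) w ha q hl hN χ
  rw [neg_add, sub_neg_eq_add, add_comm, ← add_assoc, add_neg_cancel, zero_add, norm_neg]
  calc _ ≤ _ := norm_inner_le_norm _ _
    _ ≤ (commBound w C₀ b q * ‖χ‖) * ‖invLam.op u‖ := by gcongr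
    _ = _ := by ring

/-- The point mass at a non-zero mode, in the first chaos. -/
def modeVec (p : Mode d) (hp : p ≠ 0) : Fock d := symDelta ![p] (fun i => by simpa using hp)

lemma inner_modeVec (p : Mode d) (hp : p ≠ 0) (y : Fock d) :
    inner ℂ (modeVec p hp) y = co y 1 ![p] := inner_symDelta _ _ _

lemma inner_modeVec_right (p : Mode d) (hp : p ≠ 0) (y : Fock d) :
    inner ℂ y (modeVec p hp) = starRingEnd ℂ (co y 1 ![p]) := by
  rw [← inner_modeVec p hp, inner_conj_symm]

/-- `Λ(p)` for a single mode. -/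
def lamMode (p : Mode d) : ℝ := √(1 / 2 * modeSq p)

lemma lamMode_pos {p : Mode d} (hp : p ≠ 0) : 0 < lamMode p := by
  have := one_le_modeSq hp
  exact sqrt_pos.2 (by linarith)

lemma tupleSq_singleton (p : Mode d) : tupleSq ![p] = modeSq p := by simp [tupleSq]

lemma eq_cons_zero (k : 𝕄 1) : k = ![k 0] := by
  funext i; fin_cases i; rfl

lemma co_modeVec (p : Mode d) (hp : p ≠ 0) (n) (k : 𝕄 n) :
    co (modeVec p hp) n k = if (⟨n, k⟩ : Idx d) = ⟨1, ![p]⟩ then 1 else 0 := by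
  classical
  rw [modeVec, co_symDelta]
  have : ∀ σ : Perm (Fin (0 + 1)), (![p] : 𝕄 (0 + 1)) ∘ σ = ![p] := fun σ => by
    funext i; fin_cases i; simp
  simp [this]

lemma Fock.ext_inner_left {x y : Fock d} (h : ∀ χ : Fock d, (inner ℂ χ x : ℂ) = inner ℂ χ y) :
    x = y := _root_.ext_inner_left ℂ h

lemma invLam_smul_modeVec (p : Mode d) (hp : p ≠ 0) :
    invLam.op ((lamMode p : ℂ) • modeVec p hp) = modeVec p hp := by
  refine Fock.ext fun n k => ?_
  rw [co_op, co_smul, co_modeVec]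
  split_ifs with h
  · obtain ⟨rfl, h⟩ := Sigma.mk.inj_iff.1 h
    rw [heq_eq_eq] at h
    subst h
    have := lamMode_pos hp
    simp only [invLam, tupleSq_singleton]
    rw [mul_one, ← ofReal_mul, ← lamMode, inv_mul_cancel₀ this.ne', Complex.ofReal_one]
  · simp

/-- The source generated by a single mode. -/
def modeSource (p : Mode d) (hp : p ≠ 0) : Fock d := raise w ε 1 2 ((lamMode p : ℂ) • modeVec p hp)

lemma co_commLower_one (p q : Mode d)
    {N : ℕ} (hN : 2 < N) (x : Fock d) :
    co (commLower w ε 1 2 q N x) 1 ![p] = co (annih w ε 1 2 (annihAt p N x)) 1 ![q] := by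
  rw [co_commLower w ε le_rfl q hN, co_annih]
  congr 1
  simp only [Finset.univ_unique, sum_singleton, mul_sum, Fin.default_eq_zero]
  refine sum_congr rfl fun l _ => ?_
  rw [co_annihAt, if_pos (by omega)]
  have h : entries (split (Fin.cons q ![p] : 𝕄 2) 0 l) =
      entries (Fin.cons p (split ![q] 0 l) : 𝕄 3) := by
    have h1 : (![q] : 𝕄 1) = Fin.cons q Fin.elim0 := by funext i; fin_cases i; rfl
    have h2 : (![p] : 𝕄 1) = Fin.cons p Fin.elim0 := by funext i; fin_cases i; rfl
    rw [h1, h2]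
    simp only [split_cons_zero, entries_cons]
    rw [Multiset.cons_swap p l, Multiset.cons_swap p (q - l)]
  rw [co_congr x h]
  simp
  ring

/-- Creating pairs out of a two-particle state: each of the particles is a spectator for the
other one. -/
lemma raise_two_upCreat (p q : Mode d) (hp : p ≠ 0) (hq : q ≠ 0) {N : ℕ} (hN : 2 < N) :
    raise w ε 2 3 (upCreat q N ((lamMode p : ℂ) • modeVec p hp)) =
      downCreat q N (modeSource w ε p hp) + downCreat p N (modeSource w ε q hq) := by
  refine Fock.ext_inner_left fun χ => ?_
  rw [inner_add_right, inner_downCreat, inner_downCreat, inner_raise_right, inner_upCreat,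
    upAnnih_lower w ε 1 2, inner_add_left, modeSource, inner_raise_right, modeSource,
    inner_raise_right, neg_add, inner_op, invLam_smul_modeVec, inner_modeVec_right,
    co_commLower_one w ε p q hN, ← invLam_downAnnih, ← inner_modeVec_right q hq]
  rw [← invLam_smul_modeVec q hq, ← inner_op]
  simp only [lower, comp_apply, invLam_smul_modeVec]

/-! ### Kernels and normalised coefficients -/

/-- The kernels `ψ̂_n = co x n / √(n!)` of a Fock vector. -/
def toVec (x : Fock d) : FockVec d := fun n k => (((√n.factorial)⁻¹ : ℝ) : ℂ) * co x n k

lemma sqrt_factorial_pos (n : ℕ) : 0 < √n.factorial :=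
  sqrt_pos.2 (by exact_mod_cast n.factorial_pos)

lemma sqrt_factorial_succ (n : ℕ) : √(n + 1).factorial = √(n + 1) * √n.factorial := by
  rw [Nat.factorial_succ, Nat.cast_mul, sqrt_mul (by positivity)]
  push_cast
  rfl

lemma fockNorm_toVec (x : Fock d) : fockNorm (toVec x) = ‖x‖ₑ := by
  have h : ∀ n : ℕ, (n.factorial : ℝ≥0∞) * ∑' k : 𝕄 n, ‖toVec x n k‖ₑ ^ 2 =
      ∑' k : 𝕄 n, ‖co x n k‖ₑ ^ 2 := by
    intro n
    rw [← ENNReal.tsum_mul_left]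
    refine tsum_congr fun k => ?_
    rw [toVec, enorm_mul, mul_pow, ← mul_assoc]
    have hn := sqrt_factorial_pos n
    have : ‖(((√n.factorial)⁻¹ : ℝ) : ℂ)‖ₑ ^ 2 = (n.factorial : ℝ≥0∞)⁻¹ := by
      rw [← ofReal_norm, norm_real, norm_eq_abs, abs_of_pos (by positivity),
        ← ENNReal.ofReal_pow (by positivity), inv_pow, sq_sqrt (by positivity),
        ENNReal.ofReal_inv_of_pos (by exact_mod_cast n.factorial_pos), ENNReal.ofReal_natCast]
    rw [this, ENNReal.mul_inv_cancel (by exact_mod_cast n.factorial_ne_zero)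
      (ENNReal.natCast_ne_top _), one_mul]
  unfold fockNorm
  simp only [h]
  rw [← enorm_sq_eq_tsum, ← ENNReal.rpow_natCast, ← ENNReal.rpow_mul]
  norm_num

lemma isFock_toVec (x : Fock d) : IsFock (toVec x) := by
  refine ⟨fun n σ k => by rw [toVec, toVec, co_perm], fun n k ⟨i, hi⟩ => ?_, ?_⟩
  · rw [toVec, co_of_zero x hi, mul_zero]
  · rw [fockNorm_toVec]; exact enorm_lt_top

lemma exists_eq_toVec {f : FockVec d} (h : IsFock f) (h0 : ∀ k, f 0 k = 0) :
    ∃ x : Fock d, f = toVec x := by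
  refine ⟨mkFock (fun n k => ((√n.factorial : ℝ) : ℂ) * f n k)
    (fun n σ k => by rw [h.1]) (fun n k hk => ?_) ?_, ?_⟩
  · rcases hk with rfl | hk
    · rw [h0, mul_zero]
    · rw [h.2.1 n k hk, mul_zero]
  · have h1 := h.2.2
    unfold fockNorm at h1
    rw [ENNReal.rpow_lt_top_iff_of_pos (by norm_num)] at h1
    refine lt_of_le_of_lt (le_of_eq ?_) h1
    refine tsum_congr fun n => ?_
    rw [← ENNReal.tsum_mul_left]
    refine tsum_congr fun k => ?_
    rw [enorm_mul, mul_pow]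
    congr 1
    rw [← ofReal_norm, norm_real, norm_eq_abs, abs_of_pos (sqrt_factorial_pos n),
        ← ENNReal.ofReal_pow (by positivity), sq_sqrt (by positivity),
        ENNReal.ofReal_natCast]
  · funext n k
    have := sqrt_factorial_pos n
    rw [toVec, co_mkFock, ← mul_assoc, ← ofReal_mul, inv_mul_cancel₀ this.ne']
    simp

lemma opAplus_toVec {a b n : ℕ} (h : a ≤ n ∧ n < b) (x : Fock d) (k : 𝕄 (n + 1)) :
    opAplus w ε (toVec x) (n + 1) k = toVec (creat w ε a b x) (n + 1) k := by
  have h1 := sqrt_factorial_pos n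
  have h2 : 0 < √((n : ℝ) + 1) := sqrt_pos.2 (by positivity)
  simp only [opAplus, toVec]
  rw [co_creat_lt, annihCoef, if_pos h, sqrt_factorial_succ]
  have e : ∀ i j : Fin (n + 1), (if i < j then
          ((dotMode w (k i + k j) * cutoff ε (k i) (k j) : ℝ) : ℂ) * ((((√n.factorial)⁻¹ : ℝ) : ℂ) *
              co x n (fun a => update k i (k i + k j) (j.succAbove a)))
        else 0) = (((√n.factorial)⁻¹ : ℝ) : ℂ) * if i < j then
          ((dotMode w (k i + k j) * cutoff ε (k i) (k j) : ℝ) : ℂ) * co x n (merge k i j)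
        else 0 := by
    intro i j
    split_ifs
    · unfold merge; ring
    · simp
  simp only [e, ← mul_sum]
  have h3 : ((√n.factorial : ℝ) : ℂ) ≠ 0 := ofReal_ne_zero.2 h1.ne'
  have h4 : ((√((n : ℝ) + 1) : ℝ) : ℂ) ≠ 0 := ofReal_ne_zero.2 h2.ne'
  have h5 : ((n : ℂ) + 1) ≠ 0 := by exact_mod_cast n.succ_ne_zero
  push_cast
  field_simp

lemma opAminus_toVec {a b n : ℕ} (h : a ≤ n ∧ n < b) (x : Fock d) (k : 𝕄 n) :
    opAminus w ε (toVec x) n k = toVec (annih w ε a b x) n k := by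
  have h1 := sqrt_factorial_pos n
  have h2 : 0 < √((n : ℝ) + 1) := sqrt_pos.2 (by positivity)
  simp only [opAminus, toVec]
  rw [co_annih, annihCoef, if_pos h, sqrt_factorial_succ]
  have e : ∀ j : Fin n, (dotMode w (k j) : ℂ) * ∑' l : Mode d, (cutoff ε l (k j - l) : ℂ) *
          ((((√(n + 1) * √n.factorial)⁻¹ : ℝ) : ℂ) *
            co x (n + 1) (Fin.cons l (update k j (k j - l)))) =
        (((√(n + 1) * √n.factorial)⁻¹ : ℝ) : ℂ) * ∑ l ∈ box d ε,
          ((dotMode w (k j) * cutoff ε l (k j - l) : ℝ) : ℂ) * co x (n + 1) (split k j l) := by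
    intro j
    rw [tsum_eq_sum (s := box d ε), mul_sum, mul_sum]
    · refine sum_congr rfl fun l _ => ?_
      rw [split]
      push_cast
      ring
    · intro l hl
      have : cutoff ε l (k j - l) = 0 := by
        by_contra hc
        exact hl (mem_box_of_cutoff hc)
      rw [this]
      simp
  simp only [e, ← mul_sum]
  have h3 : ((√n.factorial : ℝ) : ℂ) ≠ 0 := ofReal_ne_zero.2 h1.ne'
  have h4 : ((√((n : ℝ) + 1) : ℝ) : ℂ) ≠ 0 := ofReal_ne_zero.2 h2.ne'
  have h5 : ((√((n : ℝ) + 1) : ℝ) : ℂ) ^ 2 = (n : ℂ) + 1 := by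
    rw [← ofReal_pow, sq_sqrt (by positivity)]; push_cast; rfl
  push_cast
  rw [← h5]
  field_simp

lemma opAplus_of_source_zero {ψ : FockVec d} {n : ℕ}
    (h : ∀ k, ψ n k = 0) (k : 𝕄 (n + 1)) : opAplus w ε ψ (n + 1) k = 0 := by
  simp [opAplus, h]

lemma opAminus_of_source_zero {ψ : FockVec d} {n : ℕ}
    (h : ∀ k, ψ (n + 1) k = 0) (k : 𝕄 n) : opAminus w ε ψ n k = 0 := by
  simp [opAminus, h]

lemma opAplus_congr {ψ ψ' : FockVec d} {n : ℕ} (h : ∀ k, ψ n k = ψ' n k) (k : 𝕄 (n + 1)) :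
    opAplus w ε ψ (n + 1) k = opAplus w ε ψ' (n + 1) k := by
  simp [opAplus, h]

lemma opAminus_congr {ψ ψ' : FockVec d} {n : ℕ} (h : ∀ k, ψ (n + 1) k = ψ' (n + 1) k) (k : 𝕄 n) :
    opAminus w ε ψ n k = opAminus w ε ψ' n k := by
  simp [opAminus, h]

/-- The truncated creation operator, on the level of kernels. -/
lemma toVec_creat {a b : ℕ} (x : Fock d) :
    toVec (creat w ε a b x) =
      opAplus w ε (fun n k => if a ≤ n ∧ n < b then toVec x n k else 0) := by
  funext n k
  obtain _ | n := n
  · simp [toVec, opAplus]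
  by_cases h : a ≤ n ∧ n < b
  · rw [← opAplus_toVec w ε h]
    exact opAplus_congr w ε (fun k => by rw [if_pos h]) k
  · rw [opAplus_of_source_zero w ε (fun k => if_neg h), toVec, co_creat, annihCoef_of_notMem h]
    simp

lemma toVec_annih {a b : ℕ} (x : Fock d) : toVec (annih w ε a b x) =
      opAminus w ε (fun n k => if a + 1 ≤ n ∧ n ≤ b then toVec x n k else 0) := by
  funext n k
  by_cases h : a ≤ n ∧ n < b
  · rw [← opAminus_toVec w ε h]
    exact opAminus_congr w ε (fun k => by rw [if_pos (by omega)]) k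
  · rw [opAminus_of_source_zero w ε (fun k => if_neg (by omega)), toVec, co_annih,
      annihCoef_of_notMem h]
    simp

lemma toVec_add (x y : Fock d) : toVec (x + y) = toVec x + toVec y := by
  funext n k; simp [toVec, mul_add]

lemma toVec_sub (x y : Fock d) : toVec (x - y) = toVec x - toVec y := by
  funext n k; simp [toVec, mul_sub]

lemma toVec_smul (c : ℂ) (x : Fock d) : toVec (c • x) = c • toVec x := by
  funext n k; simp [toVec]; ring

lemma toVec_op (m : Multiplier d) (x : Fock d) (n) (k : 𝕄 n) :
    toVec (m.op x) n k = (m.val n k : ℂ) * toVec x n k := by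
  rw [toVec, co_op, toVec]; ring

lemma toVec_eq_zero {x : Fock d} {n : ℕ} {k : 𝕄 n} (h : co x n k = 0) :
    toVec x n k = 0 := by rw [toVec, h, mul_zero]

/-! ### Well-posedness in dimension at least three -/

lemma mul_invLam_invLam {x : Fock d} {n : ℕ} (k : 𝕄 n) :
    ((1 / 2 * tupleSq k : ℝ) : ℂ) * co (invLam.op (invLam.op x)) n k = co x n k := by
  rw [co_op, co_op]
  by_cases h : co x n k = 0
  · simp [h]
  have h1 := one_le_tupleSq_of_co_ne_zero h
  rw [← mul_assoc (invLam.val n k : ℂ), ← sq, ← ofReal_pow, invLam_val_sq, ← mul_assoc,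
    ← ofReal_mul, mul_inv_cancel₀ (by positivity)]
  simp

lemma chaosProj_toVec_of_support {i n : ℕ} {x : Fock d}
    (hx : ∀ m (k : 𝕄 m), ¬(i ≤ m ∧ m ≤ n) → co x m k = 0) :
    chaosProj i n (toVec x) = toVec x := by
  funext m k
  rw [chaosProj]
  split_ifs with h
  · rfl
  · rw [toVec_eq_zero (hx m k h)]

/-- The truncated generator equation, on the level of Fock vectors. -/
lemma opLtrunc_toVec {i n : ℕ} {x : Fock d}
    (hx : ∀ m (k : 𝕄 m), ¬(i ≤ m ∧ m ≤ n) → co x m k = 0) (m) (k : 𝕄 m) :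
    -opLtrunc w ε i n (toVec x) m k = ((1 / 2 * tupleSq k : ℝ) : ℂ) * toVec x m k -
      toVec (creat w ε i n x + annih w ε i n x) m k := by
  rw [opLtrunc, Pi.add_apply, Pi.add_apply, chaosProj_toVec_of_support hx, opL0, toVec_add,
    Pi.add_apply, Pi.add_apply, chaosProj]
  have h2 : ∀ P : Prop, [Decidable P] → ∀ z : ℂ, (-(((-(1 / 2) * tupleSq k : ℝ) : ℂ) *
      toVec x m k + z)) = ((1 / 2 * tupleSq k : ℝ) : ℂ) * toVec x m k - z := by
    intro _ _ z; push_cast; ring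
  rw [h2 True]
  congr 1
  split_ifs with h
  · rw [opA, Pi.add_apply, Pi.add_apply]
    congr 1
    · obtain _ | m := m
      · simp [opAplus, toVec]
      rw [toVec_creat]
      refine opAplus_congr w ε (fun k => ?_) k
      split_ifs with h3
      · rfl
      · exact toVec_eq_zero (hx m k (by omega))
    · rw [toVec_annih]
      refine opAminus_congr w ε (fun k => ?_) k
      split_ifs with h3
      · rfl
      · exact toVec_eq_zero (hx (m + 1) k (by omega))
  · obtain _ | m := m
    · simp [toVec]
    · rw [toVec, toVec, co_creat, co_annih, annihCoef_of_notMem (by omega),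
        annihCoef_of_notMem (by omega)]
      simp

lemma opAplus_toVec_of_support {i : ℕ} (hi : 1 ≤ i)
    {y : Fock d} (hy : ∀ m (k : 𝕄 m), m ≠ i - 1 → co y m k = 0) :
    opAplus w ε (toVec y) = toVec (creat w ε (i - 1) i y) := by
  rw [toVec_creat]
  congr 1
  funext m k
  split_ifs with h
  · rfl
  · exact toVec_eq_zero (hy m k (by omega))

lemma isApproxSol_resolvent (hd : d ≠ 2) (w : 𝔼 d) (ε : ℝ) {i n : ℕ}
    (hi : 1 ≤ i) (hn : i ≤ n) {y : Fock d}
    (hy : ∀ m (k : 𝕄 m), m ≠ i - 1 → co y m k = 0) :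
    IsApproxSol w ε i n (toVec (invLam.op y))
      (toVec (invLam.op (𝓡 w ε i n (raise w ε (i - 1) i y)))) := by
  set x := 𝓡 w ε i n (raise w ε (i - 1) i y) with hxdef
  have hsupp : ∀ m (k : 𝕄 m), ¬(i ≤ m ∧ m ≤ n) → co x m k = 0 := fun m k h =>
    co_resolvent_of_notMem w ε hn (fun m k hm => co_raise_of_notMem w ε _ k (by omega)) k h
  have hsupp' : ∀ m (k : 𝕄 m), ¬(i ≤ m ∧ m ≤ n) → co (invLam.op x) m k = 0 :=
    fun m k h => by rw [co_op, hsupp m k h, mul_zero]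
  have heq : x = skewOp w ε i n x + raise w ε (i - 1) i y := (isSkew_skewOp w ε i n).resolvent_eq _
  refine ⟨isFock_toVec _, chaosProj_toVec_of_support hsupp', ?_⟩
  rw [if_neg hd]
  funext m k
  change -opLtrunc w ε i n _ m k = _
  rw [opLtrunc_toVec w ε hsupp', opAplus_toVec_of_support w ε hi
    (fun m k h => by rw [co_op, hy m k h, mul_zero])]
  have h1 : invLam.op x = invLam.op (invLam.op
      (creat w ε i n (invLam.op x) + annih w ε i n (invLam.op x) +
        creat w ε (i - 1) i (invLam.op y))) := by
    nth_rewrite 1 [heq]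
    simp only [skewOp, lower, raise, add_apply, comp_apply, map_add]
    abel
  have h2 : ((1 / 2 * tupleSq k : ℝ) : ℂ) * toVec (invLam.op x) m k =
      toVec (creat w ε i n (invLam.op x) + annih w ε i n (invLam.op x) +
        creat w ε (i - 1) i (invLam.op y)) m k := by
    nth_rewrite 1 [h1]
    rw [toVec, toVec, mul_left_comm, mul_invLam_invLam]
  rw [h2, toVec_add]
  simp

lemma IsApproxSol.unique_of_ne_two (hd : d ≠ 2) (w : 𝔼 d) (ε : ℝ) {i n : ℕ}
    (hi : 1 ≤ i) {f v v' : FockVec d}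
    (hv : IsApproxSol w ε i n f v) (hv' : IsApproxSol w ε i n f v') : v = v' := by
  obtain ⟨hF, hP, hE⟩ := hv
  obtain ⟨hF', hP', hE'⟩ := hv'
  rw [if_neg hd] at hE hE'
  have hz : ∀ u : FockVec d, chaosProj i n u = u → ∀ m (k : 𝕄 m), ¬(i ≤ m ∧ m ≤ n) →
      u m k = 0 := by
    intro u hu m k h
    rw [← hu, chaosProj, if_neg h]
  obtain ⟨x, rfl⟩ := exists_eq_toVec hF fun k => hz v hP 0 k (by omega)
  obtain ⟨x', rfl⟩ := exists_eq_toVec hF' fun k => hz v' hP' 0 k (by omega)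
  have hco : ∀ {u : Fock d} {m} {k : 𝕄 m}, toVec u m k = 0 → co u m k = 0 := by
    intro u m k h
    rcases mul_eq_zero.1 h with h | h
    · exact absurd h (ofReal_ne_zero.2 (inv_ne_zero (sqrt_factorial_pos m).ne'))
    · exact h
  have hx : ∀ m (k : 𝕄 m), ¬(i ≤ m ∧ m ≤ n) → co x m k = 0 := fun m k h => hco (hz _ hP m k h)
  have hx' : ∀ m (k : 𝕄 m), ¬(i ≤ m ∧ m ≤ n) → co x' m k = 0 := fun m k h => hco (hz _ hP' m k h)
  set z := x - x' with hzdef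
  -- the difference solves the homogeneous equation, and `A` is skew
  have h1 : ∀ m (k : 𝕄 m), ((1 / 2 * tupleSq k : ℝ) : ℂ) * co z m k =
      co (creat w ε i n z + annih w ε i n z) m k := by
    intro m k
    have e1 := congrFun (congrFun hE m) k
    have e2 := congrFun (congrFun hE' m) k
    change -opLtrunc w ε i n _ m k = _ at e1 e2
    rw [opLtrunc_toVec w ε hx] at e1
    rw [opLtrunc_toVec w ε hx'] at e2
    have e3 : toVec (creat w ε i n z + annih w ε i n z) m k =
        toVec (creat w ε i n x + annih w ε i n x) m k -
          toVec (creat w ε i n x' + annih w ε i n x') m k := by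
      rw [hzdef, map_sub, map_sub]
      simp only [toVec, co_add, co_sub]
      ring
    have e4 : toVec z m k = toVec x m k - toVec x' m k := by rw [hzdef, toVec_sub]; rfl
    have e5 : ((1 / 2 * tupleSq k : ℝ) : ℂ) * toVec z m k =
        toVec (creat w ε i n z + annih w ε i n z) m k := by
      rw [e3, e4]
      linear_combination e1 - e2
    rw [toVec, toVec, mul_left_comm] at e5
    exact mul_left_cancel₀ (ofReal_ne_zero.2 (inv_ne_zero (sqrt_factorial_pos m).ne')) e5
  obtain ⟨y, hy⟩ : ∃ y, y = invLam.op (creat w ε i n z + annih w ε i n z) := ⟨_, rfl⟩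
  have hyz : invLam.op y = z := Fock.ext fun m k => by
    rw [hy, co_op, co_op, ← h1]
    by_cases hne : co z m k = 0
    · simp [hne]
    have := one_le_tupleSq_of_co_ne_zero hne
    rw [← mul_assoc, ← mul_assoc, ← ofReal_mul, ← ofReal_mul, ← sq, invLam_val_sq,
      inv_mul_cancel₀ (by positivity), Complex.ofReal_one, one_mul]
  have h2 : skewOp w ε i n y = y := by
    simp only [skewOp, lower, raise, add_apply, comp_apply, hyz]
    rw [← map_add, add_comm, ← hy]
  have h3 := (isSkew_skewOp w ε i n).norm_le y
  rw [sub_apply, one_apply_eq_self, h2, sub_self, norm_zero, norm_le_zero_iff] at h3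
  have h6 : z = 0 := by rw [← hyz, h3, map_zero]
  rw [sub_eq_zero.1 h6]

/-! ### Well-posedness in dimension two -/

lemma funL_nonneg (d : ℕ) (ε : ℝ) {x : ℝ} (hx : 0 ≤ x) : 0 ≤ funL d ε x := by
  unfold funL
  refine mul_nonneg (sq_nonneg _) (Real.log_nonneg ?_)
  have : 0 ≤ 1 / (ε ^ 2 * x) := by positivity
  linarith

lemma funG_nonneg {x : ℝ} (hx : 0 ≤ x) : 0 ≤ funG w x := by
  unfold funG
  refine mul_nonneg (by positivity) (sub_nonneg.2 (Real.one_le_rpow ?_ (by norm_num)))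
  have : 0 ≤ 3 * ‖w‖ ^ 2 / (2 * π) * x := by have := Real.pi_pos; positivity
  linarith

/-- The drift `½ (𝔴·k)² G(L^ε(½|k|²))` of the effective resolvent. -/
def driftVal {n : ℕ} (k : 𝕄 n) : ℝ := 1 / 2 * tupleDotSq w k * funG w (funL d ε (1 / 2 * tupleSq k))

lemma driftVal_nonneg {n : ℕ} (k : 𝕄 n) : 0 ≤ driftVal w ε k := by
  have h1 := tupleSq_nonneg k
  have h2 := tupleDotSq_nonneg w k
  have := funG_nonneg w (funL_nonneg d ε (x := 1 / 2 * tupleSq k) (by positivity))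
  unfold driftVal
  positivity

/-- The effective resolvent between energy spaces, `Λ² (Λ² - L_0^𝔴 G^ε)⁻¹`. -/
def effMul : Multiplier d where
  val _ k := 1 / 2 * tupleSq k * (1 / 2 * tupleSq k + driftVal w ε k)⁻¹
  symm n σ k := by simp only [driftVal, tupleSq_comp_perm, tupleDotSq_comp_perm]
  bdd := ⟨1, zero_le_one, fun n k => by
    have h1 := tupleSq_nonneg k
    have h2 := driftVal_nonneg w ε k
    rw [abs_of_nonneg (by positivity), ← div_eq_mul_inv]
    exact div_le_one_of_le₀ (by linarith) (by positivity)⟩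

lemma effMul_nonneg {n : ℕ} (k : 𝕄 n) : 0 ≤ (effMul w ε).val n k := by
  have h1 := tupleSq_nonneg k
  have h2 := driftVal_nonneg w ε k
  simp only [effMul]
  positivity

lemma effMul_le_one {n : ℕ} (k : 𝕄 n) : (effMul w ε).val n k ≤ 1 := by
  have h1 := tupleSq_nonneg k
  have h2 := driftVal_nonneg w ε k
  simp only [effMul]
  rw [← div_eq_mul_inv]
  exact div_le_one_of_le₀ (by linarith) (by positivity)

lemma norm_effMul_le (x : Fock d) : ‖(effMul w ε).op x‖ ≤ ‖x‖ := by
  simpa using (effMul w ε).norm_op_le zero_le_one x fun n k _ => by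
    rw [abs_of_nonneg (effMul_nonneg w ε k)]; exact effMul_le_one w ε k

/-- The contributions to the solution in dimension two, chaos by chaos. -/
def ladder (w : 𝔼 d) (ε : ℝ) (i n : ℕ) (y : Fock d) : ℕ → Fock d
  | 0 => (effMul w ε).op (raise w ε (i - 1) i y)
  | j + 1 => (effMul w ε).op (raise w ε i n (ladder w ε i n y j))

lemma co_ladder_of_ne {i : ℕ} (hi : 1 ≤ i) (n : ℕ)
    (y : Fock d) (j : ℕ) {m : ℕ} (k : 𝕄 m) (hm : m ≠ i + j) :
    co (ladder w ε i n y j) m k = 0 := by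
  induction j generalizing m with
  | zero =>
    rw [ladder, co_op, co_raise_of_notMem w ε _ k (by omega), mul_zero]
  | succ j ih =>
    rw [ladder, co_op]
    obtain _ | m := m
    · simp
    rw [co_raise]
    have : ∀ a c, pairTerm w ε (invLam.op (ladder w ε i n y j)) k a c = 0 := by
      intro a c
      unfold pairTerm
      rw [co_op, ih _ (by omega)]
      simp
    simp [this]

lemma ladder_eq_zero {i n : ℕ} (hi : 1 ≤ i) (hn : i ≤ n)
    (y : Fock d) : ladder w ε i n y (n - i + 1) = 0 := by
  refine Fock.ext fun m k => ?_
  by_cases hm : m = i + (n - i + 1)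
  · rw [ladder, co_op, co_raise_of_notMem w ε _ k (by omega), mul_zero]
    rfl
  · rw [co_ladder_of_ne w ε hi n y _ k hm]; rfl

/-- The solution in dimension two, between energy spaces. -/
def ladderSum (i n : ℕ) (y : Fock d) : Fock d := ∑ j ∈ range (n - i + 1), ladder w ε i n y j

lemma ladderSum_eq {i n : ℕ} (hi : 1 ≤ i) (hn : i ≤ n)
    (y : Fock d) : ladderSum w ε i n y = (effMul w ε).op (raise w ε i n (ladderSum w ε i n y)) +
      (effMul w ε).op (raise w ε (i - 1) i y) := by
  have h1 : ladderSum w ε i n y = ∑ j ∈ range (n - i + 2), ladder w ε i n y j := by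
    rw [Finset.sum_range_succ _ (n - i + 1), ladder_eq_zero w ε hi hn, add_zero, ladderSum]
  nth_rewrite 1 [h1]
  rw [Finset.sum_range_succ', ladderSum, map_sum, map_sum]
  rfl

lemma co_fock_sum {ι : Type*} (s : Finset ι) (f : ι → Fock d) (n) (k : 𝕄 n) :
    co (∑ j ∈ s, f j) n k = ∑ j ∈ s, co (f j) n k := by
  classical
  induction s using Finset.induction_on with
  | empty => simp
  | insert a s ha ih => rw [Finset.sum_insert ha, Finset.sum_insert ha, co_add, ih]

lemma co_ladderSum_of_notMem {i n : ℕ} (hi : 1 ≤ i)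
    (hn : i ≤ n) (y : Fock d) (m : ℕ) (k : 𝕄 m) (hm : ¬(i ≤ m ∧ m ≤ n)) :
    co (ladderSum w ε i n y) m k = 0 := by
  rw [ladderSum, co_fock_sum]
  refine sum_eq_zero fun j hj => co_ladder_of_ne w ε hi n y j k ?_
  have := Finset.mem_range.1 hj
  omega

lemma co_ladderSum_bottom {i n : ℕ} (hi : 1 ≤ i) (y : Fock d) (k : 𝕄 i) :
    co (ladderSum w ε i n y) i k = co ((effMul w ε).op (raise w ε (i - 1) i y)) i k := by
  rw [ladderSum, co_fock_sum, sum_eq_single 0]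
  · rfl
  · intro j _ hj
    exact co_ladder_of_ne w ε hi n y j k (by omega)
  · intro h
    exact absurd (Finset.mem_range.2 (by omega)) h

lemma isApproxSol_ladderSum (hd : d = 2) (w : 𝔼 d) (ε : ℝ) {i n : ℕ}
    (hi : 1 ≤ i) (hn : i ≤ n) {y : Fock d}
    (hy : ∀ m (k : 𝕄 m), m ≠ i - 1 → co y m k = 0) :
    IsApproxSol w ε i n (toVec (invLam.op y)) (toVec (invLam.op (ladderSum w ε i n y))) := by
  set x := ladderSum w ε i n y with hxdef
  have hsupp' : ∀ m (k : 𝕄 m), ¬(i ≤ m ∧ m ≤ n) → co (invLam.op x) m k = 0 :=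
    fun m k h => by rw [co_op, co_ladderSum_of_notMem w ε hi hn y m k h, mul_zero]
  refine ⟨isFock_toVec _, chaosProj_toVec_of_support hsupp', ?_⟩
  rw [if_pos hd]
  have e1 : opAplus w ε (chaosProj i (n - 1) (toVec (invLam.op x))) =
      toVec (creat w ε i n (invLam.op x)) := by
    rw [toVec_creat]
    congr 1
    funext m k
    rw [chaosProj]
    exact if_congr (by omega) rfl rfl
  rw [e1, opAplus_toVec_of_support w ε hi (fun m k h => by rw [co_op, hy m k h, mul_zero])]
  funext m k
  rw [Pi.add_apply, Pi.add_apply]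
  simp only [opResolvent]
  rw [← mul_add]
  have h1 : x = (effMul w ε).op (invLam.op (creat w ε i n (invLam.op x) +
      creat w ε (i - 1) i (invLam.op y))) := by
    have := ladderSum_eq w ε hi hn y
    rw [← hxdef] at this
    simp only [raise, comp_apply] at this
    rw [map_add, map_add]
    exact this
  set s := creat w ε i n (invLam.op x) + creat w ε (i - 1) i (invLam.op y) with hs
  have h2 : toVec (creat w ε i n (invLam.op x)) m k +
      toVec (creat w ε (i - 1) i (invLam.op y)) m k = toVec s m k := by
    rw [hs, toVec_add]; rfl
  rw [h2]
  nth_rewrite 1 [h1]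
  rw [toVec_op, toVec_op, toVec_op]
  by_cases h0 : co s m k = 0
  · rw [toVec_eq_zero h0]; simp
  have h3 := one_le_tupleSq_of_co_ne_zero h0
  have h4 : invLam.val m k * ((effMul w ε).val m k * invLam.val m k) =
      (1 / 2 * tupleSq k + driftVal w ε k)⁻¹ := by
    rw [mul_left_comm, ← sq, invLam_val_sq]
    simp only [effMul]
    rw [mul_right_comm, mul_inv_cancel₀ (by positivity), one_mul]
  rw [← mul_assoc, ← mul_assoc, ← ofReal_mul, ← ofReal_mul, mul_assoc, h4]
  rfl

lemma IsApproxSol.unique_of_eq_two (hd : d = 2) (w : 𝔼 d) (ε : ℝ) {i n : ℕ}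
    {f v v' : FockVec d}
    (hv : IsApproxSol w ε i n f v) (hv' : IsApproxSol w ε i n f v') : v = v' := by
  obtain ⟨-, -, hE⟩ := hv
  obtain ⟨-, -, hE'⟩ := hv'
  rw [if_pos hd] at hE hE'
  have h : ∀ m, v m = v' m := by
    intro m
    induction m with
    | zero =>
      funext k
      rw [hE, hE']
      simp [opResolvent, opAplus]
    | succ m ih =>
      funext k
      rw [hE, hE']
      simp only [Pi.add_apply, opResolvent]
      congr 2
      apply opAplus_congr
      intro k
      simp only [chaosProj, ih]
  funext m
  exact h m

/-! ### Fourier coefficients of test functions -/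

/-- The period cell. -/
def cell (d : ℕ) : Set (Fin d → ℝ) := Set.Icc 0 fun _ => 2 * π

/-- The Fourier basis function `e_k`. -/
def expMode (k : Mode d) (x : Fin d → ℝ) : ℂ := (((2 * π) ^ (-(d : ℝ) / 2) : ℝ) : ℂ) *
    Complex.exp (I * ((∑ a, (k a : ℝ) * x a : ℝ) : ℂ))

lemma continuous_expMode (k : Mode d) : Continuous (expMode k) := by
  unfold expMode; fun_prop

lemma conj_expMode (k : Mode d) (x : Fin d → ℝ) :
    starRingEnd ℂ (expMode k x) = (((2 * π) ^ (-(d : ℝ) / 2) : ℝ) : ℂ) *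
      Complex.exp (-(I * ((∑ a, (k a : ℝ) * x a : ℝ) : ℂ))) := by
  unfold expMode
  rw [map_mul, conj_ofReal, ← Complex.exp_conj, map_mul, Complex.conj_I, conj_ofReal, neg_mul]

lemma integral_exp_int (m : ℤ) : ∫ x in Set.Icc (0 : ℝ) (2 * π),
    Complex.exp (I * ((m * x : ℝ) : ℂ)) = if m = 0 then ((2 * π : ℝ) : ℂ) else 0 := by
  rw [integral_Icc_eq_integral_Ioc, ← intervalIntegral.integral_of_le (by positivity)]
  split_ifs with h
  · simp [h]
  · have hc : I * m ≠ 0 := mul_ne_zero Complex.I_ne_zero (by exact_mod_cast h)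
    have := integral_exp_mul_complex (a := 0) (b := 2 * π) hc
    have e : ∀ x : ℝ, I * ((m * x : ℝ) : ℂ) = I * m * x := by
      intro x; push_cast; ring
    simp only [e]
    rw [this]
    have h2 : Complex.exp (I * m * ((2 * π : ℝ) : ℂ)) = 1 := by
      rw [Complex.exp_eq_one_iff]
      exact ⟨m, by push_cast; ring⟩
    rw [h2]
    simp

lemma volume_restrict_cell : (volume.restrict (cell d)) =
    Measure.pi fun _ : Fin d => (volume.restrict (Set.Icc (0 : ℝ) (2 * π))) := by
  rw [← Measure.restrict_pi_pi, Set.pi_univ_Icc]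
  rfl

lemma integral_expMode_mul (k l : Mode d) : ∫ x in cell d, expMode l x *
    starRingEnd ℂ (expMode k x) = if k = l then 1 else 0 := by
  have e : ∀ x, expMode l x * starRingEnd ℂ (expMode k x) = (((2 * π) ^ (-(d : ℝ)) : ℝ) : ℂ) *
        ∏ a, Complex.exp (I * (((l a - k a : ℤ) * x a : ℝ) : ℂ)) := by
    intro x
    rw [conj_expMode, expMode, ← Complex.exp_sum, mul_mul_mul_comm, ← Complex.exp_add,
      ← ofReal_mul, ← Real.rpow_add (by positivity)]
    congr 2
    · ring_nf
    · rw [← mul_sum]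
      push_cast
      rw [← mul_neg, ← mul_add, ← Finset.sum_neg_distrib, ← sum_add_distrib]
      congr 1
      refine sum_congr rfl fun a _ => ?_
      ring
  simp only [e]
  rw [integral_const_mul, volume_restrict_cell, integral_fintype_prod_eq_prod
    (f := fun a (t : ℝ) => Complex.exp (I * (((l a - k a : ℤ) * t : ℝ) : ℂ)))]
  simp only [integral_exp_int]
  split_ifs with h
  · subst h
    simp only [sub_self, if_true, Finset.prod_const, card_univ, Fintype.card_fin]
    rw [← ofReal_pow, ← ofReal_mul, Real.rpow_neg (by positivity), Real.rpow_natCast,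
      inv_mul_cancel₀ (by positivity), Complex.ofReal_one]
  · obtain ⟨a, ha⟩ := Function.ne_iff.1 h
    rw [Finset.prod_eq_zero (mem_univ a), mul_zero]
    rw [if_neg]
    rw [sub_eq_zero]
    exact Ne.symm ha

lemma fourierMode_eq (φ : (Fin d → ℝ) → ℂ) (k : Mode d) :
    fourierMode φ k = ∫ x in cell d, φ x * starRingEnd ℂ (expMode k x) := by
  simp only [conj_expMode]; rfl

lemma memLp_cell {φ : (Fin d → ℝ) → ℂ} (h : Continuous φ) :
    MemLp φ 2 (volume.restrict (cell d)) := by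
  have hc : IsCompact (cell d) := isCompact_Icc
  obtain ⟨C, hC⟩ := hc.exists_bound_of_continuousOn h.continuousOn
  have : IsFiniteMeasure (volume.restrict (cell d)) :=
    isFiniteMeasure_restrict.2 hc.measure_lt_top.ne
  refine MemLp.of_bound h.aestronglyMeasurable C ?_
  exact (ae_restrict_iff' measurableSet_Icc).2 (Eventually.of_forall hC)

/-- Bessel's inequality. -/
lemma summable_norm_fourierMode_sq {φ : (Fin d → ℝ) → ℂ} (h : Continuous φ) :
    Summable fun k => ‖fourierMode φ k‖ ^ 2 := by
  set e : Mode d → Lp ℂ 2 (volume.restrict (cell d)) := fun k =>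
    (memLp_cell (continuous_expMode k)).toLp
  have hinner : ∀ k (ψ : (Fin d → ℝ) → ℂ) (hψ : Continuous ψ),
      inner ℂ (e k) (memLp_cell hψ).toLp = ∫ x in cell d, ψ x * starRingEnd ℂ (expMode k x) := by
    intro k ψ hψ
    rw [L2.inner_def]
    refine integral_congr_ae ?_
    filter_upwards [(memLp_cell (continuous_expMode k)).coeFn_toLp,
      (memLp_cell hψ).coeFn_toLp] with x h1 h2
    rw [h1, h2, RCLike.inner_apply]
  have ho : Orthonormal ℂ e := by
    classical
    rw [orthonormal_iff_ite]
    intro k l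
    rw [hinner k _ (continuous_expMode l), integral_expMode_mul]
  have := ho.inner_products_summable (memLp_cell h).toLp
  refine this.congr fun k => ?_
  rw [hinner k φ h, ← fourierMode_eq]

lemma isTorusTest_expMode (p : Mode d) : IsTorusTest (expMode p) := by
  refine ⟨?_, fun x m => ?_⟩
  · have h : ContDiff ℝ (⊤ : ℕ∞) fun x : Fin d → ℝ => ∑ a, (p a : ℝ) * x a :=
      ContDiff.sum fun a _ => contDiff_const.mul
        (contDiff_apply ℝ ℝ a : ContDiff ℝ _ fun x : Fin d → ℝ => x a)
    exact contDiff_const.mul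
      (Complex.contDiff_exp.comp (contDiff_const.mul (Complex.ofRealCLM.contDiff.comp h)))
  · unfold expMode
    congr 1
    rw [Complex.exp_eq_exp_iff_exists_int]
    refine ⟨∑ a, p a * m a, ?_⟩
    have : ∑ a, (p a : ℝ) * (x a + 2 * π * m a) = ∑ a, (p a : ℝ) * x a +
        2 * π * ((∑ a, p a * m a : ℤ) : ℝ) := by
      push_cast
      rw [mul_sum, ← sum_add_distrib]
      refine sum_congr rfl fun a _ => ?_
      ring
    rw [this]
    push_cast
    ring

lemma fderiv_expMode (k : Mode d) (a : Fin d) (x : Fin d → ℝ) :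
    fderiv ℝ (expMode k) x (Pi.single a 1) = I * (k a : ℂ) * expMode k x := by
  let L : (Fin d → ℝ) →L[ℝ] ℂ := I • Complex.ofRealCLM.comp
    (∑ b, (k b : ℝ) • ContinuousLinearMap.proj (R := ℝ) (φ := fun _ => ℝ) b)
  have hL : ∀ x, L x = I * ((∑ b, (k b : ℝ) * x b : ℝ) : ℂ) := fun x => by simp [L]
  have h : expMode k = fun x => (((2 * π) ^ (-(d : ℝ) / 2) : ℝ) : ℂ) * Complex.exp (L x) := by
    funext x; rw [expMode, hL]
  have h1 := (L.hasFDerivAt (x := x)).cexp.const_mul (((2 * π) ^ (-(d : ℝ) / 2) : ℝ) : ℂ)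
  rw [h, h1.fderiv]
  simp [hL, Pi.single_apply]
  ring

/-- The integral of a derivative over the torus vanishes. -/
lemma integral_fderiv_single {φ : (Fin d → ℝ) → ℂ} (h : IsTorusTest φ) (a : Fin d) :
    ∫ x in cell d, fderiv ℝ φ x (Pi.single a 1) = 0 := by
  obtain _ | n := d
  · exact a.elim0
  have e : ∀ x, ∑ i, ((Pi.single a 1 : Fin (n + 1) → ℝ) i • fderiv ℝ φ x) (Pi.single i 1) =
      fderiv ℝ φ x (Pi.single a 1) := fun x => by
    rw [Finset.sum_eq_single a (fun b _ hb => by simp [hb]) (by simp)]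
    simp
  have hdiv := integral_divergence_of_hasFDerivAt_off_countable'
    (a := (0 : Fin (n + 1) → ℝ)) (b := fun _ => 2 * π) (fun i => by simp; positivity)
    (fun i x => (Pi.single a 1 : Fin (n + 1) → ℝ) i • φ x)
    (fun i x => (Pi.single a 1 : Fin (n + 1) → ℝ) i • fderiv ℝ φ x) ∅ Set.countable_empty
    (fun i => by have := h.1.continuous; fun_prop)
    (fun x _ i => ((h.1.differentiable (by simp)) x).hasFDerivAt.fun_const_smul _) (by
      simp only [e]
      exact ((h.1.continuous_fderiv (by simp)).clm_apply
        continuous_const).continuousOn.integrableOn_Icc)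
  simp only [e] at hdiv
  refine hdiv.trans (sum_eq_zero fun i _ => sub_eq_zero.2 ?_)
  congr 1
  funext x
  -- opposite faces of the cell differ by a period
  rw [← h.2 (i.insertNth ((0 : Fin (n + 1) → ℝ) i) x) (Pi.single i 1)]
  congr 2
  funext b
  rcases Fin.eq_self_or_eq_succAbove i b with rfl | ⟨c, rfl⟩
  · simp
  · simp [Fin.succAbove_ne]

/-- Integration by parts on the torus. -/
lemma fourierMode_deriv {φ : (Fin d → ℝ) → ℂ} (h : IsTorusTest φ) (a : Fin d) (k : Mode d) :
    fourierMode (fun x => fderiv ℝ φ x (Pi.single a 1)) k =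
      I * (k a : ℂ) * fourierMode φ k := by
  have hk := isTorusTest_expMode (-k)
  have hc : ∀ x, starRingEnd ℂ (expMode k x) = expMode (-k) x := fun x => by
    rw [conj_expMode, expMode]; simp
  have h0 := integral_fderiv_single (φ := fun x => φ x * expMode (-k) x)
    ⟨h.1.mul hk.1, fun x m => by simp only [h.2, hk.2]⟩ a
  have hd : ∀ x, fderiv ℝ (fun x => φ x * expMode (-k) x) x (Pi.single a 1) =
      -(I * (k a : ℂ)) * (φ x * expMode (-k) x) +
        fderiv ℝ φ x (Pi.single a 1) * expMode (-k) x := fun x => by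
    rw [fderiv_fun_mul (h.1.differentiable (by simp) x) (hk.1.differentiable (by simp) x)]
    simp [fderiv_expMode]
    ring
  simp only [hd] at h0
  rw [integral_add, integral_const_mul] at h0
  · simp only [fourierMode_eq, hc]
    linear_combination h0
  · exact (continuous_const.mul (h.1.continuous.mul hk.1.continuous)).continuousOn.integrableOn_Icc
  · exact (((h.1.continuous_fderiv (by simp)).clm_apply continuous_const).mul
      hk.1.continuous).continuousOn.integrableOn_Icc

lemma summable_modeSq_mul_fourierMode {φ : (Fin d → ℝ) → ℂ} (h : IsTorusTest φ) :
    Summable fun k => modeSq k * ‖fourierMode φ k‖ ^ 2 := by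
  have h1 : ∀ a : Fin d, Summable fun k : Mode d => (k a : ℝ) ^ 2 * ‖fourierMode φ k‖ ^ 2 := by
    intro a
    have hdc : Continuous fun x => fderiv ℝ φ x (Pi.single a 1) :=
      (h.1.continuous_fderiv (by simp)).clm_apply continuous_const
    refine (summable_norm_fourierMode_sq hdc).congr fun k => ?_
    rw [fourierMode_deriv h, norm_mul, norm_mul, Complex.norm_I, one_mul, mul_pow,
      Complex.norm_intCast, sq_abs]
  have := summable_sum (s := univ) fun a _ => h1 a
  refine this.congr fun k => ?_
  rw [modeSq, Finset.sum_mul]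

lemma co_of_inputVec {φ ψ : (Fin d → ℝ) → ℂ} {i n : ℕ} (hi : i = 2 ∨ i = 3) (h : n ≠ i - 1)
    (k : 𝕄 n) : inputVec φ ψ i n k = 0 := by
  rcases hi with rfl | rfl
  · rw [inputVec, if_pos rfl]
    unfold oneParticle
    split
    · exact absurd rfl h
    · rfl
  · rw [inputVec, if_neg (by norm_num)]
    unfold twoParticle
    split
    · exact absurd rfl h
    · rfl

lemma inputVec_comp_perm (φ ψ : (Fin d → ℝ) → ℂ) {i : ℕ} (hi : i = 2 ∨ i = 3) (n : ℕ)
    (σ : Perm (Fin n)) (k : 𝕄 n) :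
    inputVec φ ψ i n (k ∘ σ) = inputVec φ ψ i n k := by
  by_cases hn : n = i - 1
  swap
  · rw [co_of_inputVec hi hn, co_of_inputVec hi hn]
  rcases hi with rfl | rfl
  · obtain rfl : n = 1 := hn
    rw [Subsingleton.elim σ 1]
    rfl
  · obtain rfl : n = 2 := hn
    rw [inputVec, if_neg (by norm_num)]
    rcases (by decide : ∀ σ : Perm (Fin 2), (σ 0 = 0 ∧ σ 1 = 1) ∨ (σ 0 = 1 ∧ σ 1 = 0)) σ
        with ⟨h0, h1⟩ | ⟨h0, h1⟩
    · simp [twoParticle, h0, h1]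
    · simp only [twoParticle, Function.comp_apply, h0, h1, or_comm]
      split_ifs
      · rfl
      · ring

lemma inputVec_of_zero (φ ψ : (Fin d → ℝ) → ℂ) (i n : ℕ) {k : 𝕄 n} {j : Fin n}
    (h : k j = 0) : inputVec φ ψ i n k = 0 := by
  unfold inputVec
  split_ifs
  · unfold oneParticle
    split
    · rw [Subsingleton.elim j 0] at h; simp [h]
    · rfl
  · unfold twoParticle
    split
    · rw [if_pos]
      fin_cases j
      · exact Or.inl h
      · exact Or.inr h
    · rfl

lemma summable_energy_oneParticle {φ : (Fin d → ℝ) → ℂ} (h : IsTorusTest φ) :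
    Summable fun k : 𝕄 1 => tupleSq k * ‖oneParticle φ 1 k‖ ^ 2 := by
  refine Summable.of_nonneg_of_le (fun k => by have := tupleSq_nonneg k; positivity) (fun k => ?_)
    ((Equiv.funUnique (Fin 1) (Mode d)).summable_iff.2 (summable_modeSq_mul_fourierMode h))
  have h1 : tupleSq k = modeSq (k 0) := by simp [tupleSq]
  have h2 := modeSq_nonneg (k 0)
  change tupleSq k * _ ≤ modeSq (k 0) * ‖fourierMode φ (k 0)‖ ^ 2
  rw [h1, oneParticle]
  split_ifs
  · simp; positivity
  · exact le_rfl

lemma summable_energy_twoParticle {φ ψ : (Fin d → ℝ) → ℂ} (h : IsTorusTest φ) (h' : IsTorusTest ψ) :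
    Summable fun k : 𝕄 2 => tupleSq k * ‖twoParticle φ ψ 2 k‖ ^ 2 := by
  have hm : ∀ k : Mode d, 0 ≤ modeSq k := modeSq_nonneg
  have key : ∀ {φ ψ : (Fin d → ℝ) → ℂ}, IsTorusTest φ → IsTorusTest ψ → Summable fun k : 𝕄 2 =>
      tupleSq k * (‖fourierMode φ (k 0)‖ ^ 2 * ‖fourierMode ψ (k 1)‖ ^ 2) := by
    intro φ ψ h h'
    refine ((finTwoArrowEquiv (Mode d)).summable_iff.2
      (((summable_modeSq_mul_fourierMode h).mul_of_nonneg
        (summable_norm_fourierMode_sq h'.1.continuous) (fun k => by have := hm k; positivity)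
        fun k => by positivity).add ((summable_norm_fourierMode_sq h.1.continuous).mul_of_nonneg
        (summable_modeSq_mul_fourierMode h') (fun k => by positivity)
        fun k => by have := hm k; positivity))).congr fun k => ?_
    rw [tupleSq, Fin.sum_univ_two]
    change modeSq (k 0) * ‖fourierMode φ (k 0)‖ ^ 2 * ‖fourierMode ψ (k 1)‖ ^ 2 +
      ‖fourierMode φ (k 0)‖ ^ 2 * (modeSq (k 1) * ‖fourierMode ψ (k 1)‖ ^ 2) = _
    ring
  refine Summable.of_nonneg_of_le (fun k => by have := tupleSq_nonneg k; positivity) (fun k => ?_)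
    ((key h h').add (key h' h))
  rw [← mul_add]
  refine mul_le_mul_of_nonneg_left ?_ (tupleSq_nonneg k)
  rw [twoParticle, ← mul_pow, ← mul_pow, ← norm_mul, ← norm_mul]
  split_ifs
  · simp; positivity
  rw [norm_div, Complex.norm_ofNat, div_pow]
  have := pow_le_pow_left₀ (norm_nonneg _) (norm_add_le (fourierMode φ (k 0) * fourierMode ψ (k 1))
    (fourierMode ψ (k 0) * fourierMode φ (k 1))) 2
  nlinarith [sq_nonneg (‖fourierMode φ (k 0) * fourierMode ψ (k 1)‖ -
    ‖fourierMode ψ (k 0) * fourierMode φ (k 1)‖)]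

/-- The input `f_{i-1}` has finite energy: `f_{i-1} = Λ⁻¹ y` with `y` in the Fock space. -/
lemma exists_input {φ ψ : (Fin d → ℝ) → ℂ} (hφ : IsTorusTest φ) (hψ : IsTorusTest ψ) {i : ℕ}
    (hi : i = 2 ∨ i = 3) : ∃ y : Fock d, (∀ m (k : 𝕄 m), m ≠ i - 1 → co y m k = 0) ∧
      (∀ n k, co y n k = ((√(1 / 2 * tupleSq k) * √n.factorial : ℝ) : ℂ) * inputVec φ ψ i n k) ∧
      inputVec φ ψ i = toVec (invLam.op y) := by
  have hfin : ∑' (n : ℕ) (k : 𝕄 n), ‖((√(1 / 2 * tupleSq k) * √n.factorial : ℝ) : ℂ) *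
        inputVec φ ψ i n k‖ₑ ^ 2 < ⊤ := by
    rw [tsum_eq_single (i - 1)]
    swap
    · intro n hn
      simp [co_of_inputVec hi hn]
    have hs : Summable fun k : 𝕄 (i - 1) =>
        tupleSq k * ‖inputVec φ ψ i (i - 1) k‖ ^ 2 := by
      rcases hi with rfl | rfl
      · exact summable_energy_oneParticle hφ
      · exact summable_energy_twoParticle hφ hψ
    have h1 : ∀ k : 𝕄 (i - 1), ‖((√(1 / 2 * tupleSq k) * √(i - 1).factorial : ℝ) : ℂ) *
        inputVec φ ψ i (i - 1) k‖ₑ ^ 2 = ENNReal.ofReal ((1 / 2 * (i - 1).factorial) *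
          (tupleSq k * ‖inputVec φ ψ i (i - 1) k‖ ^ 2)) := by
      intro k
      have := tupleSq_nonneg k
      rw [← ofReal_norm, ← ENNReal.ofReal_pow (norm_nonneg _), norm_mul, norm_real,
        norm_eq_abs, mul_pow, sq_abs, mul_pow, sq_sqrt (by positivity),
        sq_sqrt (by positivity)]
      congr 1
      ring
    simp only [h1]
    exact (hs.mul_left _).tsum_ofReal_lt_top
  refine ⟨mkFock _ (fun n σ k => ?_) (fun n k h => ?_) hfin, fun m k h => ?_, fun n k => rfl, ?_⟩
  · rw [tupleSq_comp_perm, inputVec_comp_perm φ ψ hi]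
  · rcases h with rfl | ⟨j, hj⟩
    · rw [co_of_inputVec hi (by omega), mul_zero]
    · rw [inputVec_of_zero φ ψ i n hj, mul_zero]
  · rw [co_mkFock, co_of_inputVec hi h, mul_zero]
  · funext n k
    rw [toVec_op, toVec, co_mkFock]
    by_cases h0 : inputVec φ ψ i n k = 0
    · rw [h0]; simp
    have ht : tupleSq k ≠ 0 := by
      intro ht
      have hn : n = i - 1 := by
        by_contra hn
        exact h0 (co_of_inputVec hi hn k)
      have hz := (Finset.sum_eq_zero_iff_of_nonneg fun j _ => modeSq_nonneg (k j)).1 ht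
      have h1 : 0 < n := by omega
      exact h0 (inputVec_of_zero φ ψ i n (modeSq_eq_zero.1 (hz ⟨0, h1⟩ (mem_univ _))))
    have ht1 := one_le_tupleSq_of_ne_zero ht
    have hs := sqrt_factorial_pos n
    have hl : 0 < √(1 / 2 * tupleSq k) := sqrt_pos.2 (by positivity)
    simp only [invLam]
    rw [← mul_assoc, ← mul_assoc, ← ofReal_mul, ← ofReal_mul]
    have : (√(1 / 2 * tupleSq k))⁻¹ * (√n.factorial)⁻¹ *
        (√(1 / 2 * tupleSq k) * √n.factorial) = 1 := by field_simp
    rw [this]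
    simp

lemma fourierMode_expMode (p k : Mode d) : fourierMode (expMode p) k = if k = p then 1 else 0 := by
  rw [fourierMode_eq, integral_expMode_mul]

/-! ### Conservation of momentum -/

open Classical in
/-- The projection onto total momentum `p`. -/
def momMul (p : Mode d) : Multiplier d where
  val _ k := if ∑ i, k i = p then 1 else 0
  symm n σ k := by
    simp only [Function.comp_apply]
    rw [Equiv.sum_comp σ k]
  bdd := ⟨1, zero_le_one, fun n k => by split_ifs <;> simp⟩

lemma Multiplier.op_comm (m m' : Multiplier d) (x : Fock d) : m.op (m'.op x) = m'.op (m.op x) := by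
  refine Fock.ext fun n k => ?_
  simp only [co_op]
  ring

lemma momMul_annih (a b : ℕ) (p : Mode d) (x : Fock d) :
    (momMul p).op (annih w ε a b x) = annih w ε a b ((momMul p).op x) := by
  refine Fock.ext fun n k => ?_
  simp only [co_op, co_annih, momMul, sum_split]
  rw [mul_left_comm, mul_sum]
  congr 1
  refine sum_congr rfl fun j _ => ?_
  rw [mul_sum]
  refine sum_congr rfl fun l _ => ?_
  ring

lemma momMul_creat (a b : ℕ) (p : Mode d) (x : Fock d) :
    (momMul p).op (creat w ε a b x) = creat w ε a b ((momMul p).op x) := by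
  refine Fock.ext_inner_left fun χ => ?_
  rw [← inner_op, inner_creat_right, inner_creat_right, ← momMul_annih, inner_op]

lemma momMul_lower (a b : ℕ) (p : Mode d) (x : Fock d) :
    (momMul p).op (lower w ε a b x) = lower w ε a b ((momMul p).op x) := by
  simp only [lower, comp_apply]
  rw [Multiplier.op_comm, momMul_annih, Multiplier.op_comm]

lemma momMul_raise (a b : ℕ) (p : Mode d) (x : Fock d) :
    (momMul p).op (raise w ε a b x) = raise w ε a b ((momMul p).op x) := by
  simp only [raise, comp_apply]
  rw [Multiplier.op_comm, momMul_creat, Multiplier.op_comm]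

lemma momMul_resolvent (a b : ℕ) (p : Mode d) (g : Fock d) : (momMul p).op (𝓡 w ε a b g) =
      𝓡 w ε a b ((momMul p).op g) := by
  apply (isSkew_skewOp w ε a b).eq_resolvent
  nth_rewrite 1 [(isSkew_skewOp w ε a b).resolvent_eq g]
  rw [map_add]
  congr 1
  simp only [skewOp, add_apply, map_add, momMul_lower, momMul_raise]

lemma momMul_modeVec (p : Mode d) (hp : p ≠ 0) : (momMul p).op (modeVec p hp) = modeVec p hp := by
  refine Fock.ext fun n k => ?_
  rw [co_op, co_modeVec]
  split_ifs with h
  · obtain ⟨rfl, h⟩ := Sigma.mk.inj_iff.1 h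
    rw [heq_eq_eq] at h
    subst h
    simp [momMul]
  · simp

lemma eq_smul_modeVec {p : Mode d} (hp : p ≠ 0) {u : Fock d} (hu : (momMul p).op u = u)
    (h1 : ∀ n (k : 𝕄 n), n ≠ 1 → co u n k = 0) : u = co u 1 ![p] • modeVec p hp := by
  refine Fock.ext fun n k => ?_
  rw [co_smul, co_modeVec]
  split_ifs with h
  · obtain ⟨rfl, h⟩ := Sigma.mk.inj_iff.1 h
    rw [heq_eq_eq] at h
    subst h
    simp
  · rw [mul_zero]
    by_cases hn : n = 1
    · subst hn
      rw [← hu, co_op]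
      have : ¬ (∑ i, k i = p) := by
        intro hs
        apply h
        rw [eq_cons_zero k]
        simp only [Finset.univ_unique, Fin.default_eq_zero, sum_singleton] at hs
        rw [hs]
      have hv : (momMul p).val 1 k = 0 := if_neg this
      rw [hv]
      simp
    · exact h1 n k hn

lemma lower_one_eq_smul {p : Mode d} (hp : p ≠ 0)
    {u : Fock d} (hu : (momMul p).op u = u) :
    lower w ε 1 2 u = co (lower w ε 1 2 u) 1 ![p] • modeVec p hp :=
  eq_smul_modeVec hp (by rw [momMul_lower, hu]) fun n k hn =>
    co_lower_of_notMem w ε u k (by omega)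

/-! ### Strong convergence on spanning sets -/

/-- A uniformly bounded family of operators which converges strongly to zero on a set, and vanishes
on the orthogonal complement of this set, converges strongly to zero. -/
lemma tendsto_zero_of_span {V ι : Type*} [NormedAddCommGroup V] [InnerProductSpace ℂ V]
    [CompleteSpace V] {F : Filter ι} (B : ι → V →L[ℂ] V) {K : ℝ}
    (hK : ∀ᶠ i in F, ∀ x, ‖B i x‖ ≤ K * ‖x‖) (E : Set V)
    (hE : ∀ e ∈ E, Tendsto (fun i => B i e) F (𝓝 0))
    (hr : ∀ r, (∀ e ∈ E, (inner ℂ e r : ℂ) = 0) → ∀ i, B i r = 0) (y : V) :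
    Tendsto (fun i => B i y) F (𝓝 0) := by
  let M : Submodule ℂ V :=
    { carrier := {y | Tendsto (fun i => B i y) F (𝓝 0)}
      add_mem' := fun {x y} (hx : Tendsto _ _ _) (hy : Tendsto _ _ _) => by
        change Tendsto _ _ _
        simpa using hx.add hy
      zero_mem' := by
        change Tendsto _ _ _
        simpa using tendsto_const_nhds
      smul_mem' := fun c x (hx : Tendsto _ _ _) => by
        change Tendsto _ _ _
        simpa using hx.const_smul c }
  have hMmem : ∀ y, y ∈ M ↔ Tendsto (fun i => B i y) F (𝓝 0) := fun y => Iff.rfl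
  have hclosed : IsClosed (M : Set V) := by
    rw [← isSeqClosed_iff_isClosed]
    intro u y hu hy
    change Tendsto (fun i => B i y) F (𝓝 0)
    rw [tendsto_zero_iff_norm_tendsto_zero, Metric.tendsto_nhds]
    intro η hη
    have hK1 : 0 < |K| + 1 := by positivity
    obtain ⟨N, hN⟩ := ((tendsto_iff_norm_sub_tendsto_zero.1 hy).eventually_lt_const
      (show 0 < η / 2 / (|K| + 1) by positivity)).exists
    have h2 := (tendsto_zero_iff_norm_tendsto_zero.1 ((hMmem _).1 (hu N))).eventually_lt_const
      (show 0 < η / 2 by positivity)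
    filter_upwards [h2, hK] with i h3 h4
    rw [Real.dist_eq, sub_zero, abs_of_nonneg (norm_nonneg _)]
    have h5 : B i y = B i (u N) - B i (u N - y) := by rw [map_sub]; abel
    have h6 : ‖B i (u N - y)‖ ≤ η / 2 := by
      refine (h4 _).trans ?_
      rw [lt_div_iff₀ hK1] at hN
      nlinarith [le_abs_self K, norm_nonneg (u N - y)]
    rw [h5]
    linarith [norm_sub_le (B i (u N)) (B i (u N - y))]
  have hcompl : CompleteSpace M := hclosed.completeSpace_coe
  obtain ⟨m, hm, r, hr', rfl⟩ := M.exists_add_mem_mem_orthogonal y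
  have h0 : ∀ i, B i r = 0 := hr r fun e he => (M.mem_orthogonal r).1 hr' e (hE e he)
  simpa [h0] using (hMmem m).1 hm

lemma inner_smul_fock (x y : Fock d) (c : ℂ) : (inner ℂ x (c • y) : ℂ) = c * inner ℂ x y :=
  inner_smul_right (𝕜 := ℂ) x y c

lemma inner_conj_fock (x y : Fock d) : starRingEnd ℂ (inner ℂ x y : ℂ) = inner ℂ y x :=
  inner_conj_symm (𝕜 := ℂ) y x

lemma tendsto_zero_of_modeVec {F : Filter ℝ} (B : ℝ → 𝓛) {K : ℝ}
    (hK : ∀ᶠ ε in F, ∀ x, ‖B ε x‖ ≤ K * ‖x‖)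
    (hE : ∀ p (hp : p ≠ 0), Tendsto (fun ε => B ε (modeVec p hp)) F (𝓝 0))
    (hr : ∀ r : Fock d, (∀ k, co r 1 k = 0) → ∀ ε, B ε r = 0) (y : Fock d) :
    Tendsto (fun ε => B ε y) F (𝓝 0) := by
  refine tendsto_zero_of_span B hK {e | ∃ p, ∃ hp : p ≠ 0, e = modeVec p hp}
    (fun e ⟨p, hp, he⟩ => he ▸ hE p hp) (fun r h => hr r fun k => ?_) y
  rw [eq_cons_zero k]
  by_cases hk : k 0 = 0
  · exact co_of_zero r (i := 0) (by simpa using hk)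
  · rw [← inner_modeVec (k 0) hk]
    exact h _ ⟨_, hk, rfl⟩

/-- A two-particle state, as a particle `p` with a spectator `q`. -/
def pairVec (p q : Mode d) (hp : p ≠ 0) (N : ℕ) : Fock d :=
  upCreat q N ((lamMode p : ℂ) • modeVec p hp)

lemma tendsto_zero_of_pairVec {F : Filter ℝ} (B : ℝ → 𝓛) {K : ℝ}
    (hK : ∀ᶠ ε in F, ∀ x, ‖B ε x‖ ≤ K * ‖x‖) {N : ℕ} (hN : 1 < N)
    (hE : ∀ p q (hp : p ≠ 0), q ≠ 0 → Tendsto (fun ε => B ε (pairVec p q hp N)) F (𝓝 0))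
    (hr : ∀ r : Fock d, (∀ k, co r 2 k = 0) → ∀ ε, B ε r = 0) (y : Fock d) :
    Tendsto (fun ε => B ε y) F (𝓝 0) := by
  refine tendsto_zero_of_span B hK {e | ∃ p q, ∃ hp : p ≠ 0, q ≠ 0 ∧ e = pairVec p q hp N}
    (fun e ⟨p, q, hp, hq, he⟩ => he ▸ hE p q hp hq) (fun r h => hr r fun k => ?_) y
  by_cases hk0 : k 0 = 0
  · exact co_of_zero r hk0
  by_cases hk1 : k 1 = 0
  · exact co_of_zero r hk1
  have h1 := h _ ⟨k 1, k 0, hk1, hk0, rfl⟩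
  rw [pairVec, ← inner_conj_fock, inner_upCreat, inner_smul_fock, inner_modeVec_right, map_mul,
    Complex.conj_conj, conj_ofReal, upAnnih, comp_apply,
    co_op, co_annihAt, if_pos ⟨le_rfl, hN⟩] at h1
  have hm := modeSq_nonneg (k 0)
  have hm1 := lt_of_lt_of_le one_pos (one_le_modeSq hk1)
  have e1 : ((lamMode (k 1) : ℝ) : ℂ) ≠ 0 := ofReal_ne_zero.2 (lamMode_pos hk1).ne'
  have e2 : (((ratioUp (k 0)).val 1 ![k 1] : ℝ) : ℂ) ≠ 0 := by
    rw [ofReal_ne_zero]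
    simp only [ratioUp, tupleSq_singleton]
    positivity
  have e3 : ((√((1 : ℕ) + 1) : ℝ) : ℂ) ≠ 0 := ofReal_ne_zero.2 (sqrt_pos.2 (by positivity)).ne'
  have e4 : (Fin.cons (k 0) ![k 1] : 𝕄 2) = k := by
    funext i; fin_cases i <;> rfl
  rw [e4] at h1
  simpa [e1, e2, e3] using h1

/-- The drift operator `Λ⁻¹ L_0^𝔴 Λ⁻¹`. -/
def driftMul : Multiplier d where
  val _ k := -(1 / 2 * tupleDotSq w k) * (1 / 2 * tupleSq k)⁻¹
  symm n σ k := by rw [tupleSq_comp_perm, tupleDotSq_comp_perm]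
  bdd := ⟨‖w‖ ^ 2, sq_nonneg _, fun n k => by
    have h1 := tupleSq_nonneg k
    have h2 := tupleDotSq_nonneg w k
    rw [neg_mul, abs_neg, abs_of_nonneg (by positivity), ← div_eq_mul_inv]
    refine div_le_of_le_mul₀ (by positivity) (by positivity) ?_
    linarith [tupleDotSq_le w k]⟩

lemma driftMul_modeVec (p : Mode d) (hp : p ≠ 0) :
    (driftMul w).op (modeVec p hp) = ((driftMul w).val 1 ![p] : ℂ) • modeVec p hp := by
  refine Fock.ext fun n k => ?_
  rw [co_op, co_smul, co_modeVec]
  split_ifs with h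
  · obtain ⟨rfl, h⟩ := Sigma.mk.inj_iff.1 h
    rw [heq_eq_eq] at h
    subst h
    rfl
  · simp

/-- The drift of a pair is the sum of the drifts of its members. -/
lemma driftMul_pairVec (p q : Mode d) (hp : p ≠ 0) (hq : q ≠ 0)
    {N : ℕ} (hN : 1 < N) : (driftMul w).op (pairVec p q hp N) =
      downCreat q N (((driftMul w).val 1 ![p] : ℂ) • (lamMode p : ℂ) • modeVec p hp) +
      downCreat p N (((driftMul w).val 1 ![q] : ℂ) • (lamMode q : ℂ) • modeVec q hq) := by
  refine Fock.ext_inner_left fun χ => ?_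
  rw [inner_add_right, ← inner_op, pairVec, inner_upCreat, inner_downCreat, inner_downCreat]
  simp only [inner_smul_fock, inner_modeVec_right, upAnnih, downAnnih,
    comp_apply, co_op, co_annihAt, if_pos (And.intro le_rfl hN)]
  have hsw : co χ (1 + 1) (Fin.cons p ![q]) = co χ (1 + 1) (Fin.cons q ![p]) := by
    apply co_congr
    have h1 : (![q] : 𝕄 1) = Fin.cons q Fin.elim0 := by funext i; fin_cases i; rfl
    have h2 : (![p] : 𝕄 1) = Fin.cons p Fin.elim0 := by funext i; fin_cases i; rfl
    rw [h1, h2]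
    simp only [entries_cons]
    rw [Multiset.cons_swap]
  rw [hsw]
  simp only [map_mul, conj_ofReal]
  set z := starRingEnd ℂ (co χ (1 + 1) (Fin.cons q ![p]))
  have hmp := lt_of_lt_of_le one_pos (one_le_modeSq hp)
  have hmq := lt_of_lt_of_le one_pos (one_le_modeSq hq)
  have td1 : ∀ v : Mode d, tupleDotSq w ![v] = dotMode w v ^ 2 := fun v => by simp [tupleDotSq]
  have td2 : tupleDotSq w (Fin.cons q ![p] : 𝕄 2) = dotMode w q ^ 2 + dotMode w p ^ 2 := by
    simp [tupleDotSq, Fin.sum_univ_succ]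
  have num : lamMode p * ((ratioUp q).val 1 ![p] * (driftMul w).val (1 + 1) (Fin.cons q ![p])) =
      (driftMul w).val 1 ![p] * (lamMode p * (ratioDown q).val 1 ![p]) +
      (driftMul w).val 1 ![q] * (lamMode q * (ratioDown p).val 1 ![q]) := by
    simp only [ratioUp, ratioDown, driftMul, td1, td2, tupleSq_cons, tupleSq_singleton, lamMode]
    rw [add_comm (modeSq p) (modeSq q), sqrt_mul (by norm_num), sqrt_mul (by norm_num)]
    set s := √(1 / 2)
    have s1 := sq_sqrt hmp.le
    have s2 := sq_sqrt hmq.le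
    have s3 := sq_sqrt (show 0 ≤ modeSq q + modeSq p by linarith)
    have l1 := sqrt_pos.2 hmp
    have l2 := sqrt_pos.2 hmq
    have l3 := sqrt_pos.2 (show 0 < modeSq q + modeSq p by linarith)
    rw [show 1 / 2 * (modeSq q + modeSq p) = 1 / 2 * √(modeSq q + modeSq p) ^ 2 by rw [s3],
      show 1 / 2 * modeSq p = 1 / 2 * √(modeSq p) ^ 2 by rw [s1],
      show 1 / 2 * modeSq q = 1 / 2 * √(modeSq q) ^ 2 by rw [s2]]
    set A := √(modeSq p)
    set B := √(modeSq q)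
    set L := √(modeSq q + modeSq p)
    field_simp
    ring
  have num' := congrArg (fun r : ℝ => (r : ℂ)) num
  push_cast at num'
  linear_combination ((√((1 : ℕ) + 1) : ℝ) : ℂ) * z * num'

lemma norm_driftMul_le (x : Fock d) : ‖(driftMul w).op x‖ ≤ ‖w‖ ^ 2 * ‖x‖ := by
  refine (driftMul w).norm_op_le (sq_nonneg _) x fun n k _ => ?_
  have h1 := tupleSq_nonneg k
  have h2 := tupleDotSq_nonneg w k
  simp only [driftMul]
  rw [neg_mul, abs_neg, abs_of_nonneg (by positivity), ← div_eq_mul_inv]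
  refine div_le_of_le_mul₀ (by positivity) (by positivity) ?_
  linarith [tupleDotSq_le w k]

/-! ### Reduction to single modes -/

lemma norm_lower_comp_raise_le {ε C₀ : ℝ} (hC : ∀ k : Mode d, loopSum ε k ≤ C₀) (i : ℕ) {R : 𝓛}
    (hR : ∀ x, ‖R x‖ ≤ ‖x‖) (x : Fock d) :
    ‖lower w ε (i - 1) i (R (raise w ε (i - 1) i x))‖ ≤ (opConst w C₀ * i) ^ 2 * ‖x‖ := by
  have h0 := opConst_nonneg w C₀
  calc _ ≤ opConst w C₀ * i * ‖R (raise w ε (i - 1) i x)‖ := norm_lower_le w hC _ _ _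
    _ ≤ opConst w C₀ * i * (opConst w C₀ * i * ‖x‖) := by
        gcongr
        exact (hR _).trans (norm_raise_le (norm_lower_le w hC _ _) x)
    _ = _ := by ring

lemma raise_eq_zero {i : ℕ} {r : Fock d}
    (h : ∀ k : 𝕄 (i - 1), co r (i - 1) k = 0) : raise w ε (i - 1) i r = 0 := by
  rw [← map_zero (raise w ε (i - 1) i)]
  refine raise_congr w ε fun n h1 h2 k => ?_
  obtain rfl : n = i - 1 := by omega
  rw [h k]
  rfl

/-- The error operator in the definition of the diffusivity. -/
def errOp (i : ℕ) (D : ℝ) (R : ℝ → 𝓛) (ε : ℝ) : 𝓛 :=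
  lower w ε (i - 1) i ∘L R ε ∘L raise w ε (i - 1) i -
    (D : ℂ) • ((driftMul w).op ∘L (chaosMul d {i - 1}).op)

lemma errOp_apply (i : ℕ) (D : ℝ) (R : ℝ → 𝓛) (ε : ℝ) {y : Fock d}
    (hy : ∀ m (k : 𝕄 m), m ≠ i - 1 → co y m k = 0) :
    errOp w i D R ε y = lower w ε (i - 1) i (R ε (raise w ε (i - 1) i y)) -
      (D : ℂ) • (driftMul w).op y := by
  classical
  have : (chaosMul d {i - 1}).op y = y := by
    refine Fock.ext fun n k => ?_
    rw [co_chaosMul]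
    split_ifs with h
    · rfl
    · rw [hy n k h]
  simp only [errOp, sub_apply, smul_apply, comp_apply, this]

lemma errOp_eq_zero (i : ℕ) (D : ℝ) (R : ℝ → 𝓛) (ε : ℝ) {r : Fock d}
    (h : ∀ k : 𝕄 (i - 1), co r (i - 1) k = 0) : errOp w i D R ε r = 0 := by
  classical
  have : (chaosMul d {i - 1}).op r = 0 := by
    refine Fock.ext fun n k => ?_
    rw [co_chaosMul]
    split_ifs with hn
    · obtain rfl : n = i - 1 := hn
      rw [h k]; rfl
    · rfl
  simp only [errOp, sub_apply, smul_apply, comp_apply, this,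
    raise_eq_zero w ε h, map_zero, smul_zero, sub_zero]

lemma norm_errOp_le {F : Filter ℝ} {C₀ : ℝ}
    (hC : ∀ᶠ ε in F, ∀ k : Mode d, loopSum ε k ≤ C₀) (i : ℕ) (D : ℝ)
    {R : ℝ → 𝓛} (hR : ∀ ε x, ‖R ε x‖ ≤ ‖x‖) :
    ∀ᶠ ε in F, ∀ x, ‖errOp w i D R ε x‖ ≤ ((opConst w C₀ * i) ^ 2 + |D| * ‖w‖ ^ 2) * ‖x‖ := by
  filter_upwards [hC] with ε hε x
  have h1 := norm_lower_comp_raise_le w hε i (hR ε) x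
  have h2 : ‖(D : ℂ) • (driftMul w).op ((chaosMul d {i - 1}).op x)‖ ≤ |D| * (‖w‖ ^ 2 * ‖x‖) := by
    rw [norm_smul, norm_real, norm_eq_abs]
    gcongr
    exact (norm_driftMul_le w _).trans (by gcongr; exact norm_chaosMul_le _ x)
  calc _ ≤ _ := norm_sub_le _ _
    _ ≤ _ := add_le_add h1 h2
    _ = _ := by ring

lemma co_modeVec_of_ne (p : Mode d) (hp : p ≠ 0) (m : ℕ) (k : 𝕄 m) (hm : m ≠ 1) :
    co (modeVec p hp) m k = 0 := by
  rw [co_modeVec, if_neg]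
  exact fun h => hm (congrArg Sigma.fst h)

lemma co_upCreat_of_ne (q : Mode d) (N : ℕ) {x : Fock d} {n : ℕ}
    (hx : ∀ m (k : 𝕄 m), m ≠ n → co x m k = 0) (m : ℕ) (k : 𝕄 m)
    (hm : m ≠ n + 1) : co (upCreat q N x) m k = 0 := by
  obtain _ | m := m
  · simp
  by_cases hk : ∀ i, k i ≠ 0
  swap
  · push Not at hk
    obtain ⟨i, hi⟩ := hk
    exact co_of_zero _ hi
  rw [← inner_symDelta k hk, inner_upCreat, ← (hasSum_inner_co _ _).tsum_eq]
  refine (tsum_congr fun i => ?_).trans tsum_zero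
  obtain ⟨j, κ⟩ := i
  by_cases hj : j = n
  · subst hj
    simp only [upAnnih, comp_apply, co_op, co_annihAt, co_symDelta]
    have : ∀ σ : Perm (Fin (m + 1)),
        ((⟨j + 1, Fin.cons q κ⟩ : Idx d) = ⟨m + 1, k ∘ σ⟩) = False := fun σ => by
      rw [eq_iff_iff, iff_false]
      exact fun h => hm (congrArg Sigma.fst h).symm
    simp [this]
  · simp [hx j κ hj]

lemma co_pairVec_of_ne (p q : Mode d) (hp : p ≠ 0) (N m : ℕ) (k : 𝕄 m) (hm : m ≠ 2) :
    co (pairVec p q hp N) m k = 0 :=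
  co_upCreat_of_ne q N (n := 1) fun m k h => by rw [co_smul, co_modeVec_of_ne p hp m k h, mul_zero]
    m k hm

lemma tendsto_errOp_one {F : Filter ℝ} {C₀ : ℝ}
    (hC : ∀ᶠ ε in F, ∀ k : Mode d, loopSum ε k ≤ C₀) (D : ℝ) {R : ℝ → 𝓛}
    (hR : ∀ ε x, ‖R ε x‖ ≤ ‖x‖)
    (hRm : ∀ ε p x, (momMul p).op (R ε x) = R ε ((momMul p).op x))
    (hτ : ∀ p (hp : p ≠ 0), Tendsto
      (fun ε => co (lower w ε 1 2 (R ε (raise w ε 1 2 (modeVec p hp)))) 1 ![p]) F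
      (𝓝 ((D * (driftMul w).val 1 ![p] : ℝ) : ℂ))) (y : Fock d) :
    Tendsto (fun ε => errOp w 2 D R ε y) F (𝓝 0) := by
  refine tendsto_zero_of_modeVec _ (norm_errOp_le w hC 2 D hR) (fun p hp => ?_)
    (fun r hr ε => errOp_eq_zero w 2 D R ε hr) y
  have h1 : ∀ ε, errOp w 2 D R ε (modeVec p hp) =
      (co (lower w ε 1 2 (R ε (raise w ε 1 2 (modeVec p hp)))) 1 ![p] -
        ((D * (driftMul w).val 1 ![p] : ℝ) : ℂ)) • modeVec p hp := by
    intro ε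
    rw [errOp_apply w 2 D R ε (co_modeVec_of_ne p hp), sub_smul, driftMul_modeVec, smul_smul,
      ofReal_mul]
    congr 1
    refine lower_one_eq_smul w ε hp ?_
    rw [hRm, momMul_raise, momMul_modeVec]
  simp only [h1]
  have := ((hτ p hp).sub_const ((D * (driftMul w).val 1 ![p] : ℝ) : ℂ)).smul_const (modeVec p hp)
  simpa using this

lemma tendsto_errOp_two {F : Filter ℝ} {C₀ : ℝ}
    (hC : ∀ᶠ ε in F, ∀ k : Mode d, loopSum ε k ≤ C₀) (D : ℝ) {R : ℝ → 𝓛}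
    (hR : ∀ ε x, ‖R ε x‖ ≤ ‖x‖) {N : ℕ} (hN : 1 < N)
    (hE : ∀ p q (hp : p ≠ 0), q ≠ 0 → Tendsto (fun ε =>
      lower w ε 2 3 (R ε (raise w ε 2 3 (pairVec p q hp N))) -
        (D : ℂ) • (driftMul w).op (pairVec p q hp N)) F (𝓝 0)) (y : Fock d) :
    Tendsto (fun ε => errOp w 3 D R ε y) F (𝓝 0) := by
  refine tendsto_zero_of_pairVec _ (norm_errOp_le w hC 3 D hR) hN (fun p q hp hq => ?_)
    (fun r hr ε => errOp_eq_zero w 3 D R ε hr) y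
  refine (hE p q hp hq).congr fun ε => ?_
  rw [errOp_apply w 3 D R ε (co_pairVec_of_ne p q hp N)]

/-- The solution operator, measured in the weak norm. -/
def weakOp (i : ℕ) (R : ℝ → 𝓛) (ε : ℝ) : 𝓛 := invLam.op ∘L R ε ∘L raise w ε (i - 1) i

lemma norm_weakOp_le {F : Filter ℝ} {C₀ : ℝ}
    (hC : ∀ᶠ ε in F, ∀ k : Mode d, loopSum ε k ≤ C₀) (i : ℕ)
    {R : ℝ → 𝓛} (hR : ∀ ε x, ‖R ε x‖ ≤ ‖x‖) :
    ∀ᶠ ε in F, ∀ x, ‖weakOp w i R ε x‖ ≤ (2 * (opConst w C₀ * i)) * ‖x‖ := by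
  filter_upwards [hC] with ε hε x
  calc _ ≤ 2 * ‖R ε (raise w ε (i - 1) i x)‖ := norm_invLam_le _
    _ ≤ 2 * (opConst w C₀ * i * ‖x‖) := by
        gcongr
        exact (hR ε _).trans (norm_raise_le (norm_lower_le w hε _ _) x)
    _ = _ := by ring

lemma weakOp_eq_zero (i : ℕ) (R : ℝ → 𝓛) (ε : ℝ) {r : Fock d}
    (h : ∀ k : 𝕄 (i - 1), co r (i - 1) k = 0) : weakOp w i R ε r = 0 := by
  simp only [weakOp, comp_apply, raise_eq_zero w ε h, map_zero]

/-! ### Spectators in dimension at least three -/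

lemma norm_invLam_upCreat_le (q : Mode d) (N : ℕ) (u : Fock d) :
    ‖invLam.op (upCreat q N u)‖ ≤ √N * ‖invLam.op u‖ := by
  refine norm_le_of_forall_inner (by positivity) fun χ => ?_
  rw [← inner_op, inner_upCreat, upAnnih_invLam, inner_op]
  calc _ ≤ _ := norm_inner_le_norm _ _
    _ ≤ (√N * ‖χ‖) * ‖invLam.op u‖ := by gcongr; exact norm_annihAt_le q N χ
    _ = _ := by ring

/-- The constant in the comparison of two-particle and one-particle solutions. -/
def pairConst (C₀ : ℝ) (n : ℕ) (q : Mode d) (N : ℕ) : ℝ :=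
  opConst w C₀ * 3 * spectatorBound w C₀ n q N + commBound w C₀ 2 q

lemma norm_resolvent_pair_sub_le {ε C₀ : ℝ}
    (hC : ∀ k : Mode d, loopSum ε k ≤ C₀) (hl : |coupling d ε| ≤ 1) {n N : ℕ}
    (hN : n < N) (p q : Mode d) {g g' : Fock d} :
    ‖𝓡 w ε 3 (n + 1) (downCreat q N g + downCreat p N g') -
      (upCreat q N (𝓡 w ε 2 n g) + upCreat p N (𝓡 w ε 2 n g'))‖ ≤
      spectatorBound w C₀ n q N * ‖invLam.op (𝓡 w ε 2 n g)‖ +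
      spectatorBound w C₀ n p N * ‖invLam.op (𝓡 w ε 2 n g')‖ := by
  set u := 𝓡 w ε 2 n g with hu
  set u' := 𝓡 w ε 2 n g' with hu'
  have h1 := norm_sub_skewOp_upCreat_le w (a := 2) (by norm_num) q (hC q) hl hN
    ((isSkew_skewOp w ε 2 n).resolvent_eq g)
  have h2 := norm_sub_skewOp_upCreat_le w (a := 2) (by norm_num) p (hC p) hl hN
    ((isSkew_skewOp w ε 2 n).resolvent_eq g')
  rw [← hu] at h1
  rw [← hu'] at h2
  set x := 𝓡 w ε 3 (n + 1) (downCreat q N g + downCreat p N g') with hx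
  have hx' := (isSkew_skewOp w ε 3 (n + 1)).resolvent_eq (downCreat q N g + downCreat p N g')
  rw [← hx] at hx'
  refine ((isSkew_skewOp w ε 3 (n + 1)).norm_le _).trans ?_
  have e : (1 - skewOp w ε 3 (n + 1)) (x - (upCreat q N u + upCreat p N u')) =
      -((upCreat q N u - skewOp w ε 3 (n + 1) (upCreat q N u) - downCreat q N g) +
        (upCreat p N u' - skewOp w ε 3 (n + 1) (upCreat p N u') - downCreat p N g')) := by
    rw [sub_apply, one_apply_eq_self, map_sub, map_add]
    nth_rewrite 1 [hx']
    abel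
  rw [e, norm_neg]
  exact (norm_add_le _ _).trans (add_le_add h1 h2)

lemma norm_lower_resolvent_pair_sub_le {ε C₀ : ℝ}
    (hC : ∀ k : Mode d, loopSum ε k ≤ C₀) (hl : |coupling d ε| ≤ 1) {n N : ℕ} (hn : 2 ≤ n)
    (hN : n < N) (p q : Mode d) {g g' : Fock d} :
    ‖lower w ε 2 3 (𝓡 w ε 3 (n + 1) (downCreat q N g + downCreat p N g')) -
      (downCreat q N (lower w ε 1 2 (𝓡 w ε 2 n g)) +
        downCreat p N (lower w ε 1 2 (𝓡 w ε 2 n g')))‖ ≤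
      pairConst w C₀ n q N * ‖invLam.op (𝓡 w ε 2 n g)‖ +
      pairConst w C₀ n p N * ‖invLam.op (𝓡 w ε 2 n g')‖ := by
  have h0 := norm_resolvent_pair_sub_le w hC hl hN p q (g := g) (g' := g')
  set u := 𝓡 w ε 2 n g with hu
  set u' := 𝓡 w ε 2 n g' with hu'
  set x := 𝓡 w ε 3 (n + 1) (downCreat q N g + downCreat p N g') with hx
  have h1 := norm_lower_upCreat_sub_le w C₀ (a := 1) (b := 2) le_rfl q hl (by omega : 2 < N) u
  have h2 := norm_lower_upCreat_sub_le w C₀ (a := 1) (b := 2) le_rfl p hl (by omega : 2 < N) u'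
  have h3 := norm_lower_le w hC 2 3 (x - (upCreat q N u + upCreat p N u'))
  have hop := opConst_nonneg w C₀
  have e : lower w ε 2 3 x - (downCreat q N (lower w ε 1 2 u) + downCreat p N (lower w ε 1 2 u')) =
      lower w ε 2 3 (x - (upCreat q N u + upCreat p N u')) +
      ((lower w ε 2 3 (upCreat q N u) - downCreat q N (lower w ε 1 2 u)) +
       (lower w ε 2 3 (upCreat p N u') - downCreat p N (lower w ε 1 2 u'))) := by
    rw [map_sub, map_add]; abel
  rw [e]
  have h4 : opConst w C₀ * (3 : ℕ) * ‖x - (upCreat q N u + upCreat p N u')‖ ≤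
      opConst w C₀ * 3 * (spectatorBound w C₀ n q N * ‖invLam.op u‖ +
        spectatorBound w C₀ n p N * ‖invLam.op u'‖) := by
    push_cast
    gcongr
  calc _ ≤ _ := norm_add_le _ _
    _ ≤ _ := add_le_add (h3.trans h4) ((norm_add_le _ _).trans (add_le_add h1 h2))
    _ = _ := by simp only [pairConst]; ring

lemma modeSource_eq (p : Mode d) (hp : p ≠ 0) :
    modeSource w ε p hp = (lamMode p : ℂ) • raise w ε 1 2 (modeVec p hp) := by
  rw [modeSource, map_smul]

/-- The response to the source of a mode, from its single Fourier coefficient. -/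
lemma tendsto_lower_modeSource {F : Filter ℝ} {D : ℝ} {S : ℝ → 𝓛} {p : Mode d}
    (hp : p ≠ 0) (hS : ∀ ε x, (momMul p).op (S ε x) = S ε ((momMul p).op x))
    (hτ : Tendsto (fun ε => co (lower w ε 1 2 (S ε (raise w ε 1 2 (modeVec p hp)))) 1 ![p]) F
      (𝓝 ((D * (driftMul w).val 1 ![p] : ℝ) : ℂ))) :
    Tendsto (fun ε => lower w ε 1 2 (S ε (modeSource w ε p hp))) F
      (𝓝 ((D : ℂ) • ((driftMul w).val 1 ![p] : ℂ) • (lamMode p : ℂ) • modeVec p hp)) := by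
  have h := (hτ.smul_const (modeVec p hp)).const_smul (lamMode p : ℂ)
  have e : (lamMode p : ℂ) • ((D * (driftMul w).val 1 ![p] : ℝ) : ℂ) • modeVec p hp =
      (D : ℂ) • ((driftMul w).val 1 ![p] : ℂ) • (lamMode p : ℂ) • modeVec p hp := by
    simp only [smul_smul]
    congr 1
    push_cast
    ring
  rw [e] at h
  refine h.congr fun ε => ?_
  rw [modeSource_eq, map_smul, map_smul]
  congr 1
  refine (lower_one_eq_smul w ε hp ?_).symm
  rw [hS, momMul_raise, momMul_modeVec]

lemma tendsto_invLam_modeSource {F : Filter ℝ} {S : ℝ → 𝓛} {p : Mode d}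
    (hp : p ≠ 0) (hw : Tendsto (fun ε => invLam.op (S ε (raise w ε 1 2 (modeVec p hp)))) F
      (𝓝 0)) : Tendsto (fun ε => ‖invLam.op (S ε (modeSource w ε p hp))‖) F (𝓝 0) := by
  have := (hw.const_smul (lamMode p : ℂ)).norm
  rw [smul_zero, norm_zero] at this
  refine this.congr fun ε => ?_
  rw [modeSource_eq, map_smul, map_smul]

/-- Two one-particle responses, each with the other particle as a spectator, add up to the drift
of the pair. -/
lemma tendsto_sub_drift_pairVec {F : Filter ℝ} {D : ℝ} {p q : Mode d} (hp : p ≠ 0) (hq : q ≠ 0)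
    {N : ℕ} (hN : 1 < N) {u u' x : ℝ → Fock d}
    (hu : Tendsto u F
      (𝓝 ((D : ℂ) • ((driftMul w).val 1 ![p] : ℂ) • (lamMode p : ℂ) • modeVec p hp)))
    (hu' : Tendsto u' F
      (𝓝 ((D : ℂ) • ((driftMul w).val 1 ![q] : ℂ) • (lamMode q : ℂ) • modeVec q hq)))
    (hx : Tendsto (fun ε => x ε - (downCreat q N (u ε) + downCreat p N (u' ε))) F (𝓝 0)) :
    Tendsto (fun ε => x ε - (D : ℂ) • (driftMul w).op (pairVec p q hp N)) F (𝓝 0) := by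
  have hlim := (((downCreat q N).continuous.tendsto _).comp hu).add
    (((downCreat p N).continuous.tendsto _).comp hu')
  rw [map_smul, map_smul (downCreat p N), ← smul_add, ← driftMul_pairVec w p q hp hq hN] at hlim
  have := hx.add (hlim.sub_const ((D : ℂ) • (driftMul w).op (pairVec p q hp N)))
  rw [sub_self, zero_add] at this
  refine this.congr fun ε => ?_
  simp only [Function.comp_apply]
  abel

/-- A solution with two particles is asymptotically a superposition of one-particle solutions. -/
lemma tendsto_errOp_pairVec {F : Filter ℝ} {C₀ : ℝ}
    (hC : ∀ᶠ ε in F, ∀ k : Mode d, loopSum ε k ≤ C₀) (hl : ∀ᶠ ε in F, |coupling d ε| ≤ 1)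
    {n N : ℕ} (hn : 2 ≤ n) (hN : n < N) (D : ℝ)
    (hτ : ∀ p (hp : p ≠ 0), Tendsto (fun ε => co (lower w ε 1 2
      (𝓡 w ε 2 n (raise w ε 1 2 (modeVec p hp)))) 1 ![p]) F
      (𝓝 ((D * (driftMul w).val 1 ![p] : ℝ) : ℂ)))
    (hw : ∀ p (hp : p ≠ 0), Tendsto (fun ε => invLam.op
      (𝓡 w ε 2 n (raise w ε 1 2 (modeVec p hp)))) F (𝓝 0))
    (p q : Mode d) (hp : p ≠ 0) (hq : q ≠ 0) :
    Tendsto (fun ε => lower w ε 2 3 (𝓡 w ε 3 (n + 1)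
      (raise w ε 2 3 (pairVec p q hp N))) - (D : ℂ) • (driftMul w).op (pairVec p q hp N)) F (𝓝 0) ∧
    Tendsto (fun ε => invLam.op (𝓡 w ε 3 (n + 1) (raise w ε 2 3 (pairVec p q hp N)))) F (𝓝 0) := by
  have hu := fun p (hp : p ≠ 0) => tendsto_invLam_modeSource w
    (S := fun ε => 𝓡 w ε 2 n) hp (hw p hp)
  have hlow := fun p (hp : p ≠ 0) => tendsto_lower_modeSource w
    (S := fun ε => 𝓡 w ε 2 n) hp (fun ε => momMul_resolvent w ε 2 n p) (hτ p hp)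
  have hr : ∀ ε, raise w ε 2 3 (pairVec p q hp N) =
      downCreat q N (modeSource w ε p hp) + downCreat p N (modeSource w ε q hq) := fun ε =>
    raise_two_upCreat w ε p q hp hq (by omega)
  simp only [hr]
  constructor
  · refine tendsto_sub_drift_pairVec w hp hq (by omega) (hlow p hp) (hlow q hq) ?_
    refine squeeze_zero_norm' ?_ (by
      simpa using ((hu p hp).const_mul (pairConst w C₀ n q N)).add
        ((hu q hq).const_mul (pairConst w C₀ n p N)))
    filter_upwards [hC, hl] with ε h1 h2
    exact norm_lower_resolvent_pair_sub_le w h1 h2 hn hN p q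
  · refine squeeze_zero_norm' (a := fun ε =>
      2 * (spectatorBound w C₀ n q N * ‖invLam.op (𝓡 w ε 2 n (modeSource w ε p hp))‖ +
        spectatorBound w C₀ n p N * ‖invLam.op (𝓡 w ε 2 n (modeSource w ε q hq))‖) +
      (√N * ‖invLam.op (𝓡 w ε 2 n (modeSource w ε p hp))‖ +
        √N * ‖invLam.op (𝓡 w ε 2 n (modeSource w ε q hq))‖)) ?_ (by
        simpa using ((((hu p hp).const_mul (spectatorBound w C₀ n q N)).add
          ((hu q hq).const_mul (spectatorBound w C₀ n p N))).const_mul 2).add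
          (((hu p hp).const_mul (√N)).add ((hu q hq).const_mul (√N))))
    filter_upwards [hC, hl] with ε h1 h2
    have h3 := norm_resolvent_pair_sub_le w h1 h2 hN p q (g := modeSource w ε p hp)
      (g' := modeSource w ε q hq)
    set u := 𝓡 w ε 2 n (modeSource w ε p hp)
    set u' := 𝓡 w ε 2 n (modeSource w ε q hq)
    set x := 𝓡 w ε 3 (n + 1)
        (downCreat q N (modeSource w ε p hp) + downCreat p N (modeSource w ε q hq))
    have e : invLam.op x = invLam.op (x - (upCreat q N u + upCreat p N u')) +
        (invLam.op (upCreat q N u) + invLam.op (upCreat p N u')) := by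
      rw [map_sub, map_add]; abel
    rw [e]
    refine (norm_add_le _ _).trans (add_le_add ((norm_invLam_le _).trans (by gcongr))
      ((norm_add_le _ _).trans (add_le_add (norm_invLam_upCreat_le q N u)
        (norm_invLam_upCreat_le p N u'))))

/-! ### Spectators in dimension two -/

lemma Multiplier.val_congr (m : Multiplier d) {n : ℕ} {k k' : 𝕄 n}
    (h : entries k = entries k') : m.val n k = m.val n k' := by
  obtain ⟨σ, rfl⟩ := exists_perm_of_entries_eq h
  exact (m.symm n σ k).symm

/-- The multiplier seen by the remaining particles in the presence of a spectator `q`. -/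
def Multiplier.shift (m : Multiplier d) (q : Mode d) : Multiplier d where
  val n k := m.val (n + 1) (Fin.cons q k)
  symm n σ k := m.val_congr (by rw [entries_cons, entries_cons, entries_comp_perm])
  bdd := ⟨m.bdd.choose, m.bdd.choose_spec.1, fun n k => m.bdd.choose_spec.2 _ _⟩

lemma op_downCreat (m : Multiplier d) (q : Mode d) (N : ℕ) (v : Fock d) :
    m.op (downCreat q N v) = downCreat q N ((m.shift q).op v) := by
  refine Fock.ext_inner_left fun χ => ?_
  rw [← inner_op, inner_downCreat, inner_downCreat, ← inner_op]
  congr 1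
  refine Fock.ext fun n k => ?_
  simp only [downAnnih, comp_apply, co_op, co_annihAt, Multiplier.shift]
  split_ifs
  · ring
  · simp

/-- The constant in the comparison of `A_-` with and without a spectator mode. -/
def lowerConst (C₀ : ℝ) (q : Mode d) (N : ℕ) : ℝ :=
  opConst w C₀ * 3 * (modeSq q * √N) + commBound w C₀ 2 q

lemma norm_lower_downCreat_sub_le {ε C₀ : ℝ}
    (hC : ∀ k : Mode d, loopSum ε k ≤ C₀) (hl : |coupling d ε| ≤ 1) {N : ℕ}
    (hN : 2 < N) (q : Mode d) (v : Fock d) :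
    ‖lower w ε 2 3 (downCreat q N v) - downCreat q N (lower w ε 1 2 v)‖ ≤
      lowerConst w C₀ q N * ‖invLam.op v‖ := by
  have h1 := norm_lower_upCreat_sub_le w C₀ (a := 1) (b := 2) le_rfl q hl hN v
  have h2 := norm_upCreat_sub_downCreat_le q N v
  have h3 := norm_lower_le w hC 2 3 (upCreat q N v - downCreat q N v)
  have hop := opConst_nonneg w C₀
  have e : lower w ε 2 3 (downCreat q N v) - downCreat q N (lower w ε 1 2 v) =
      (lower w ε 2 3 (upCreat q N v) - downCreat q N (lower w ε 1 2 v)) -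
        lower w ε 2 3 (upCreat q N v - downCreat q N v) := by
    rw [map_sub]; abel
  rw [e]
  have h4 : opConst w C₀ * (3 : ℕ) * ‖upCreat q N v - downCreat q N v‖ ≤
      opConst w C₀ * 3 * (modeSq q * √N * ‖invLam.op v‖) := by
    push_cast
    gcongr
  calc _ ≤ _ := norm_sub_le _ _
    _ ≤ _ := add_le_add h1 (h3.trans h4)
    _ = _ := by rw [lowerConst]; ring

lemma effMul_shift_abs_le_one (q : Mode d) {n : ℕ}
    (k : 𝕄 n) : |((effMul w ε).shift q).val n k| ≤ 1 := by
  change |(effMul w ε).val (n + 1) (Fin.cons q k)| ≤ 1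
  rw [abs_of_nonneg (effMul_nonneg w ε _)]
  exact effMul_le_one w ε _

lemma tendsto_errOp_pairVec_effMul {F : Filter ℝ} {C₀ : ℝ}
    (hC : ∀ᶠ ε in F, ∀ k : Mode d, loopSum ε k ≤ C₀) (hl : ∀ᶠ ε in F, |coupling d ε| ≤ 1)
    {N : ℕ} (hN : 2 < N) (D : ℝ)
    (hτ : ∀ p q (hp : p ≠ 0), Tendsto (fun ε => co (lower w ε 1 2
      (((effMul w ε).shift q).op (raise w ε 1 2 (modeVec p hp)))) 1 ![p]) F
      (𝓝 ((D * (driftMul w).val 1 ![p] : ℝ) : ℂ)))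
    (hw : ∀ p (hp : p ≠ 0), Tendsto (fun ε => invLam.op (raise w ε 1 2 (modeVec p hp))) F (𝓝 0))
    (p q : Mode d) (hp : p ≠ 0) (hq : q ≠ 0) :
    Tendsto (fun ε => lower w ε 2 3 ((effMul w ε).op
      (raise w ε 2 3 (pairVec p q hp N))) - (D : ℂ) • (driftMul w).op (pairVec p q hp N))
      F (𝓝 0) := by
  have hu := fun p q (hp : p ≠ 0) => tendsto_invLam_modeSource w
    (S := fun ε => ((effMul w ε).shift q).op) hp (by
      refine squeeze_zero_norm (fun ε => ?_) (by simpa using (hw p hp).norm)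
      rw [Multiplier.op_comm]
      simpa using ((effMul w ε).shift q).norm_op_le zero_le_one _
        fun n k _ => effMul_shift_abs_le_one w ε q k)
  have hlow := fun p q (hp : p ≠ 0) => tendsto_lower_modeSource w
    (S := fun ε => ((effMul w ε).shift q).op) hp (fun ε x => Multiplier.op_comm _ _ x) (hτ p q hp)
  have hr : ∀ ε, (effMul w ε).op (raise w ε 2 3 (pairVec p q hp N)) =
      downCreat q N (((effMul w ε).shift q).op (modeSource w ε p hp)) +
        downCreat p N (((effMul w ε).shift p).op (modeSource w ε q hq)) := fun ε => by
    rw [pairVec, raise_two_upCreat w ε p q hp hq hN, map_add, op_downCreat, op_downCreat]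
  simp only [hr]
  have herr : ∀ p q (hp : p ≠ 0), Tendsto (fun ε =>
      lower w ε 2 3 (downCreat q N (((effMul w ε).shift q).op (modeSource w ε p hp))) -
        downCreat q N (lower w ε 1 2 (((effMul w ε).shift q).op (modeSource w ε p hp)))) F
        (𝓝 0) := by
    intro p q hp
    refine squeeze_zero_norm' ?_ (by simpa using (hu p q hp).const_mul (lowerConst w C₀ q N))
    filter_upwards [hC, hl] with ε h1 h2
    exact norm_lower_downCreat_sub_le w h1 h2 hN q _
  refine tendsto_sub_drift_pairVec w hp hq (by omega) (hlow p q hp) (hlow q p hq) ?_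
  simpa [add_sub_add_comm] using (herr p q hp).add (herr q p hq)

/-! ### Lattice sums -/

/-- The modes with all coordinates at most `r` in absolute value. -/
def cube (d r : ℕ) : Finset (Mode d) := Fintype.piFinset fun _ => Finset.Icc (-(r : ℤ)) r

lemma mem_cube {r : ℕ} {l : Mode d} : l ∈ cube d r ↔ ∀ a, |l a| ≤ r := by
  simp [cube, abs_le]

lemma card_cube (d r : ℕ) : (cube d r).card = (2 * r + 1) ^ d := by
  have : (r + 1 + (r : ℤ)).toNat = 2 * r + 1 := by omega
  simp [cube, this]

lemma pow_sub_pow_le_mul {a b : ℝ} (ha : 0 < a) (hb : 0 ≤ b) (n : ℕ) :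
    a ^ n - b ^ n ≤ n * (a - b) * a ^ (n - 1) := by
  obtain _ | n := n
  · simp
  have h := one_add_mul_sub_le_pow (a := b / a) (by have := div_nonneg hb ha.le; linarith) (n + 1)
  rw [div_pow, le_div_iff₀ (by positivity)] at h
  have : (1 + ((n + 1 : ℕ) : ℝ) * (b / a - 1)) * a ^ (n + 1) =
      a ^ (n + 1) - ((n + 1 : ℕ) : ℝ) * (a - b) * a ^ n := by
    field_simp
    ring
  rw [this] at h
  simp only [Nat.add_sub_cancel]
  linarith

/-- Lattice sums of `|ℓ|⁻²` are compared with sums over shells. -/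
lemma sum_cube_inv_modeSq_le (d r : ℕ) : ∑ l ∈ cube d r, (modeSq l)⁻¹ ≤
    (2 * d * 3 ^ (d - 1) : ℝ) * ∑ s ∈ range r, ((s : ℝ) + 1) ^ (d - 1) / ((s : ℝ) + 1) ^ 2 := by
  induction r with
  | zero =>
    refine le_of_eq ?_
    rw [Finset.range_zero, Finset.sum_empty, mul_zero]
    refine sum_eq_zero fun l hl => ?_
    have : l = 0 := by
      funext a
      have := mem_cube.1 hl a
      simpa using this
    simp [this, modeSq]
  | succ r ih =>
    have hsub : cube d r ⊆ cube d (r + 1) := fun l hl => mem_cube.2 fun a =>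
      (mem_cube.1 hl a).trans (by push_cast; omega)
    rw [← Finset.sum_sdiff hsub, Finset.sum_range_succ, mul_add, add_comm]
    refine add_le_add ih ?_
    have hterm : ∀ l ∈ cube d (r + 1) \ cube d r, (modeSq l)⁻¹ ≤ (((r : ℝ) + 1) ^ 2)⁻¹ := by
      intro l hl
      rw [Finset.mem_sdiff, mem_cube, mem_cube] at hl
      obtain ⟨-, h2⟩ := hl
      push Not at h2
      obtain ⟨a, ha⟩ := h2
      have h3 : ((r : ℝ) + 1) ≤ |(l a : ℝ)| := by
        have : (r : ℤ) + 1 ≤ |l a| := by omega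
        exact_mod_cast this
      have h4 : (l a : ℝ) ^ 2 ≤ modeSq l := Finset.single_le_sum (f := fun a => (l a : ℝ) ^ 2)
        (fun _ _ => sq_nonneg _) (mem_univ a)
      apply inv_anti₀ (by positivity)
      rw [← sq_abs] at h4
      exact (pow_le_pow_left₀ (by positivity) h3 2).trans h4
    refine (sum_le_sum hterm).trans ?_
    rw [sum_const, Finset.card_sdiff_of_subset hsub, card_cube, card_cube, nsmul_eq_mul,
      Nat.cast_sub (Nat.pow_le_pow_left (by omega) d), ← div_eq_mul_inv, mul_div_assoc']
    gcongr
    push_cast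
    have h5 := pow_sub_pow_le_mul (a := 2 * ((r : ℝ) + 1) + 1) (b := 2 * (r : ℝ) + 1)
      (by positivity) (by positivity) d
    refine h5.trans ?_
    have h6 : (2 * ((r : ℝ) + 1) + 1) ^ (d - 1) ≤ (3 * ((r : ℝ) + 1)) ^ (d - 1) := by
      gcongr
      linarith [(Nat.cast_nonneg r : (0 : ℝ) ≤ r)]
    rw [mul_pow] at h6
    calc _ = 2 * (d : ℝ) * (2 * ((r : ℝ) + 1) + 1) ^ (d - 1) := by ring
      _ ≤ 2 * (d : ℝ) * (3 ^ (d - 1) * ((r : ℝ) + 1) ^ (d - 1)) := by gcongr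
      _ = _ := by ring

/-- The constant in the bounds for lattice sums. -/
def latConst (d : ℕ) : ℝ := 2 * d * 3 ^ (d - 1)

lemma latConst_nonneg (d : ℕ) : 0 ≤ latConst d := by unfold latConst; positivity

lemma sum_cube_inv_modeSq_le_pow (hd : 3 ≤ d) (r : ℕ) :
    ∑ l ∈ cube d r, (modeSq l)⁻¹ ≤ latConst d * (r : ℝ) ^ (d - 2) := by
  refine (sum_cube_inv_modeSq_le d r).trans ?_
  rw [latConst]
  gcongr
  obtain ⟨e, rfl⟩ : ∃ e, d = e + 3 := ⟨d - 3, by omega⟩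
  have h1 : ∀ s ∈ range r, ((s : ℝ) + 1) ^ (e + 3 - 1) / ((s : ℝ) + 1) ^ 2 ≤ (r : ℝ) ^ e := by
    intro s hs
    have h2 : (s : ℝ) + 1 ≤ r := by exact_mod_cast Finset.mem_range.1 hs
    rw [show e + 3 - 1 = e + 2 from by omega, pow_add, mul_div_cancel_right₀ _ (by positivity)]
    gcongr
  refine (sum_le_sum h1).trans ?_
  rw [sum_const, Finset.card_range, nsmul_eq_mul, show e + 3 - 2 = e + 1 from by omega, pow_succ']

lemma sum_cube_inv_modeSq_le_log (r : ℕ) :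
    ∑ l ∈ cube 2 r, (modeSq l)⁻¹ ≤ latConst 2 * (1 + log r) := by
  refine (sum_cube_inv_modeSq_le 2 r).trans ?_
  rw [latConst]
  gcongr
  have h1 : ∀ s ∈ range r, ((s : ℝ) + 1) ^ (2 - 1) / ((s : ℝ) + 1) ^ 2 =
      ((((s + 1 : ℕ) : ℚ)⁻¹ : ℚ) : ℝ) := by
    intro s _
    push_cast
    have : (s : ℝ) + 1 ≠ 0 := by positivity
    field_simp
  rw [sum_congr rfl h1]
  have := harmonic_le_one_add_log r
  rw [harmonic] at this
  push_cast at this ⊢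
  exact this

lemma loopSum_le_sum_cube (ε : ℝ) (k : Mode d) :
    loopSum ε k ≤ coupling d ε ^ 2 * (2 * ∑ l ∈ cube d ⌊ε⁻¹⌋₊, (modeSq l)⁻¹) := by
  unfold loopSum
  refine mul_le_mul_of_nonneg_left ?_ (sq_nonneg _)
  have h1 : ∑ l ∈ box d ε, cutoff ε l (k - l) * (𝓔 k l)⁻¹ ≤
      ∑ l ∈ box d ε, if l ∈ cube d ⌊ε⁻¹⌋₊ then 2 * (modeSq l)⁻¹ else 0 := by
    refine sum_le_sum fun l _ => ?_
    have hm := modeSq_nonneg l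
    have hm' := modeSq_nonneg (k - l)
    by_cases hc : cutoff ε l (k - l) = 0
    · rw [hc, zero_mul]
      split_ifs
      · positivity
      · exact le_rfl
    · have hl := of_cutoff_ne_zero hc
      have hpos := lt_of_lt_of_le one_pos (one_le_modeSq (ne_zero_of_cutoffNorm_pos hl.1.1))
      rw [if_pos]
      · have h2 : (𝓔 k l)⁻¹ ≤ 2 * (modeSq l)⁻¹ := by
          rw [show 2 * (modeSq l)⁻¹ = (1 / 2 * modeSq l)⁻¹ by rw [mul_inv]; norm_num]
          apply inv_anti₀ (by positivity)
          linarith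
        calc _ ≤ 1 * (𝓔 k l)⁻¹ := by
              gcongr; exact cutoff_le_one _ _ _
          _ ≤ _ := by rwa [one_mul]
      · rw [mem_cube]
        intro a
        have h3 := abs_coord_le_inv hl.1 a
        have h4 : ((l a).natAbs : ℝ) ≤ ε⁻¹ := by
          rwa [Nat.cast_natAbs, Int.cast_abs]
        have h5 := Nat.le_floor h4
        rw [Int.abs_eq_natAbs]
        exact_mod_cast h5
  refine h1.trans ?_
  rw [← Finset.sum_filter, ← mul_sum]
  refine mul_le_mul_of_nonneg_left ?_ (by norm_num)
  refine Finset.sum_le_sum_of_subset_of_nonneg (fun l hl => (Finset.mem_filter.1 hl).2)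
    fun l _ _ => inv_nonneg.2 (modeSq_nonneg l)

lemma coupling_sq_of_three_le (hd : 3 ≤ d) {ε : ℝ} (hε : 0 < ε) :
    coupling d ε ^ 2 = ε ^ (d - 2) := by
  rw [coupling, if_neg (by omega), ← Real.rpow_natCast, ← Real.rpow_mul hε.le, ← Real.rpow_natCast]
  congr 1
  rw [Nat.cast_sub (by omega)]
  push_cast
  ring

lemma coupling_sq_two {ε : ℝ} (hε : 0 < ε) (hε1 : ε < 1) :
    coupling 2 ε ^ 2 = 1 / (2 * log ε⁻¹) := by
  have : 0 < log ε⁻¹ := Real.log_pos ((one_lt_inv₀ hε).2 hε1)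
  rw [coupling, if_pos rfl, div_pow, Real.log_pow, sq_sqrt (by positivity)]
  norm_num

lemma log_two_le_log_inv {ε : ℝ} (hε : 0 < ε) (hε1 : ε ≤ 1 / 2) : 1 / 2 ≤ log ε⁻¹ := by
  have h1 : (2 : ℝ) ≤ ε⁻¹ := by
    rw [le_inv_comm₀ (by norm_num) hε]; linarith
  have h2 := Real.log_le_log (by norm_num) h1
  linarith [Real.log_two_gt_d9]

lemma eventually_scale_le (d : ℕ) {δ : ℝ} (hδ : 0 < δ) :
    ∀ᶠ ε in scaleFilter d, ε ∈ scales d ∧ ε ≤ δ := by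
  have h1 : ∀ᶠ ε in scaleFilter d, ε ∈ scales d := self_mem_nhdsWithin
  have h2 : ∀ᶠ ε in scaleFilter d, ε ≤ δ :=
    (tendsto_id.mono_left nhdsWithin_le_nhds).eventually (ge_mem_nhds hδ)
  exact h1.and h2

lemma eventually_abs_coupling_le (hd : 2 ≤ d) : ∀ᶠ ε in scaleFilter d, |coupling d ε| ≤ 1 := by
  filter_upwards [eventually_scale_le d (δ := 1 / 2) (by norm_num)] with ε hε
  obtain ⟨⟨h0, h1, -⟩, h2⟩ := hε
  rw [← sq_le_one_iff_abs_le_one]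
  rcases hd.eq_or_lt with rfl | hd3
  · rw [coupling_sq_two h0 h1]
    have := log_two_le_log_inv h0 h2
    rw [div_le_one (by positivity)]
    linarith
  · rw [coupling_sq_of_three_le hd3 h0]
    exact pow_le_one₀ h0.le h1.le

lemma loopSum_le_of_three_le (hd : 3 ≤ d) {ε : ℝ} (hε : 0 < ε) (k : Mode d) :
    loopSum ε k ≤ 2 * latConst d := by
  refine (loopSum_le_sum_cube ε k).trans ?_
  rw [coupling_sq_of_three_le hd hε]
  have h1 := sum_cube_inv_modeSq_le_pow hd ⌊ε⁻¹⌋₊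
  have h2 : (⌊ε⁻¹⌋₊ : ℝ) ^ (d - 2) ≤ (ε⁻¹) ^ (d - 2) := by
    gcongr
    exact Nat.floor_le (by positivity)
  have h3 := latConst_nonneg d
  calc _ ≤ ε ^ (d - 2) * (2 * (latConst d * (ε⁻¹) ^ (d - 2))) := by
        gcongr
        exact h1.trans (by gcongr)
    _ = 2 * latConst d * (ε * ε⁻¹) ^ (d - 2) := by rw [mul_pow]; ring
    _ = _ := by rw [mul_inv_cancel₀ hε.ne', one_pow, mul_one]

lemma loopSum_le_of_eq_two {ε : ℝ} (hε : 0 < ε) (hε1 : ε ≤ 1 / 2) (k : Mode 2) :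
    loopSum ε k ≤ 3 * latConst 2 := by
  refine (loopSum_le_sum_cube ε k).trans ?_
  rw [coupling_sq_two hε (by linarith)]
  have h1 := sum_cube_inv_modeSq_le_log ⌊ε⁻¹⌋₊
  have hl := log_two_le_log_inv hε hε1
  have h2 : log ⌊ε⁻¹⌋₊ ≤ log ε⁻¹ := by
    rcases Nat.eq_zero_or_pos ⌊ε⁻¹⌋₊ with h | h
    · rw [h, Nat.cast_zero, Real.log_zero]; linarith
    · exact Real.log_le_log (by exact_mod_cast h) (Nat.floor_le (by positivity))
  have h3 := latConst_nonneg 2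
  calc _ ≤ 1 / (2 * log ε⁻¹) * (2 * (latConst 2 * (1 + log ε⁻¹))) := by
        gcongr
        exact h1.trans (by gcongr)
    _ ≤ _ := by
        rw [div_mul_eq_mul_div, one_mul, div_le_iff₀ (by positivity)]
        nlinarith

lemma exists_loopSum_le (hd : 2 ≤ d) : ∃ C₀ : ℝ, 0 ≤ C₀ ∧
    ∀ᶠ ε in scaleFilter d, ∀ k : Mode d, loopSum ε k ≤ C₀ := by
  have := latConst_nonneg d
  rcases hd.eq_or_lt with rfl | hd3
  · refine ⟨3 * latConst 2, by positivity, ?_⟩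
    filter_upwards [eventually_scale_le 2 (δ := 1 / 2) (by norm_num)] with ε hε k
    exact loopSum_le_of_eq_two hε.1.1 hε.2 k
  · refine ⟨2 * latConst d, by positivity, ?_⟩
    filter_upwards [eventually_scale_le d (δ := 1 / 2) (by norm_num)] with ε hε k
    exact loopSum_le_of_three_le hd3 hε.1.1 k

/-! ### The source of a single mode -/

lemma invLam_val_pair_sq (l m : Mode d) :
    invLam.val 2 ![l, m] ^ 2 = (1 / 2 * (modeSq l + modeSq m))⁻¹ := by
  rw [invLam_val_sq, tupleSq, Fin.sum_univ_two]
  rfl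

lemma split_singleton (p l : Mode d) : split ![p] 0 l = ![l, p - l] := by
  funext i
  fin_cases i <;> simp [split, update]

lemma merge_pair (κ : 𝕄 2) : merge κ 0 1 = ![κ 0 + κ 1] := by
  funext i
  fin_cases i
  simp [merge]

lemma co_raise_modeVec (p : Mode d) (hp : p ≠ 0) (κ : 𝕄 2) : co (raise w ε 1 2 (modeVec p hp)) 2 κ =
      if κ 0 + κ 1 = p then annihCoef d ε 1 2 1 * (invLam.val 2 κ *
        ((dotMode w p * cutoff ε (κ 0) (κ 1) * invLam.val 1 ![p] : ℝ) : ℂ)) else 0 := by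
  rw [co_raise]
  have h01 : pairTerm w ε (invLam.op (modeVec p hp)) κ 0 1 = if κ 0 + κ 1 = p then
      ((dotMode w p * cutoff ε (κ 0) (κ 1) * invLam.val 1 ![p] : ℝ) : ℂ) else 0 := by
    rw [pairTerm, if_neg (by decide), merge_pair, co_op, co_modeVec]
    by_cases h : κ 0 + κ 1 = p
    · rw [if_pos h, h, if_pos rfl]
      push_cast
      ring
    · rw [if_neg h, if_neg, mul_zero, mul_zero]
      intro h2
      rw [Sigma.mk.injEq] at h2
      exact h (congrFun (heq_eq_eq _ _ ▸ h2.2) 0)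
  have h10 := pairTerm_comm w ε (invLam.op (modeVec p hp)) κ 1 0
  have h00 : ∀ i, pairTerm w ε (invLam.op (modeVec p hp)) κ i i = 0 := fun i => if_pos rfl
  rw [Fin.sum_univ_two, Fin.sum_univ_two, Fin.sum_univ_two, h00, h00, h10, h01]
  split_ifs
  · push_cast
    ring
  · simp

/-- The second-order response to a single mode, for a Fourier multiplier `m` in place of the
resolvent, is a weighted loop sum. -/
lemma co_lower_one_of_eq (p : Mode d) (hp : p ≠ 0)
    {u : Fock d} {m : Mode d → ℝ} (hu : ∀ l, co u 2 ![l, p - l] =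
      m l * co (raise w ε 1 2 (modeVec p hp)) 2 ![l, p - l]) :
    co (lower w ε 1 2 u) 1 ![p] = (((driftMul w).val 1 ![p] * (4 / (2 * π) ^ d *
      (coupling d ε ^ 2 * ∑ l ∈ box d ε,
        cutoff ε l (p - l) * (𝓔 p l)⁻¹ * m l)) : ℝ) : ℂ) := by
  rw [co_lower, Fin.sum_univ_one]
  have hA : annihCoef d ε 1 2 1 * annihCoef d ε 1 2 1 =
      ((-(2 * coupling d ε ^ 2 / (2 * π) ^ d) : ℝ) : ℂ) := by
    have h2 : √((1 : ℕ) + 1) ^ 2 = 2 := by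
      rw [sq_sqrt (by positivity)]; norm_num
    have h3 : ((2 * π) ^ ((d : ℝ) / 2)) ^ 2 = (2 * π) ^ d := by
      rw [← Real.rpow_natCast, ← Real.rpow_mul (by positivity), ← Real.rpow_natCast]
      congr 1
      push_cast
      ring
    have h4 := (two_pi_rpow_pos ((d : ℝ) / 2)).ne'
    rw [annihCoef, if_pos (by norm_num), ← h3]
    have h5 : (((2 * π) ^ ((d : ℝ) / 2) : ℝ) : ℂ) ≠ 0 := by exact_mod_cast h4
    have h6 : ((√((1 : ℕ) + 1) : ℝ) : ℂ) ^ 2 = 2 := by exact_mod_cast h2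
    set P := (2 * π) ^ ((d : ℝ) / 2)
    set s := √((1 : ℕ) + 1)
    push_cast
    field_simp
    linear_combination (-(coupling d ε : ℂ) ^ 2) * h6 +
      (s : ℂ) ^ 2 * (coupling d ε : ℂ) ^ 2 * Complex.I_sq
  have hD : (driftMul w).val 1 ![p] = -(1 / 2) * dotMode w p ^ 2 * invLam.val 1 ![p] ^ 2 := by
    rw [invLam_val_sq]
    simp only [driftMul, tupleDotSq, Fin.sum_univ_one]
    rw [show (![p] : 𝕄 1) 0 = p from rfl]
    ring
  have hs : ∀ l ∈ box d ε, ((dotMode w (![p] 0 : Mode d) * cutoff ε l (![p] 0 - l) : ℝ) : ℂ) *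
      (invLam.val (1 + 1) (split ![p] 0 l) * co u (1 + 1) (split ![p] 0 l)) =
      annihCoef d ε 1 2 1 * (dotMode w p ^ 2 * invLam.val 1 ![p]) *
      ((cutoff ε l (p - l) * (𝓔 p l)⁻¹ * m l : ℝ) : ℂ) := by
    intro l _
    rw [split_singleton]
    have h1 := hu l
    rw [co_raise_modeVec, if_pos (by simp)] at h1
    change _ * (_ * co u 2 ![l, p - l]) = _
    rw [h1, ← invLam_val_pair_sq]
    change ((dotMode w p * cutoff ε l (p - l) : ℝ) : ℂ) * (((invLam.val 2 ![l, p - l] : ℝ) : ℂ) *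
      ((m l : ℂ) * (annihCoef d ε 1 2 1 * (_ *
        ((dotMode w p * cutoff ε l (p - l) * _ : ℝ) : ℂ))))) = _
    have h2 : (cutoff ε l (p - l) : ℂ) ^ 2 = cutoff ε l (p - l) := by
      exact_mod_cast cutoff_sq ε l (p - l)
    push_cast
    linear_combination (dotMode w p ^ 2 * (invLam.val 2 ![l, p - l] : ℂ) ^ 2 * m l *
      annihCoef d ε 1 2 1 * (invLam.val 1 ![p] : ℂ)) * h2
  rw [sum_congr rfl hs, ← mul_sum, ← Complex.ofReal_sum]
  rw [hD]
  set S := ∑ l ∈ box d ε, cutoff ε l (p - l) * (𝓔 p l)⁻¹ * m l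
  calc _ = annihCoef d ε 1 2 1 * annihCoef d ε 1 2 1 *
        (((dotMode w p ^ 2 * invLam.val 1 ![p] ^ 2 * S : ℝ)) : ℂ) := by push_cast; ring
    _ = _ := by
      rw [hA, ← ofReal_mul]
      congr 1
      ring

lemma co_lower_op_raise_modeVec (p : Mode d) (hp : p ≠ 0)
    (m : Multiplier d) : co (lower w ε 1 2 (m.op (raise w ε 1 2 (modeVec p hp)))) 1 ![p] =
      (((driftMul w).val 1 ![p] * (4 / (2 * π) ^ d *
      (coupling d ε ^ 2 * ∑ l ∈ box d ε, cutoff ε l (p - l) *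
        (𝓔 p l)⁻¹ * m.val 2 ![l, p - l])) : ℝ) : ℂ) :=
  co_lower_one_of_eq w ε p hp fun _ => m.co_op _ _ _

lemma norm_raise_modeVec_sq (p : Mode d) (hp : p ≠ 0) : ‖raise w ε 1 2 (modeVec p hp)‖ ^ 2 =
      -(driftMul w).val 1 ![p] * (4 / (2 * π) ^ d) * loopSum ε p := by
  set g := raise w ε 1 2 (modeVec p hp) with hg
  have h1 : (inner ℂ g g : ℂ) = -co (lower w ε 1 2 g) 1 ![p] := by
    conv_lhs => rw [hg, inner_raise_left, inner_modeVec]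
  rw [co_lower_one_of_eq w ε p hp (m := fun _ => 1) (fun l => by rw [Complex.ofReal_one, one_mul])]
    at h1
  have h2 : ((‖g‖ ^ 2 : ℝ) : ℂ) = inner ℂ g g := by
    rw [inner_self_eq_norm_sq_to_K]; push_cast; rfl
  rw [← h2, ← Complex.ofReal_neg, Complex.ofReal_inj] at h1
  rw [h1, loopSum]
  simp only [mul_one]
  ring

lemma norm_invLam_raise_modeVec_sq (p : Mode d)
    (hp : p ≠ 0) : ‖invLam.op (raise w ε 1 2 (modeVec p hp))‖ ^ 2 =
      -(driftMul w).val 1 ![p] * (4 / (2 * π) ^ d) * (coupling d ε ^ 2 *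
        ∑ l ∈ box d ε, cutoff ε l (p - l) * (𝓔 p l)⁻¹ ^ 2) := by
  set g := raise w ε 1 2 (modeVec p hp) with hg
  have h1 : (inner ℂ (invLam.op g) (invLam.op g) : ℂ) =
      -co (lower w ε 1 2 (invLam.op (invLam.op g))) 1 ![p] := by
    rw [inner_op]
    conv_lhs => rw [hg, inner_raise_left, inner_modeVec]
  rw [co_lower_one_of_eq w ε p hp (m := fun l => (𝓔 p l)⁻¹) (fun l => by
      rw [co_op, co_op, ← mul_assoc, ← ofReal_mul, ← sq, invLam_val_pair_sq])] at h1
  have h2 : ((‖invLam.op g‖ ^ 2 : ℝ) : ℂ) = inner ℂ (invLam.op g) (invLam.op g) := by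
    rw [inner_self_eq_norm_sq_to_K]; push_cast; rfl
  rw [← h2, ← Complex.ofReal_neg, Complex.ofReal_inj] at h1
  rw [h1]
  have : ∀ l, cutoff ε l (p - l) * (𝓔 p l)⁻¹ ^ 2 = cutoff ε l (p - l) * (𝓔 p l)⁻¹ *
      (𝓔 p l)⁻¹ := fun l => by ring
  simp only [this]
  ring

/-- Creation does not increase the `Λ⁻¹` norm, up to a constant. -/
lemma norm_invLam_raise_le {ε C₀ : ℝ} (hC : ∀ k : Mode d, loopSum ε k ≤ C₀) (a b : ℕ) (x : Fock d) :
    ‖invLam.op (raise w ε a b x)‖ ≤ √2 * (opConst w C₀ * b) * ‖invLam.op x‖ := by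
  set one : Multiplier d := ⟨fun _ _ => 1, fun _ _ _ => rfl, 1, zero_le_one, by simp⟩ with hone
  have hone' : ∀ y : Fock d, one.op y = y := fun y => Fock.ext fun n k => by
    rw [co_op]; simp [hone]
  set m₂ : Multiplier d :=
    { val := fun n k => invLam.val n k * invLam.val n k
      symm := fun n σ k => by rw [invLam.symm]
      bdd := by
        obtain ⟨c, hc, h⟩ := invLam.bdd
        refine ⟨c * c, by positivity, fun n k => ?_⟩
        rw [abs_mul]
        exact mul_le_mul (h n k) (h n k) (abs_nonneg _) hc } with hm₂
  have hm₂' : ∀ y : Fock d, m₂.op y = invLam.op (invLam.op y) := fun y =>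
    Fock.ext fun n k => by
      rw [co_op, co_op, co_op, hm₂]
      push_cast
      ring
  have h1 : ∀ y, ‖(annih w ε a b ∘L m₂.op) y‖ ≤ √2 * (opConst w C₀ * b) * ‖y‖ := by
    intro y
    have := norm_annih_between_le w hC a b one m₂ (K := √2) (by positivity) ?_ y
    · rwa [hone'] at this
    · intro n k j l hc
      have hl := ne_zero_of_cutoffNorm_pos (of_cutoff_ne_zero hc).1.1
      have hk : k j ≠ 0 := by
        have := (of_cutoff_ne_zero hc).2.2.1
        rw [add_sub_cancel] at this
        exact ne_zero_of_cutoffNorm_pos this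
      have h2 := (one_le_modeSq hk).trans (modeSq_le_tupleSq k j)
      have h3 := (one_le_modeSq hl).trans (by
        have := le_tupleSq_split k j l
        linarith [modeSq_nonneg (k j - l)] : modeSq l ≤ tupleSq (split k j l))
      have h4 := tupleSq_le_two_mul_split k j l
      have h5 : m₂.val (n + 1) (split k j l) = (1 / 2 * tupleSq (split k j l))⁻¹ := by
        rw [← invLam_val_sq, sq]
      rw [h5, sq_sqrt (by norm_num), show one.val n k = 1 from rfl, one_pow, one_mul, sq,
        ← mul_assoc]
      refine mul_le_mul_of_nonneg_right ?_ (by positivity)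
      rw [← div_eq_mul_inv, le_div_iff₀ (by positivity), inv_mul_le_iff₀ (by positivity)]
      linarith
  have h2 := norm_le_of_inner_eq_neg (A := annih w ε a b ∘L m₂.op) (B := m₂.op ∘L creat w ε a b)
    (fun x y => by
      rw [comp_apply, comp_apply, ← inner_op, inner_creat_right]) h1 (invLam.op x)
  rw [comp_apply, hm₂'] at h2
  exact h2

/-- Sums over a finite set of modes as integrals of step functions. -/
lemma integral_comp_eq_sum {X E M : Type*} [MeasurableSpace X] {μ : Measure X}
    [NormedAddCommGroup E] [NormedSpace ℝ E] [CompleteSpace E] (fl : X → M) {v : ℝ} (hv : 0 ≤ v)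
    (hm : ∀ l, MeasurableSet (fl ⁻¹' {l})) (hfl : ∀ l, μ (fl ⁻¹' {l}) = ENNReal.ofReal v)
    (s : Finset M) {F : M → E} (hF : ∀ l, l ∉ s → F l = 0) :
    Integrable (fun x => F (fl x)) μ ∧ ∫ x, F (fl x) ∂μ = v • ∑ l ∈ s, F l := by
  classical
  have h1 : (fun x => F (fl x)) = fun x => ∑ l ∈ s, (fl ⁻¹' {l}).indicator (fun _ => F l) x := by
    funext x
    by_cases hx : fl x ∈ s
    · rw [sum_eq_single (fl x)]
      · rw [Set.indicator_of_mem (show x ∈ fl ⁻¹' {fl x} from rfl)]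
      · intro l _ hl
        exact Set.indicator_of_notMem (fun h => hl (by exact h.symm)) _
      · exact fun h => absurd hx h
    · rw [hF _ hx, sum_eq_zero]
      intro l hl
      refine Set.indicator_of_notMem (fun h => hx ?_) _
      rw [show fl x = l from h]
      exact hl
  have h2 : ∀ l ∈ s, Integrable ((fl ⁻¹' {l}).indicator fun _ => F l) μ := fun l _ =>
    (integrable_indicator_iff (hm l)).2
      (integrableOn_const (by rw [hfl]; exact ENNReal.ofReal_ne_top))
  rw [h1]
  refine ⟨integrable_finsetSum s h2, ?_⟩
  rw [integral_finsetSum s h2, Finset.smul_sum]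
  refine sum_congr rfl fun l _ => ?_
  rw [integral_indicator_const _ (hm l), Measure.real, hfl, ENNReal.toReal_ofReal hv]

/-! ### Decay of the solutions in dimension two -/

lemma tendsto_log_inv_atTop : Tendsto (fun ε : ℝ => log ε⁻¹) (scaleFilter d) atTop := by
  have h1 : Tendsto (fun ε : ℝ => ε) (scaleFilter d) (𝓝[>] 0) :=
    tendsto_nhdsWithin_of_tendsto_nhds_of_eventually_within _
      (tendsto_id.mono_left nhdsWithin_le_nhds) (by
        filter_upwards [self_mem_nhdsWithin] with ε hε using hε.1)
  exact Real.tendsto_log_atTop.comp (tendsto_inv_nhdsGT_zero.comp h1)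

lemma tendsto_coupling_sq_two : Tendsto (fun ε : ℝ => coupling 2 ε ^ 2) (scaleFilter 2) (𝓝 0) := by
  have h : Tendsto (fun ε : ℝ => (2 * log ε⁻¹)⁻¹) (scaleFilter 2) (𝓝 0) :=
    (tendsto_log_inv_atTop.const_mul_atTop (by norm_num)).inv_tendsto_atTop
  refine h.congr' ?_
  filter_upwards [self_mem_nhdsWithin] with ε hε
  rw [coupling_sq_two hε.1 hε.2.1, one_div]

lemma norm_sq_le_modeSq (l : Mode d) : ‖l‖ ^ 2 ≤ modeSq l := by
  have h1 : ‖l‖ ≤ √(modeSq l) := by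
    refine (pi_norm_le_iff_of_nonneg (sqrt_nonneg _)).2 fun a => ?_
    rw [Int.norm_eq_abs]
    exact Real.abs_le_sqrt (Finset.single_le_sum (f := fun a => (l a : ℝ) ^ 2)
      (fun _ _ => sq_nonneg _) (mem_univ a))
  calc ‖l‖ ^ 2 ≤ √(modeSq l) ^ 2 := by gcongr
    _ = _ := sq_sqrt (modeSq_nonneg l)

lemma one_le_norm_mode {l : Mode d} (hl : l ≠ 0) : 1 ≤ ‖l‖ := by
  obtain ⟨a, ha⟩ := Function.ne_iff.1 hl
  refine le_trans ?_ (norm_le_pi_norm l a)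
  rw [Int.norm_eq_abs]
  exact_mod_cast Int.one_le_abs ha

/-- In dimension two, weighted loop sums with an additional decay are negligible: the coupling
vanishes and `∑ |ℓ|⁻³` is finite. -/
lemma tendsto_coupling_sq_mul_sum (p : Mode 2) {B : ℝ} (hB : 0 ≤ B)
    {h : ℝ → Mode 2 → ℝ} (hh : ∀ᶠ ε in scaleFilter 2, ∀ l, l ≠ 0 → |h ε l| ≤ B * ‖l‖ ^ (-3 : ℝ)) :
    Tendsto (fun ε => coupling 2 ε ^ 2 * ∑ l ∈ box 2 ε, cutoff ε l (p - l) * h ε l)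
      (scaleFilter 2) (𝓝 0) := by
  have hs := EisensteinSeries.summable_one_div_norm_rpow (k := 3) (by norm_num)
  have h1 := tendsto_coupling_sq_two.mul_const (B * ∑' l : Mode 2, ‖l‖ ^ (-3 : ℝ))
  rw [zero_mul] at h1
  refine squeeze_zero_norm' ?_ h1
  filter_upwards [hh] with ε hε
  rw [norm_mul, norm_eq_abs, abs_of_nonneg (sq_nonneg _)]
  refine mul_le_mul_of_nonneg_left ?_ (sq_nonneg _)
  refine (norm_sum_le _ _).trans ?_
  rw [← tsum_mul_left]
  refine (sum_le_sum fun l _ => ?_).trans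
    ((hs.mul_left B).sum_le_tsum (box 2 ε) fun l _ => by positivity)
  rw [norm_mul, norm_eq_abs, norm_eq_abs, abs_of_nonneg (cutoff_nonneg _ _ _)]
  by_cases hl : l = 0
  · rw [hl, cutoff_zero_left, zero_mul]
    positivity
  · calc _ ≤ 1 * |h ε l| := by gcongr; exact cutoff_le_one _ _ _
      _ ≤ _ := by rw [one_mul]; exact hε l hl

lemma tendsto_invLam_raise_modeVec (w : 𝔼 2) (p : Mode 2) (hp : p ≠ 0) :
    Tendsto (fun ε => invLam.op (raise w ε 1 2 (modeVec p hp))) (scaleFilter 2) (𝓝 0) := by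
  have h1 := (tendsto_coupling_sq_mul_sum p (B := 4) (by norm_num) (h := fun _ l => (𝓔 p l)⁻¹ ^ 2)
    (Eventually.of_forall fun _ l hl => by
      have h2 := norm_sq_le_modeSq l
      have h3 := one_le_norm_mode hl
      have h4 := modeSq_nonneg (p - l)
      rw [abs_of_nonneg (by positivity)]
      have h5 : (𝓔 p l)⁻¹ ≤ (1 / 2 * ‖l‖ ^ 2)⁻¹ := by
        apply inv_anti₀ (by positivity)
        linarith
      calc _ ≤ (1 / 2 * ‖l‖ ^ 2)⁻¹ ^ 2 := by
            have : 0 ≤ modeSq l := modeSq_nonneg l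
            gcongr
        _ = 4 * (‖l‖ ^ 4)⁻¹ := by rw [mul_inv, mul_pow, inv_pow, inv_pow, ← pow_mul]; norm_num
        _ ≤ 4 * (‖l‖ ^ 3)⁻¹ := by
            gcongr
            norm_num
        _ = _ := by rw [Real.rpow_neg (norm_nonneg _)]; norm_cast)).const_mul
    (-(driftMul w).val 1 ![p] * (4 / (2 * π) ^ 2))
  simp only [← norm_invLam_raise_modeVec_sq w _ p hp, mul_zero] at h1
  rw [tendsto_zero_iff_norm_tendsto_zero]
  have h2 := h1.sqrt
  rw [Real.sqrt_zero] at h2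
  exact h2.congr fun ε => Real.sqrt_sq (norm_nonneg _)

lemma invLam_downCreat (q : Mode d) (N : ℕ) (u : Fock d) : invLam.op (downCreat q N u) =
    downCreat q N ((ratioDown q).op (invLam.op u)) := by
  refine Fock.ext_inner_left fun χ => ?_
  rw [← inner_op, inner_downCreat, inner_downCreat, ← inner_op,
    ← inner_op, Multiplier.op_comm, invLam_downAnnih]
  rfl

/-- In dimension two already the first step of the ladder vanishes in the Fock space norm. -/
lemma tendsto_invLam_raise (w : 𝔼 2) {i : ℕ} (hi : i = 2 ∨ i = 3) (y : Fock 2) :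
    Tendsto (fun ε => invLam.op (raise w ε (i - 1) i y)) (scaleFilter 2) (𝓝 0) := by
  obtain ⟨C₀, -, hC⟩ := exists_loopSum_le (le_refl 2)
  have hK := norm_weakOp_le w hC i (R := fun _ => ContinuousLinearMap.id ℂ (Fock 2))
    fun _ _ => le_rfl
  have h0 := fun r h ε => weakOp_eq_zero w i
    (fun _ => ContinuousLinearMap.id ℂ (Fock 2)) ε (r := r) h
  rcases hi with rfl | rfl
  · exact tendsto_zero_of_modeVec _ hK (tendsto_invLam_raise_modeVec w) h0 y
  · refine tendsto_zero_of_pairVec _ hK (N := 3) (by norm_num) (fun p q hp hq => ?_) h0 y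
    have h1 : ∀ p q : Mode 2, ∀ hp : p ≠ 0, Tendsto (fun ε =>
        invLam.op (downCreat q 3 (modeSource w ε p hp))) (scaleFilter 2) (𝓝 0) := by
      intro p q hp
      simp only [invLam_downCreat, modeSource_eq, map_smul]
      have h2 := ((((downCreat q 3) ∘L (ratioDown q).op).continuous.tendsto 0).comp
        (tendsto_invLam_raise_modeVec w p hp)).const_smul (lamMode p : ℂ)
      rw [map_zero, smul_zero] at h2
      exact h2
    have h2 := (h1 p q hp).add (h1 q p hq)
    rw [add_zero] at h2
    refine h2.congr fun ε => ?_
    rw [← map_add, ← raise_two_upCreat w ε p q hp hq (by norm_num)]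
    rfl

lemma tendsto_invLam_ladderSum (w : 𝔼 2) {i : ℕ} (hi : i = 2 ∨ i = 3) (n : ℕ) (y : Fock 2) :
    Tendsto (fun ε => invLam.op (ladderSum w ε i n y)) (scaleFilter 2) (𝓝 0) := by
  obtain ⟨C₀, -, hC⟩ := exists_loopSum_le (le_refl 2)
  have hle : ∀ ε x, ‖invLam.op ((effMul w ε).op x)‖ ≤ ‖invLam.op x‖ := fun ε x => by
    rw [Multiplier.op_comm]; exact norm_effMul_le w ε _
  have h : ∀ j, Tendsto (fun ε => ‖invLam.op (ladder w ε i n y j)‖) (scaleFilter 2) (𝓝 0) := by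
    intro j
    induction j with
    | zero =>
      exact squeeze_zero (fun _ => norm_nonneg _) (fun ε => hle ε _)
        (tendsto_zero_iff_norm_tendsto_zero.1 (tendsto_invLam_raise w hi y))
    | succ j ih =>
      refine squeeze_zero_norm' ?_ (by simpa using ih.const_mul (√2 * (opConst w C₀ * n)))
      filter_upwards [hC] with ε hε
      rw [norm_norm]
      exact (hle ε _).trans (norm_invLam_raise_le w hε i n _)
  have h2 := tendsto_finsetSum (range (n - i + 1)) fun j _ =>
    tendsto_zero_iff_norm_tendsto_zero.2 (h j)
  rw [Finset.sum_const_zero] at h2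
  simpa only [ladderSum, map_sum] using h2

/-! ### The angular and the radial integral in dimension two -/

/-- `∫ dθ / (1 + a |𝔴·e_θ|²) = 2π / √(1 + a |𝔴|²)`, written with the components `c`, `s` of `e_θ`
along and across `𝔴`. -/
lemma integral_inv_one_add_sq {c s : ℝ → ℝ} (hc : ∀ θ, HasDerivAt c (-s θ) θ)
    (hs : ∀ θ, HasDerivAt s (c θ) θ) (hcs : ∀ θ, c θ ^ 2 + s θ ^ 2 = 1)
    (hcp : c π = c (-π)) (hsp : s π = s (-π)) {b : ℝ} (hb : 1 ≤ b) :
    ∫ θ in (-π)..Real.pi, (1 + (b ^ 2 - 1) * c θ ^ 2)⁻¹ = 2 * π / b := by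
  have hD : ∀ θ, 0 < b * c θ ^ 2 + s θ ^ 2 := fun θ => by
    nlinarith [hcs θ, sq_nonneg (c θ), sq_nonneg (s θ)]
  have hE : ∀ θ, 0 < b ^ 2 * c θ ^ 2 + s θ ^ 2 := fun θ => by
    have : 0 ≤ (b ^ 2 - 1) * c θ ^ 2 := mul_nonneg (by nlinarith) (sq_nonneg _)
    linarith [hcs θ]
  -- `tan (θ - φ)` with `tan φ = tan θ / b` gives a primitive without branch points.
  set u : ℝ → ℝ := fun θ => (b - 1) * (s θ * c θ) / (b * c θ ^ 2 + s θ ^ 2) with hu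
  have hu' : ∀ θ, HasDerivAt u
      ((b - 1) * (b * c θ ^ 2 - s θ ^ 2) / (b * c θ ^ 2 + s θ ^ 2) ^ 2) θ := by
    intro θ
    have h1 := (((hs θ).mul (hc θ)).const_mul (b - 1)).div
      ((((hc θ).pow 2).const_mul b).add ((hs θ).pow 2)) (hD θ).ne'
    refine h1.congr_deriv ?_
    congr 1
    have h2 := hcs θ
    push_cast
    simp only [Pi.mul_apply, Pi.add_apply, Pi.pow_apply]
    linear_combination (b - 1) * (b * c θ ^ 2 - s θ ^ 2) * h2
  have hder : ∀ θ, HasDerivAt (fun θ => b⁻¹ * (θ - Real.arctan (u θ)))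
      (1 + (b ^ 2 - 1) * c θ ^ 2)⁻¹ θ := by
    intro θ
    have h1 := ((hasDerivAt_id θ).sub (hu' θ).arctan).const_mul b⁻¹
    refine h1.congr_deriv ?_
    have h2 : 1 + u θ ^ 2 = (b ^ 2 * c θ ^ 2 + s θ ^ 2) / (b * c θ ^ 2 + s θ ^ 2) ^ 2 := by
      rw [hu, eq_div_iff (pow_ne_zero 2 (hD θ).ne')]
      simp only
      rw [div_pow, add_mul, div_mul_cancel₀ _ (pow_ne_zero 2 (hD θ).ne')]
      linear_combination (b ^ 2 * c θ ^ 2 + s θ ^ 2) * hcs θ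
    have h3 : 1 + (b ^ 2 - 1) * c θ ^ 2 = b ^ 2 * c θ ^ 2 + s θ ^ 2 := by
      linear_combination -hcs θ
    have h4 := (hD θ).ne'
    have h5 := (hE θ).ne'
    have hb0 : b ≠ 0 := by linarith
    rw [h2, h3]
    field_simp
    linear_combination b * hcs θ
  have hcont : Continuous fun θ => (1 + (b ^ 2 - 1) * c θ ^ 2)⁻¹ := by
    have hcc : Continuous c := continuous_iff_continuousAt.2 fun θ => (hc θ).continuousAt
    refine Continuous.inv₀ (by fun_prop) fun θ => ?_
    have : 0 ≤ (b ^ 2 - 1) * c θ ^ 2 := mul_nonneg (by nlinarith) (sq_nonneg _)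
    positivity
  rw [intervalIntegral.integral_eq_sub_of_hasDerivAt (fun θ _ => hder θ)
    (hcont.intervalIntegrable _ _)]
  have hup : u π = u (-π) := by rw [hu]; simp only [hcp, hsp]
  rw [hup]
  ring

/-- The scalar product of `𝔴` with the unit vector of angle `θ`. -/
def dotAngle (w : 𝔼 2) (θ : ℝ) : ℝ := w 0 * Real.cos θ + w 1 * Real.sin θ

lemma norm_sq_two (w : 𝔼 2) : ‖w‖ ^ 2 = w 0 ^ 2 + w 1 ^ 2 := by
  rw [EuclideanSpace.norm_sq_eq, Fin.sum_univ_two, norm_eq_abs, norm_eq_abs, sq_abs, sq_abs]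

lemma integral_inv_one_add_dotAngle (w : 𝔼 2) (hw : w ≠ 0) {a : ℝ}
    (ha : 0 ≤ a) : ∫ θ in (-π)..Real.pi, (1 + dotAngle w θ ^ 2 * a)⁻¹ =
      2 * π / √(1 + ‖w‖ ^ 2 * a) := by
  have hw0 : 0 < ‖w‖ := norm_pos_iff.2 hw
  have hn := norm_sq_two w
  have h1 := integral_inv_one_add_sq (c := fun θ => dotAngle w θ / ‖w‖)
    (s := fun θ => (w 0 * Real.sin θ - w 1 * Real.cos θ) / ‖w‖)
    (b := √(1 + ‖w‖ ^ 2 * a)) (fun θ => by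
      have := ((((Real.hasDerivAt_cos θ).const_mul (w 0)).add
        ((Real.hasDerivAt_sin θ).const_mul (w 1))).div_const ‖w‖)
      exact this.congr_deriv (by ring)) (fun θ => by
      have := ((((Real.hasDerivAt_sin θ).const_mul (w 0)).sub
        ((Real.hasDerivAt_cos θ).const_mul (w 1))).div_const ‖w‖)
      exact this.congr_deriv (by rw [dotAngle]; ring)) (fun θ => by
      rw [div_pow, div_pow, ← add_div, div_eq_one_iff_eq (by positivity), hn, dotAngle]
      linear_combination (w 0 ^ 2 + w 1 ^ 2) * Real.cos_sq_add_sin_sq θ) (by simp [dotAngle])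
    (by simp) (by rw [Real.one_le_sqrt]; linarith [mul_nonneg (sq_nonneg ‖w‖) ha])
  rw [← h1]
  refine intervalIntegral.integral_congr fun θ _ => ?_
  rw [sq_sqrt (by positivity), div_pow]
  congr 2
  field_simp
  ring

lemma one_add_norm_sq_mul_funG (hw : w ≠ 0) (x : ℝ) :
    1 + ‖w‖ ^ 2 * funG w x = (3 * ‖w‖ ^ 2 / (2 * π) * x + 1) ^ (2 / 3 : ℝ) := by
  have hw0 : ‖w‖ ≠ 0 := norm_ne_zero_iff.2 hw
  rw [funG]
  field_simp
  ring

lemma continuousOn_funG : Continuous (funG w) := by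
  unfold funG
  have : Continuous fun x : ℝ => x ^ (2 / 3 : ℝ) := Real.continuous_rpow_const (by norm_num)
  fun_prop

lemma integral_inv_sqrt_funG (hw : w ≠ 0) :
    ∫ s in (0 : ℝ)..1, 2 * π / √(1 + ‖w‖ ^ 2 * funG w (1 - s)) = 2 * π ^ 2 * funG w 1 := by
  have hw0 : 0 < ‖w‖ := norm_pos_iff.2 hw
  set β : ℝ := 3 * ‖w‖ ^ 2 / (2 * π) with hβ
  have hβ0 : 0 < β := by have := Real.pi_pos; positivity
  rw [intervalIntegral.integral_comp_sub_left
    (fun s => 2 * π / √(1 + ‖w‖ ^ 2 * funG w s)) 1, sub_self, sub_zero]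
  have hder : ∀ x ∈ Set.uIcc (0 : ℝ) 1, HasDerivAt
      (fun x => 2 * π ^ 2 / ‖w‖ ^ 2 * (β * x + 1) ^ (2 / 3 : ℝ))
      (2 * π / √(1 + ‖w‖ ^ 2 * funG w x)) x := by
    intro x hx
    rw [Set.uIcc_of_le zero_le_one] at hx
    have hpos : 0 < β * x + 1 := by have := mul_nonneg hβ0.le hx.1; linarith
    have h1 := ((((hasDerivAt_id x).const_mul β).add_const 1).rpow_const (p := 2 / 3)
      (Or.inl hpos.ne')).const_mul (2 * π ^ 2 / ‖w‖ ^ 2)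
    refine h1.congr_deriv ?_
    rw [one_add_norm_sq_mul_funG w hw, Real.sqrt_eq_rpow, ← Real.rpow_mul hpos.le,
      div_eq_mul_inv (2 * π), ← Real.rpow_neg hpos.le]
    rw [show (2 / 3 - 1 : ℝ) = -(2 / 3 * (1 / 2)) by norm_num]
    simp only [id]
    rw [hβ]
    field_simp
  have hcont : ContinuousOn (fun x => 2 * π / √(1 + ‖w‖ ^ 2 * funG w x)) (Set.uIcc 0 1) := by
    rw [Set.uIcc_of_le zero_le_one]
    refine ContinuousOn.div (by fun_prop) ?_ fun x hx => ?_
    · exact (Real.continuous_sqrt.comp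
        (continuous_const.add (continuous_const.mul (continuousOn_funG w)))).continuousOn
    · have := mul_nonneg (sq_nonneg ‖w‖) (funG_nonneg w hx.1)
      exact (sqrt_pos.2 (by linarith)).ne'
  rw [intervalIntegral.integral_eq_sub_of_hasDerivAt hder hcont.intervalIntegrable, funG, ← hβ]
  simp only [mul_zero, mul_one, zero_add, Real.one_rpow]
  ring

/-! ### Lattice sums in logarithmic polar coordinates -/

/-- The lattice point closest to a point of the plane. -/
def roundMode (x : ℝ × ℝ) : Mode 2 := ![round x.1, round x.2]

lemma measurable_roundMode : Measurable roundMode := by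
  have hr : Measurable (round : ℝ → ℤ) := by
    have : (round : ℝ → ℤ) = fun x => ⌊x + 1 / 2⌋ := funext fun x => round_eq x
    rw [this]
    exact Int.measurable_floor.comp (measurable_id.add_const _)
  refine measurable_pi_lambda _ fun a => ?_
  fin_cases a
  · exact hr.comp measurable_fst
  · exact hr.comp measurable_snd

lemma volume_roundMode_preimage (l : Mode 2) :
    volume (roundMode ⁻¹' {l}) = ENNReal.ofReal 1 := by
  have h : roundMode ⁻¹' {l} = Set.Ico ((l 0 : ℝ) - 1 / 2) (l 0 + 1 / 2) ×ˢ
      Set.Ico ((l 1 : ℝ) - 1 / 2) (l 1 + 1 / 2) := by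
    have hr : ∀ (x : ℝ) (n : ℤ), round x = n ↔ x ∈ Set.Ico ((n : ℝ) - 1 / 2) (n + 1 / 2) := by
      intro x n
      rw [round_eq, Int.floor_eq_iff, Set.mem_Ico]
      constructor <;> rintro ⟨h1, h2⟩ <;> constructor <;> linarith
    ext x
    rw [Set.mem_preimage, Set.mem_singleton_iff, Set.mem_prod, ← hr, ← hr]
    constructor
    · rintro rfl; exact ⟨rfl, rfl⟩
    · rintro ⟨h1, h2⟩
      funext a
      fin_cases a
      · exact h1
      · exact h2
  rw [h, Measure.volume_eq_prod, Measure.prod_prod, Real.volume_Ico, Real.volume_Ico,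
    ← ENNReal.ofReal_mul (by linarith)]
  congr 1
  ring

/-- The point of the plane with polar coordinates `(e^{sL}, θ)`. -/
def logPolar (L : ℝ) (z : ℝ × ℝ) : ℝ × ℝ :=
  (exp (z.1 * L) * Real.cos z.2, exp (z.1 * L) * Real.sin z.2)

lemma integral_logPolar {L : ℝ} (hL : 0 < L) (f : ℝ × ℝ → ℝ) : ∫ z in Set.univ ×ˢ Set.Ioo (-π) π,
      L * exp (z.1 * L) ^ 2 * f (logPolar L z) = ∫ x, f x := by
  rw [← integral_comp_polarCoord_symm]
  set e : ℝ × ℝ → ℝ × ℝ := fun z => (exp (z.1 * L), z.2) with he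
  have himg : e '' (Set.univ ×ˢ Set.Ioo (-π) π) = polarCoord.target := by
    ext ⟨r, θ⟩
    rw [polarCoord_target]
    constructor
    · rintro ⟨z, hz, h⟩
      obtain ⟨rfl, rfl⟩ := Prod.mk.inj h
      exact ⟨exp_pos _, hz.2⟩
    · rintro ⟨hr, hθ⟩
      refine ⟨(log r / L, θ), ⟨trivial, hθ⟩, ?_⟩
      rw [he]
      simp only
      rw [div_mul_cancel₀ _ hL.ne', Real.exp_log hr]
  have hder : ∀ z ∈ (Set.univ ×ˢ Set.Ioo (-π) π : Set (ℝ × ℝ)),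
      HasFDerivWithinAt e ((ContinuousLinearMap.toSpanSingleton ℝ
        (exp (z.1 * L) * L)).prodMap (ContinuousLinearMap.id ℝ ℝ))
        (Set.univ ×ˢ Set.Ioo (-π) π) z := by
    intro z _
    have h1 : HasDerivAt (fun s => exp (s * L)) (exp (z.1 * L) * L) z.1 := by
      simpa using ((hasDerivAt_id z.1).mul_const L).exp
    exact (HasFDerivAt.prodMap (p := z) h1.hasFDerivAt (hasFDerivAt_id z.2)).hasFDerivWithinAt
  have hinj : Set.InjOn e (Set.univ ×ˢ Set.Ioo (-π) π) := by
    rintro ⟨s, θ⟩ - ⟨s', θ'⟩ - h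
    obtain ⟨h1, rfl⟩ := Prod.mk.inj h
    exact Prod.ext (mul_right_cancel₀ hL.ne' (Real.exp_injective h1)) rfl
  rw [← himg, integral_image_eq_integral_abs_det_fderiv_smul volume
    (MeasurableSet.univ.prod measurableSet_Ioo) hder hinj]
  refine setIntegral_congr_fun (MeasurableSet.univ.prod measurableSet_Ioo) fun z _ => ?_
  have hdet : ((ContinuousLinearMap.toSpanSingleton ℝ (exp (z.1 * L) * L)).prodMap
      (ContinuousLinearMap.id ℝ ℝ)).det = exp (z.1 * L) * L := by
    rw [ContinuousLinearMap.det, ContinuousLinearMap.coe_prodMap, LinearMap.det_prodMap]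
    simp
  rw [hdet, abs_of_pos (by positivity), smul_eq_mul, smul_eq_mul, polarCoord_symm_apply]
  simp only [logPolar, he]
  ring

lemma inv_mul_sum_eq_integral_logPolar {L : ℝ} (hL : 0 < L) (s : Finset (Mode 2))
    {F : Mode 2 → ℝ} (hF : ∀ l, l ∉ s → F l = 0) :
    L⁻¹ * ∑ l ∈ s, F l = ∫ z in Set.univ ×ˢ Set.Ioo (-π) π,
      exp (z.1 * L) ^ 2 * F (roundMode (logPolar L z)) := by
  have h1 := (integral_comp_eq_sum (μ := volume) roundMode zero_le_one
    (fun l => measurable_roundMode (measurableSet_singleton l)) volume_roundMode_preimage s hF).2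
  rw [one_smul] at h1
  rw [← h1, ← integral_logPolar hL, ← integral_const_mul]
  congr 1
  funext z
  field_simp

/-! ### The effective diffusivity in dimension two -/

/-- The limiting density of the loop sum in logarithmic polar coordinates. -/
def loopDensity (w : 𝔼 2) (z : ℝ × ℝ) : ℝ := (1 + dotAngle w z.2 ^ 2 * funG w (1 - z.1))⁻¹

lemma integral_loopDensity (w : 𝔼 2) (hw : w ≠ 0) : ∫ z in Set.univ ×ˢ Set.Ioo (-π) π,
      (Set.Ioo (0 : ℝ) 1 ×ˢ Set.univ).indicator (loopDensity w) z = 2 * π ^ 2 * funG w 1 := by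
  have hpi := Real.pi_pos
  rw [setIntegral_indicator (measurableSet_Ioo.prod MeasurableSet.univ), Set.prod_inter_prod,
    Set.univ_inter, Set.inter_univ, Measure.volume_eq_prod]
  have hint : IntegrableOn (loopDensity w)
      (Set.Ioo (0 : ℝ) 1 ×ˢ Set.Ioo (-π) π) (volume.prod volume) := by
    have h1 : ContinuousOn (loopDensity w) (Set.Icc (0 : ℝ) 1 ×ˢ Set.Icc (-π) π) := by
      have hG := continuousOn_funG w
      refine ContinuousOn.inv₀ ?_ fun z hz => ?_
      · have : Continuous fun z : ℝ × ℝ => 1 + dotAngle w z.2 ^ 2 * funG w (1 - z.1) := by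
          unfold dotAngle
          fun_prop
        exact this.continuousOn
      · have := funG_nonneg w (x := 1 - z.1) (by linarith [hz.1.2])
        positivity
    exact (h1.integrableOn_compact (isCompact_Icc.prod isCompact_Icc)).mono_set
      (Set.prod_mono Set.Ioo_subset_Icc_self Set.Ioo_subset_Icc_self)
  rw [setIntegral_prod _ hint, ← integral_inv_sqrt_funG w hw,
    intervalIntegral.integral_of_le zero_le_one, integral_Ioc_eq_integral_Ioo]
  refine setIntegral_congr_fun measurableSet_Ioo fun s hs => ?_
  simp only [loopDensity]
  rw [← integral_inv_one_add_dotAngle w hw (funG_nonneg w (by linarith [hs.2])),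
    intervalIntegral.integral_of_le (by linarith), integral_Ioc_eq_integral_Ioo]

/-- The summand of the loop sum with the effective resolvent and a spectator `q`. -/
def loopTerm (w : 𝔼 2) (p q : Mode 2) (ε : ℝ) (l : Mode 2) : ℝ := cutoff ε l (p - l) * (𝓔 p l)⁻¹ *
    ((effMul w ε).shift q).val 2 ![l, p - l]

lemma cutoffNorm_two (l : Mode 2) : cutoffNorm l = √(modeSq l) := by
  rw [cutoffNorm, if_pos rfl]

lemma logPolar_sq (L : ℝ) (z : ℝ × ℝ) :
    (logPolar L z).1 ^ 2 + (logPolar L z).2 ^ 2 = exp (z.1 * L) ^ 2 := by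
  simp only [logPolar]
  linear_combination exp (z.1 * L) ^ 2 * Real.cos_sq_add_sin_sq z.2

lemma modeSq_roundMode_bounds (x : ℝ × ℝ) (h : roundMode x ≠ 0) :
    x.1 ^ 2 + x.2 ^ 2 ≤ 3 * modeSq (roundMode x) ∧
      modeSq (roundMode x) ≤ 4 * (x.1 ^ 2 + x.2 ^ 2) := by
  have h1 := one_le_modeSq h
  have e : modeSq (roundMode x) = (round x.1 : ℝ) ^ 2 + (round x.2 : ℝ) ^ 2 := by
    rw [modeSq, Fin.sum_univ_two]; rfl
  have hup : ∀ y : ℝ, y ^ 2 ≤ 2 * (round y : ℝ) ^ 2 + 1 / 2 := fun y => by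
    have := abs_le.1 (abs_sub_round y)
    nlinarith [sq_nonneg (y - 2 * (round y : ℝ))]
  have hlow : ∀ y : ℝ, (round y : ℝ) ^ 2 ≤ 4 * y ^ 2 := fun y => by
    have h2 := abs_le.1 (abs_sub_round y)
    have h3 : |(round y : ℝ)| ≤ 2 * |y| := by
      by_cases h0 : round y = 0
      · rw [h0, Int.cast_zero, abs_zero]; positivity
      · have h4 : (1 : ℝ) ≤ |(round y : ℝ)| := by exact_mod_cast Int.one_le_abs h0
        have h5 := abs_sub_abs_le_abs_sub (round y : ℝ) y
        rw [abs_sub_comm] at h5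
        linarith [abs_sub_round y]
    rw [← sq_abs, ← sq_abs y]
    nlinarith [abs_nonneg (round y : ℝ), abs_nonneg y]
  rw [e] at h1 ⊢
  constructor
  · linarith [hup x.1, hup x.2]
  · linarith [hlow x.1, hlow x.2]

lemma loopTerm_nonneg (w : 𝔼 2) (p q : Mode 2) (ε : ℝ) (l : Mode 2) : 0 ≤ loopTerm w p q ε l := by
  have h1 := modeSq_nonneg l
  have h2 := modeSq_nonneg (p - l)
  have h3 := cutoff_nonneg ε l (p - l)
  have h4 : 0 ≤ ((effMul w ε).shift q).val 2 ![l, p - l] := effMul_nonneg w ε _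
  unfold loopTerm
  positivity

lemma loopTerm_le (w : 𝔼 2) (p q : Mode 2) (ε : ℝ) {l : Mode 2} (hl : l ≠ 0) :
    loopTerm w p q ε l ≤ 2 / modeSq l := by
  have h1 := one_le_modeSq hl
  have h2 := modeSq_nonneg (p - l)
  have h3 := cutoff_nonneg ε l (p - l)
  have h4 : ((effMul w ε).shift q).val 2 ![l, p - l] ≤ 1 := effMul_le_one w ε _
  have h5 : (𝓔 p l)⁻¹ ≤ 2 / modeSq l := by
    rw [show 2 / modeSq l = (1 / 2 * modeSq l)⁻¹ by rw [mul_inv]; norm_num; rfl]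
    apply inv_anti₀ (by positivity)
    linarith
  calc _ ≤ 1 * (2 / modeSq l) * 1 := by
        unfold loopTerm
        have h6 : 0 ≤ ((effMul w ε).shift q).val 2 ![l, p - l] := effMul_nonneg w ε _
        have := cutoff_le_one ε l (p - l)
        gcongr
    _ = _ := by ring

/-- A non-vanishing term of the loop sum sits, in logarithmic polar coordinates, essentially at
`0 ≤ s ≤ 1`. -/
lemma of_loopTerm_ne_zero (w : 𝔼 2) (p q : Mode 2) {ε : ℝ} (hε : 0 < ε)
    {z : ℝ × ℝ} {L : ℝ} (hL : L = log ε⁻¹)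
    (h : loopTerm w p q ε (roundMode (logPolar L z)) ≠ 0) :
    roundMode (logPolar L z) ≠ 0 ∧ exp (z.1 * L) ^ 2 ≤ 3 * exp L ^ 2 ∧
      1 ≤ 4 * exp (z.1 * L) ^ 2 := by
  have hc : cutoff ε (roundMode (logPolar L z)) (p - roundMode (logPolar L z)) ≠ 0 := by
    intro h0
    exact h (by rw [loopTerm, h0, zero_mul, zero_mul])
  have h1 := (of_cutoff_ne_zero hc).1
  have hne := ne_zero_of_cutoffNorm_pos h1.1
  have h2 := modeSq_roundMode_bounds _ hne
  rw [logPolar_sq] at h2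
  have h3 : exp L = ε⁻¹ := by rw [hL, Real.exp_log (inv_pos.2 hε)]
  have h4 : modeSq (roundMode (logPolar L z)) ≤ exp L ^ 2 := by
    have h5 := h1.2
    rw [cutoffNorm_two, ← le_div_iff₀' hε, one_div, ← h3] at h5
    exact (Real.sqrt_le_left (exp_pos L).le).1 h5
  exact ⟨hne, by linarith, by linarith [one_le_modeSq hne]⟩

lemma loopTerm_mul_le (w : 𝔼 2) (p q : Mode 2) {ε : ℝ} (hε : 0 < ε)
    {z : ℝ × ℝ} {L : ℝ} (hL : L = log ε⁻¹) (hL1 : 1 ≤ L)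
    (hz : z ∈ Set.univ ×ˢ Set.Ioo (-π) π) :
    ‖exp (z.1 * L) ^ 2 * loopTerm w p q ε (roundMode (logPolar L z))‖ ≤
      (Set.Icc (-1 : ℝ) 2 ×ˢ Set.Icc (-π) π).indicator (fun _ => (6 : ℝ)) z := by
  by_cases h0 : loopTerm w p q ε (roundMode (logPolar L z)) = 0
  · rw [h0, mul_zero, norm_zero]
    exact Set.indicator_nonneg (fun _ _ => by norm_num) _
  obtain ⟨h1, h2, h3⟩ := of_loopTerm_ne_zero w p q hε hL h0
  have he1 : exp 1 > 2 := by have := Real.exp_one_gt_d9; linarith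
  have he2 : exp 1 ≤ exp L := Real.exp_le_exp.2 hL1
  rw [Set.indicator_of_mem]
  · rw [norm_mul, norm_eq_abs, norm_eq_abs, abs_of_nonneg (sq_nonneg _),
      abs_of_nonneg (loopTerm_nonneg w p q ε _)]
    have h4 := one_le_modeSq h1
    have h5 := (modeSq_roundMode_bounds _ h1).1
    rw [logPolar_sq] at h5
    calc _ ≤ 3 * modeSq (roundMode (logPolar L z)) * (2 / modeSq (roundMode (logPolar L z))) := by
          gcongr
          · exact loopTerm_nonneg w p q ε _
          · exact loopTerm_le w p q ε h1
      _ = 6 := by field_simp; norm_num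
  · refine ⟨⟨?_, ?_⟩, Set.Ioo_subset_Icc_self hz.2⟩
    · by_contra hlt
      push Not at hlt
      have h6 : exp (z.1 * L) ≤ exp (-L) := Real.exp_le_exp.2 (by nlinarith)
      rw [Real.exp_neg] at h6
      have h7 : exp (z.1 * L) * exp L ≤ 1 := by
        calc _ ≤ (exp L)⁻¹ * exp L := by gcongr
          _ = 1 := inv_mul_cancel₀ (exp_pos L).ne'
      nlinarith [exp_pos (z.1 * L)]
    · by_contra hlt
      push Not at hlt
      have h6 : exp (L + L) ≤ exp (z.1 * L) := Real.exp_le_exp.2 (by nlinarith)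
      rw [Real.exp_add] at h6
      have h7 := pow_le_pow_left₀ (by positivity) h6 2
      have h8 : 4 < exp L ^ 2 := by nlinarith
      nlinarith

section Pointwise

variable {F : Filter ℝ} {ρ : ℝ → ℝ} {l : ℝ → Mode 2} {e : Fin 2 → ℝ}

lemma tendsto_modeSq_div (hl : ∀ a, Tendsto (fun ε => (l ε a : ℝ) / ρ ε) F (𝓝 (e a))) :
    Tendsto (fun ε => modeSq (l ε) / ρ ε ^ 2) F (𝓝 (∑ a, e a ^ 2)) := by
  refine (tendsto_finsetSum univ fun a _ => (hl a).pow 2).congr fun ε => ?_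
  simp only [modeSq, Finset.sum_div, div_pow]

lemma tendsto_dotMode_div (w : 𝔼 2) (hl : ∀ a, Tendsto (fun ε => (l ε a : ℝ) / ρ ε) F (𝓝 (e a))) :
    Tendsto (fun ε => dotMode w (l ε) / ρ ε) F (𝓝 (∑ a, w a * e a)) := by
  refine (tendsto_finsetSum univ fun a _ => (hl a).const_mul (w a)).congr fun ε => ?_
  simp only [dotMode, Finset.sum_div, mul_div_assoc]

end Pointwise

/-- `L^ε(x)` at a scale `x ≈ ε^{-2s}` tends to `1 - s`. -/
lemma tendsto_funL {F : Filter ℝ} {L T : ℝ → ℝ} {s : ℝ} (hs : s < 1) (hL : Tendsto L F atTop)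
    (hlam : ∀ᶠ ε in F, coupling 2 ε ^ 2 = 1 / (2 * L ε)) (hε : ∀ᶠ ε in F, ε = exp (-L ε))
    (hT : Tendsto (fun ε => T ε / exp (s * L ε) ^ 2) F (𝓝 1)) :
    Tendsto (fun ε => funL 2 ε (T ε)) F (𝓝 (1 - s)) := by
  have hη : Tendsto (fun ε => exp (-(2 * (1 - s) * L ε))) F (𝓝 0) :=
    Real.tendsto_exp_neg_atTop_nhds_zero.comp (hL.const_mul_atTop (by linarith))
  have h1 : Tendsto (fun ε => 1 + exp (-(2 * (1 - s) * L ε)) *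
      (T ε / exp (s * L ε) ^ 2)) F (𝓝 1) := by
    simpa using (hη.mul hT).const_add 1
  have h2 : Tendsto (fun ε => 1 / (2 * L ε)) F (𝓝 0) := by
    exact ((hL.const_mul_atTop (by norm_num : (0 : ℝ) < 2)).inv_tendsto_atTop).congr
      fun ε => (one_div _).symm
  have h3 := (h2.mul ((h1.log one_ne_zero).sub (hT.log one_ne_zero))).add_const (1 - s)
  rw [zero_mul, zero_add] at h3
  refine h3.congr' ?_
  filter_upwards [hlam, hε, hT.eventually (lt_mem_nhds zero_lt_one),
    hL.eventually_gt_atTop 0] with ε e1 e2 e3 e4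
  set τ := T ε / exp (s * L ε) ^ 2 with hτ
  have e5 : T ε = τ * exp (s * L ε) ^ 2 := by
    rw [hτ, div_mul_cancel₀ _ (by positivity)]
  have e6 : ε ^ 2 * T ε = exp (-(2 * (1 - s) * L ε)) * τ := by
    have : exp (-(2 * (1 - s) * L ε)) = ε ^ 2 * exp (s * L ε) ^ 2 := by
      nth_rewrite 2 [e2]
      rw [← Real.exp_nat_mul, ← Real.exp_nat_mul, ← Real.exp_add]
      congr 1
      push_cast
      ring
    rw [this, e5]
    ring
  have hpos : 0 < exp (-(2 * (1 - s) * L ε)) * τ := mul_pos (exp_pos _) e3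
  rw [funL, e1, e6, show 1 + 1 / (exp (-(2 * (1 - s) * L ε)) * τ) =
    (1 + exp (-(2 * (1 - s) * L ε)) * τ) / (exp (-(2 * (1 - s) * L ε)) * τ) by
      field_simp; ring, Real.log_div (by positivity) hpos.ne',
    Real.log_mul (exp_pos _).ne' e3.ne', Real.log_exp]
  field_simp
  ring

lemma tendsto_loopTerm_middle (w : 𝔼 2) (p q : Mode 2) (hp : p ≠ 0)
    {z : ℝ × ℝ} (h0 : 0 < z.1) (h1 : z.1 < 1) :
    Tendsto (fun ε : ℝ => exp (z.1 * log ε⁻¹) ^ 2 *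
      loopTerm w p q ε (roundMode (logPolar (log ε⁻¹) z))) (scaleFilter 2)
      (𝓝 (loopDensity w z)) := by
  set L : ℝ → ℝ := fun ε => log ε⁻¹ with hLdef
  have hL : Tendsto L (scaleFilter 2) atTop := tendsto_log_inv_atTop
  set ρ : ℝ → ℝ := fun ε => exp (z.1 * L ε) with hρ
  have hρpos : ∀ ε, 0 < ρ ε := fun ε => exp_pos _
  have hρinf : Tendsto ρ (scaleFilter 2) atTop :=
    Real.tendsto_exp_atTop.comp (hL.const_mul_atTop h0)
  have hρinv : Tendsto (fun ε => (ρ ε)⁻¹) (scaleFilter 2) (𝓝 0) := hρinf.inv_tendsto_atTop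
  set l : ℝ → Mode 2 := fun ε => roundMode (logPolar (L ε) z) with hl
  set e : Fin 2 → ℝ := ![Real.cos z.2, Real.sin z.2] with he
  have hlim : ∀ a, Tendsto (fun ε => (l ε a : ℝ) / ρ ε) (scaleFilter 2) (𝓝 (e a)) := by
    intro a
    rw [tendsto_iff_norm_sub_tendsto_zero]
    refine squeeze_zero (fun _ => norm_nonneg _) (fun ε => ?_) hρinv
    have h2 : |ρ ε * e a - l ε a| ≤ 1 / 2 := by
      fin_cases a
      · exact abs_sub_round _
      · exact abs_sub_round _
    rw [norm_eq_abs, abs_sub_comm, ← mul_div_cancel_left₀ (e a) (hρpos ε).ne', ← sub_div,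
      abs_div, abs_of_pos (hρpos ε), div_eq_mul_inv]
    refine mul_le_of_le_one_left (inv_nonneg.2 (hρpos ε).le) (by linarith)
  have hconst : ∀ q : Mode 2, ∀ a, Tendsto (fun ε => (q a : ℝ) / ρ ε) (scaleFilter 2) (𝓝 0) := by
    intro q a
    simpa [div_eq_mul_inv] using hρinv.const_mul (q a : ℝ)
  have hlim' : ∀ a, Tendsto (fun ε => ((p - l ε) a : ℝ) / ρ ε) (scaleFilter 2) (𝓝 (-e a)) := by
    intro a
    have := (hconst p a).sub (hlim a)
    rw [zero_sub] at this
    refine this.congr fun ε => ?_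
    rw [← sub_div, Pi.sub_apply, Int.cast_sub]
  have he1 : ∑ a, e a ^ 2 = 1 := by
    rw [Fin.sum_univ_two]; exact Real.cos_sq_add_sin_sq z.2
  have he2 : ∑ a, (-e a) ^ 2 = 1 := by simpa only [neg_sq] using he1
  have hdot : ∑ a, w a * e a = dotAngle w z.2 := by rw [Fin.sum_univ_two]; rfl
  have hdot' : ∑ a, w a * -e a = -dotAngle w z.2 := by
    rw [← hdot, ← Finset.sum_neg_distrib]; simp
  have m1 := tendsto_modeSq_div hlim
  have m2 := tendsto_modeSq_div hlim'
  have m3 := tendsto_modeSq_div (hconst q)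
  have d1 := tendsto_dotMode_div w hlim
  have d2 := tendsto_dotMode_div w hlim'
  have d3 := tendsto_dotMode_div w (hconst q)
  rw [he1] at m1
  rw [he2] at m2
  simp only [ne_eq, OfNat.ofNat_ne_zero, not_false_eq_true, zero_pow, Finset.sum_const_zero] at m3
  rw [hdot] at d1
  rw [hdot'] at d2
  simp only [mul_zero, Finset.sum_const_zero] at d3
  -- the energy without the spectator
  have t0 : Tendsto (fun ε => (𝓔 p (l ε)) / ρ ε ^ 2) (scaleFilter 2) (𝓝 1) := by
    have := (m1.add m2).const_mul (1 / 2)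
    rw [show (1 / 2 * (1 + 1) : ℝ) = 1 by norm_num] at this
    exact this.congr fun ε => by ring
  set κ : ℝ → Fin 3 → Mode 2 := fun ε => Fin.cons q ![l ε, p - l ε] with hκ
  have t1 : Tendsto (fun ε => (1 / 2 * tupleSq (κ ε)) / ρ ε ^ 2) (scaleFilter 2) (𝓝 1) := by
    have := t0.add (m3.const_mul (1 / 2))
    rw [mul_zero, add_zero] at this
    refine this.congr fun ε => ?_
    rw [hκ, tupleSq_cons, tupleSq, Fin.sum_univ_two]
    simp only [Matrix.cons_val_zero, Matrix.cons_val_one]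
    ring
  have t2 : Tendsto (fun ε => (1 / 2 * tupleDotSq w (κ ε)) / ρ ε ^ 2) (scaleFilter 2)
      (𝓝 (dotAngle w z.2 ^ 2)) := by
    have := (((d1.pow 2).add (d2.pow 2)).add (d3.pow 2)).const_mul (1 / 2)
    rw [show 1 / 2 * (dotAngle w z.2 ^ 2 + (-dotAngle w z.2) ^ 2 + 0 ^ 2) = dotAngle w z.2 ^ 2 by
      ring] at this
    refine this.congr fun ε => ?_
    rw [hκ, tupleDotSq, Fin.sum_univ_succ, Fin.sum_univ_two]
    simp only [Fin.cons_zero, Fin.cons_succ, Matrix.cons_val_zero, Matrix.cons_val_one]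
    ring
  have hscale : ∀ᶠ ε in scaleFilter 2, ε ∈ scales 2 := self_mem_nhdsWithin
  have hεL : ∀ᶠ ε in scaleFilter 2, ε = exp (-L ε) := by
    filter_upwards [hscale] with ε hε
    change ε = exp (-log ε⁻¹)
    rw [Real.log_inv, neg_neg, Real.exp_log hε.1]
  have t3 : Tendsto (fun ε => funG w (funL 2 ε (1 / 2 * tupleSq (κ ε)))) (scaleFilter 2)
      (𝓝 (funG w (1 - z.1))) := by
    refine ((continuousOn_funG w).tendsto _).comp (tendsto_funL h1 hL ?_ hεL t1)
    filter_upwards [hscale] with ε hε using coupling_sq_two hε.1 hε.2.1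
  have hden : (1 : ℝ) + dotAngle w z.2 ^ 2 * funG w (1 - z.1) ≠ 0 := by
    have := funG_nonneg w (x := 1 - z.1) (by linarith)
    positivity
  have t4 := (t0.inv₀ one_ne_zero).mul (t1.mul ((t1.add (t2.mul t3)).inv₀ hden))
  rw [inv_one, one_mul, one_mul] at t4
  -- the cut-off is eventually inactive
  have c0 : Tendsto (fun ε => ε * ρ ε) (scaleFilter 2) (𝓝 0) := by
    have : Tendsto (fun ε => exp (-((1 - z.1) * L ε))) (scaleFilter 2) (𝓝 0) :=
      Real.tendsto_exp_neg_atTop_nhds_zero.comp (hL.const_mul_atTop (by linarith))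
    refine this.congr' ?_
    filter_upwards [hεL] with ε hε
    nth_rewrite 2 [hε]
    rw [hρ, ← Real.exp_add]
    congr 1
    ring
  have c1 : ∀ {k : ℝ → Mode 2} {c : ℝ},
      Tendsto (fun ε => modeSq (k ε) / ρ ε ^ 2) (scaleFilter 2) (𝓝 c) →
      ∀ᶠ ε in scaleFilter 2, ε * cutoffNorm (k ε) ≤ 1 := by
    intro k c hk
    have h2 := c0.mul hk.sqrt
    rw [zero_mul] at h2
    filter_upwards [h2.eventually (ge_mem_nhds one_pos)] with ε h3
    rw [cutoffNorm_two]
    rw [Real.sqrt_div' _ (sq_nonneg _), Real.sqrt_sq (hρpos ε).le, mul_assoc,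
      mul_div_cancel₀ _ (hρpos ε).ne'] at h3
    exact h3
  have c2 : ∀ {k : ℝ → Mode 2}, Tendsto (fun ε => modeSq (k ε) / ρ ε ^ 2) (scaleFilter 2) (𝓝 1) →
      ∀ᶠ ε in scaleFilter 2, 0 < ε * cutoffNorm (k ε) := by
    intro k hk
    filter_upwards [hk.eventually (lt_mem_nhds one_pos), hscale] with ε h3 hε
    rw [cutoffNorm_two]
    have : 0 < modeSq (k ε) := by
      by_contra h4
      rw [le_antisymm (not_lt.1 h4) (modeSq_nonneg _), zero_div] at h3
      exact lt_irrefl _ h3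
    exact mul_pos hε.1 (sqrt_pos.2 this)
  have m4 := tendsto_modeSq_div (hconst p)
  refine t4.congr' ?_
  filter_upwards [c1 m1, c1 m2, c1 m4, c2 m1, c2 m2, hscale] with ε a1 a2 a3 a4 a5 hε
  have hcut : cutoff ε (l ε) (p - l ε) = 1 := by
    rw [cutoff, if_pos]
    refine ⟨⟨a4, a1⟩, ⟨a5, a2⟩, ?_⟩
    rw [add_sub_cancel]
    refine ⟨?_, a3⟩
    rw [cutoffNorm_two]
    exact mul_pos hε.1 (sqrt_pos.2 (lt_of_lt_of_le one_pos (one_le_modeSq hp)))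
  rw [loopTerm, hcut, one_mul]
  change _ = ρ ε ^ 2 * ((𝓔 p (l ε))⁻¹ *
    (1 / 2 * tupleSq (κ ε) * (1 / 2 * tupleSq (κ ε) + 1 / 2 * tupleDotSq w (κ ε) *
      funG w (funL 2 ε (1 / 2 * tupleSq (κ ε))))⁻¹))
  have hr := (hρpos ε).ne'
  rw [show 1 / 2 * tupleSq (κ ε) / ρ ε ^ 2 + 1 / 2 * tupleDotSq w (κ ε) / ρ ε ^ 2 *
      funG w (funL 2 ε (1 / 2 * tupleSq (κ ε))) = (1 / 2 * tupleSq (κ ε) +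
      1 / 2 * tupleDotSq w (κ ε) * funG w (funL 2 ε (1 / 2 * tupleSq (κ ε)))) / ρ ε ^ 2 by ring,
    inv_div, inv_div]
  field_simp

/-- In dimension two the loop sum with the effective resolvent converges, whatever the
spectator. -/
lemma tendsto_loopSum_effMul (w : 𝔼 2) (hw : w ≠ 0) (p q : Mode 2) (hp : p ≠ 0) :
    Tendsto (fun ε => coupling 2 ε ^ 2 * ∑ l ∈ box 2 ε, cutoff ε l (p - l) *
      (𝓔 p l)⁻¹ * ((effMul w ε).shift q).val 2 ![l, p - l])
      (scaleFilter 2) (𝓝 (π ^ 2 * funG w 1)) := by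
  have hgen : (scaleFilter 2).IsCountablyGenerated := by unfold scaleFilter; infer_instance
  have hpi := Real.pi_pos
  have hscale : ∀ᶠ ε in scaleFilter 2, ε ∈ scales 2 := self_mem_nhdsWithin
  have hL := tendsto_log_inv_atTop (d := 2)
  have hS : MeasurableSet (Set.univ ×ˢ Set.Ioo (-π) π : Set (ℝ × ℝ)) :=
    MeasurableSet.univ.prod measurableSet_Ioo
  have key : Tendsto (fun ε : ℝ => ∫ z in Set.univ ×ˢ Set.Ioo (-π) π, exp (z.1 * log ε⁻¹) ^ 2 *
        loopTerm w p q ε (roundMode (logPolar (log ε⁻¹) z))) (scaleFilter 2)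
      (𝓝 (2 * π ^ 2 * funG w 1)) := by
    rw [← integral_loopDensity w hw]
    refine tendsto_integral_filter_of_dominated_convergence
      ((Set.Icc (-1 : ℝ) 2 ×ˢ Set.Icc (-π) π).indicator fun _ => (6 : ℝ)) ?_ ?_ ?_ ?_
    · refine Eventually.of_forall fun ε => ?_
      have h1 : Measurable fun z : ℝ × ℝ => roundMode (logPolar (log ε⁻¹) z) := by
        refine measurable_roundMode.comp ?_
        unfold logPolar
        fun_prop
      exact (Measurable.mul (by fun_prop)
        ((Measurable.of_discrete (f := loopTerm w p q ε)).comp h1)).aestronglyMeasurable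
    · filter_upwards [hscale, hL.eventually_ge_atTop 1] with ε hε h1
      exact (ae_restrict_iff' hS).2 (Eventually.of_forall fun z hz =>
        loopTerm_mul_le w p q hε.1 rfl h1 hz)
    · refine Integrable.restrict ?_
      exact (integrable_indicator_iff (measurableSet_Icc.prod measurableSet_Icc)).2
        (integrableOn_const (isCompact_Icc.prod isCompact_Icc).measure_lt_top.ne)
    · have hnull : ∀ c : ℝ, ∀ᵐ z : ℝ × ℝ, z.1 ≠ c := by
        intro c
        have h1 : {z : ℝ × ℝ | ¬z.1 ≠ c} = {c} ×ˢ Set.univ := by ext z; simp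
        rw [ae_iff, h1, Measure.volume_eq_prod, Measure.prod_prod, Real.volume_singleton, zero_mul]
      filter_upwards [ae_restrict_of_ae (hnull 0), ae_restrict_of_ae (hnull 1)] with z h0 h1
      by_cases hz : z.1 ∈ Set.Ioo (0 : ℝ) 1
      · rw [Set.indicator_of_mem (show z ∈ Set.Ioo (0 : ℝ) 1 ×ˢ Set.univ from ⟨hz, trivial⟩)]
        exact tendsto_loopTerm_middle w p q hp hz.1 hz.2
      rw [Set.indicator_of_notMem (fun h => hz h.1)]
      refine tendsto_const_nhds.congr' ?_
      rcases lt_or_gt_of_ne h0 with h2 | h2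
      · filter_upwards [hscale, hL.eventually_gt_atTop (log 2 / (-z.1))] with ε hε h3
        by_contra hne
        obtain ⟨-, -, h4⟩ := of_loopTerm_ne_zero w p q hε.1 rfl (right_ne_zero_of_mul (Ne.symm hne))
        rw [div_lt_iff₀ (by linarith)] at h3
        have h5 : exp (z.1 * log ε⁻¹) < exp (-log 2) := Real.exp_lt_exp.2 (by linarith)
        rw [Real.exp_neg, Real.exp_log (by norm_num)] at h5
        nlinarith [exp_pos (z.1 * log ε⁻¹)]
      · have h3 : 1 < z.1 := lt_of_le_of_ne (not_lt.1 fun h => hz ⟨h2, h⟩) (Ne.symm h1)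
        filter_upwards [hscale, hL.eventually_gt_atTop (log 2 / (z.1 - 1))] with ε hε h4
        by_contra hne
        obtain ⟨-, h5, -⟩ := of_loopTerm_ne_zero w p q hε.1 rfl (right_ne_zero_of_mul (Ne.symm hne))
        rw [div_lt_iff₀ (by linarith)] at h4
        have h6 : exp (log 2 + log ε⁻¹) < exp (z.1 * log ε⁻¹) := Real.exp_lt_exp.2 (by linarith)
        rw [Real.exp_add, Real.exp_log (by norm_num)] at h6
        nlinarith [exp_pos (log ε⁻¹)]
  have h2 := key.const_mul (1 / 2)
  rw [show 1 / 2 * (2 * π ^ 2 * funG w 1) = π ^ 2 * funG w 1 by ring] at h2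
  refine h2.congr' ?_
  filter_upwards [hscale, hL.eventually_gt_atTop 0] with ε hε h3
  rw [← inv_mul_sum_eq_integral_logPolar h3 (box 2 ε), coupling_sq_two hε.1 hε.2.1]
  · change 1 / 2 * ((log ε⁻¹)⁻¹ * ∑ l ∈ box 2 ε, loopTerm w p q ε l) =
      1 / (2 * log ε⁻¹) * ∑ l ∈ box 2 ε, loopTerm w p q ε l
    field_simp
  · intro l hl
    have : cutoff ε l (p - l) = 0 := by
      by_contra h
      exact hl (mem_box_of_cutoff h)
    rw [loopTerm, this, zero_mul, zero_mul]

lemma funG_one_pos {w : 𝔼 d} (hw : w ≠ 0) : 0 < funG w 1 := by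
  have hw0 : 0 < ‖w‖ := norm_pos_iff.2 hw
  have := Real.pi_pos
  rw [funG]
  refine mul_pos (by positivity) (sub_pos.2 (Real.one_lt_rpow ?_ (by norm_num)))
  have : 0 < 3 * ‖w‖ ^ 2 / (2 * π) * 1 := by positivity
  linarith

lemma tendsto_co_lower_effMul_shift (w : 𝔼 2) (hw : w ≠ 0) (p q : Mode 2)
    (hp : p ≠ 0) : Tendsto (fun ε => co (lower w ε 1 2
      (((effMul w ε).shift q).op (raise w ε 1 2 (modeVec p hp)))) 1 ![p]) (scaleFilter 2)
      (𝓝 ((funG w 1 * (driftMul w).val 1 ![p] : ℝ) : ℂ)) := by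
  simp only [co_lower_op_raise_modeVec]
  refine (Complex.continuous_ofReal.tendsto _).comp ?_
  have h := ((tendsto_loopSum_effMul w hw p q hp).const_mul (4 / (2 * π) ^ 2)).const_mul
    ((driftMul w).val 1 ![p])
  have e : (driftMul w).val 1 ![p] * (4 / (2 * π) ^ 2 * (π ^ 2 * funG w 1)) =
      funG w 1 * (driftMul w).val 1 ![p] := by
    have := Real.pi_pos.ne'
    field_simp
    ring
  rwa [e] at h

/-- The statement for `d = 2`: the diffusivity is attained for every truncation. -/
lemma tendsto_ladderSum (w : 𝔼 2) (hw : w ≠ 0) {i : ℕ} (hi : i = 2 ∨ i = 3) (n : ℕ) {y : Fock 2}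
    (hy : ∀ m (k : Fin m → Mode 2), m ≠ i - 1 → co y m k = 0) :
    Tendsto (fun ε => lower w ε (i - 1) i (ladderSum w ε i n y) -
      (funG w 1 : ℂ) • (driftMul w).op y) (scaleFilter 2) (𝓝 0) := by
  obtain ⟨C₀, -, hC⟩ := exists_loopSum_le (le_refl 2)
  have hl := eventually_abs_coupling_le (le_refl 2)
  have hbot : ∀ ε, lower w ε (i - 1) i (ladderSum w ε i n y) =
      lower w ε (i - 1) i ((effMul w ε).op (raise w ε (i - 1) i y)) := fun ε =>
    lower_congr w ε fun m h1 h2 k => by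
      obtain rfl : m = i := by omega
      exact co_ladderSum_bottom w ε (by omega) y k
  simp only [hbot]
  have h := fun ε => (errOp_apply w i (funG w 1) (fun ε => (effMul w ε).op) ε hy).symm
  simp only [h]
  have hR := norm_effMul_le w
  rcases hi with rfl | rfl
  · refine tendsto_errOp_one w hC _ hR (fun ε p x => Multiplier.op_comm _ _ _) (fun p hp => ?_) y
    -- without spectator: the spectator `q = 0` carries no energy
    have h0 : ∀ ε, (effMul w ε).op (raise w ε 1 2 (modeVec p hp)) =
        ((effMul w ε).shift 0).op (raise w ε 1 2 (modeVec p hp)) := fun ε =>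
      Fock.ext fun n k => by
        rw [co_op, co_op]
        congr 2
        have h1 : tupleSq (Fin.cons 0 k : Fin (n + 1) → Mode 2) = tupleSq k := by
          rw [tupleSq_cons, modeSq_eq_zero.2 rfl, zero_add]
        have h2 : tupleDotSq w (Fin.cons 0 k : Fin (n + 1) → Mode 2) = tupleDotSq w k := by
          simp [tupleDotSq, Fin.sum_univ_succ, dotMode]
        simp only [Multiplier.shift, effMul, driftVal, h1, h2]
    simp only [h0]
    exact tendsto_co_lower_effMul_shift w hw p 0 hp
  · exact tendsto_errOp_two w hC _ hR (N := 3) (by norm_num) (fun p q hp hq =>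
      tendsto_errOp_pairVec_effMul w hC hl (by norm_num) _ (tendsto_co_lower_effMul_shift w hw)
        (tendsto_invLam_raise_modeVec w) p q hp hq) y

/-! ### Convergence of lattice sums in the scaling limit -/

/-- The lattice points below the rescaled points of a configuration. -/
def floorModes (ε : ℝ) {n : ℕ} (u : Fin n → Fin d → ℝ) : 𝕄 n := fun i a => ⌊u i a / ε⌋

lemma measurable_floorModes (ε : ℝ) {n : ℕ} :
    Measurable (floorModes ε : (Fin n → Fin d → ℝ) → 𝕄 n) :=
  measurable_pi_lambda _ fun i => measurable_pi_lambda _ fun a =>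
    Int.measurable_floor.comp (Measurable.div_const
      ((measurable_pi_apply a).comp (measurable_pi_apply i) :
        Measurable fun u : Fin n → Fin d → ℝ => u i a) ε)

lemma volume_floorModes_preimage {ε : ℝ} (hε : 0 < ε) {n : ℕ} (κ : 𝕄 n) :
    volume (floorModes ε ⁻¹' {κ}) = ENNReal.ofReal ((ε ^ d) ^ n) := by
  have h : floorModes ε ⁻¹' {κ} = Set.univ.pi fun i => Set.univ.pi fun a =>
      Set.Ico (κ i a * ε) ((κ i a + 1) * ε) := by
    ext u
    simp only [Set.mem_preimage, Set.mem_singleton_iff, Set.mem_pi, Set.mem_univ, true_implies,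
      funext_iff, floorModes, Int.floor_eq_iff, Set.mem_Ico, le_div_iff₀ hε, div_lt_iff₀ hε]
  rw [h, volume_pi_pi]
  simp only [volume_pi_pi, Real.volume_Ico]
  have h1 : ∀ x : ℤ, ENNReal.ofReal (((x : ℝ) + 1) * ε - x * ε) = ENNReal.ofReal ε := fun x => by
    congr 1; ring
  simp only [h1, Finset.prod_const, card_univ, Fintype.card_fin]
  rw [ENNReal.ofReal_pow (by positivity), ENNReal.ofReal_pow hε.le]

lemma abs_mul_floor_sub_le {ε : ℝ} (hε : 0 < ε) (x : ℝ) : |ε * (⌊x / ε⌋ : ℝ) - x| ≤ ε := by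
  have h1 := Int.floor_le (x / ε)
  have h2 := Int.lt_floor_add_one (x / ε)
  rw [le_div_iff₀ hε] at h1
  rw [div_lt_iff₀ hε] at h2
  rw [abs_le]
  constructor <;> nlinarith

lemma tendsto_mul_floor {ε : ℕ → ℝ} (hε : ∀ j, 0 < ε j) (h0 : Tendsto ε atTop (𝓝 0)) (x : ℝ) :
    Tendsto (fun j => ε j * (⌊x / ε j⌋ : ℝ)) atTop (𝓝 x) := by
  rw [tendsto_iff_norm_sub_tendsto_zero]
  exact squeeze_zero (fun _ => norm_nonneg _) (fun j => abs_mul_floor_sub_le (hε j) x) h0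

lemma tendsto_lattice_sum {n : ℕ} {ε : ℕ → ℝ} (hε : ∀ j, 0 < ε j ∧ ε j ≤ 1)
    {Φ : ℕ → 𝕄 n → ℂ} {M R : ℝ}
    (hM : ∀ j κ, ‖Φ j κ‖ ≤ M) (hR : ∀ j κ, Φ j κ ≠ 0 → ∀ i a, ε j * |(κ i a : ℝ)| ≤ R)
    (s : ℕ → Finset (𝕄 n)) (hs : ∀ j κ, κ ∉ s j → Φ j κ = 0)
    {Lim : (Fin n → Fin d → ℝ) → ℂ}
    (hlim : ∀ᵐ u, Tendsto (fun j => Φ j (floorModes (ε j) u)) atTop (𝓝 (Lim u))) :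
    Tendsto (fun j => (((ε j ^ d) ^ n : ℝ) : ℂ) * ∑ κ ∈ s j, Φ j κ) atTop (𝓝 (∫ u, Lim u)) := by
  have hM0 : 0 ≤ M := (norm_nonneg _).trans (hM 0 0)
  have h1 : ∀ j, ∫ u, Φ j (floorModes (ε j) u) = (((ε j ^ d) ^ n : ℝ) : ℂ) * ∑ κ ∈ s j, Φ j κ := by
    intro j
    rw [(integral_comp_eq_sum (μ := volume) (floorModes (ε j)) (v := (ε j ^ d) ^ n)
      (by have := (hε j).1; positivity)
      (fun κ => measurable_floorModes (ε j) (measurableSet_singleton κ))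
      (volume_floorModes_preimage (hε j).1) (s j) (hs j)).2, Complex.real_smul]
  simp only [← h1]
  have hK : IsCompact (Set.Icc (fun _ _ => -(R + 1)) (fun _ _ => R + 1) :
      Set (Fin n → Fin d → ℝ)) := isCompact_Icc
  refine tendsto_integral_of_dominated_convergence
    ((Set.Icc (fun _ _ => -(R + 1)) (fun _ _ => R + 1) :
      Set (Fin n → Fin d → ℝ)).indicator fun _ => M) (fun j => ?_) ?_ (fun j => ?_) hlim
  · exact ((Measurable.of_discrete (f := Φ j)).comp
      (measurable_floorModes (ε j))).aestronglyMeasurable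
  · exact (integrable_indicator_iff measurableSet_Icc).2
      (integrableOn_const hK.measure_lt_top.ne)
  · refine Eventually.of_forall fun u => ?_
    by_cases h2 : Φ j (floorModes (ε j) u) = 0
    · rw [h2, norm_zero]
      exact Set.indicator_nonneg (fun _ _ => hM0) _
    · rw [Set.indicator_of_mem]
      · exact hM j _
      have h3 : ∀ i a, |u i a| ≤ R + 1 := by
        intro i a
        have h4 := hR j _ h2 i a
        have h5 := abs_mul_floor_sub_le (hε j).1 (u i a)
        have h6 := abs_sub_abs_le_abs_sub (u i a) (ε j * (⌊u i a / ε j⌋ : ℝ))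
        rw [abs_sub_comm (u i a), abs_mul, abs_of_pos (hε j).1] at h6
        have h7 : ε j * |(⌊u i a / ε j⌋ : ℝ)| ≤ R := h4
        linarith [(hε j).2]
      exact ⟨fun i a => (abs_le.1 (h3 i a)).1, fun i a => (abs_le.1 (h3 i a)).2⟩

/-! ### Generic configurations -/

/-- A configuration is generic if no coordinate of a proper partial sum is `0` or `±1`: away from
these hyperplanes the rescaled cut-off is locally constant. -/
def Generic {n : ℕ} (v : Fin n → Fin d → ℝ) : Prop :=
  ∀ S : Finset (Fin n), S.Nonempty → S ≠ univ → ∀ a,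
    ∑ i ∈ S, v i a ≠ 0 ∧ ∑ i ∈ S, v i a ≠ 1 ∧ ∑ i ∈ S, v i a ≠ -1

lemma ae_sum_ne {n : ℕ} {S : Finset (Fin n)} (hS : S.Nonempty) (a : Fin d) (c : ℝ) :
    ∀ᵐ u : Fin n → Fin d → ℝ, ∑ i ∈ S, u i a ≠ c := by
  obtain ⟨i₀, hi₀⟩ := hS
  let A : AffineSubspace ℝ (Fin n → Fin d → ℝ) :=
    { carrier := {u | ∑ i ∈ S, u i a = c}
      smul_vsub_vadd_mem' := by
        intro t u₁ u₂ u₃ h1 h2 h3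
        simp only [Set.mem_ofPred_eq, vsub_eq_sub, vadd_eq_add, Pi.add_apply, Pi.smul_apply,
          Pi.sub_apply, smul_eq_mul, sum_add_distrib, ← mul_sum,
          Finset.sum_sub_distrib] at *
        rw [h1, h2, h3]
        ring }
  have hA : A ≠ ⊤ := by
    intro h
    have h1 : (fun i _ => if i = i₀ then c + 1 else 0 : Fin n → Fin d → ℝ) ∈ A := by
      rw [h]; exact AffineSubspace.mem_top ℝ _ _
    have h2 : ∑ i ∈ S, (if i = i₀ then c + 1 else 0) = c := h1
    rw [Finset.sum_ite_eq' S i₀, if_pos hi₀] at h2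
    linarith
  have h := Measure.addHaar_affineSubspace (volume : Measure (Fin n → Fin d → ℝ)) A hA
  rw [ae_iff]
  simp only [not_not]
  exact h

lemma sum_finset_succ {M : Type*} [AddCommMonoid M] {n : ℕ} (S : Finset (Fin (n + 1)))
    (f : Fin (n + 1) → M) : ∑ i ∈ S, f i = (if 0 ∈ S then f 0 else 0) +
      ∑ i ∈ univ.filter (fun i : Fin n => i.succ ∈ S), f i.succ := by
  rw [Finset.sum_filter, ← Fin.sum_univ_succ (fun i => if i ∈ S then f i else 0),
    Finset.sum_ite_mem, Finset.univ_inter]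

/-- Almost every configuration of `n` particles, balanced by a further one, is generic. -/
lemma ae_generic_cons (d n : ℕ) :
    ∀ᵐ u : Fin n → Fin d → ℝ, Generic (Fin.cons (-∑ i, u i) u : Fin (n + 1) → Fin d → ℝ) := by
  have h1 : ∀ᵐ u : Fin n → Fin d → ℝ, ∀ S : Finset (Fin n), S.Nonempty → ∀ a,
      ∑ i ∈ S, u i a ≠ 0 ∧ ∑ i ∈ S, u i a ≠ 1 ∧ ∑ i ∈ S, u i a ≠ -1 := by
    rw [ae_all_iff]; intro S
    rw [ae_all_iff]; intro hS
    rw [ae_all_iff]; intro a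
    filter_upwards [ae_sum_ne hS a 0, ae_sum_ne hS a 1, ae_sum_ne hS a (-1)] with u h1 h2 h3
    exact ⟨h1, h2, h3⟩
  filter_upwards [h1] with u hu S hS hS' a
  rw [sum_finset_succ]
  simp only [Fin.cons_zero, Fin.cons_succ, Pi.neg_apply, Finset.sum_apply]
  set T : Finset (Fin n) := univ.filter fun i => i.succ ∈ S with hT
  by_cases h0 : 0 ∈ S
  · -- a partial sum containing the first particle is minus the complementary sum
    have hTc : Tᶜ.Nonempty := by
      rw [Finset.nonempty_iff_ne_empty]
      intro h
      rw [Finset.compl_eq_empty_iff] at h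
      refine hS' (Finset.eq_univ_iff_forall.2 fun i => ?_)
      refine Fin.cases h0 (fun i => ?_) i
      have : i ∈ T := by rw [h]; exact mem_univ i
      simpa [hT] using this
    have h2 := Finset.sum_add_sum_compl T fun i => u i a
    obtain ⟨h3, h4, h5⟩ := hu Tᶜ hTc a
    rw [if_pos h0, ← h2]
    refine ⟨fun h => h3 ?_, fun h => h5 ?_, fun h => h4 ?_⟩ <;> linarith
  · rw [if_neg h0, zero_add]
    refine hu T ?_ a
    obtain ⟨i, hi⟩ := hS
    obtain ⟨j, rfl⟩ := Fin.exists_succ_eq.2 (fun h => h0 (h ▸ hi))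
    exact ⟨j, by simpa [hT] using hi⟩

/-- Replacing the particle `j` by the two particles `u` and `v_j - u`. -/
def splitPt {n : ℕ} (v : Fin n → Fin d → ℝ) (j : Fin n) (u : Fin d → ℝ) :
    Fin (n + 1) → Fin d → ℝ := Fin.cons u (update v j (v j - u))

lemma ae_generic_splitPt {n : ℕ} {v : Fin n → Fin d → ℝ} (hv : Generic v) (j : Fin n) :
    ∀ᵐ u : Fin 1 → Fin d → ℝ, Generic (splitPt v j (u 0)) := by
  have h1 : ∀ᵐ u : Fin 1 → Fin d → ℝ, ∀ T : Finset (Fin n), ∀ a, ∀ c ∈ ({0, 1, -1} : Set ℝ),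
      u 0 a ≠ c - ∑ i ∈ T, v i a ∧ u 0 a ≠ ∑ i ∈ T, v i a - c := by
    rw [ae_all_iff]; intro T
    rw [ae_all_iff]; intro a
    rw [ae_ball_iff (Set.to_countable _)]; intro c _
    have := fun c' => ae_sum_ne (Finset.singleton_nonempty (0 : Fin 1)) a c'
    simp only [sum_singleton] at this
    filter_upwards [this (c - ∑ i ∈ T, v i a), this (∑ i ∈ T, v i a - c)] with u h1 h2
    exact ⟨h1, h2⟩
  filter_upwards [h1] with u hu S hS hS' a
  rw [sum_finset_succ]
  simp only [splitPt, Fin.cons_zero, Fin.cons_succ]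
  set T : Finset (Fin n) := univ.filter fun i => i.succ ∈ S with hT
  have hupd : ∑ i ∈ T, update v j (v j - u 0) i a =
      ∑ i ∈ T, v i a - if j ∈ T then u 0 a else 0 := by
    rw [← Finset.sum_ite_eq' T j (fun _ => u 0 a), ← Finset.sum_sub_distrib]
    refine sum_congr rfl fun i _ => ?_
    by_cases h : i = j
    · subst h; simp
    · simp [h]
  rw [hupd]
  have hu' := hu T a
  by_cases h0 : 0 ∈ S <;> by_cases hj : j ∈ T
  · have hTu : T ≠ univ := by
      intro h
      refine hS' (Finset.eq_univ_iff_forall.2 fun i => ?_)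
      refine Fin.cases h0 (fun i => ?_) i
      have : i ∈ T := by rw [h]; exact mem_univ i
      simpa [hT] using this
    rw [if_pos h0, if_pos hj, add_sub_cancel]
    exact hv T ⟨j, hj⟩ hTu a
  · rw [if_pos h0, if_neg hj, sub_zero]
    refine ⟨fun h => (hu' 0 (by simp)).1 ?_, fun h => (hu' 1 (by simp)).1 ?_,
      fun h => (hu' (-1) (by simp)).1 ?_⟩ <;> linarith
  · rw [if_neg h0, if_pos hj, zero_add]
    refine ⟨fun h => (hu' 0 (by simp)).2 ?_, fun h => (hu' 1 (by simp)).2 ?_,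
      fun h => (hu' (-1) (by simp)).2 ?_⟩ <;> linarith
  · rw [if_neg h0, if_neg hj, zero_add, sub_zero]
    refine hv T ?_ (fun h => hj (h ▸ mem_univ j)) a
    obtain ⟨i, hi⟩ := hS
    obtain ⟨j, rfl⟩ := Fin.exists_succ_eq.2 (fun h => h0 (h ▸ hi))
    exact ⟨j, by simpa [hT] using hi⟩

/-- Merging the particles `a` and `c`. -/
def mergePt {n : ℕ} (v : Fin (n + 1) → Fin d → ℝ) (a c : Fin (n + 1)) : Fin n → Fin d → ℝ :=
  fun i => update v a (v a + v c) (c.succAbove i)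

lemma Generic.mergePt {n : ℕ} {v : Fin (n + 1) → Fin d → ℝ} (hv : Generic v) {a c : Fin (n + 1)}
    (hac : a ≠ c) : Generic (mergePt v a c) := by
  intro S hS hS' b
  set T : Finset (Fin (n + 1)) := S.map c.succAboveEmb with hT
  have hc : c ∉ T := by simp [hT, Fin.succAbove_ne]
  have hsum : ∑ i ∈ S, Burgers.mergePt v a c i b =
      ∑ i ∈ (if a ∈ T then insert c T else T), v i b := by
    have h1 : ∑ i ∈ S, Burgers.mergePt v a c i b = ∑ i ∈ T, update v a (v a + v c) i b := by
      rw [hT, Finset.sum_map]; rfl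
    have h2 : ∑ i ∈ T, update v a (v a + v c) i b =
        ∑ i ∈ T, v i b + if a ∈ T then v c b else 0 := by
      rw [← Finset.sum_ite_eq' T a (fun _ => v c b), ← sum_add_distrib]
      refine sum_congr rfl fun i _ => ?_
      by_cases h : i = a
      · subst h; simp
      · simp [h]
    rw [h1, h2]
    split_ifs with h
    · rw [Finset.sum_insert hc, add_comm]
    · rw [add_zero]
  rw [hsum]
  have hTne : T.Nonempty := hS.map
  obtain ⟨i₀, hi₀⟩ : ∃ i, i ∉ S := by
    by_contra! h
    exact hS' (Finset.eq_univ_iff_forall.2 h)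
  have hi₀T : c.succAbove i₀ ∉ T := by
    rw [hT, Finset.mem_map]
    rintro ⟨i, hi, h⟩
    exact hi₀ (Fin.succAbove_right_injective h ▸ hi)
  split_ifs with h
  · refine hv _ (Finset.insert_nonempty c T) (fun hu => ?_) b
    have := hu ▸ mem_univ (c.succAbove i₀)
    rcases Finset.mem_insert.1 this with h1 | h1
    · exact Fin.succAbove_ne c i₀ h1
    · exact hi₀T h1
  · exact hv _ hTne (fun hu => hi₀T (hu ▸ mem_univ _)) b

/-! ### Kernels in the scaling limit -/

/-- The pairs of a mode and a scale for which the response to the mode is studied. -/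
def Adm (p : Mode d) (ε : ℝ) : Prop := ε ∈ scales d ∧ dotMode w p ≠ 0

lemma Adm.ne_zero {w : 𝔼 d} {p : Mode d} {ε : ℝ} (h : Adm w p ε) : p ≠ 0 := by
  rintro rfl
  exact h.2 (by simp [dotMode])

/-- Sequences of modes and scales for which the scale, and the rescaled mode, vanish. -/
def IsScaleSeq (p : ℕ → Mode d) (ε : ℕ → ℝ) : Prop :=
  (∀ j, Adm w (p j) (ε j)) ∧ Tendsto ε atTop (𝓝 0) ∧
    ∀ a, Tendsto (fun j => ε j * (p j a : ℝ)) atTop (𝓝 0)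

/-- Configurations of total momentum `p` whose rescalings converge to `v`. -/
def Compat {m : ℕ} (v : Fin m → Fin d → ℝ) (p : ℕ → Mode d) (ε : ℕ → ℝ) (k : ℕ → 𝕄 m) : Prop :=
  IsScaleSeq w p ε ∧ (∀ j, ∑ i, k j i = p j) ∧
    ∀ i a, Tendsto (fun j => ε j * (k j i a : ℝ)) atTop (𝓝 (v i a))

/-- The kernel `f` converges in the scaling limit at `v`, along all sequences of configurations. -/
def Conv {m : ℕ} (v : Fin m → Fin d → ℝ) (f : Mode d → ℝ → 𝕄 m → ℂ) : Prop :=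
  ∃ L : ℂ, ∀ p ε k, Compat w v p ε k → Tendsto (fun j => f (p j) (ε j) (k j)) atTop (𝓝 L)

section Conv

variable {w} {m : ℕ} {v : Fin m → Fin d → ℝ}
  {f g : Mode d → ℝ → (Fin m → Mode d) → ℂ}

lemma conv_const (c : ℂ) : Conv w v fun _ _ _ => c := ⟨c, fun _ _ _ _ => tendsto_const_nhds⟩

lemma Conv.add (hf : Conv w v f) (hg : Conv w v g) :
    Conv w v fun p ε k => f p ε k + g p ε k := by
  obtain ⟨L, hL⟩ := hf
  obtain ⟨L', hL'⟩ := hg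
  exact ⟨L + L', fun p ε k h => (hL p ε k h).add (hL' p ε k h)⟩

lemma Conv.mul (hf : Conv w v f) (hg : Conv w v g) :
    Conv w v fun p ε k => f p ε k * g p ε k := by
  obtain ⟨L, hL⟩ := hf
  obtain ⟨L', hL'⟩ := hg
  exact ⟨L * L', fun p ε k h => (hL p ε k h).mul (hL' p ε k h)⟩

lemma Conv.star (hf : Conv w v f) : Conv w v fun p ε k => starRingEnd ℂ (f p ε k) := by
  obtain ⟨L, hL⟩ := hf
  exact ⟨starRingEnd ℂ L, fun p ε k h => (Complex.continuous_conj.tendsto L).comp (hL p ε k h)⟩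

lemma Conv.sum {ι : Type*} (s : Finset ι) {f : ι → Mode d → ℝ → 𝕄 m → ℂ}
    (hf : ∀ i ∈ s, Conv w v (f i)) : Conv w v fun p ε k => ∑ i ∈ s, f i p ε k := by
  choose! L hL using hf
  exact ⟨∑ i ∈ s, L i, fun p ε k h => tendsto_finsetSum s fun i hi => hL i hi p ε k h⟩

lemma Conv.congr (hf : Conv w v f)
    (h : ∀ p ε k, Adm w p ε → ∑ i, k i = p → f p ε k = g p ε k) : Conv w v g := by
  obtain ⟨L, hL⟩ := hf
  exact ⟨L, fun p ε k hk => (hL p ε k hk).congr fun j => h _ _ _ (hk.1.1 j) (hk.2.1 j)⟩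

lemma Conv.of_real {f : Mode d → ℝ → 𝕄 m → ℝ} (h : ∃ L : ℝ, ∀ p ε k, Compat w v p ε k →
      Tendsto (fun j => f (p j) (ε j) (k j)) atTop (𝓝 L)) :
    Conv w v fun p ε k => ((f p ε k : ℝ) : ℂ) := by
  obtain ⟨L, hL⟩ := h
  exact ⟨L, fun p ε k hk => (Complex.continuous_ofReal.tendsto L).comp (hL p ε k hk)⟩

/-- `ε (𝔴 · A)` converges when `εA` does. -/
lemma tendsto_mul_dotMode {ε : ℕ → ℝ} {A : ℕ → Mode d} {α : Fin d → ℝ}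
    (hA : ∀ a, Tendsto (fun j => ε j * (A j a : ℝ)) atTop (𝓝 (α a))) :
    Tendsto (fun j => ε j * dotMode w (A j)) atTop (𝓝 (∑ a, w a * α a)) := by
  refine (tendsto_finsetSum univ fun a _ => (hA a).const_mul (w a)).congr fun j => ?_
  rw [dotMode, mul_sum]
  exact sum_congr rfl fun a _ => by ring

lemma Compat.pos {p : ℕ → Mode d} {ε : ℕ → ℝ} {k : ℕ → 𝕄 m} (h : Compat w v p ε k)
    (j : ℕ) : 0 < ε j := (h.1.1 j).1.1

lemma Compat.tendsto_tupleSq {p : ℕ → Mode d} {ε : ℕ → ℝ} {k : ℕ → 𝕄 m}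
    (h : Compat w v p ε k) : Tendsto (fun j => ε j ^ 2 * tupleSq (k j)) atTop
      (𝓝 (∑ i, ∑ a, v i a ^ 2)) := by
  refine (tendsto_finsetSum univ fun i _ => tendsto_finsetSum univ fun a _ =>
    (h.2.2 i a).pow 2).congr fun j => ?_
  simp only [tupleSq, modeSq, mul_sum, mul_pow]

lemma sqrt_half_mul {ε t : ℝ} (hε : 0 < ε) : √(1 / 2 * (ε ^ 2 * t)) = ε * √(1 / 2 * t) := by
  rw [show 1 / 2 * (ε ^ 2 * t) = ε ^ 2 * (1 / 2 * t) by ring, sqrt_mul (sq_nonneg _),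
    Real.sqrt_sq hε.le]

/-- `ε⁻¹ Λ⁻¹` converges at configurations which are not at rest. -/
lemma conv_invLam (hv : 0 < ∑ i, ∑ a, v i a ^ 2) :
    Conv w v fun _ ε k => ((ε⁻¹ * invLam.val m k : ℝ) : ℂ) := by
  refine Conv.of_real ⟨(√(1 / 2 * ∑ i, ∑ a, v i a ^ 2))⁻¹, fun p ε k h => ?_⟩
  have h1 := ((h.tendsto_tupleSq.const_mul (1 / 2)).sqrt).inv₀ (sqrt_pos.2 (by linarith)).ne'
  refine h1.congr fun j => ?_
  rw [sqrt_half_mul (h.pos j), mul_inv]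
  rfl

/-- The cut-off converges off its discontinuities. -/
lemma tendsto_indicator {ε : ℕ → ℝ} (hε : ∀ j, 0 < ε j) {A : ℕ → Mode d} {α : Fin d → ℝ}
    (hd : 3 ≤ d) (hα : ∀ a, α a ≠ 0 ∧ α a ≠ 1 ∧ α a ≠ -1)
    (hA : ∀ a, Tendsto (fun j => ε j * (A j a : ℝ)) atTop (𝓝 (α a))) :
    ∀ᶠ j in atTop, (0 < ε j * cutoffNorm (A j) ∧ ε j * cutoffNorm (A j) ≤ 1) ↔ ‖α‖ ≤ 1 := by
  have hn : ∀ j, ε j * cutoffNorm (A j) = ‖fun a => ε j * (A j a : ℝ)‖ := by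
    intro j
    have : (fun a => ε j * (A j a : ℝ)) = ε j • fun a => (A j a : ℝ) := rfl
    rw [this, norm_smul, norm_eq_abs, abs_of_pos (hε j), cutoffNorm, if_neg (by omega)]
    congr 1
  have ht : Tendsto (fun j => ε j * cutoffNorm (A j)) atTop (𝓝 ‖α‖) := by
    simp only [hn]
    exact (tendsto_pi_nhds.2 hA).norm
  have : Nonempty (Fin d) := ⟨⟨0, by omega⟩⟩
  obtain ⟨a, ha⟩ : ∃ a, ‖α a‖ = ‖α‖ := by
    obtain ⟨a, -, ha⟩ := Finset.exists_mem_eq_sup univ Finset.univ_nonempty (fun a => ‖α a‖₊)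
    exact ⟨a, by rw [← coe_nnnorm, ← coe_nnnorm, Pi.nnnorm_def, ha]⟩
  have h0 : 0 < ‖α‖ := by
    rw [← ha]; exact norm_pos_iff.2 (hα a).1
  have h1 : ‖α‖ ≠ 1 := by
    rw [← ha, norm_eq_abs]
    intro h
    rcases (abs_eq zero_le_one).1 h with h | h
    · exact (hα a).2.1 h
    · exact (hα a).2.2 h
  rcases lt_or_gt_of_ne h1 with h2 | h2
  · filter_upwards [ht.eventually (lt_mem_nhds h0), ht.eventually (ge_mem_nhds h2)] with j h3 h4
    exact ⟨fun _ => h2.le, fun _ => ⟨h3, h4⟩⟩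
  · filter_upwards [ht.eventually (lt_mem_nhds h2)] with j h3
    exact ⟨fun h => absurd h.2 (not_le.2 h3), fun h => absurd h (not_le.2 h2)⟩

/-- The cut-off converges at generic configurations; `A` and `B` are partial sums. -/
lemma conv_cutoff (hd : 3 ≤ d) {α β : Fin d → ℝ} (hα : ∀ a, α a ≠ 0 ∧ α a ≠ 1 ∧ α a ≠ -1)
    (hβ : ∀ a, β a ≠ 0 ∧ β a ≠ 1 ∧ β a ≠ -1)
    (hαβ : ∀ a, α a + β a ≠ 0 ∧ α a + β a ≠ 1 ∧ α a + β a ≠ -1)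
    {A B : 𝕄 m → Mode d}
    (hA : ∀ p ε k, Compat w v p ε k → ∀ a, Tendsto (fun j => ε j * (A (k j) a : ℝ)) atTop (𝓝 (α a)))
    (hB : ∀ p ε k, Compat w v p ε k → ∀ a,
      Tendsto (fun j => ε j * (B (k j) a : ℝ)) atTop (𝓝 (β a))) :
    Conv w v fun _ ε k => ((cutoff ε (A k) (B k) : ℝ) : ℂ) := by
  classical
  refine Conv.of_real ⟨if ‖α‖ ≤ 1 ∧ ‖β‖ ≤ 1 ∧ ‖α + β‖ ≤ 1 then 1 else 0, fun p ε k h => ?_⟩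
  refine tendsto_const_nhds.congr' ?_
  have hAB : ∀ a, Tendsto (fun j => ε j * ((A (k j) + B (k j)) a : ℝ)) atTop
      (𝓝 ((α + β) a)) := fun a =>
    ((hA p ε k h a).add (hB p ε k h a)).congr fun j => by
      rw [Pi.add_apply, Int.cast_add, mul_add]
  filter_upwards [tendsto_indicator h.pos hd hα (hA p ε k h),
    tendsto_indicator h.pos hd hβ (hB p ε k h), tendsto_indicator h.pos hd hαβ hAB] with j h1 h2 h3
  rw [cutoff]
  exact (if_congr (and_congr h1 (and_congr h2 h3)) rfl rfl).symm

end Conv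

lemma Generic.apply {m : ℕ} {v : Fin m → Fin d → ℝ} (hv : Generic v) (hm : 2 ≤ m) (i : Fin m)
    (a : Fin d) : v i a ≠ 0 ∧ v i a ≠ 1 ∧ v i a ≠ -1 := by
  have := hv {i} (Finset.singleton_nonempty i) (fun h => ?_) a
  · simpa only [sum_singleton] using this
  · have := congrArg Finset.card h
    rw [Finset.card_singleton, card_univ, Fintype.card_fin] at this
    omega

lemma Generic.apply_add {m : ℕ} {v : Fin m → Fin d → ℝ} (hv : Generic v) (hm : 3 ≤ m)
    {i i' : Fin m} (hi : i ≠ i') (a : Fin d) :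
    v i a + v i' a ≠ 0 ∧ v i a + v i' a ≠ 1 ∧ v i a + v i' a ≠ -1 := by
  have := hv {i, i'} ⟨i, by simp⟩ (fun h => ?_) a
  · simpa only [Finset.sum_pair hi] using this
  · have := congrArg Finset.card h
    rw [Finset.card_pair hi, card_univ, Fintype.card_fin] at this
    omega

lemma Generic.sum_sq_pos {m : ℕ} {v : Fin m → Fin d → ℝ} (hv : Generic v) (hm : 2 ≤ m)
    (hd : 3 ≤ d) : 0 < ∑ i, ∑ a, v i a ^ 2 := by
  have h1 := (hv.apply hm ⟨0, by omega⟩ ⟨0, by omega⟩).1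
  refine Finset.sum_pos' (fun i _ => sum_nonneg fun a _ => sq_nonneg _)
    ⟨⟨0, by omega⟩, mem_univ _, Finset.sum_pos' (fun a _ => sq_nonneg _)
      ⟨⟨0, by omega⟩, mem_univ _, by positivity⟩⟩

lemma Compat.merge {w : 𝔼 d} {m : ℕ} {v : Fin (m + 1) → Fin d → ℝ}
    {p : ℕ → Mode d} {ε : ℕ → ℝ} {k : ℕ → 𝕄 (m + 1)} (h : Compat w v p ε k)
    {i c : Fin (m + 1)} (hic : i ≠ c) :
    Compat w (mergePt v i c) p ε fun j => merge (k j) i c := by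
  refine ⟨h.1, fun j => by rw [sum_merge _ hic, h.2.1], fun r a => ?_⟩
  simp only [Burgers.merge, mergePt]
  by_cases hr : c.succAbove r = i
  · rw [hr, Function.update_self]
    refine ((h.2.2 i a).add (h.2.2 c a)).congr fun j => ?_
    rw [Function.update_self, Pi.add_apply, Int.cast_add, mul_add]
  · rw [Function.update_of_ne hr]
    refine (h.2.2 (c.succAbove r) a).congr fun j => ?_
    rw [Function.update_of_ne hr]

lemma Compat.split {w : 𝔼 d} {m : ℕ} {v : Fin m → Fin d → ℝ}
    {p : ℕ → Mode d} {ε : ℕ → ℝ} {k : ℕ → 𝕄 m} (h : Compat w v p ε k) (i : Fin m)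
    (u : Fin d → ℝ) : Compat w (splitPt v i u) p ε fun j => split (k j) i fun a => ⌊u a / ε j⌋ := by
  have hu : ∀ a, Tendsto (fun j => ε j * (⌊u a / ε j⌋ : ℝ)) atTop (𝓝 (u a)) := fun a =>
    tendsto_mul_floor h.pos h.1.2.1 (u a)
  refine ⟨h.1, fun j => by rw [sum_split, h.2.1], fun r a => ?_⟩
  simp only [Burgers.split, splitPt]
  refine Fin.cases ?_ (fun r => ?_) r
  · exact hu a
  · simp only [Fin.cons_succ]
    by_cases hr : r = i
    · subst hr
      rw [Function.update_self]
      refine ((h.2.2 r a).sub (hu a)).congr fun j => ?_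
      rw [Function.update_self, Pi.sub_apply, Int.cast_sub, mul_sub]
    · rw [Function.update_of_ne hr]
      refine (h.2.2 r a).congr fun j => ?_
      rw [Function.update_of_ne hr]

/-- Loop sums converge in the scaling limit. -/
lemma conv_loop {w : 𝔼 d} {m : ℕ} {v : Fin m → Fin d → ℝ} (hv : Generic v)
    (i : Fin m) {Φ : Mode d → ℝ → 𝕄 (m + 1) → ℂ} {M R : ℝ}
    (hM : ∀ p ε κ, Adm w p ε → ‖Φ p ε κ‖ ≤ M)
    (hR : ∀ p ε κ, Adm w p ε → Φ p ε κ ≠ 0 → ∀ r a, ε * |(κ r a : ℝ)| ≤ R)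
    (hbox : ∀ p ε κ, Adm w p ε → Φ p ε κ ≠ 0 → κ 0 ∈ box d ε)
    (hconv : ∀ v' : Fin (m + 1) → Fin d → ℝ, Generic v' → Conv w v' Φ) :
    Conv w v fun p ε k => ((ε ^ d : ℝ) : ℂ) * ∑ l ∈ box d ε, Φ p ε (split k i l) := by
  classical
  choose! L hL using hconv
  refine ⟨∫ u : Fin 1 → Fin d → ℝ, L (splitPt v i (u 0)), fun p ε k h => ?_⟩
  let emb : Mode d ↪ 𝕄 1 := ⟨fun l _ => l, fun l l' h => congrFun h 0⟩
  have key := tendsto_lattice_sum (n := 1) (ε := ε) (fun j => ⟨h.pos j, (h.1.1 j).1.2.1.le⟩)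
    (Φ := fun j κ => Φ (p j) (ε j) (split (k j) i (κ 0))) (M := M) (R := R)
    (fun j κ => hM _ _ _ (h.1.1 j))
    (fun j κ hne r a => by
      have := hR _ _ _ (h.1.1 j) hne 0 a
      rw [Subsingleton.elim r 0]
      exact this)
    (fun j => (box d (ε j)).map emb)
    (fun j κ hκ => by
      by_contra hne
      refine hκ (Finset.mem_map.2 ⟨κ 0, hbox _ _ _ (h.1.1 j) hne, ?_⟩)
      funext r
      rw [Subsingleton.elim r 0]
      rfl)
    (Lim := fun u => L (splitPt v i (u 0))) (by
      filter_upwards [ae_generic_splitPt hv i] with u hu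
      exact hL _ hu _ _ _ (h.split i (u 0)))
  refine key.congr fun j => ?_
  rw [pow_one, Finset.sum_map]
  rfl

/-! ### Families with a scaling limit -/

/-- Bounded kernels which converge in the scaling limit at generic configurations. -/
def Tame {m : ℕ} (f : Mode d → ℝ → 𝕄 m → ℂ) : Prop :=
  (∃ M, ∀ p ε k, Adm w p ε → ‖f p ε k‖ ≤ M) ∧ ∀ v, Generic v → Conv w v f

section Tame

variable {w} {m : ℕ} {f g : Mode d → ℝ → (Fin m → Mode d) → ℂ}

lemma tame_const (c : ℂ) : Tame w (m := m) fun _ _ _ => c :=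
  ⟨⟨‖c‖, fun _ _ _ _ => le_rfl⟩, fun _ _ => conv_const c⟩

lemma Tame.mul (hf : Tame w f) (hg : Tame w g) : Tame w fun p ε k => f p ε k * g p ε k := by
  obtain ⟨⟨M, hM⟩, h1⟩ := hf
  obtain ⟨⟨M', hM'⟩, h2⟩ := hg
  refine ⟨⟨M * M', fun p ε k h => ?_⟩, fun v hv => (h1 v hv).mul (h2 v hv)⟩
  rw [norm_mul]
  exact mul_le_mul (hM p ε k h) (hM' p ε k h) (norm_nonneg _) ((norm_nonneg _).trans (hM p ε k h))

lemma Tame.sum {ι : Type*} {s : Finset ι} {f : ι → Mode d → ℝ → 𝕄 m → ℂ}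
    (hf : ∀ i ∈ s, Tame w (f i)) : Tame w fun p ε k => ∑ i ∈ s, f i p ε k := by
  refine ⟨?_, fun v hv => Conv.sum s fun i hi => (hf i hi).2 v hv⟩
  choose! M hM using fun i hi => (hf i hi).1
  exact ⟨∑ i ∈ s, M i, fun p ε k h => norm_sum_le_of_le s fun i hi => hM i hi p ε k h⟩

lemma Tame.congr (hf : Tame w f) (h : ∀ p ε k, Adm w p ε → f p ε k = g p ε k) : Tame w g := by
  obtain ⟨⟨M, hM⟩, h1⟩ := hf
  exact ⟨⟨M, fun p ε k hk => h p ε k hk ▸ hM p ε k hk⟩,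
    fun v hv => (h1 v hv).congr fun p ε k hk _ => h p ε k hk⟩

lemma Tame.merge (hf : Tame w f) {i c : Fin (m + 1)} (hic : i ≠ c) :
    Tame w fun p ε (k : 𝕄 (m + 1)) => f p ε (merge k i c) := by
  obtain ⟨⟨M, hM⟩, h1⟩ := hf
  refine ⟨⟨M, fun p ε k hk => hM p ε _ hk⟩, fun v hv => ?_⟩
  obtain ⟨L, hL⟩ := h1 _ (hv.mergePt hic)
  exact ⟨L, fun p ε k hk => hL p ε _ (hk.merge hic)⟩

lemma card_box_le {ε : ℝ} (hε : 0 < ε) (hε1 : ε ≤ 1) : ε ^ d * ((box d ε).card : ℝ) ≤ 5 ^ d := by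
  have h1 : ((box d ε).card : ℝ) = ((2 * ⌈ε⁻¹⌉ + 1 : ℤ) : ℝ) ^ d := by
    have : 0 ≤ ⌈ε⁻¹⌉ := Int.ceil_nonneg (by positivity)
    have h2 : (((⌈ε⁻¹⌉ + 1 + ⌈ε⁻¹⌉).toNat : ℕ) : ℤ) = 2 * ⌈ε⁻¹⌉ + 1 := by omega
    have h3 : (box d ε).card = (⌈ε⁻¹⌉ + 1 + ⌈ε⁻¹⌉).toNat ^ d := by simp [box]
    rw [← h2, h3]
    push_cast
    rfl
  rw [h1, ← mul_pow]
  have h3 : (0 : ℝ) ≤ (⌈ε⁻¹⌉ : ℝ) := by exact_mod_cast Int.ceil_nonneg (by positivity)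
  have h4 := Int.ceil_lt_add_one ε⁻¹
  have h5 : ε * ε⁻¹ = 1 := mul_inv_cancel₀ hε.ne'
  push_cast
  refine pow_le_pow_left₀ (by positivity) ?_ d
  nlinarith

lemma Tame.loop (i : Fin m) {Φ : Mode d → ℝ → 𝕄 (m + 1) → ℂ} {R : ℝ} (hΦ : Tame w Φ)
    (hR : ∀ p ε κ, Adm w p ε → Φ p ε κ ≠ 0 → ∀ r a, ε * |(κ r a : ℝ)| ≤ R)
    (hbox : ∀ p ε κ, Adm w p ε → Φ p ε κ ≠ 0 → κ 0 ∈ box d ε) :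
    Tame w fun p ε k => ((ε ^ d : ℝ) : ℂ) * ∑ l ∈ box d ε, Φ p ε (split k i l) := by
  obtain ⟨⟨M, hM⟩, h1⟩ := hΦ
  refine ⟨⟨5 ^ d * M, fun p ε k h => ?_⟩, fun v hv => conv_loop hv i hM hR hbox h1⟩
  have hε := h.1.1
  have hM0 := (norm_nonneg _).trans (hM p ε 0 h)
  rw [norm_mul, norm_real, Real.norm_of_nonneg (by positivity)]
  calc _ ≤ ε ^ d * ((box d ε).card * M) := by
        gcongr
        refine (norm_sum_le_of_le _ fun l _ => hM p ε _ h).trans_eq ?_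
        rw [sum_const, nsmul_eq_mul]
    _ = ε ^ d * (box d ε).card * M := by ring
    _ ≤ _ := by gcongr; exact card_box_le hε h.1.2.1.le

/-- The drift of a partial momentum, divided by the total energy. -/
lemma tame_dot (hd : 3 ≤ d) (hm : 2 ≤ m) {A : 𝕄 m → Mode d}
    {α : (Fin m → Fin d → ℝ) → Fin d → ℝ} (hA : ∀ k, modeSq (A k) ≤ 4 * tupleSq k)
    (hα : ∀ v p ε k, Compat w v p ε k → ∀ a,
      Tendsto (fun j => ε j * (A (k j) a : ℝ)) atTop (𝓝 (α v a))) :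
    Tame w fun _ ε k => ((ε⁻¹ * invLam.val m k : ℝ) : ℂ) * ((ε * dotMode w (A k) : ℝ) : ℂ) := by
  refine ⟨⟨3 * ‖w‖, fun p ε k h => ?_⟩, fun v hv => (conv_invLam (hv.sum_sq_pos hm hd)).mul
    (Conv.of_real ⟨_, fun p ε k hk => tendsto_mul_dotMode (hα v p ε k hk)⟩)⟩
  have hε := h.1.1
  simp only [← ofReal_mul, norm_real, norm_eq_abs]
  refine abs_le_of_sq_le_sq ?_ (by positivity)
  have h1 := dotMode_sq_le w (A k)
  have h2 := hA k
  have h3 := invLam_val_sq k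
  have e : (ε⁻¹ * invLam.val m k * (ε * dotMode w (A k))) ^ 2 =
      invLam.val m k ^ 2 * dotMode w (A k) ^ 2 := by
    field_simp
  rw [e, h3]
  rcases (tupleSq_nonneg k).eq_or_lt with h0 | h0
  · rw [← h0]; simp
  · calc _ ≤ (1 / 2 * tupleSq k)⁻¹ * (‖w‖ ^ 2 * (4 * tupleSq k)) := by
          gcongr; exact h1.trans (by gcongr)
      _ = 8 * ‖w‖ ^ 2 := by field_simp; ring
      _ ≤ _ := by nlinarith [sq_nonneg ‖w‖]

lemma tame_cutoff (hd : 3 ≤ d) (hm : 3 ≤ m) {i c : Fin m} (hic : i ≠ c) :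
    Tame w fun _ ε (k : 𝕄 m) => ((cutoff ε (k i) (k c) : ℝ) : ℂ) := by
  refine ⟨⟨1, fun p ε k _ => ?_⟩, fun v hv => conv_cutoff hd (α := v i) (β := v c)
    (hv.apply (by omega) i) (hv.apply (by omega) c) (hv.apply_add hm hic)
    (fun p ε k h => h.2.2 i) (fun p ε k h => h.2.2 c)⟩
  rw [norm_real, Real.norm_of_nonneg (cutoff_nonneg _ _ _)]
  exact cutoff_le_one _ _ _

end Tame

/-- The multiplier `min(1, ε Λ / δ)`, which removes low energies on the scale `ε⁻¹`. -/
def cutMul (d : ℕ) (ε δ : ℝ) : Multiplier d where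
  val _ k := min 1 |ε / δ * √(1 / 2 * tupleSq k)|
  symm n σ k := by rw [tupleSq_comp_perm]
  bdd := ⟨1, zero_le_one, fun n k => by
    rw [abs_of_nonneg (le_min zero_le_one (abs_nonneg _))]; exact min_le_left _ _⟩

lemma cutMul_val_nonneg (ε δ : ℝ) {n : ℕ} (k : 𝕄 n) : 0 ≤ (cutMul d ε δ).val n k :=
  le_min zero_le_one (abs_nonneg _)

lemma cutMul_val_le_one (ε δ : ℝ) {n : ℕ} (k : 𝕄 n) : (cutMul d ε δ).val n k ≤ 1 := min_le_left _ _

lemma invLam_mul_cutMul_le {ε δ : ℝ} (hε : 0 < ε) (hδ : 0 < δ) {n : ℕ} (k : 𝕄 n) :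
    invLam.val n k * (cutMul d ε δ).val n k ≤ ε / δ := by
  have h1 : (cutMul d ε δ).val n k ≤ ε / δ * √(1 / 2 * tupleSq k) :=
    (min_le_right _ _).trans_eq (abs_of_nonneg (by positivity))
  calc _ ≤ invLam.val n k * (ε / δ * √(1 / 2 * tupleSq k)) := by
        gcongr; exact invLam_val_nonneg k
    _ = ε / δ * ((√(1 / 2 * tupleSq k))⁻¹ * √(1 / 2 * tupleSq k)) := by
        simp only [invLam]; ring
    _ ≤ ε / δ * 1 := by gcongr; exact inv_mul_le_one
    _ = _ := mul_one _

lemma tame_cutMul (w : 𝔼 d) (hd : 3 ≤ d) {m : ℕ} (hm : 2 ≤ m) {δ : ℝ}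
    (hδ : 0 < δ) : Tame w fun _ ε (k : 𝕄 m) =>
      ((ε⁻¹ * (invLam.val m k * (cutMul d ε δ).val m k) : ℝ) : ℂ) := by
  refine ⟨⟨δ⁻¹, fun p ε k h => ?_⟩, fun v hv => ?_⟩
  · have hε := h.1.1
    have := invLam_val_nonneg k
    have := cutMul_val_nonneg ε δ k
    rw [norm_real, Real.norm_of_nonneg (by positivity)]
    calc _ ≤ ε⁻¹ * (ε / δ) := by gcongr; exact invLam_mul_cutMul_le hε hδ k
      _ = _ := by field_simp
  · have h2 : Conv w v fun _ ε (k : 𝕄 m) => (((cutMul d ε δ).val m k : ℝ) : ℂ) := by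
      refine Conv.of_real ⟨min 1 |√(1 / 2 * ∑ i, ∑ a, v i a ^ 2) / δ|, fun p ε k h => ?_⟩
      refine (tendsto_const_nhds.min
        ((((h.tendsto_tupleSq.const_mul (1 / 2)).sqrt).div_const δ).abs)).congr fun j => ?_
      rw [sqrt_half_mul (h.pos j), mul_div_right_comm]
      rfl
    refine ((conv_invLam (hv.sum_sq_pos hm hd)).mul h2).congr fun p ε k _ _ => ?_
    push_cast
    ring

/-- The square root of the volume of a cell of the rescaled lattice. -/
def cellRoot (d : ℕ) (ε : ℝ) : ℝ := √(ε ^ d)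

lemma cellRoot_pos {ε : ℝ} (hε : 0 < ε) : 0 < cellRoot d ε := sqrt_pos.2 (by positivity)

lemma cellRoot_sq {ε : ℝ} (hε : 0 < ε) : cellRoot d ε ^ 2 = ε ^ d := sq_sqrt (by positivity)

lemma coupling_eq (hd : 3 ≤ d) {ε : ℝ} (hε : 0 < ε) : coupling d ε = cellRoot d ε / ε := by
  rw [coupling, if_neg (by omega), cellRoot, Real.sqrt_eq_rpow, ← Real.rpow_natCast,
    ← Real.rpow_mul hε.le, Real.rpow_sub hε, Real.rpow_one]
  congr 2
  ring

/-- The constant `annihCoef` without the power of the scale. -/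
def annihConst (d a b n : ℕ) : ℂ := if a ≤ n ∧ n < b then
    -(I / (((2 * π) ^ ((d : ℝ) / 2) : ℝ) : ℂ)) * ((√(n + 1) : ℝ) : ℂ) else 0

lemma annihCoef_eq_mul (hd : 3 ≤ d) {ε : ℝ} (hε : 0 < ε) (a b n : ℕ) :
    annihCoef d ε a b n = annihConst d a b n * ((cellRoot d ε / ε : ℝ) : ℂ) := by
  unfold annihCoef annihConst
  split_ifs
  · rw [coupling_eq hd hε]; push_cast; ring
  · rw [zero_mul]

/-- The rescaled kernel of order `n + 1`. -/
def kern (ε : ℝ) (n : ℕ) (x : Fock d) (k : 𝕄 (n + 1)) : ℂ :=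
  (((cellRoot d ε ^ n)⁻¹ : ℝ) : ℂ) * co x (n + 1) k

lemma co_eq_kern {ε : ℝ} (hε : 0 < ε) (n : ℕ) (x : Fock d) (k : 𝕄 (n + 1)) :
    co x (n + 1) k = ((cellRoot d ε ^ n : ℝ) : ℂ) * kern ε n x k := by
  have := pow_pos (cellRoot_pos (d := d) hε) n
  rw [kern, ← mul_assoc, ← ofReal_mul, mul_inv_cancel₀ this.ne', Complex.ofReal_one, one_mul]

/-- Families of Fock vectors with finitely many kernels of orders at least two, total momentum `p`,
modes of order `ε⁻¹`, and whose rescaled kernels are bounded and have a scaling limit. -/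
def Good (w : 𝔼 d) (Y : Mode d → ℝ → Fock d) : Prop :=
  (∃ (N : ℕ) (R : ℝ), ∀ p ε n k, Adm w p ε → co (Y p ε) n k ≠ 0 →
    (2 ≤ n ∧ n ≤ N) ∧ ∑ i, k i = p ∧ ∀ i a, ε * |(k i a : ℝ)| ≤ R) ∧
  ∀ n, Tame w fun p ε k => kern ε n (Y p ε) k

section Good

variable {w} {Y Z : Mode d → ℝ → Fock d}

lemma Good.kern_zero (hY : Good w Y) {p : Mode d} {ε : ℝ} (h : Adm w p ε)
    (k : 𝕄 (0 + 1)) : kern ε 0 (Y p ε) k = 0 := by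
  obtain ⟨⟨N, R, hs⟩, -⟩ := hY
  by_contra hne
  have := (hs p ε _ k h (right_ne_zero_of_mul hne)).1.1
  omega

lemma mul_abs_le_one_of_cutoffNorm {ε : ℝ} {l : Mode d}
    (h : 0 < ε * cutoffNorm l ∧ ε * cutoffNorm l ≤ 1) (a : Fin d) : ε * |(l a : ℝ)| ≤ 1 := by
  have hε := eps_pos_of_cutoffNorm_pos h.1
  calc _ ≤ ε * ε⁻¹ := by gcongr; exact abs_coord_le_inv h a
    _ = 1 := mul_inv_cancel₀ hε.ne'

lemma Good.lower (hd : 3 ≤ d) (hY : Good w Y) {a b : ℕ} (ha : 2 ≤ a) {δ : ℝ} (hδ : 0 < δ) :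
    Good w fun p ε => lower w ε a b ((cutMul d ε δ).op (Y p ε)) := by
  obtain ⟨⟨N, R, hs⟩, hT⟩ := hY
  refine ⟨⟨N, max R 1, fun p ε n k h hne => ?_⟩, fun n => ?_⟩
  · have hn : a ≤ n ∧ n < b := by
      by_contra hn
      exact hne (co_lower_of_notMem w ε _ k hn)
    rw [co_lower] at hne
    obtain ⟨j, -, hj⟩ := Finset.exists_ne_zero_of_sum_ne_zero
      (right_ne_zero_of_mul (right_ne_zero_of_mul hne))
    obtain ⟨l, -, hl⟩ := Finset.exists_ne_zero_of_sum_ne_zero hj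
    have h1 : co (Y p ε) (n + 1) (split k j l) ≠ 0 :=
      right_ne_zero_of_mul (right_ne_zero_of_mul (right_ne_zero_of_mul hl))
    have h2 : cutoff ε l (k j - l) ≠ 0 := fun h0 => hl (by rw [h0]; simp)
    obtain ⟨h3, h4, h5⟩ := hs p ε _ _ h h1
    refine ⟨⟨by omega, by omega⟩, by rw [← h4, sum_split], fun i c => ?_⟩
    by_cases hi : i = j
    · have h6 := (of_cutoff_ne_zero h2).2.2
      rw [add_sub_cancel] at h6
      rw [hi]
      exact (mul_abs_le_one_of_cutoffNorm h6 c).trans (le_max_right _ _)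
    · have h6 := h5 i.succ c
      rw [split, Fin.cons_succ, Function.update_of_ne hi] at h6
      exact h6.trans (le_max_left _ _)
  · by_cases hn : a ≤ n + 1 ∧ n + 1 < b
    swap
    · refine (tame_const 0).congr fun p ε k h => ?_
      rw [kern, co_lower_of_notMem w ε _ k hn, mul_zero]
    have key : ∀ j : Fin (n + 1), Tame w fun p ε (κ : 𝕄 (n + 2)) =>
        ((cutoff ε (κ 0) (κ j.succ) : ℝ) : ℂ) *
          (((ε⁻¹ * (invLam.val _ κ * (cutMul d ε δ).val _ κ) : ℝ) : ℂ) *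
            kern ε (n + 1) (Y p ε) κ) := fun j =>
      (tame_cutoff hd (by omega) (Fin.succ_ne_zero j).symm).mul
        ((tame_cutMul w hd (by omega) hδ).mul (hT (n + 1)))
    have key2 := fun j : Fin (n + 1) => (tame_dot (w := w) hd (m := n + 1) (by omega)
      (A := fun k => k j) (α := fun v => v j)
      (fun k => (modeSq_le_tupleSq k j).trans (by linarith [tupleSq_nonneg k]))
      (fun v p ε k h => h.2.2 j)).mul ((key j).loop (R := R) j
        (fun p ε κ h hne => (hs p ε _ κ h (right_ne_zero_of_mul (right_ne_zero_of_mul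
          (right_ne_zero_of_mul hne)))).2.2)
        (fun p ε κ h hne => mem_box_of_cutoff (fun h0 => hne (by rw [h0]; simp))))
    refine ((tame_const (annihConst d a b (n + 1))).mul
      (Tame.sum (s := univ) fun j _ => key2 j)).congr fun p ε k h => ?_
    have hε := h.1.1
    have hr := cellRoot_pos (d := d) hε
    rw [kern, co_lower, annihCoef_eq_mul hd hε]
    simp only [mul_sum]
    refine sum_congr rfl fun j _ => sum_congr rfl fun l _ => ?_
    rw [co_op, co_eq_kern hε (n + 1)]
    have e1 : split k j l 0 = l := rfl
    have e2 : split k j l j.succ = k j - l := by rw [split, Fin.cons_succ, Function.update_self]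
    rw [e1, e2, ← cellRoot_sq hε]
    have hε' : (ε : ℂ) ≠ 0 := ofReal_ne_zero.2 hε.ne'
    have hr' : (cellRoot d ε : ℂ) ≠ 0 := ofReal_ne_zero.2 hr.ne'
    push_cast
    field_simp
    ring

lemma Good.raise (hd : 3 ≤ d) (hY : Good w Y) {a b : ℕ} (ha : 2 ≤ a) {δ : ℝ} (hδ : 0 < δ) :
    Good w fun p ε => raise w ε a b ((cutMul d ε δ).op (Y p ε)) := by
  obtain ⟨⟨N, R, hs⟩, hT⟩ := hY
  refine ⟨⟨N + 1, max R 1, fun p ε n k h hne => ?_⟩, fun n => ?_⟩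
  · have hn : a + 1 ≤ n ∧ n ≤ b := by
      by_contra hn
      exact hne (co_raise_of_notMem w ε _ k hn)
    obtain _ | n := n
    · omega
    rw [co_raise] at hne
    obtain ⟨i, -, hi⟩ := Finset.exists_ne_zero_of_sum_ne_zero
      (right_ne_zero_of_mul (right_ne_zero_of_mul (right_ne_zero_of_mul hne)))
    obtain ⟨c, -, hc⟩ := Finset.exists_ne_zero_of_sum_ne_zero hi
    have hic : i ≠ c := fun h0 => hc (by rw [pairTerm, if_pos h0])
    rw [pairTerm, if_neg hic] at hc
    have h1 : co (Y p ε) n (merge k i c) ≠ 0 :=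
      right_ne_zero_of_mul (right_ne_zero_of_mul (right_ne_zero_of_mul hc))
    have h2 : cutoff ε (k i) (k c) ≠ 0 := fun h0 => hc (by rw [h0]; simp)
    obtain ⟨h3, h4, h5⟩ := hs p ε _ _ h h1
    refine ⟨⟨by omega, by omega⟩, by rw [← h4, sum_merge _ hic], fun r e => ?_⟩
    have h6 := of_cutoff_ne_zero h2
    by_cases hrc : r = c
    · rw [hrc]
      exact (mul_abs_le_one_of_cutoffNorm h6.2.1 e).trans (le_max_right _ _)
    by_cases hri : r = i
    · rw [hri]
      exact (mul_abs_le_one_of_cutoffNorm h6.1 e).trans (le_max_right _ _)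
    · obtain ⟨r', rfl⟩ := Fin.exists_succAbove_eq hrc
      have h7 := h5 r' e
      rw [merge, Function.update_of_ne hri] at h7
      exact h7.trans (le_max_left _ _)
  · obtain _ | n := n
    · refine (tame_const 0).congr fun p ε k h => ?_
      rw [kern, co_raise_of_notMem w ε _ k (by omega), mul_zero]
    obtain _ | n := n
    · refine (tame_const 0).congr fun p ε k h => ?_
      rw [kern, co_raise_of_notMem w ε _ k (by omega), mul_zero]
    have key : ∀ i c : Fin (n + 3), i ≠ c → Tame w fun p ε (k : 𝕄 (n + 3)) =>
        (((ε⁻¹ * invLam.val _ k : ℝ) : ℂ) * ((ε * dotMode w (k i + k c) : ℝ) : ℂ)) *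
          (((cutoff ε (k i) (k c) : ℝ) : ℂ) *
          (((ε⁻¹ * (invLam.val _ (merge k i c) * (cutMul d ε δ).val _ (merge k i c)) : ℝ) : ℂ) *
            kern ε (n + 1) (Y p ε) (merge k i c))) := fun i c hic => by
      have h1 := (tame_cutMul w hd (m := n + 2) (by omega) hδ).merge hic
      have h2 := (hT (n + 1)).merge hic
      have h3 := tame_dot (w := w) hd (m := n + 3) (by omega)
        (A := fun k => k i + k c) (α := fun v => v i + v c)
        (fun k => by
          have e1 := modeSq_add_le (k i) (k c)
          have e2 := modeSq_le_tupleSq k i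
          have e3 := modeSq_le_tupleSq k c
          linarith)
        (fun v p ε k h e => ((h.2.2 i e).add (h.2.2 c e)).congr fun j => by
          rw [Pi.add_apply, Int.cast_add, mul_add])
      exact h3.mul ((tame_cutoff hd (by omega) hic).mul (h1.mul h2))
    have key2 : ∀ i c : Fin (n + 3), Tame w fun p ε (k : 𝕄 (n + 3)) =>
        if i = c then 0 else
        (((ε⁻¹ * invLam.val _ k : ℝ) : ℂ) * ((ε * dotMode w (k i + k c) : ℝ) : ℂ)) *
          (((cutoff ε (k i) (k c) : ℝ) : ℂ) *
          (((ε⁻¹ * (invLam.val _ (merge k i c) * (cutMul d ε δ).val _ (merge k i c)) : ℝ) : ℂ) *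
            kern ε (n + 1) (Y p ε) (merge k i c))) := fun i c => by
      by_cases hic : i = c
      · simp only [if_pos hic]; exact tame_const 0
      · simp only [if_neg hic]; exact key i c hic
    refine ((tame_const (annihConst d a b (n + 2) * (((n + 2 : ℕ) : ℂ) + 1)⁻¹)).mul
      (Tame.sum (s := univ) fun i _ =>
        Tame.sum (s := univ) fun c _ => key2 i c)).congr fun p ε k h => ?_
    have hε := h.1.1
    have hr := cellRoot_pos (d := d) hε
    have hε' : (ε : ℂ) ≠ 0 := ofReal_ne_zero.2 hε.ne'
    have hr' : (cellRoot d ε : ℂ) ≠ 0 := ofReal_ne_zero.2 hr.ne'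
    rw [kern, co_raise, annihCoef_eq_mul hd hε]
    simp only [mul_sum]
    refine sum_congr rfl fun i _ => sum_congr rfl fun c _ => ?_
    rw [pairTerm]
    split_ifs
    · simp
    rw [co_op, co_op, co_eq_kern hε (n + 1)]
    push_cast
    field_simp
    ring

end Good

/-! ### Scalar products in the scaling limit -/

lemma mem_cube_floor {l : Mode d} {x : ℝ} (h : ∀ a, |(l a : ℝ)| ≤ x) : l ∈ cube d ⌊x⌋₊ := by
  refine mem_cube.2 fun a => ?_
  have h1 : (((l a).natAbs : ℕ) : ℝ) ≤ x := by
    rw [Nat.cast_natAbs, Int.cast_abs]; exact h a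
  rw [Int.abs_eq_natAbs]
  exact_mod_cast Nat.le_floor h1

/-- Sums over the tuples of momentum `p`, parametrised by all but the first of the modes. -/
lemma hasSum_of_momentum {E : Type*} [NormedAddCommGroup E] {F : Idx d → E} {p : Mode d} {N r : ℕ}
    (hF : ∀ i, F i ≠ 0 → (1 ≤ i.1 ∧ i.1 ≤ N) ∧ ∑ j, i.2 j = p ∧ ∀ j, i.2 j ∈ cube d r) :
    HasSum F (∑ n ∈ range N, ∑ κ ∈ Fintype.piFinset (fun _ : Fin n => cube d r),
      F ⟨n + 1, Fin.cons (p - ∑ j, κ j) κ⟩) := by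
  classical
  let g : Idx d → Idx d := fun i => ⟨i.1 + 1, Fin.cons (p - ∑ j, i.2 j) i.2⟩
  have hg : Function.Injective g := by
    rintro ⟨n, κ⟩ ⟨n', κ'⟩ h
    obtain rfl : n = n' := Nat.succ_injective (congrArg Sigma.fst h)
    obtain ⟨-, rfl⟩ := Fin.cons_injective2 (eq_of_heq (Sigma.mk.inj h).2)
    rfl
  have hr : ∀ i, F i ≠ 0 → ∃ κ : 𝕄 (i.1 - 1), g ⟨i.1 - 1, κ⟩ = i ∧ ∀ j, κ j ∈ cube d r := by
    rintro ⟨n, k⟩ h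
    obtain ⟨⟨h1, -⟩, h2, h3⟩ := hF _ h
    obtain _ | n := n
    · simp at h1
    refine ⟨Fin.tail k, ?_, fun j => h3 j.succ⟩
    have : p - ∑ j, Fin.tail k j = k 0 := by
      rw [← h2]
      simp only [Fin.sum_univ_succ, Fin.tail]
      abel
    change (⟨n + 1, Fin.cons (p - ∑ j, Fin.tail k j) (Fin.tail k)⟩ : Idx d) = _
    rw [this, Fin.cons_self_tail]
  rw [← hg.hasSum_iff fun i hi => by
    by_contra h
    obtain ⟨κ, h1, -⟩ := hr i h
    exact hi ⟨_, h1⟩]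
  have := hasSum_sum_of_ne_finset_zero (L := .unconditional _) (f := F ∘ g)
    (s := (range N).sigma fun n => Fintype.piFinset fun _ : Fin n => cube d r) (by
      rintro i hi
      by_contra h
      obtain ⟨⟨-, h1⟩, -, h3⟩ := hF _ h
      refine hi (Finset.mem_sigma.2 ⟨Finset.mem_range.2 h1, Fintype.mem_piFinset.2 fun j => ?_⟩)
      exact h3 j.succ)
  rwa [Finset.sum_sigma] at this

lemma norm_sq_le_of_momentum {x : Fock d} {p : Mode d} {N r : ℕ} {ε : ℝ} (hε : 0 < ε)
    (hx : ∀ n k, co x n k ≠ 0 → (1 ≤ n ∧ n ≤ N) ∧ ∑ j, k j = p ∧ ∀ j, k j ∈ cube d r)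
    {M : ℕ → ℝ} (hM : ∀ n k, ‖kern ε n x k‖ ≤ M n) :
    ‖x‖ ^ 2 ≤ ∑ n ∈ range N, ((2 * r + 1) * ε) ^ (d * n) * M n ^ 2 := by
  rw [(hasSum_norm_sq x).unique (hasSum_of_momentum (p := p) (N := N) (r := r)
    fun i hi => hx i.1 i.2 fun h => hi (by simp [h]))]
  refine sum_le_sum fun n _ => ?_
  have h1 : ∀ k : 𝕄 (n + 1), ‖co x (n + 1) k‖ ^ 2 ≤ (ε ^ d) ^ n * M n ^ 2 := by
    intro k
    rw [co_eq_kern hε, norm_mul, mul_pow, norm_real, Real.norm_of_nonneg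
      (pow_nonneg (cellRoot_pos hε).le n), ← pow_mul, mul_comm n 2, pow_mul, cellRoot_sq hε]
    gcongr
    exact hM n k
  refine (sum_le_sum fun κ _ => h1 _).trans_eq ?_
  rw [sum_const, Fintype.card_piFinset_const, card_cube, nsmul_eq_mul, pow_mul, mul_pow, mul_pow]
  push_cast
  ring

lemma mul_abs_le_of_cutMul_ne_one {ε δ : ℝ} (hε : 0 < ε) (hδ : 0 < δ) {n : ℕ}
    {k : 𝕄 n} (h : (cutMul d ε δ).val n k ≠ 1) (j : Fin n) (a : Fin d) :
    ε * |(k j a : ℝ)| ≤ 2 * δ := by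
  have h5 : ε / δ * √(1 / 2 * tupleSq k) < 1 := by
    by_contra! h6
    exact h (min_eq_left (h6.trans (le_abs_self _)))
  have h6 : √(1 / 2 * tupleSq k) ≤ δ / ε := by
    rw [le_div_iff₀ hε, mul_comm]
    rw [div_mul_eq_mul_div, div_lt_one hδ] at h5
    exact h5.le
  rw [Real.sqrt_le_left (by positivity)] at h6
  have h7 : (k j a : ℝ) ^ 2 ≤ modeSq (k j) := Finset.single_le_sum
    (f := fun a => (k j a : ℝ) ^ 2) (fun _ _ => sq_nonneg _) (mem_univ a)
  have h8 := modeSq_le_tupleSq k j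
  have h9 : 0 < δ / ε := by positivity
  have h10 : |(k j a : ℝ)| ≤ 2 * (δ / ε) := abs_le_of_sq_le_sq (by nlinarith) (by positivity)
  rwa [← mul_div_assoc, le_div_iff₀ hε, mul_comm] at h10

section Good

variable {w} {Y Z : Mode d → ℝ → Fock d}

lemma Good.bounded (hY : Good w Y) : ∃ B, 0 ≤ B ∧ ∀ p ε, Adm w p ε → ‖Y p ε‖ ≤ B := by
  obtain ⟨⟨N, R, hs⟩, hT⟩ := hY
  choose M hM using fun n => (hT n).1
  refine ⟨_, sqrt_nonneg (∑ n ∈ range N, (2 * |R| + 1) ^ (d * n) * M n ^ 2),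
    fun p ε h => Real.le_sqrt_of_sq_le ?_⟩
  have hε := h.1.1
  refine (norm_sq_le_of_momentum (p := p) (N := N) (r := ⌊|R| / ε⌋₊) hε (fun n k hk => ?_)
    (fun n k => hM n p ε k h)).trans ?_
  · obtain ⟨h1, h2, h3⟩ := hs p ε n k h hk
    exact ⟨⟨by omega, h1.2⟩, h2, fun j => mem_cube_floor fun a => by
      rw [le_div_iff₀ hε, mul_comm]; exact (h3 j a).trans (le_abs_self R)⟩
  · refine sum_le_sum fun n _ => ?_
    gcongr
    have h1 := Nat.floor_le (a := |R| / ε) (by positivity)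
    rw [le_div_iff₀ hε] at h1
    nlinarith [h.1.2.1]

/-- Low energies carry little of the norm of a family with a scaling limit. -/
lemma Good.exists_norm_sub_cutMul_le (hd : 3 ≤ d) (hY : Good w Y) {η : ℝ} (hη : 0 < η) :
    ∃ δ, 0 < δ ∧ ∀ p ε, Adm w p ε → ε ≤ δ → ‖Y p ε - (cutMul d ε δ).op (Y p ε)‖ ≤ η := by
  have hY0 := hY
  obtain ⟨⟨N, R, hs⟩, hT⟩ := hY
  choose M hM using fun n => (hT n).1
  set S := ∑ n ∈ range N, M n ^ 2 with hS
  have hS0 : 0 ≤ S := sum_nonneg fun n _ => sq_nonneg _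
  set δ := min (1 / 5) (η ^ 2 / (5 * (S + 1))) with hδ
  have hδ0 : 0 < δ := lt_min (by norm_num) (by positivity)
  have hδ5 : 5 * δ ≤ 1 := by linarith [min_le_left (1 / 5) (η ^ 2 / (5 * (S + 1)))]
  have hδS : 5 * δ * (S + 1) ≤ η ^ 2 := by
    have := min_le_right (1 / 5) (η ^ 2 / (5 * (S + 1)))
    rw [← hδ, le_div_iff₀ (by positivity)] at this
    linarith
  refine ⟨δ, hδ0, fun p ε h hεδ => abs_le_of_sq_le_sq' ?_ hη.le |>.2⟩
  have hε := h.1.1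
  have hco : ∀ n (k : 𝕄 n), co (Y p ε - (cutMul d ε δ).op (Y p ε)) n k =
      ((1 - (cutMul d ε δ).val n k : ℝ) : ℂ) * co (Y p ε) n k := fun n k => by
    rw [co_sub, co_op]; push_cast; ring
  refine (norm_sq_le_of_momentum (p := p) (N := N) (r := ⌊2 * δ / ε⌋₊)
    (M := fun n => if n = 0 then 0 else M n) hε (fun n k hk => ?_) (fun n k => ?_)).trans ?_
  · rw [hco] at hk
    obtain ⟨h1, h2, h3⟩ := hs p ε n k h (right_ne_zero_of_mul hk)
    refine ⟨⟨by omega, h1.2⟩, h2, fun j => mem_cube_floor fun a => ?_⟩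
    rw [le_div_iff₀ hε, mul_comm]
    exact mul_abs_le_of_cutMul_ne_one hε hδ0
      (fun h0 => left_ne_zero_of_mul hk (by rw [h0]; simp)) j a
  · rw [kern, hco]
    have h1 := cutMul_val_nonneg ε δ k
    have h2 := cutMul_val_le_one ε δ k
    rw [mul_left_comm, norm_mul, norm_real, Real.norm_of_nonneg (by linarith)]
    change _ * ‖kern ε n (Y p ε) k‖ ≤ _
    split_ifs with hn
    · subst hn
      rw [hY0.kern_zero h, norm_zero, mul_zero]
    · calc _ ≤ 1 * ‖kern ε n (Y p ε) k‖ := by gcongr; linarith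
        _ ≤ _ := by rw [one_mul]; exact hM n p ε k h
  · calc _ ≤ ∑ n ∈ range N, 5 * δ * M n ^ 2 := by
          refine sum_le_sum fun n _ => ?_
          split_ifs with hn
          · simp; positivity
          · gcongr
            have h1 := Nat.floor_le (a := 2 * δ / ε) (by positivity)
            rw [le_div_iff₀ hε] at h1
            have h2 : (2 * (⌊2 * δ / ε⌋₊ : ℝ) + 1) * ε ≤ 5 * δ := by nlinarith
            calc _ ≤ (5 * δ) ^ (d * n) := by gcongr
              _ ≤ (5 * δ) ^ 1 := pow_le_pow_of_le_one (by positivity) hδ5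
                  (Nat.mul_pos (by omega) (Nat.pos_of_ne_zero hn))
              _ = _ := pow_one _
      _ = 5 * δ * S := by rw [← mul_sum]
      _ ≤ η ^ 2 := by nlinarith

/-- The scaling limit: the scale and the rescaled mode vanish. -/
def scaleLim (w : 𝔼 d) : Filter (Mode d × ℝ) := 𝓟 {x | Adm w x.1 x.2} ⊓ (comap Prod.snd (𝓝 0) ⊓
    comap (fun (x : Mode d × ℝ) (a : Fin d) => x.2 * (x.1 a : ℝ)) (𝓝 0))

instance : (scaleLim w).IsCountablyGenerated := by
  unfold scaleLim; infer_instance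

lemma eventually_scaleLim (w : 𝔼 d) {ε₀ : ℝ} (h : 0 < ε₀) :
    ∀ᶠ x in scaleLim w, Adm w x.1 x.2 ∧ x.2 ≤ ε₀ := by
  have h1 : ∀ᶠ x in scaleLim w, Adm w x.1 x.2 :=
    (inf_le_left : scaleLim w ≤ _) (mem_principal_self _)
  have h2 : Tendsto (Prod.snd : Mode d × ℝ → ℝ) (scaleLim w) (𝓝 0) :=
    tendsto_comap.mono_left (inf_le_right.trans inf_le_left)
  filter_upwards [h1, h2.eventually (ge_mem_nhds h)] with x h1 h2
  exact ⟨h1, h2⟩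

lemma tendsto_of_scaleSeq {f : Mode d → ℝ → ℂ} {c : ℂ}
    (h : ∀ p ε, IsScaleSeq w p ε → Tendsto (fun j => f (p j) (ε j)) atTop (𝓝 c)) :
    Tendsto (fun x : Mode d × ℝ => f x.1 x.2) (scaleLim w) (𝓝 c) := by
  refine tendsto_of_seq_tendsto fun x hx => ?_
  obtain ⟨h1, h2⟩ := tendsto_inf.1 hx
  obtain ⟨h2, h3⟩ := tendsto_inf.1 h2
  rw [tendsto_comap_iff] at h2 h3
  obtain ⟨J, hJ⟩ := eventually_atTop.1 (tendsto_principal.1 h1)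
  rw [← tendsto_add_atTop_iff_nat J]
  exact h (fun j => (x (j + J)).1) (fun j => (x (j + J)).2) ⟨fun j => hJ _ (by omega),
    h2.comp (tendsto_add_atTop_nat J), fun a =>
      ((tendsto_pi_nhds.1 h3) a).comp (tendsto_add_atTop_nat J)⟩

lemma Good.exists_tendsto_inner (hY : Good w Y) (hZ : Good w Z) :
    ∃ c : ℂ, Tendsto (fun x : Mode d × ℝ => (inner ℂ (Y x.1 x.2) (Z x.1 x.2) : ℂ))
      (scaleLim w) (𝓝 c) := by
  obtain ⟨⟨N, R, hs⟩, hT⟩ := hY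
  have key : ∀ n, Tame w fun p ε (k : 𝕄 (n + 1)) =>
      starRingEnd ℂ (kern ε n (Y p ε) k) * kern ε n (Z p ε) k := fun n =>
    Tame.mul ⟨by simpa only [RCLike.norm_conj] using (hT n).1, fun v hv => ((hT n).2 v hv).star⟩
      (hZ.2 n)
  choose M hM using fun n => (key n).1
  choose! L hL using fun n => (key n).2
  refine ⟨∑ n ∈ range N, ∫ u : Fin n → Fin d → ℝ, L n (Fin.cons (-∑ i, u i) u),
    tendsto_of_scaleSeq (f := fun p ε => inner ℂ (Y p ε) (Z p ε)) fun p ε h => ?_⟩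
  have hε := fun j => (h.1 j).1.1
  have hne : ∀ j n (k : 𝕄 (n + 1)), starRingEnd ℂ (kern (ε j) n (Y (p j) (ε j)) k) *
      kern (ε j) n (Z (p j) (ε j)) k ≠ 0 → co (Y (p j) (ε j)) (n + 1) k ≠ 0 := fun j n k h0 =>
    right_ne_zero_of_mul ((map_ne_zero _).1 (left_ne_zero_of_mul h0))
  have hcube : ∀ j n (k : 𝕄 n), co (Y (p j) (ε j)) n k ≠ 0 →
      ∀ i, k i ∈ cube d ⌊R / ε j⌋₊ := fun j n k h0 i => mem_cube_floor fun a => by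
    rw [le_div_iff₀ (hε j), mul_comm]
    exact (hs _ _ _ _ (h.1 j) h0).2.2 i a
  have hlim := tendsto_finsetSum (range N) fun n _ => tendsto_lattice_sum (n := n) (ε := ε)
    (fun j => ⟨hε j, (h.1 j).1.2.1.le⟩)
    (Φ := fun j κ => starRingEnd ℂ (kern (ε j) n (Y (p j) (ε j)) (Fin.cons (p j - ∑ i, κ i) κ)) *
        kern (ε j) n (Z (p j) (ε j)) (Fin.cons (p j - ∑ i, κ i) κ)) (M := M n) (R := R)
    (fun j κ => hM n _ _ _ (h.1 j))
    (fun j κ h0 i a => by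
      have := (hs _ _ _ _ (h.1 j) (hne j n _ h0)).2.2 i.succ a
      rwa [Fin.cons_succ] at this)
    (fun j => Fintype.piFinset fun _ => cube d ⌊R / ε j⌋₊)
    (fun j κ hκ => by
      by_contra h0
      refine hκ (Fintype.mem_piFinset.2 fun i => ?_)
      have := hcube j _ _ (hne j n _ h0) i.succ
      rwa [Fin.cons_succ] at this)
    (Lim := fun u => L n (Fin.cons (-∑ i, u i) u)) (by
      filter_upwards [ae_generic_cons d n] with u hu
      refine hL n _ hu p ε _ ⟨h, fun j => by rw [Fin.sum_cons]; abel, fun i a => ?_⟩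
      have hfl : ∀ i, Tendsto (fun j => ε j * (floorModes (ε j) u i a : ℝ)) atTop (𝓝 (u i a)) :=
        fun i => tendsto_mul_floor hε h.2.1 (u i a)
      refine Fin.cases ?_ (fun i => ?_) i
      · simp only [Fin.cons_zero]
        have := (h.2.2 a).sub (tendsto_finsetSum univ fun i _ => hfl i)
        rw [zero_sub] at this
        rw [Pi.neg_apply, Finset.sum_apply]
        refine this.congr fun j => ?_
        rw [Pi.sub_apply, Finset.sum_apply, Int.cast_sub, Int.cast_sum, mul_sub, mul_sum]
      · simp only [Fin.cons_succ]
        exact hfl i)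
  refine hlim.congr fun j => ?_
  rw [(hasSum_inner_co _ _).unique (hasSum_of_momentum (p := p j) (N := N) (r := ⌊R / ε j⌋₊)
    fun i hi => by
      have h0 : co (Y (p j) (ε j)) i.1 i.2 ≠ 0 := (map_ne_zero _).1 (left_ne_zero_of_mul hi)
      obtain ⟨h1, h2, -⟩ := hs _ _ _ _ (h.1 j) h0
      exact ⟨⟨by omega, h1.2⟩, h2, hcube j _ _ h0⟩)]
  refine sum_congr rfl fun n _ => ?_
  rw [mul_sum]
  refine sum_congr rfl fun κ _ => ?_
  rw [co_eq_kern (hε j), co_eq_kern (hε j), map_mul, conj_ofReal, ← cellRoot_sq (hε j)]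
  push_cast
  ring

end Good

/-! ### Families approximated by families with a scaling limit -/

section Approx

variable {w} {Y Z : Mode d → ℝ → Fock d}

lemma Tame.add {m : ℕ} {f g : Mode d → ℝ → 𝕄 m → ℂ} (hf : Tame w f) (hg : Tame w g) :
    Tame w fun p ε k => f p ε k + g p ε k := by
  obtain ⟨⟨M, hM⟩, h1⟩ := hf
  obtain ⟨⟨M', hM'⟩, h2⟩ := hg
  exact ⟨⟨M + M', fun p ε k h => norm_add_le_of_le (hM p ε k h) (hM' p ε k h)⟩,
    fun v hv => (h1 v hv).add (h2 v hv)⟩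

lemma Good.add (hY : Good w Y) (hZ : Good w Z) : Good w fun p ε => Y p ε + Z p ε := by
  obtain ⟨⟨N, R, h1⟩, h2⟩ := hY
  obtain ⟨⟨N', R', h3⟩, h4⟩ := hZ
  refine ⟨⟨max N N', max R R', fun p ε n k h hne => ?_⟩, fun n => ?_⟩
  · by_cases h0 : co (Y p ε) n k = 0
    · obtain ⟨h5, h6, h7⟩ := h3 p ε n k h fun h8 => hne (by rw [co_add, h0, h8, add_zero])
      exact ⟨⟨h5.1, h5.2.trans (le_max_right _ _)⟩, h6, fun i a =>
        (h7 i a).trans (le_max_right _ _)⟩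
    · obtain ⟨h5, h6, h7⟩ := h1 p ε n k h h0
      exact ⟨⟨h5.1, h5.2.trans (le_max_left _ _)⟩, h6, fun i a => (h7 i a).trans (le_max_left _ _)⟩
  · exact ((h2 n).add (h4 n)).congr fun p ε k _ => by simp only [kern, co_add, mul_add]

lemma Good.smul (c : ℂ) (hY : Good w Y) : Good w fun p ε => c • Y p ε := by
  obtain ⟨⟨N, R, h1⟩, h2⟩ := hY
  refine ⟨⟨N, R, fun p ε n k h hne => h1 p ε n k h (right_ne_zero_of_mul hne)⟩, fun n => ?_⟩
  exact ((tame_const c).mul (h2 n)).congr fun p ε k _ => by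
    simp only [kern, co_smul]; ring

variable (w) in
lemma good_zero : Good w fun _ _ => (0 : Fock d) :=
  ⟨⟨0, 0, fun _ _ _ _ _ h => absurd rfl h⟩, fun n => (tame_const 0).congr fun p ε k _ => by
    simp [kern]⟩

/-- Families which, at small scales, are uniformly approximated by families with a scaling limit. -/
def Approx (w : 𝔼 d) (Y : Mode d → ℝ → Fock d) : Prop :=
  ∀ η > 0, ∃ Z, Good w Z ∧ ∃ ε₀ > 0, ∀ p ε, Adm w p ε → ε ≤ ε₀ → ‖Y p ε - Z p ε‖ ≤ η

lemma Good.approx (hY : Good w Y) : Approx w Y := fun η hη =>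
  ⟨Y, hY, 1, one_pos, fun p ε _ _ => by rw [sub_self, norm_zero]; exact hη.le⟩

/-- Uniform limits at small scales. -/
lemma approx_of_forall_close (h : ∀ η > 0, ∃ Z, Approx w Z ∧ ∃ ε₀ > 0, ∀ p ε, Adm w p ε → ε ≤ ε₀ →
    ‖Y p ε - Z p ε‖ ≤ η) : Approx w Y := by
  intro η hη
  obtain ⟨Z, hZ, ε₀, hε₀, h1⟩ := h (η / 2) (half_pos hη)
  obtain ⟨Z', hZ', ε₁, hε₁, h2⟩ := hZ (η / 2) (half_pos hη)
  refine ⟨Z', hZ', min ε₀ ε₁, lt_min hε₀ hε₁, fun p ε h hε => ?_⟩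
  have := norm_sub_le_norm_sub_add_norm_sub (Y p ε) (Z p ε) (Z' p ε)
  linarith [h1 p ε h (hε.trans (min_le_left _ _)), h2 p ε h (hε.trans (min_le_right _ _))]

lemma Approx.add (hY : Approx w Y) (hZ : Approx w Z) : Approx w fun p ε => Y p ε + Z p ε := by
  intro η hη
  obtain ⟨Y', hY', ε₀, hε₀, h1⟩ := hY (η / 2) (half_pos hη)
  obtain ⟨Z', hZ', ε₁, hε₁, h2⟩ := hZ (η / 2) (half_pos hη)
  refine ⟨_, hY'.add hZ', min ε₀ ε₁, lt_min hε₀ hε₁, fun p ε h hε => ?_⟩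
  rw [add_sub_add_comm]
  have := norm_add_le (Y p ε - Y' p ε) (Z p ε - Z' p ε)
  linarith [h1 p ε h (hε.trans (min_le_left _ _)), h2 p ε h (hε.trans (min_le_right _ _))]

lemma Approx.smul (c : ℂ) (hY : Approx w Y) : Approx w fun p ε => c • Y p ε := by
  intro η hη
  obtain ⟨Z, hZ, ε₀, hε₀, h1⟩ := hY (η / (‖c‖ + 1)) (by positivity)
  refine ⟨_, hZ.smul c, ε₀, hε₀, fun p ε h hε => ?_⟩
  rw [← smul_sub, norm_smul]
  calc _ ≤ (‖c‖ + 1) * (η / (‖c‖ + 1)) := by gcongr; exacts [by linarith, h1 p ε h hε]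
    _ = η := by field_simp

/-- Operators which preserve the existence of a scaling limit after a cut-off at low energies. -/
lemma Approx.map (hd : 3 ≤ d) (hY : Approx w Y) {T : ℝ → 𝓛} {C : ℝ}
    (hC : 0 ≤ C) (hT : ∀ p ε, Adm w p ε → ∀ x, ‖T ε x‖ ≤ C * ‖x‖)
    (hG : ∀ Z, Good w Z → ∀ δ > 0, Good w fun p ε => T ε ((cutMul d ε δ).op (Z p ε))) :
    Approx w fun p ε => T ε (Y p ε) := by
  intro η hη
  have hη' : 0 < η / (2 * (C + 1)) := by positivity
  obtain ⟨Z, hZ, ε₀, hε₀, h1⟩ := hY _ hη'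
  obtain ⟨δ, hδ, h2⟩ := hZ.exists_norm_sub_cutMul_le hd hη'
  refine ⟨_, hG Z hZ δ hδ, min ε₀ δ, lt_min hε₀ hδ, fun p ε h hε => ?_⟩
  rw [← map_sub]
  have h3 := norm_sub_le_norm_sub_add_norm_sub (Y p ε) (Z p ε) ((cutMul d ε δ).op (Z p ε))
  have h4 : ‖Y p ε - (cutMul d ε δ).op (Z p ε)‖ ≤ η / (C + 1) := by
    have : η / (C + 1) = η / (2 * (C + 1)) + η / (2 * (C + 1)) := by field_simp; ring
    linarith [h1 p ε h (hε.trans (min_le_left _ _)), h2 p ε h (hε.trans (min_le_right _ _))]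
  calc _ ≤ C * ‖Y p ε - (cutMul d ε δ).op (Z p ε)‖ := hT p ε h _
    _ ≤ (C + 1) * (η / (C + 1)) := by gcongr; linarith
    _ = η := by field_simp

/-- The norm bound of `Λ⁻¹ A_∓ Λ⁻¹` from level `b`, in dimension at least three. -/
def latOpConst (w : 𝔼 d) : ℝ := opConst w (2 * latConst d)

lemma latOpConst_nonneg (w : 𝔼 d) : 0 ≤ latOpConst w := opConst_nonneg _ _

lemma Adm.norm_lower_le (hd : 3 ≤ d) {p : Mode d} {ε : ℝ} (h : Adm w p ε) (a b : ℕ) (x : Fock d) :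
    ‖lower w ε a b x‖ ≤ latOpConst w * b * ‖x‖ :=
  Burgers.norm_lower_le w (loopSum_le_of_three_le hd h.1.1) a b x

lemma Adm.norm_skewOp_le (hd : 3 ≤ d) {p : Mode d} {ε : ℝ} (h : Adm w p ε) (a b : ℕ) (x : Fock d) :
    ‖skewOp w ε a b x‖ ≤ 2 * (latOpConst w * b) * ‖x‖ :=
  Burgers.norm_skewOp_le w (loopSum_le_of_three_le hd h.1.1) a b x

lemma Approx.skewOp (hd : 3 ≤ d) (hY : Approx w Y) {a : ℕ} (ha : 2 ≤ a) (b : ℕ) :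
    Approx w fun p ε => skewOp w ε a b (Y p ε) :=
  hY.map hd (T := fun ε => Burgers.skewOp w ε a b) (by have := latOpConst_nonneg w; positivity)
    (fun p ε h x => h.norm_skewOp_le hd a b x)
    (fun _ hZ _ hδ => (hZ.lower hd ha hδ).add (hZ.raise hd ha hδ))

lemma Approx.resolvent (hd : 3 ≤ d) (hY : Approx w Y) {B : ℝ} (hB : ∀ p ε, Adm w p ε → ‖Y p ε‖ ≤ B)
    {a : ℕ} (ha : 2 ≤ a) (b : ℕ) :
    Approx w fun p ε => resolvent (Burgers.skewOp w ε a b) (Y p ε) := by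
  set R := 2 * (latOpConst w * b)
  have hiter : ∀ m, Approx w fun p ε =>
      dampedIter (Burgers.skewOp w ε a b) (1 / (1 + R ^ 2)) (Y p ε) m := by
    intro m
    induction m with
    | zero => exact (good_zero w).approx
    | succ m ih =>
      exact (ih.smul _).add (((ih.skewOp hd ha b).add hY).smul _)
  refine approx_of_forall_close fun η hη => ?_
  have hq : √(1 - 1 / (1 + R ^ 2)) < 1 := by
    rw [Real.sqrt_lt' one_pos]
    have : 0 < 1 / (1 + R ^ 2) := by positivity
    linarith
  have hB0 : 0 < |B| + 1 := by positivity
  obtain ⟨m, hm⟩ := exists_pow_lt_of_lt_one (div_pos hη hB0) hq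
  refine ⟨_, hiter m, 1, one_pos, fun p ε h _ => ?_⟩
  rw [norm_sub_rev]
  calc _ ≤ _ := (isSkew_skewOp w ε a b).norm_dampedIter_sub_le (h.norm_skewOp_le hd a b) _ m
    _ ≤ η / (|B| + 1) * (|B| + 1) := by
        gcongr
        exact (hB p ε h).trans (by linarith [le_abs_self B])
    _ = η := by field_simp

lemma exists_tendsto_of_approx {X : Type*} {l : Filter X} {f : X → ℂ}
    (h : ∀ η > 0, ∃ g : X → ℂ, (∃ c, Tendsto g l (𝓝 c)) ∧ ∀ᶠ x in l, ‖f x - g x‖ ≤ η) :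
    ∃ c, Tendsto f l (𝓝 c) := by
  rcases l.eq_or_neBot with rfl | hl
  · exact ⟨0, tendsto_bot⟩
  refine cauchy_map_iff_exists_tendsto.1 (Metric.cauchy_iff.2 ⟨hl.map f, fun η hη => ?_⟩)
  obtain ⟨g, ⟨c, hc⟩, hg⟩ := h (η / 5) (by positivity)
  refine ⟨Metric.ball c (2 * (η / 5)), ?_, fun x hx y hy => ?_⟩
  · rw [mem_map]
    filter_upwards [hg, hc.eventually (Metric.ball_mem_nhds c (by positivity : 0 < η / 5))]
      with x h1 h2
    rw [← dist_eq_norm] at h1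
    have := dist_triangle (f x) (g x) c
    have h3 : dist (g x) c < η / 5 := h2
    exact Metric.mem_ball.2 (by linarith)
  · have := dist_triangle_right x y c
    rw [Metric.mem_ball] at hx hy
    linarith

lemma Approx.bounded (hY : Approx w Y) :
    ∃ B, 0 ≤ B ∧ ∃ ε₀ > 0, ∀ p ε, Adm w p ε → ε ≤ ε₀ → ‖Y p ε‖ ≤ B := by
  obtain ⟨Z, hZ, ε₀, hε₀, h1⟩ := hY 1 one_pos
  obtain ⟨B, hB, h2⟩ := hZ.bounded
  refine ⟨1 + B, by positivity, ε₀, hε₀, fun p ε h hε => ?_⟩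
  have := norm_le_norm_sub_add (Y p ε) (Z p ε)
  linarith [h1 p ε h hε, h2 p ε h]

lemma Approx.exists_tendsto_inner (hY : Approx w Y) (hZ : Approx w Z) :
    ∃ c : ℂ, Tendsto (fun x : Mode d × ℝ => (inner ℂ (Y x.1 x.2) (Z x.1 x.2) : ℂ))
      (scaleLim w) (𝓝 c) := by
  refine exists_tendsto_of_approx fun η hη => ?_
  obtain ⟨B, hB, ε₀, hε₀, h1⟩ := hZ.bounded
  obtain ⟨Y', hY', ε₁, hε₁, h2⟩ := hY (η / (2 * (B + 1))) (by positivity)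
  obtain ⟨B', hB', h3⟩ := hY'.bounded
  obtain ⟨Z', hZ', ε₂, hε₂, h4⟩ := hZ (η / (2 * (B' + 1))) (by positivity)
  refine ⟨_, hY'.exists_tendsto_inner hZ', ?_⟩
  filter_upwards [eventually_scaleLim w (lt_min hε₀ (lt_min hε₁ hε₂))] with x ⟨hx, hε⟩
  rw [le_min_iff, le_min_iff] at hε
  have e : (inner ℂ (Y x.1 x.2) (Z x.1 x.2) : ℂ) - inner ℂ (Y' x.1 x.2) (Z' x.1 x.2) =
      inner ℂ (Y x.1 x.2 - Y' x.1 x.2) (Z x.1 x.2) +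
        inner ℂ (Y' x.1 x.2) (Z x.1 x.2 - Z' x.1 x.2) := by
    rw [inner_sub_left, inner_sub_right]; ring
  rw [e]
  calc _ ≤ η / (2 * (B + 1)) * (B + 1) + (B' + 1) * (η / (2 * (B' + 1))) := by
        refine norm_add_le_of_le ((norm_inner_le_norm _ _).trans ?_)
          ((norm_inner_le_norm _ _).trans ?_)
        · gcongr
          · exact h2 _ _ hx hε.2.1
          · linarith [h1 _ _ hx hε.1]
        · gcongr
          · linarith [h3 _ _ hx]
          · exact h4 _ _ hx hε.2.2
    _ = η := by field_simp; ring

/-- Families with a scaling limit vanish weakly. -/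
lemma Approx.tendsto_invLam (hd : 3 ≤ d) (hY : Approx w Y) {p : Mode d} (hp : dotMode w p ≠ 0) :
    Tendsto (fun ε => invLam.op (Y p ε)) (scaleFilter d) (𝓝 0) := by
  rw [tendsto_zero_iff_norm_tendsto_zero]
  refine tendsto_order.2 ⟨fun a ha => Eventually.of_forall fun _ => ha.trans_le (norm_nonneg _),
    fun η hη => ?_⟩
  obtain ⟨Z, hZ, ε₀, hε₀, h1⟩ := hY (η / 8) (by positivity)
  obtain ⟨δ, hδ, h2⟩ := hZ.exists_norm_sub_cutMul_le hd (by positivity : 0 < η / 8)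
  obtain ⟨B, hB, h3⟩ := hZ.bounded
  have hε₁ : 0 < min ε₀ (min δ (δ * (η / (4 * (B + 1))))) := by positivity
  filter_upwards [eventually_scale_le d hε₁, self_mem_nhdsWithin] with ε hε hs
  have h : Adm w p ε := ⟨hs, hp⟩
  obtain ⟨-, hε⟩ := hε
  rw [le_min_iff, le_min_iff] at hε
  have h4 : ‖invLam.op ((cutMul d ε δ).op (Z p ε))‖ ≤ η / 4 := by
    set m : Multiplier d :=
      { val := fun n k => invLam.val n k * (cutMul d ε δ).val n k
        symm := fun n σ k => by rw [invLam.symm, (cutMul d ε δ).symm]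
        bdd := ⟨ε / δ, by have := h.1.1; positivity, fun n k => by
          rw [abs_of_nonneg (mul_nonneg (invLam_val_nonneg k) (cutMul_val_nonneg ε δ k))]
          exact invLam_mul_cutMul_le h.1.1 hδ k⟩ }
    have e : invLam.op ((cutMul d ε δ).op (Z p ε)) = m.op (Z p ε) := Fock.ext fun n k => by
      simp only [co_op, m]; push_cast; ring
    have hε0 := h.1.1
    rw [e]
    calc _ ≤ ε / δ * ‖Z p ε‖ := m.norm_op_le (by positivity) _ fun n k _ => by
          rw [abs_of_nonneg (mul_nonneg (invLam_val_nonneg k) (cutMul_val_nonneg ε δ k))]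
          exact invLam_mul_cutMul_le h.1.1 hδ k
      _ ≤ η / (4 * (B + 1)) * (B + 1) := by
          refine mul_le_mul ?_ (by linarith [h3 p ε h]) (norm_nonneg _) (by positivity)
          rw [div_le_iff₀ hδ, mul_comm]
          exact hε.2.2
      _ = η / 4 := by field_simp
  have h5 := norm_invLam_le (Y p ε - (cutMul d ε δ).op (Z p ε))
  have h6 := norm_sub_le_norm_sub_add_norm_sub (Y p ε) (Z p ε) ((cutMul d ε δ).op (Z p ε))
  rw [map_sub] at h5
  have h7 := norm_le_norm_sub_add (invLam.op (Y p ε)) (invLam.op ((cutMul d ε δ).op (Z p ε)))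
  linarith [h1 p ε h hε.1, h2 p ε h hε.2.1]

end Approx

/-! ### The normalised source of a single mode -/

lemma invLam_val_one_pos {p : Mode d} (hp : p ≠ 0) : 0 < invLam.val 1 ![p] := by
  simp only [invLam, tupleSq_singleton]
  exact inv_pos.2 (lamMode_pos hp)

/-- The source generated by the mode `p`, normalised so that it has a scaling limit. -/
def modeDir (p : Mode d) (ε : ℝ) : Fock d := if hp : p ≠ 0 then
    (((dotMode w p * invLam.val 1 ![p])⁻¹ : ℝ) : ℂ) • raise w ε 1 2 (modeVec p hp)
  else 0

section

variable {w}

lemma Adm.raise_modeVec {p : Mode d} {ε : ℝ} (h : Adm w p ε) : raise w ε 1 2 (modeVec p h.ne_zero) =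
      ((dotMode w p * invLam.val 1 ![p] : ℝ) : ℂ) • modeDir w p ε := by
  have hne : dotMode w p * invLam.val 1 ![p] ≠ 0 :=
    mul_ne_zero h.2 (invLam_val_one_pos h.ne_zero).ne'
  rw [modeDir, dif_pos h.ne_zero, smul_smul, ← ofReal_mul, mul_inv_cancel₀ hne,
    Complex.ofReal_one, one_smul]

lemma Adm.co_modeDir {p : Mode d} {ε : ℝ} (h : Adm w p ε) (κ : 𝕄 2) :
    co (modeDir w p ε) 2 κ = if ∑ i, κ i = p then
      annihCoef d ε 1 2 1 * ((invLam.val 2 κ * cutoff ε (κ 0) (κ 1) : ℝ) : ℂ) else 0 := by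
  have hne : (dotMode w p : ℂ) ≠ 0 := ofReal_ne_zero.2 h.2
  have hne' : (invLam.val 1 ![p] : ℂ) ≠ 0 := ofReal_ne_zero.2 (invLam_val_one_pos h.ne_zero).ne'
  rw [modeDir, dif_pos h.ne_zero, co_smul, co_raise_modeVec, Fin.sum_univ_two]
  split_ifs
  · push_cast
    field_simp
  · rw [mul_zero]

lemma modeDir_support {p : Mode d} {ε : ℝ} (h : Adm w p ε) {n : ℕ} {k : 𝕄 n}
    (hne : co (modeDir w p ε) n k ≠ 0) :
    n = 2 ∧ ∑ i, k i = p ∧ ∀ i a, ε * |(k i a : ℝ)| ≤ 1 := by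
  have hn : n = 2 := by
    by_contra hn
    rw [modeDir, dif_pos h.ne_zero, co_smul, co_raise_of_notMem w ε _ k (by omega), mul_zero] at hne
    exact hne rfl
  subst hn
  rw [h.co_modeDir] at hne
  obtain ⟨h1, h2⟩ := ite_ne_right_iff.1 hne
  have h3 : cutoff ε (k 0) (k 1) ≠ 0 := fun h0 => h2 (by rw [h0]; simp)
  obtain ⟨h4, h5, -⟩ := of_cutoff_ne_zero h3
  refine ⟨rfl, h1, fun i a => ?_⟩
  fin_cases i
  · exact mul_abs_le_one_of_cutoffNorm h4 a
  · exact mul_abs_le_one_of_cutoffNorm h5 a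

/-- Of the two modes of a pair with finite total momentum, only the large one is cut off. -/
lemma conv_cutoff_pair (hd : 3 ≤ d) {v : Fin 2 → Fin d → ℝ} (hv : Generic v) :
    Conv w v fun _ ε k => ((cutoff ε (k 0) (k 1) : ℝ) : ℂ) := by
  classical
  refine Conv.of_real ⟨if ‖v 0‖ ≤ 1 ∧ ‖v 1‖ ≤ 1 then 1 else 0, fun p ε k h => ?_⟩
  refine tendsto_const_nhds.congr' ?_
  have hn : ∀ j, ε j * cutoffNorm (p j) = ‖fun a => ε j * (p j a : ℝ)‖ := by
    intro j
    have : (fun a => ε j * (p j a : ℝ)) = ε j • fun a => (p j a : ℝ) := rfl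
    rw [this, norm_smul, norm_eq_abs, abs_of_pos (h.pos j), cutoffNorm, if_neg (by omega)]
    congr 1
  have ht : Tendsto (fun j => ε j * cutoffNorm (p j)) atTop (𝓝 0) := by
    simp only [hn]
    rw [← norm_zero (E := Fin d → ℝ)]
    exact (tendsto_pi_nhds.2 h.1.2.2).norm
  filter_upwards [tendsto_indicator h.pos hd (hv.apply le_rfl 0) (h.2.2 0),
    tendsto_indicator h.pos hd (hv.apply le_rfl 1) (h.2.2 1),
    ht.eventually (ge_mem_nhds one_pos)] with j h1 h2 h3
  have h4 : k j 0 + k j 1 = p j := by rw [← h.2.1 j, Fin.sum_univ_two]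
  have h5 : 0 < ε j * cutoffNorm (p j) := by
    refine mul_pos (h.pos j) ?_
    rw [cutoffNorm, if_neg (by omega)]
    exact norm_pos_iff.2 (h.1.1 j).ne_zero
  rw [cutoff, h4]
  refine (if_congr ?_ rfl rfl).symm
  rw [h1, h2]
  tauto

lemma good_cutMul_modeDir (hd : 3 ≤ d) {δ : ℝ} (hδ : 0 < δ) :
    Good w fun p ε => (cutMul d ε δ).op (modeDir w p ε) := by
  refine ⟨⟨2, 1, fun p ε n k h hne => ?_⟩, fun n => ?_⟩
  · obtain ⟨h1, h2, h3⟩ := modeDir_support h (right_ne_zero_of_mul hne)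
    exact ⟨⟨h1.ge, h1.le⟩, h2, h3⟩
  · by_cases hn : n = 1
    swap
    · refine (tame_const 0).congr fun p ε k h => ?_
      rw [kern, co_op]
      by_contra hne
      have := (modeDir_support h (right_ne_zero_of_mul (right_ne_zero_of_mul (Ne.symm hne)))).1
      omega
    subst hn
    have hT := (tame_const (w := w) (m := 2) (annihConst d 1 2 1)).mul (tame_cutMul w hd le_rfl hδ)
    have e : ∀ p ε k, Adm w p ε → kern ε 1 ((cutMul d ε δ).op (modeDir w p ε)) k =
        (annihConst d 1 2 1 * ((ε⁻¹ * (invLam.val 2 k * (cutMul d ε δ).val 2 k) : ℝ) : ℂ)) *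
          (if ∑ i, k i = p then ((cutoff ε (k 0) (k 1) : ℝ) : ℂ) else 0) := by
      intro p ε k h
      have hε' : (ε : ℂ) ≠ 0 := ofReal_ne_zero.2 h.1.1.ne'
      have hr' : (cellRoot d ε : ℂ) ≠ 0 := ofReal_ne_zero.2 (cellRoot_pos h.1.1).ne'
      rw [kern, co_op, h.co_modeDir, annihCoef_eq_mul hd h.1.1]
      split_ifs
      · push_cast
        field_simp
      · simp
    obtain ⟨⟨M, hM⟩, hc⟩ := hT
    refine ⟨⟨M, fun p ε k h => ?_⟩, fun v hv => ?_⟩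
    · change ‖kern ε 1 ((cutMul d ε δ).op (modeDir w p ε)) k‖ ≤ M
      rw [e p ε k h, norm_mul]
      refine (mul_le_mul (d := 1) (hM p ε k h) ?_ (norm_nonneg _)
        ((norm_nonneg _).trans (hM p ε k h))).trans_eq (mul_one M)
      split_ifs
      · rw [norm_real, Real.norm_of_nonneg (cutoff_nonneg _ _ _)]
        exact cutoff_le_one _ _ _
      · simp
    · exact ((hc v hv).mul (conv_cutoff_pair hd hv)).congr fun p ε k h hk => by
        rw [e p ε k h, if_pos hk]

lemma norm_sq_pair_le (hd : 3 ≤ d) {x : Fock d} {p : Mode d} {r : ℕ}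
    (hx : ∀ n (k : 𝕄 n), co x n k ≠ 0 → n = 2 ∧ ∑ i, k i = p ∧ ∀ i, k i ∈ cube d r)
    {C : ℝ} (hC : 0 ≤ C) (hk : ∀ k : 𝕄 2, ‖co x 2 k‖ ^ 2 ≤ C * (modeSq (k 1))⁻¹) :
    ‖x‖ ^ 2 ≤ C * (latConst d * (r : ℝ) ^ (d - 2)) := by
  rw [(hasSum_norm_sq x).unique (hasSum_of_momentum (p := p) (N := 2) (r := r) fun i hi => by
    obtain ⟨h1, h2, h3⟩ := hx i.1 i.2 fun h => hi (by simp [h])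
    exact ⟨⟨by omega, by omega⟩, h2, h3⟩), Finset.sum_range_succ, Finset.sum_range_one]
  have h0 : ∀ k : 𝕄 (0 + 1), co x (0 + 1) k = 0 := fun k => by
    by_contra h
    have := (hx _ _ h).1
    omega
  simp only [h0, norm_zero]
  rw [zero_pow two_ne_zero, Finset.sum_const_zero, zero_add]
  have h2 : ∀ κ : 𝕄 1, ‖co x (1 + 1) (Fin.cons (p - ∑ j, κ j) κ)‖ ^ 2 ≤
      C * (modeSq (κ 0))⁻¹ := fun κ => hk (Fin.cons (p - ∑ j, κ j) κ)
  calc _ ≤ ∑ κ ∈ Fintype.piFinset (fun _ : Fin 1 => cube d r), C * (modeSq (κ 0))⁻¹ :=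
        sum_le_sum fun κ _ => h2 κ
    _ = C * ∑ l ∈ cube d r, (modeSq l)⁻¹ := by
        rw [← mul_sum]
        congr 1
        refine Finset.sum_bij (fun κ _ => κ 0) (fun κ h => Fintype.mem_piFinset.1 h 0)
          (fun κ _ κ' _ h => funext fun i => by rw [Subsingleton.elim i 0]; exact h)
          (fun l hl => ⟨fun _ => l, Fintype.mem_piFinset.2 fun _ => hl, rfl⟩) (fun _ _ => rfl)
    _ ≤ _ := by gcongr; exact sum_cube_inv_modeSq_le_pow hd r

/-- The bound for the part of the normalised source with modes at most `ρ / ε`. -/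
lemma norm_sq_modeDir_part_le (hd : 3 ≤ d) {p : Mode d} {ε ρ : ℝ} (h : Adm w p ε) (hρ : 0 ≤ ρ)
    {x : Fock d} (hx : ∀ n k, ‖co x n k‖ ≤ ‖co (modeDir w p ε) n k‖)
    (hρx : ∀ n (k : 𝕄 n), co x n k ≠ 0 → ∀ i a, ε * |(k i a : ℝ)| ≤ ρ) :
    ‖x‖ ^ 2 ≤ 2 * ‖annihConst d 1 2 1‖ ^ 2 * latConst d * ρ ^ (d - 2) := by
  have hε := h.1.1
  have hne : ∀ n (k : 𝕄 n), co x n k ≠ 0 → co (modeDir w p ε) n k ≠ 0 :=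
    fun n k h1 h2 => h1 (norm_le_zero_iff.1 ((hx n k).trans (by rw [h2, norm_zero])))
  refine (norm_sq_pair_le hd (p := p) (r := ⌊ρ / ε⌋₊)
    (C := 2 * ‖annihConst d 1 2 1‖ ^ 2 * (ε⁻¹ ^ 2 * cellRoot d ε ^ 2)) (fun n k hk => ?_)
    (by positivity) (fun k => ?_)).trans ?_
  · obtain ⟨h1, h2, -⟩ := modeDir_support h (hne n k hk)
    exact ⟨h1, h2, fun i => mem_cube_floor fun a => by
      rw [le_div_iff₀ hε, mul_comm]; exact hρx n k hk i a⟩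
  · by_cases h0 : co x 2 k = 0
    · rw [h0, norm_zero, zero_pow two_ne_zero]
      have := modeSq_nonneg (k 1)
      positivity
    have hk1 : k 1 ≠ 0 := fun h1 => h0 (co_of_zero x h1)
    have hm := lt_of_lt_of_le one_pos (one_le_modeSq hk1)
    have h2 : ‖co (modeDir w p ε) 2 k‖ ≤
        ‖annihConst d 1 2 1‖ * (cellRoot d ε / ε) * invLam.val 2 k := by
      have hc := cellRoot_pos (d := d) hε
      have hl := invLam_val_nonneg k
      rw [h.co_modeDir]
      split_ifs
      · rw [annihCoef_eq_mul hd hε, norm_mul, norm_mul, norm_real, norm_real,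
          Real.norm_of_nonneg (by positivity),
          Real.norm_of_nonneg (mul_nonneg hl (cutoff_nonneg _ _ _))]
        gcongr
        exact mul_le_of_le_one_right hl (cutoff_le_one _ _ _)
      · rw [norm_zero]; positivity
    calc _ ≤ (‖annihConst d 1 2 1‖ * (cellRoot d ε / ε) * invLam.val 2 k) ^ 2 := by
          gcongr; exact (hx 2 k).trans h2
      _ = ‖annihConst d 1 2 1‖ ^ 2 * (ε⁻¹ ^ 2 * cellRoot d ε ^ 2) * (1 / 2 * tupleSq k)⁻¹ := by
          rw [mul_pow, invLam_val_sq]; field_simp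
      _ ≤ ‖annihConst d 1 2 1‖ ^ 2 * (ε⁻¹ ^ 2 * cellRoot d ε ^ 2) * (1 / 2 * modeSq (k 1))⁻¹ := by
          gcongr; exact modeSq_le_tupleSq k 1
      _ = _ := by rw [mul_inv]; norm_num; ring
  · have h1 := Nat.floor_le (a := ρ / ε) (by positivity)
    have h2 : ε⁻¹ ^ 2 * cellRoot d ε ^ 2 = ε ^ (d - 2) := by
      rw [cellRoot_sq hε, inv_pow, pow_sub₀ ε hε.ne' (by omega : 2 ≤ d), mul_comm]
    have hl := latConst_nonneg d
    rw [h2]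
    calc _ = 2 * ‖annihConst d 1 2 1‖ ^ 2 * latConst d * (ε * (⌊ρ / ε⌋₊ : ℝ)) ^ (d - 2) := by
          rw [mul_pow]; ring
      _ ≤ _ := by
          gcongr
          rw [le_div_iff₀ hε] at h1
          linarith

lemma exists_norm_modeDir_le (hd : 3 ≤ d) (w : 𝔼 d) :
    ∃ B, 0 ≤ B ∧ ∀ p ε, Adm w p ε → ‖modeDir w p ε‖ ≤ B :=
  ⟨_, sqrt_nonneg _, fun _ _ h => Real.le_sqrt_of_sq_le
    (norm_sq_modeDir_part_le hd h zero_le_one (fun _ _ => le_rfl)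
      fun _ _ hk => (modeDir_support h hk).2.2)⟩

lemma approx_modeDir (hd : 3 ≤ d) (w : 𝔼 d) : Approx w (modeDir w) := by
  intro η hη
  set K := 2 * ‖annihConst d 1 2 1‖ ^ 2 * latConst d with hK
  have hK0 : 0 ≤ K := by have := latConst_nonneg d; positivity
  set δ := min (1 / 2) (η ^ 2 / (2 * (K + 1))) with hδ
  have hδ0 : 0 < δ := by positivity
  have hδ1 : 2 * δ ≤ 1 := by linarith [min_le_left (1 / 2) (η ^ 2 / (2 * (K + 1)))]
  have hδK : 2 * δ * (K + 1) ≤ η ^ 2 := by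
    have := min_le_right (1 / 2) (η ^ 2 / (2 * (K + 1)))
    rw [← hδ, le_div_iff₀ (by positivity)] at this
    linarith
  refine ⟨_, good_cutMul_modeDir hd hδ0, 1, one_pos, fun p ε h _ =>
    abs_le_of_sq_le_sq' ?_ hη.le |>.2⟩
  have hco : ∀ n (k : 𝕄 n), co (modeDir w p ε - (cutMul d ε δ).op (modeDir w p ε)) n k =
      ((1 - (cutMul d ε δ).val n k : ℝ) : ℂ) * co (modeDir w p ε) n k := fun n k => by
    rw [co_sub, co_op]; push_cast; ring
  refine (norm_sq_modeDir_part_le hd h (by positivity : 0 ≤ 2 * δ) (fun n k => ?_)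
    (fun n k hk i a => ?_)).trans ?_
  · have h1 := cutMul_val_nonneg ε δ k
    have h2 := cutMul_val_le_one ε δ k
    rw [hco, norm_mul, norm_real, Real.norm_of_nonneg (by linarith)]
    exact mul_le_of_le_one_left (norm_nonneg _) (by linarith)
  · rw [hco] at hk
    exact mul_abs_le_of_cutMul_ne_one h.1.1 hδ0
      (fun h0 => left_ne_zero_of_mul hk (by rw [h0]; simp)) i a
  · calc _ ≤ K * (2 * δ) ^ 1 := by
          exact mul_le_mul_of_nonneg_left (pow_le_pow_of_le_one (by positivity) hδ1 (by omega)) hK0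
      _ ≤ _ := by rw [pow_one]; nlinarith

end

/-! ### The diffusivity in dimension at least three -/

/-- The parity of the chaos order. -/
def parityMul (d : ℕ) : Multiplier d where
  val n _ := (-1) ^ n
  symm _ _ _ := rfl
  bdd := ⟨1, zero_le_one, fun n _ => by simp⟩

variable {w}

lemma parityMul_lower (ε : ℝ) (a b : ℕ) (x : Fock d) :
    (parityMul d).op (lower w ε a b x) = -lower w ε a b ((parityMul d).op x) := by
  refine Fock.ext fun n k => ?_
  simp only [co_op, co_neg, co_lower, parityMul, mul_sum]
  rw [← Finset.sum_neg_distrib]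
  refine sum_congr rfl fun j _ => ?_
  rw [← Finset.sum_neg_distrib]
  refine sum_congr rfl fun l _ => ?_
  push_cast
  ring

lemma parityMul_raise (ε : ℝ) (a b : ℕ) (x : Fock d) :
    (parityMul d).op (raise w ε a b x) = -raise w ε a b ((parityMul d).op x) := by
  refine Fock.ext_inner_left fun χ => ?_
  rw [← inner_op, inner_raise_right, inner_neg_right, inner_raise_right,
    ← inner_op, parityMul_lower, inner_neg_left, neg_neg]

/-- As `A` changes the parity of the chaos order, the response `⟨g, (1 - S)⁻¹ g⟩` is real. -/
lemma conj_inner_resolvent (ε : ℝ) (a b : ℕ) {g : Fock d} (hg : (parityMul d).op g = g) :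
    starRingEnd ℂ (inner ℂ g (𝓡 w ε a b g)) =
      inner ℂ g (𝓡 w ε a b g) := by
  have hS := isSkew_skewOp w ε a b
  set x := 𝓡 w ε a b g with hx
  have h1 : x = skewOp w ε a b x + g := hS.resolvent_eq g
  set y := (parityMul d).op x with hy
  have h2 : y = -skewOp w ε a b y + g := by
    conv_lhs => rw [hy, h1, map_add, hg]
    simp only [skewOp, add_apply, map_add, parityMul_lower, parityMul_raise]
    rw [neg_add]
  have h3 : inner ℂ g x = (inner ℂ y g : ℂ) := by
    have e1 : g = y + skewOp w ε a b y := by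
      rw [add_comm]
      exact (eq_neg_add_iff_add_eq.1 h2).symm
    have e2 : g = x - skewOp w ε a b x := (sub_eq_of_eq_add' h1).symm
    conv_lhs => rw [e1]
    conv_rhs => rw [e2]
    rw [inner_add_left, inner_sub_right, hS]
    ring
  rw [inner_conj_symm, h3, hy, inner_op, hg]

lemma parityMul_modeDir (p : Mode d) {ε : ℝ} (h : Adm w p ε) :
    (parityMul d).op (modeDir w p ε) = modeDir w p ε := by
  refine Fock.ext fun n k => ?_
  rw [co_op]
  by_cases h0 : co (modeDir w p ε) n k = 0
  · rw [h0, mul_zero]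
  · simp [parityMul, (modeDir_support h h0).1]

/-- The response to a single mode. -/
def modeResp (w : 𝔼 d) (n : ℕ) (p : Mode d) (ε : ℝ) : Fock d := 𝓡 w ε 2 n (modeDir w p ε)

lemma approx_modeResp (hd : 3 ≤ d) (w : 𝔼 d) (n : ℕ) :
    Approx w (modeResp w n) := by
  obtain ⟨B, -, hB⟩ := exists_norm_modeDir_le hd w
  exact (approx_modeDir hd w).resolvent hd hB le_rfl n

/-- The diffusivity of the truncation at chaos `n`, as the limit of the response to a mode. -/
lemma exists_tendsto_response (hd : 3 ≤ d) (w : 𝔼 d) (n : ℕ) :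
    ∃ D : ℝ, Tendsto (fun x : Mode d × ℝ =>
      (inner ℂ (modeDir w x.1 x.2) (modeResp w n x.1 x.2) : ℂ)) (scaleLim w)
      (𝓝 ((D / 2 : ℝ) : ℂ)) := by
  obtain ⟨c, hc⟩ := (approx_modeDir hd w).exists_tendsto_inner (approx_modeResp hd w n)
  refine ⟨2 * c.re, ?_⟩
  rw [mul_div_cancel_left₀ _ two_ne_zero]
  refine ((Complex.continuous_ofReal.comp Complex.continuous_re).tendsto c |>.comp hc).congr' ?_
  filter_upwards [eventually_scaleLim w one_pos] with x hx
  exact Complex.conj_eq_iff_re.1 (conj_inner_resolvent x.2 2 n (parityMul_modeDir x.1 hx.1))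

lemma tendsto_scaleLim {p : Mode d} (hp : dotMode w p ≠ 0) :
    Tendsto (fun ε => (p, ε)) (scaleFilter d) (scaleLim w) := by
  have h0 : Tendsto (fun ε : ℝ => ε) (scaleFilter d) (𝓝 0) :=
    tendsto_id.mono_left nhdsWithin_le_nhds
  refine tendsto_inf.2 ⟨tendsto_principal.2 ?_, tendsto_inf.2 ⟨tendsto_comap_iff.2 h0,
    tendsto_comap_iff.2 (tendsto_pi_nhds.2 fun a => ?_)⟩⟩
  · filter_upwards [self_mem_nhdsWithin] with ε hε
    exact ⟨hε, hp⟩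
  · simpa using h0.mul_const (p a : ℝ)

section

variable {n : ℕ} {p : Mode d} {ε : ℝ}

lemma norm_modeResp_le (w : 𝔼 d) (n : ℕ) (p : Mode d) (ε : ℝ) :
    ‖modeResp w n p ε‖ ≤ ‖modeDir w p ε‖ := (isSkew_skewOp w ε 2 n).norm_resolvent_le _

lemma Adm.resolvent_raise (h : Adm w p ε) : 𝓡 w ε 2 n (raise w ε 1 2 (modeVec p h.ne_zero)) =
      ((dotMode w p * invLam.val 1 ![p] : ℝ) : ℂ) • modeResp w n p ε := by
  rw [h.raise_modeVec, map_smul]; rfl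

lemma driftMul_val_one (p : Mode d) :
    (driftMul w).val 1 ![p] = -(1 / 2) * (dotMode w p * invLam.val 1 ![p]) ^ 2 := by
  have : tupleDotSq w ![p] = dotMode w p ^ 2 := by simp [tupleDotSq]
  rw [mul_pow, invLam_val_sq]
  simp only [driftMul, this]
  ring

lemma Adm.co_lower_response (h : Adm w p ε) :
    co (lower w ε 1 2 (𝓡 w ε 2 n (raise w ε 1 2 (modeVec p h.ne_zero)))) 1 ![p] =
      (driftMul w).val 1 ![p] * (2 * inner ℂ (modeDir w p ε) (modeResp w n p ε)) := by
  rw [← inner_modeVec p h.ne_zero]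
  have h1 := inner_raise_left w ε 1 2 (modeVec p h.ne_zero)
    (𝓡 w ε 2 n (raise w ε 1 2 (modeVec p h.ne_zero)))
  rw [eq_neg_iff_add_eq_zero, add_comm, ← eq_neg_iff_add_eq_zero] at h1
  rw [h1, h.resolvent_raise, h.raise_modeVec, inner_smul_left (𝕜 := ℂ) (E := Fock d),
    inner_smul_right (𝕜 := ℂ) (E := Fock d), conj_ofReal, driftMul_val_one]
  push_cast
  ring

lemma Adm.norm_sq_modeDir (h : Adm w p ε) :
    ‖modeDir w p ε‖ ^ 2 = 2 / (2 * π) ^ d * loopSum ε p := by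
  have h1 := norm_raise_modeVec_sq w ε p h.ne_zero
  rw [h.raise_modeVec, driftMul_val_one, norm_smul, mul_pow, norm_real, norm_eq_abs, sq_abs] at h1
  have h2 : (dotMode w p * invLam.val 1 ![p]) ^ 2 ≠ 0 :=
    pow_ne_zero 2 (mul_ne_zero h.2 (invLam_val_one_pos h.ne_zero).ne')
  refine mul_left_cancel₀ h2 (h1.trans ?_)
  ring

/-- A positive proportion of the modes at scale `ε⁻¹` contributes to the loop sum. -/
lemma eventually_le_loopSum (hd : 3 ≤ d) {p : Mode d} (hp : p ≠ 0) :
    ∀ᶠ ε in scaleFilter d, 1 / (2 * d * 2 ^ d : ℝ) ≤ loopSum ε p := by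
  classical
  have hp' : 0 < ‖p‖ := norm_pos_iff.2 hp
  filter_upwards [eventually_scale_le d (by positivity : 0 < min (1 / 4) (1 / (2 * ‖p‖)))]
    with ε ⟨hs, hε'⟩
  have hε := hs.1
  rw [le_min_iff] at hε'
  have hεp : ε * ‖p‖ ≤ 1 / 2 := by
    have := hε'.2
    rw [le_div_iff₀ (by positivity)] at this
    linarith
  set r := ⌊1 / (2 * ε)⌋₊ with hr
  have hr1 : ε * r ≤ 1 / 2 := by
    have := Nat.floor_le (a := 1 / (2 * ε)) (by positivity)
    rw [le_div_iff₀ (by positivity)] at this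
    linarith
  have hr2 : 1 / (2 * ε) < r + 1 := Nat.lt_floor_add_one _
  have hnorm : ∀ l : Mode d, cutoffNorm l = ‖l‖ := fun l => by rw [cutoffNorm, if_neg (by omega)]
  have hd0 : (0 : ℝ) < d := by exact_mod_cast (by omega : 0 < d)
  set s := (cube d r).erase 0 |>.erase p with hs'
  have hl : ∀ l ∈ s, cutoff ε l (p - l) = 1 ∧ ε ^ 2 / d ≤ (𝓔 p l)⁻¹ := by
    intro l hl
    rw [hs', Finset.mem_erase, Finset.mem_erase, mem_cube] at hl
    obtain ⟨hlp, hl0, hlr⟩ := hl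
    have h1 : ε * ‖l‖ ≤ 1 / 2 := by
      refine (mul_le_mul_of_nonneg_left ?_ hε.le).trans hr1
      rw [pi_norm_le_iff_of_nonneg (by positivity)]
      intro a
      rw [Int.norm_eq_abs]
      exact_mod_cast hlr a
    have h2 : ε * ‖p - l‖ ≤ 1 := by
      have := mul_le_mul_of_nonneg_left (norm_sub_le p l) hε.le
      linarith
    have h3 : 0 < ‖l‖ := norm_pos_iff.2 hl0
    have h4 : 0 < ‖p - l‖ := norm_pos_iff.2 (sub_ne_zero.2 (Ne.symm hlp))
    have hsq : ∀ m : Mode d, ε * ‖m‖ ≤ 1 → modeSq m ≤ d * (ε⁻¹) ^ 2 := by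
      intro m hm
      have h5 : ∀ a ∈ univ, (m a : ℝ) ^ 2 ≤ ε⁻¹ ^ 2 := fun a _ => by
        rw [← sq_abs, ← Int.norm_eq_abs]
        gcongr
        rw [← one_div, le_div_iff₀ hε, mul_comm]
        exact (mul_le_mul_of_nonneg_left (norm_le_pi_norm m a) hε.le).trans hm
      refine (sum_le_sum h5).trans_eq ?_
      rw [sum_const, card_univ, Fintype.card_fin, nsmul_eq_mul]
    refine ⟨?_, ?_⟩
    · rw [cutoff, if_pos]
      rw [add_sub_cancel, hnorm, hnorm, hnorm]
      exact ⟨⟨by positivity, by linarith⟩, ⟨by positivity, h2⟩, by positivity, by linarith⟩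
    · have h6 := hsq l (by linarith)
      have h7 := hsq (p - l) h2
      have h8 := one_le_modeSq hl0
      have h9 := modeSq_nonneg (p - l)
      rw [show ε ^ 2 / d = (d * ε⁻¹ ^ 2)⁻¹ by field_simp]
      exact inv_anti₀ (by linarith) (by linarith)
  have hsub : s ⊆ box d ε := fun l hl' => mem_box_of_cutoff (m := p - l) (by
    rw [(hl l hl').1]; exact one_ne_zero)
  have hcard : 1 / 2 * (1 / (2 * ε)) ^ d ≤ (s.card : ℝ) := by
    have h1 : (cube d r).card ≤ s.card + 2 := by
      have e1 := Finset.pred_card_le_card_erase (s := (cube d r).erase 0) (a := p)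
      have e2 := Finset.pred_card_le_card_erase (s := cube d r) (a := 0)
      rw [hs']
      omega
    have h2 : ((cube d r).card : ℝ) ≤ s.card + 2 := by exact_mod_cast h1
    rw [card_cube] at h2
    push_cast at h2
    have h6 : 2 ≤ 1 / (2 * ε) := by
      rw [le_div_iff₀ (by positivity)]; linarith [hε'.1]
    have h3 : 1 / (2 * ε) ≤ 2 * r + 1 := by linarith
    have h4 : (1 / (2 * ε)) ^ d ≤ (2 * (r : ℝ) + 1) ^ d := by gcongr
    have h5 : (4 : ℝ) ≤ (1 / (2 * ε)) ^ d := by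
      calc (4 : ℝ) ≤ 2 ^ 3 := by norm_num
        _ ≤ 2 ^ d := pow_le_pow_right₀ (by norm_num) hd
        _ ≤ _ := by gcongr
    linarith
  calc 1 / (2 * d * 2 ^ d : ℝ) = ε ^ (d - 2) * (1 / 2 * (1 / (2 * ε)) ^ d * (ε ^ 2 / d)) := by
        rw [pow_sub₀ ε hε.ne' (by omega : 2 ≤ d), div_pow, one_pow, mul_pow]
        field_simp
    _ ≤ ε ^ (d - 2) * ∑ l ∈ s, cutoff ε l (p - l) * (𝓔 p l)⁻¹ := by
        gcongr
        calc _ ≤ s.card * (ε ^ 2 / d) := by gcongr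
          _ = ∑ l ∈ s, ε ^ 2 / d := by rw [sum_const, nsmul_eq_mul]
          _ ≤ _ := sum_le_sum fun l h => by
            rw [(hl l h).1, one_mul]; exact (hl l h).2
    _ ≤ loopSum ε p := by
        rw [loopSum, coupling_sq_of_three_le hd hε]
        gcongr
        intro l _ _
        have := modeSq_nonneg l
        have := modeSq_nonneg (p - l)
        have := cutoff_nonneg ε l (p - l)
        positivity

lemma re_inner_modeResp (w : 𝔼 d) (n : ℕ) (p : Mode d) (ε : ℝ) :
    (inner ℂ (modeDir w p ε) (modeResp w n p ε) : ℂ).re = ‖modeResp w n p ε‖ ^ 2 := by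
  have hS := isSkew_skewOp w ε 2 n
  have h1 : modeResp w n p ε = skewOp w ε 2 n (modeResp w n p ε) + modeDir w p ε :=
    hS.resolvent_eq _
  set x := modeResp w n p ε
  have h2 : modeDir w p ε = x - skewOp w ε 2 n x := (sub_eq_of_eq_add' h1).symm
  have h3 : (inner ℂ x x : ℂ).re = ‖x‖ ^ 2 := inner_self_eq_norm_sq (𝕜 := ℂ) x
  rw [h2, inner_sub_left, Complex.sub_re, h3, ← inner_conj_symm, Complex.conj_re,
    hS.re_inner_self, sub_zero]

lemma Adm.norm_modeDir_le_modeResp (hd : 3 ≤ d) (h : Adm w p ε) (hn : 3 ≤ n) :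
    ‖modeDir w p ε‖ ≤ (1 + 6 * latOpConst w) * ‖modeResp w n p ε‖ := by
  have hS := isSkew_skewOp w ε 2 n
  have h1 : modeResp w n p ε = skewOp w ε 2 n (modeResp w n p ε) + modeDir w p ε :=
    hS.resolvent_eq _
  set x := modeResp w n p ε
  set g := modeDir w p ε with hg
  have h2 : g = x - skewOp w ε 2 n x := (sub_eq_of_eq_add' h1).symm
  have h3 : skewOp w ε 2 n g = skewOp w ε 2 3 g := by
    rw [← skewOp_add_skewOp w ε (by norm_num : 2 ≤ 3) hn,
      skewOp_congr w ε (a := 3) (b := n) (x := g) (y := 0) fun m h3 h4 k => by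
        by_contra h5
        have := (modeDir_support h (by simpa using h5)).1
        omega, map_zero, add_zero]
  have h4 : ‖skewOp w ε 2 n g‖ ≤ 6 * latOpConst w * ‖g‖ := by
    rw [h3]
    refine (h.norm_skewOp_le hd 2 3 g).trans_eq ?_
    push_cast
    ring
  have h5 : (inner ℂ g g : ℂ) = inner ℂ g x + inner ℂ (skewOp w ε 2 n g) x := by
    nth_rewrite 2 [h2]
    rw [inner_sub_right, hS, sub_neg_eq_add]
  have h6 : ‖g‖ ^ 2 ≤ ‖g‖ * ((1 + 6 * latOpConst w) * ‖x‖) := by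
    have h7 : ‖(inner ℂ g g : ℂ)‖ = ‖g‖ ^ 2 := by
      rw [inner_self_eq_norm_sq_to_K]; simp
    rw [← h7, h5]
    refine (norm_add_le_of_le (norm_inner_le_norm _ _)
      ((norm_inner_le_norm _ _).trans (mul_le_mul_of_nonneg_right h4 (norm_nonneg _)))).trans_eq ?_
    ring
  rcases (norm_nonneg g).eq_or_lt with h0 | h0
  · rw [← h0]
    have := latOpConst_nonneg w
    positivity
  · rw [sq] at h6
    exact le_of_mul_le_mul_left h6 h0

end

instance neBot_scaleFilter (d : ℕ) : (scaleFilter d).NeBot := by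
  rw [scaleFilter, ← mem_closure_iff_nhdsWithin_neBot]
  have ht : Tendsto (fun N : ℕ => 1 / (((N + 1 : ℕ) : ℝ) + 1 / 2)) atTop (𝓝 0) := by
    have h1 : Tendsto (fun N : ℕ => ((N + 1 : ℕ) : ℝ) + 1 / 2) atTop atTop :=
      tendsto_atTop_add_const_right _ _ (tendsto_natCast_atTop_atTop.comp (tendsto_add_atTop_nat 1))
    exact h1.inv_tendsto_atTop.congr fun N => (one_div _).symm
  refine mem_closure_of_tendsto ht (Eventually.of_forall fun N => ⟨by positivity, ?_, fun _ =>
    ⟨N + 1, by rw [one_div_one_div]⟩⟩)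
  rw [div_lt_one (by positivity)]
  push_cast
  have : (0 : ℝ) ≤ N := by positivity
  linarith

lemma exists_dotMode_ne_zero {w : 𝔼 d} (hw : w ≠ 0) : ∃ p : Mode d, dotMode w p ≠ 0 := by
  by_contra! h
  apply hw
  ext a
  have := h (Pi.single a 1)
  rw [dotMode, sum_eq_single a] at this
  · simpa using this
  · intro b _ hb; simp [hb]
  · simp

lemma raise_modeVec_eq_zero (ε : ℝ) {p : Mode d} (hp : p ≠ 0) (h : dotMode w p = 0) :
    raise w ε 1 2 (modeVec p hp) = 0 := by
  refine Fock.ext fun n k => ?_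
  by_cases hn : n = 2
  · subst hn
    rw [co_raise_modeVec, h]
    simp
  · rw [co_raise_of_notMem w ε _ k (by omega), co_zero]

lemma tendsto_sum_Ico_inv : Tendsto (fun n : ℕ => ∑ j ∈ Ico 2 n, 1 / ((j : ℝ) + 1))
    atTop atTop := by
  refine (tendsto_atTop_add_const_right _ (-∑ j ∈ range 2, 1 / ((j : ℝ) + 1))
    Real.tendsto_sum_range_one_div_nat_succ_atTop).congr' ?_
  filter_upwards [eventually_ge_atTop 2] with n hn
  rw [Finset.sum_Ico_eq_sub _ hn, sub_eq_add_neg]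

/-- The responses of the truncations at levels `n ≤ m` differ little, by the flux estimate. -/
lemma Adm.norm_inner_modeResp_sub_le (hd : 3 ≤ d) {p : Mode d} {ε B : ℝ} (h : Adm w p ε)
    (hB : ‖modeDir w p ε‖ ≤ B) {n m : ℕ} (hnm : n ≤ m) :
    ‖(inner ℂ (modeDir w p ε) (modeResp w m p ε) : ℂ) -
      inner ℂ (modeDir w p ε) (modeResp w n p ε)‖ ^ 2 *
      ∑ j ∈ Ico 2 n, 1 / ((j : ℝ) + 1) ≤ B ^ 2 * (latOpConst w * (2 * B) ^ 2) := by
  classical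
  set y := modeResp w m p ε - modeResp w n p ε with hy
  have h1 := carleman w ε (latOpConst_nonneg w) (h.norm_lower_le hd) (i := 2) hnm
    (modeDir w p ε) (y := y) rfl
  have h2 : ‖y‖ ≤ 2 * B := by
    refine (norm_sub_le _ _).trans ?_
    linarith [norm_modeResp_le w m p ε, norm_modeResp_le w n p ε]
  have h3 : (inner ℂ (modeDir w p ε) (modeResp w m p ε) : ℂ) -
      inner ℂ (modeDir w p ε) (modeResp w n p ε) =
        inner ℂ (modeDir w p ε) ((chaosMul d {2}).op y) := by
    have h4 : (chaosMul d {2}).op (modeDir w p ε) = modeDir w p ε := Fock.ext fun l k => by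
      rw [co_chaosMul]
      split_ifs with h5
      · rfl
      · by_contra h6
        exact h5 (modeDir_support h (Ne.symm h6)).1
    rw [← inner_op, h4, hy, inner_sub_right]
  have hB0 := (norm_nonneg _).trans hB
  have hs : 0 ≤ ∑ j ∈ Ico 2 n, 1 / ((j : ℝ) + 1) := sum_nonneg fun j _ => by positivity
  have h5 : ‖(inner ℂ (modeDir w p ε) ((chaosMul d {2}).op y) : ℂ)‖ ≤
      B * ‖(chaosMul d {2}).op y‖ := (norm_inner_le_norm _ _).trans (by gcongr)
  have hK := latOpConst_nonneg w
  rw [h3]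
  calc _ ≤ (B * ‖(chaosMul d {2}).op y‖) ^ 2 * ∑ j ∈ Ico 2 n, 1 / ((j : ℝ) + 1) := by
        gcongr
    _ = B ^ 2 * (‖(chaosMul d {2}).op y‖ ^ 2 * ∑ j ∈ Ico 2 n, 1 / ((j : ℝ) + 1)) := by ring
    _ ≤ B ^ 2 * (latOpConst w * ‖y‖ ^ 2) := by gcongr
    _ ≤ _ := by gcongr

lemma cauchySeq_of_sq_sub_mul_le {E s : ℕ → ℝ} {Q : ℝ} (hs : Tendsto s atTop atTop)
    (h : ∀ n m, n ≤ m → (E m - E n) ^ 2 * s n ≤ Q) : CauchySeq E := by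
  refine Metric.cauchySeq_iff'.2 fun η hη => ?_
  obtain ⟨N, hN, hN0⟩ := ((hs.eventually_gt_atTop (Q / η ^ 2)).and
    (hs.eventually_ge_atTop 0)).exists
  refine ⟨N, fun n hn => ?_⟩
  rw [Real.dist_eq]
  refine abs_lt_of_sq_lt_sq ?_ hη.le
  by_contra! h1
  have h2 := h N n hn
  rw [div_lt_iff₀ (by positivity)] at hN
  have h3 := mul_le_mul_of_nonneg_right h1 hN0
  linarith

lemma eventually_adm {p : Mode d} (hp : dotMode w p ≠ 0) : ∀ᶠ ε in scaleFilter d, Adm w p ε := by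
  filter_upwards [self_mem_nhdsWithin] with ε hε
  exact ⟨hε, hp⟩

/-- The limiting responses of the truncations form a Cauchy sequence, since the harmonic series
in the flux estimate diverges. -/
lemma cauchySeq_response {E : ℕ → ℝ} {p : Mode d} (hE : ∀ n, Tendsto (fun ε =>
      (inner ℂ (modeDir w p ε) (modeResp w n p ε) : ℂ)) (scaleFilter d) (𝓝 ((E n / 2 : ℝ) : ℂ)))
    (hd : 3 ≤ d) (hp : dotMode w p ≠ 0) : CauchySeq E := by
  obtain ⟨B, -, hB⟩ := exists_norm_modeDir_le hd w
  refine cauchySeq_of_sq_sub_mul_le (Q := 4 * (B ^ 2 * (latOpConst w * (2 * B) ^ 2)))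
    tendsto_sum_Ico_inv fun n m hnm => ?_
  generalize hs : ∑ j ∈ Ico 2 n, 1 / ((j : ℝ) + 1) = s
  have h1 := ((((hE m).sub (hE n)).norm).pow 2).mul_const s
  have h2 := le_of_tendsto (b := B ^ 2 * (latOpConst w * (2 * B) ^ 2)) h1 (by
    filter_upwards [eventually_adm hp] with ε h
    rw [← hs]
    exact h.norm_inner_modeResp_sub_le hd (hB _ _ h) hnm)
  rw [← Complex.ofReal_sub, norm_real, norm_eq_abs, sq_abs] at h2
  have e : (E m - E n) ^ 2 = 4 * (E m / 2 - E n / 2) ^ 2 := by ring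
  rw [e, mul_assoc]
  linarith

/-- A positive lower bound for the limiting responses, uniform in the truncation. -/
lemma exists_le_response {E : ℕ → ℝ} {p : Mode d} (hE : ∀ n, Tendsto (fun ε =>
      (inner ℂ (modeDir w p ε) (modeResp w n p ε) : ℂ)) (scaleFilter d) (𝓝 ((E n / 2 : ℝ) : ℂ)))
    (hd : 3 ≤ d) (hp : dotMode w p ≠ 0) :
    ∃ c : ℝ, 0 < c ∧ ∀ n, 3 ≤ n → c ≤ E n := by
  have hp' : p ≠ 0 := by rintro rfl; exact hp (by simp [dotMode])
  have hd0 : (0 : ℝ) < d := by exact_mod_cast (by omega : 0 < d)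
  obtain ⟨c, hc⟩ : ∃ c : ℝ, c = 2 / (2 * π) ^ d * (1 / (2 * d * 2 ^ d : ℝ)) := ⟨_, rfl⟩
  have hc0 : 0 < c := by rw [hc]; positivity
  have hK := latOpConst_nonneg w
  refine ⟨2 * (c / (1 + 6 * latOpConst w) ^ 2), by positivity, fun n hn => ?_⟩
  have h1 := ((Complex.continuous_re.tendsto _).comp (hE n))
  have h2 : c / (1 + 6 * latOpConst w) ^ 2 ≤ ((E n / 2 : ℝ) : ℂ).re := by
    refine ge_of_tendsto h1 ?_
    filter_upwards [eventually_adm hp, eventually_le_loopSum hd hp'] with ε h h3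
    rw [Function.comp_apply, re_inner_modeResp, div_le_iff₀ (by positivity), ← mul_pow, mul_comm]
    calc c ≤ ‖modeDir w p ε‖ ^ 2 := by rw [h.norm_sq_modeDir, hc]; gcongr
      _ ≤ _ := by gcongr; exact h.norm_modeDir_le_modeResp hd hn
  rw [Complex.ofReal_re] at h2
  linarith

lemma tendsto_co_lower_resolvent {E : ℝ} {n : ℕ} {p : Mode d} (hp : p ≠ 0)
    (hwp : dotMode w p ≠ 0) (hE : Tendsto (fun ε =>
      (inner ℂ (modeDir w p ε) (modeResp w n p ε) : ℂ)) (scaleFilter d) (𝓝 ((E / 2 : ℝ) : ℂ))) :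
    Tendsto (fun ε => co (lower w ε 1 2
      (𝓡 w ε 2 n (raise w ε 1 2 (modeVec p hp)))) 1 ![p]) (scaleFilter d)
      (𝓝 ((E * (driftMul w).val 1 ![p] : ℝ) : ℂ)) := by
  have h1 := (hE.const_mul 2).const_mul ((driftMul w).val 1 ![p] : ℂ)
  have e : ((driftMul w).val 1 ![p] : ℂ) * (2 * ((E / 2 : ℝ) : ℂ)) =
      ((E * (driftMul w).val 1 ![p] : ℝ) : ℂ) := by push_cast; ring
  rw [e] at h1
  refine h1.congr' ?_
  filter_upwards [eventually_adm hwp] with ε h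
  exact h.co_lower_response.symm

lemma tendsto_invLam_resolvent (hd : 3 ≤ d) {p : Mode d} (hp : p ≠ 0) (hwp : dotMode w p ≠ 0)
    (n : ℕ) : Tendsto (fun ε => invLam.op
      (𝓡 w ε 2 n (raise w ε 1 2 (modeVec p hp)))) (scaleFilter d) (𝓝 0) := by
  have h1 := ((approx_modeResp hd w n).tendsto_invLam hd hwp).const_smul
    ((dotMode w p * invLam.val 1 ![p] : ℝ) : ℂ)
  rw [smul_zero] at h1
  refine h1.congr' ?_
  filter_upwards [eventually_adm hwp] with ε h
  rw [h.resolvent_raise, map_smul]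

/-- Existence and positivity of the diffusivity, as the limit of the diffusivities of the
truncations. -/
lemma exists_diffusivity (hd : 3 ≤ d) (hw : w ≠ 0) : ∃ D : ℝ, 0 < D ∧ ∃ E : ℕ → ℝ,
    Tendsto E atTop (𝓝 D) ∧ ∀ n p (hp : p ≠ 0), Tendsto (fun ε => co (lower w ε 1 2
        (𝓡 w ε 2 n (raise w ε 1 2 (modeVec p hp)))) 1 ![p]) (scaleFilter d)
        (𝓝 ((E n * (driftMul w).val 1 ![p] : ℝ) : ℂ)) ∧
      Tendsto (fun ε => invLam.op
        (𝓡 w ε 2 n (raise w ε 1 2 (modeVec p hp)))) (scaleFilter d) (𝓝 0) := by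
  choose E hE using exists_tendsto_response hd w
  obtain ⟨p₀, hp₀⟩ := exists_dotMode_ne_zero hw
  have hEp := fun n (p : Mode d) (hp : dotMode w p ≠ 0) => (hE n).comp (tendsto_scaleLim hp)
  obtain ⟨D, hD⟩ := cauchySeq_tendsto_of_complete
    (cauchySeq_response (fun n => hEp n p₀ hp₀) hd hp₀)
  obtain ⟨c, hc0, hlow⟩ := exists_le_response (fun n => hEp n p₀ hp₀) hd hp₀
  refine ⟨D, hc0.trans_le (ge_of_tendsto hD ?_), E, hD, fun n p hp => ?_⟩
  · filter_upwards [eventually_ge_atTop 3] with n hn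
    exact hlow n hn
  by_cases hwp : dotMode w p = 0
  · simp only [raise_modeVec_eq_zero _ hp hwp, map_zero, co_zero, driftMul_val_one, hwp]
    exact ⟨by simp, tendsto_const_nhds⟩
  exact ⟨tendsto_co_lower_resolvent hp hwp (hEp n p hwp), tendsto_invLam_resolvent hd hp hwp n⟩

/-- The limits which determine the diffusivity in dimension at least three, for all inputs. -/
lemma exists_tendsto_resolvent (hd : 3 ≤ d) (hw : w ≠ 0) : ∃ D : ℝ, 0 < D ∧ ∃ Dn : ℕ → ℕ → ℝ,
    ∀ i, i = 2 ∨ i = 3 → Tendsto (Dn i) atTop (𝓝 D) ∧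
      ∀ n, i ≤ n → ∀ y : Fock d, (∀ m (k : 𝕄 m), m ≠ i - 1 → co y m k = 0) →
      Tendsto (fun ε => lower w ε (i - 1) i (𝓡 w ε i n (raise w ε (i - 1) i y)) -
        (Dn i n : ℂ) • (driftMul w).op y) (scaleFilter d) (𝓝 0) ∧
      Tendsto (fun ε => invLam.op (𝓡 w ε i n (raise w ε (i - 1) i y))) (scaleFilter d) (𝓝 0) := by
  obtain ⟨D, hD, E, hE, hlim⟩ := exists_diffusivity hd hw
  obtain ⟨C₀, -, hC⟩ := exists_loopSum_le (show 2 ≤ d by omega)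
  have hl := eventually_abs_coupling_le (show 2 ≤ d by omega)
  have hR : ∀ i n ε x, ‖𝓡 w ε i n x‖ ≤ ‖x‖ := fun i n ε x =>
    (isSkew_skewOp w ε i n).norm_resolvent_le x
  refine ⟨D, hD, fun i n => if i = 2 then E n else E (n - 1), fun i hi => ?_⟩
  rcases hi with rfl | rfl
  · refine ⟨by simpa using hE, fun n hn y hy => ⟨?_, ?_⟩⟩
    · simp only [if_true]
      refine (tendsto_errOp_one w hC (E n) (R := fun ε => 𝓡 w ε 2 n) (hR 2 n)
        (fun ε p x => momMul_resolvent w ε 2 n p x) (fun p hp => (hlim n p hp).1) y).congr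
        fun ε => ?_
      rw [errOp_apply w 2 _ _ ε hy]
    · exact tendsto_zero_of_modeVec (weakOp w 2 fun ε => 𝓡 w ε 2 n)
        (norm_weakOp_le w hC 2 (hR 2 n)) (fun p hp => (hlim n p hp).2)
        (fun r hr ε => weakOp_eq_zero w 2 _ ε hr) y
  · refine ⟨?_, fun n hn y hy => ?_⟩
    · simp only [if_neg (by norm_num : (3 : ℕ) ≠ 2)]
      exact hE.comp (tendsto_sub_atTop_nat 1)
    obtain ⟨n, rfl⟩ : ∃ m, n = m + 1 := ⟨n - 1, by omega⟩
    have h1 := fun p q (hp : p ≠ 0) (hq : q ≠ 0) => tendsto_errOp_pairVec w hC hl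
      (show 2 ≤ n by omega) (Nat.lt_add_one n) (E n) (fun p hp => (hlim n p hp).1)
      (fun p hp => (hlim n p hp).2) p q hp hq
    refine ⟨?_, ?_⟩
    · simp only [show (3 : ℕ) ≠ 2 by norm_num, if_false, Nat.add_sub_cancel]
      refine (tendsto_errOp_two w hC (E n) (R := fun ε => 𝓡 w ε 3 (n + 1))
        (hR 3 (n + 1)) (show 1 < n + 1 by omega) (fun p q hp hq => (h1 p q hp hq).1) y).congr
        fun ε => ?_
      rw [errOp_apply w 3 _ _ ε hy]
    · exact tendsto_zero_of_pairVec (weakOp w 3 fun ε => 𝓡 w ε 3 (n + 1))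
        (norm_weakOp_le w hC 3 (hR 3 (n + 1))) (show 1 < n + 1 by omega)
        (fun p q hp hq => (h1 p q hp hq).2)
        (fun r hr ε => weakOp_eq_zero w 3 _ ε hr) y

/-! ### From the Fock space to the kernels -/

/-- The solution `w^{ε,n}`, between energy spaces: `w^{ε,n} = Λ⁻¹ x`, with input `f = Λ⁻¹ y`. -/
def solVec (w : 𝔼 d) (ε : ℝ) (i n : ℕ) (y : Fock d) : Fock d :=
  if d = 2 then ladderSum w ε i n y else 𝓡 w ε i n (raise w ε (i - 1) i y)

lemma isApproxSol_iff (w : 𝔼 d) (ε : ℝ) {i n : ℕ}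
    (hi : 1 ≤ i) (hn : i ≤ n) {y : Fock d}
    (hy : ∀ m (k : 𝕄 m), m ≠ i - 1 → co y m k = 0) {v : FockVec d} :
    IsApproxSol w ε i n (toVec (invLam.op y)) v ↔
      v = toVec (invLam.op (solVec w ε i n y)) := by
  by_cases hd : d = 2
  · rw [solVec, if_pos hd]
    have h := isApproxSol_ladderSum hd w ε hi hn hy
    exact ⟨fun hv => hv.unique_of_eq_two hd w ε h, fun hv => hv ▸ h⟩
  · rw [solVec, if_neg hd]
    have h := isApproxSol_resolvent hd w ε hi hn hy
    exact ⟨fun hv => hv.unique_of_ne_two hd w ε hi h, fun hv => hv ▸ h⟩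

lemma opL0InvSqrt_toVec (w : 𝔼 d) (ε D : ℝ) {i : ℕ} (hi : 1 ≤ i)
    (x y : Fock d) :
    opL0InvSqrt (opAminus w ε (chaosProj i i (toVec (invLam.op x))) -
      (D : ℂ) • opL0w w (toVec (invLam.op y))) =
      toVec (lower w ε (i - 1) i x - (D : ℂ) • (driftMul w).op y) := by
  have h1 : opAminus w ε (chaosProj i i (toVec (invLam.op x))) =
      toVec (annih w ε (i - 1) i (invLam.op x)) := by
    rw [toVec_annih]
    congr 1
    funext m k
    rw [chaosProj]
    exact if_congr (by omega) rfl rfl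
  rw [h1]
  funext n k
  have hl : (1 / 2 * tupleSq k) ^ (-(1 / 2) : ℝ) = invLam.val n k := by
    have := tupleSq_nonneg k
    simp only [invLam]
    rw [Real.rpow_neg (by positivity), Real.sqrt_eq_rpow]
  have h2 := invLam_val_sq k
  have h3 : (driftMul w).val n k =
      invLam.val n k * ((-(1 / 2) * tupleDotSq w k) * invLam.val n k) := by
    have : invLam.val n k * ((-(1 / 2) * tupleDotSq w k) * invLam.val n k) =
      (-(1 / 2) * tupleDotSq w k) * invLam.val n k ^ 2 := by ring
    rw [this, h2]
    simp only [driftMul]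
    ring
  simp only [opL0InvSqrt, Pi.sub_apply, Pi.smul_apply, opL0w, toVec_op, toVec_sub, toVec_smul,
    lower, comp_apply, smul_eq_mul, hl, h3]
  push_cast
  ring

lemma enorm_zero_fock : ‖(0 : Fock d)‖ₑ = 0 := by
  rw [← ofReal_norm, norm_zero, ENNReal.ofReal_zero]

/-- The effective behaviour of the solutions, between energy spaces, with diffusivity `D`. -/
def HasLimit (w : 𝔼 d) (D : ℝ) : Prop :=
  ∃ Dn : ℕ → ℕ → ℝ, ∀ i, i = 2 ∨ i = 3 → Tendsto (Dn i) atTop (𝓝 D) ∧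
    ∀ n, i ≤ n → ∀ y : Fock d, (∀ m (k : 𝕄 m), m ≠ i - 1 → co y m k = 0) →
      Tendsto (fun ε => lower w ε (i - 1) i (solVec w ε i n y) -
        (Dn i n : ℂ) • (driftMul w).op y) (scaleFilter d) (𝓝 0) ∧
      Tendsto (fun ε => invLam.op (solVec w ε i n y)) (scaleFilter d) (𝓝 0)

lemma enorm_expr_eq {w : 𝔼 d} {i : ℕ} (hi : 1 ≤ i)
    {f : FockVec d} {y : Fock d} (hy : ∀ m (k : 𝕄 m), m ≠ i - 1 → co y m k = 0)
    (hf : f = toVec (invLam.op y)) {W : ℝ → ℕ → FockVec d} (hW : IsApproxFamily w i f W)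
    (D : ℝ) {n : ℕ} (hn : i ≤ n) {ε : ℝ} (hε : ε ∈ scales d) :
    fockNorm (opL0InvSqrt (opAminus w ε (chaosProj i i (W ε n)) - (D : ℂ) • opL0w w f)) =
      ‖lower w ε (i - 1) i (solVec w ε i n y) - (D : ℂ) • (driftMul w).op y‖ₑ := by
  have h := hW ε hε n hn
  rw [hf, isApproxSol_iff w ε hi hn hy] at h
  rw [h, hf, opL0InvSqrt_toVec w ε D hi, fockNorm_toVec]

lemma HasLimit.hasDiffusivity {w : 𝔼 d} {D : ℝ} (h : HasLimit w D) :
    HasDiffusivity w D := by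
  intro φ ψ hφ hψ i hi W hW
  obtain ⟨Dn, hDn⟩ := h
  obtain ⟨hDlim, hlim⟩ := hDn i hi
  obtain ⟨y, hy, -, hf⟩ := exists_input hφ hψ hi
  have hi1 : 1 ≤ i := by omega
  have hlimsup : ∀ n, i ≤ n → limsup (fun ε : ℝ =>
        fockNorm (opL0InvSqrt (opAminus w ε (chaosProj i i (W ε n)) -
          (D : ℂ) • opL0w w (inputVec φ ψ i)))) (scaleFilter d) =
      ‖((Dn i n - D : ℝ) : ℂ) • (driftMul w).op y‖ₑ := by
    intro n hn
    apply Tendsto.limsup_eq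
    have h1 : Tendsto (fun ε => lower w ε (i - 1) i (solVec w ε i n y) -
        (D : ℂ) • (driftMul w).op y) (scaleFilter d)
        (𝓝 (((Dn i n - D : ℝ) : ℂ) • (driftMul w).op y)) := by
      have h2 := (hlim n hn y hy).1.add_const (((Dn i n - D : ℝ) : ℂ) • (driftMul w).op y)
      rw [zero_add] at h2
      refine h2.congr fun ε => ?_
      push_cast
      rw [sub_smul]
      abel
    refine (h1.enorm).congr' ?_
    filter_upwards [self_mem_nhdsWithin] with ε hε
    rw [enorm_expr_eq hi1 hy hf hW D hn hε]
  have h3 : Tendsto (fun n => ‖((Dn i n - D : ℝ) : ℂ) • (driftMul w).op y‖ₑ) atTop (𝓝 0) := by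
    have h4 : Tendsto (fun n => ((Dn i n - D : ℝ) : ℂ) • (driftMul w).op y) atTop (𝓝 0) := by
      have h5 : Tendsto (fun n => ((Dn i n - D : ℝ) : ℂ)) atTop (𝓝 0) := by
        rw [← Complex.ofReal_zero]
        exact (Complex.continuous_ofReal.tendsto 0).comp (by simpa using hDlim.sub_const D)
      simpa using h5.smul_const ((driftMul w).op y)
    rw [← enorm_zero_fock (d := d)]
    exact h4.enorm
  refine h3.congr' ?_
  filter_upwards [eventually_ge_atTop i] with n hn
  rw [hlimsup n hn]

lemma HasLimit.unique {w : 𝔼 d} (hw : w ≠ 0) {D D' : ℝ} (h : HasLimit w D)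
    (h' : HasDiffusivity w D') : D' = D := by
  obtain ⟨p, hp⟩ := exists_dotMode_ne_zero hw
  have hD := h.hasDiffusivity
  have hφ := isTorusTest_expMode p
  obtain ⟨y, hy, hyco, hf⟩ := exists_input hφ hφ (Or.inl rfl : 2 = 2 ∨ 2 = 3)
  set W : ℝ → ℕ → FockVec d := fun ε n => toVec (invLam.op (solVec w ε 2 n y)) with hWdef
  have hW : IsApproxFamily w 2 (inputVec (expMode p) (expMode p) 2) W := by
    intro ε hε n hn
    rw [hf, isApproxSol_iff w ε (by norm_num) hn hy]
  have t1 := hD _ _ hφ hφ 2 (Or.inl rfl) W hW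
  have t2 := h' _ _ hφ hφ 2 (Or.inl rfl) W hW
  have hQ : (driftMul w).op y ≠ 0 := by
    intro h0
    have h1 : co ((driftMul w).op y) 1 ![p] = 0 := by rw [h0]; rfl
    have hp0 : p ≠ 0 := by rintro rfl; simp at hp
    have hm : 0 < modeSq p := lt_of_lt_of_le one_pos (one_le_modeSq hp0)
    have h3 : tupleDotSq w ![p] = dotMode w p ^ 2 := by simp [tupleDotSq]
    rw [co_op, hyco, inputVec, if_pos rfl] at h1
    simp only [oneParticle, driftMul, tupleSq_singleton, h3, Matrix.cons_val_zero, if_neg hp0,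
      fourierMode_expMode, if_true, mul_one] at h1
    rw [← ofReal_mul, Complex.ofReal_eq_zero] at h1
    have h4 : 0 < √(1 / 2 * modeSq p) := sqrt_pos.2 (by positivity)
    have h5 := sqrt_factorial_pos 1
    have h6 : 0 < dotMode w p ^ 2 := by positivity
    have h7 : 0 < 1 / 2 * dotMode w p ^ 2 * (1 / 2 * modeSq p)⁻¹ *
        (√(1 / 2 * modeSq p) * √(Nat.factorial 1)) := by positivity
    linarith
  have h0 : ((D' - D : ℝ) : ℂ) • (driftMul w).op y = 0 := by
    by_contra hne
    set c := ‖((D' - D : ℝ) : ℂ) • (driftMul w).op y‖ₑ with hc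
    have hc0 : 0 < c / 2 := ENNReal.half_pos fun h =>
      hne (by rwa [hc, ← ofReal_norm, ENNReal.ofReal_eq_zero, norm_le_zero_iff] at h)
    obtain ⟨n, ⟨h1, h2⟩, hn⟩ := (((t1.eventually_lt_const hc0).and
      (t2.eventually_lt_const hc0)).and (eventually_ge_atTop 2)).exists
    obtain ⟨ε, ⟨h3, h4⟩, hε⟩ := (((eventually_lt_of_limsup_lt h1).and
      (eventually_lt_of_limsup_lt h2)).and self_mem_nhdsWithin).exists
    rw [enorm_expr_eq (by norm_num) hy hf hW D hn hε] at h3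
    rw [enorm_expr_eq (by norm_num) hy hf hW D' hn hε] at h4
    set t := lower w ε (2 - 1) 2 (solVec w ε 2 n y)
    have e : ((D' - D : ℝ) : ℂ) • (driftMul w).op y = (t - (D : ℂ) • (driftMul w).op y) -
        (t - (D' : ℂ) • (driftMul w).op y) := by
      push_cast
      rw [sub_smul]
      abel
    have h5 : c ≤ ‖t - (D : ℂ) • (driftMul w).op y‖ₑ + ‖t - (D' : ℂ) • (driftMul w).op y‖ₑ := by
      rw [hc, e]
      exact enorm_sub_le
    have h6 := lt_of_le_of_lt h5 (ENNReal.add_lt_add h3 h4)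
    rw [ENNReal.add_halves] at h6
    exact lt_irrefl _ h6
  rcases smul_eq_zero.1 h0 with h1 | h1
  · exact sub_eq_zero.1 (Complex.ofReal_eq_zero.1 h1)
  · exact absurd h1 hQ

lemma HasLimit.tendsto_fockNorm {w : 𝔼 d} {D : ℝ} (h : HasLimit w D)
    {φ ψ : (Fin d → ℝ) → ℂ} (hφ : IsTorusTest φ) (hψ : IsTorusTest ψ) {i : ℕ}
    (hi : i = 2 ∨ i = 3) {W : ℝ → ℕ → FockVec d} (hW : IsApproxFamily w i (inputVec φ ψ i) W)
    {n : ℕ} (hn : i ≤ n) : Tendsto (fun ε : ℝ => fockNorm (W ε n)) (scaleFilter d) (𝓝 0) := by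
  obtain ⟨Dn, hDn⟩ := h
  obtain ⟨y, hy, -, hf⟩ := exists_input hφ hψ hi
  have h1 := (((hDn i hi).2 n hn y hy).2).enorm
  rw [enorm_zero_fock] at h1
  refine h1.congr' ?_
  filter_upwards [self_mem_nhdsWithin] with ε hε
  have h2 := hW ε hε n hn
  rw [hf, isApproxSol_iff w ε (by omega) hn hy] at h2
  rw [h2, fockNorm_toVec]

lemma exists_hasLimit (hd : 2 ≤ d) {w : 𝔼 d} (hw : w ≠ 0) :
    ∃ D : ℝ, 0 < D ∧ HasLimit w D ∧ (d = 2 → D = funG w 1) := by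
  rcases hd.eq_or_lt with h | h
  · subst h
    refine ⟨funG w 1, funG_one_pos hw, ⟨fun _ _ => funG w 1, fun i hi =>
      ⟨tendsto_const_nhds, fun n hn y hy => ?_⟩⟩, fun _ => rfl⟩
    simp only [solVec, if_true]
    exact ⟨tendsto_ladderSum w hw hi n hy, tendsto_invLam_ladderSum w hi n y⟩
  · obtain ⟨D, hD, Dn, hDn⟩ := exists_tendsto_resolvent (show 3 ≤ d from h) hw
    refine ⟨D, hD, ⟨Dn, fun i hi => ⟨(hDn i hi).1, fun n hn y hy => ?_⟩⟩, fun h' => by omega⟩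
    simp only [solVec, if_neg h.ne']
    exact (hDn i hi).2 n hn y hy

end Burgers

theorem theorem2p12 (d : ℕ) (hd : 2 ≤ d) (w : EuclideanSpace ℝ (Fin d)) (hw : w ≠ 0) :
    -- the approximations `w^{ε,n}` are well defined
    (∀ φ ψ : (Fin d → ℝ) → ℂ, Burgers.IsTorusTest φ → Burgers.IsTorusTest ψ →
      ∀ i : ℕ, i = 2 ∨ i = 3 → ∀ ε ∈ Burgers.scales d, ∀ n : ℕ, i ≤ n →
        ∃! v : Burgers.FockVec d,
          Burgers.IsApproxSol w ε i n (Burgers.inputVec φ ψ i) v) ∧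
    -- existence, positivity and uniqueness of the diffusivity, and its value for `d = 2`
    (∃ D : ℝ, 0 < D ∧ Burgers.HasDiffusivity w D ∧
      (∀ D' : ℝ, Burgers.HasDiffusivity w D' → D' = D) ∧
      (d = 2 → D = Burgers.funG w 1)) ∧
    -- the approximations vanish in the Fock space norm
    (∀ φ ψ : (Fin d → ℝ) → ℂ, Burgers.IsTorusTest φ → Burgers.IsTorusTest ψ →
      ∀ i : ℕ, i = 2 ∨ i = 3 →
      ∀ W : ℝ → ℕ → Burgers.FockVec d,
        Burgers.IsApproxFamily w i (Burgers.inputVec φ ψ i) W →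
        ∀ n : ℕ, i ≤ n →
          Tendsto (fun ε : ℝ => Burgers.fockNorm (W ε n)) (Burgers.scaleFilter d) (𝓝 0)) := by
  obtain ⟨D, hD, hlim, hD2⟩ := Burgers.exists_hasLimit hd hw
  refine ⟨fun φ ψ hφ hψ i hi ε _ n hn => ?_, ⟨D, hD, hlim.hasDiffusivity, fun D' h' =>
    hlim.unique hw h', hD2⟩, fun φ ψ hφ hψ i hi W hW n hn => hlim.tendsto_fockNorm hφ hψ hi hW hn⟩
  obtain ⟨y, hy, -, hf⟩ := Burgers.exists_input hφ hψ hi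
  rw [hf]
  exact ⟨_, (Burgers.isApproxSol_iff w ε (by omega) hn hy).2 rfl, fun v hv =>
    (Burgers.isApproxSol_iff w ε (by omega) hn hy).1 hv⟩
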